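/- Work on $\mathbb{Z}^2$, where $(i,j)$ is called even if $i+j$ is even. A path (resp. $\times$-path) is a finite sequence of vertices whose consecutive terms are at Euclidean distance $1$ (resp. $\sqrt2$); two vertices at distance $1$ are neighbours, and a $\times$-circuit is a $\times$-path whose first and last vertices coincide. For a finite $D\subset\mathbb{Z}^2$, let $\partial D$ be the set of vertices of $D$ having at least one neighbour outside $D$; $D$ is an even domain if $\partial D$ is the vertex set of a $\times$-circuit of even vertices. A height function on $D$ is a map $h:D\to\mathbb{Z}$ with $|h_u-h_v|=1$ for all neighbours $u,v\in D$ and with $h_v$ even if and only if $v$ is even. Let $\phi_D^0$ be the uniform probability distribution on the finite set of height functions on $D$ that equal $0$ on $\partial D$. For a real number $\rho>0$ and an integer $n\ge 0$ let $\Lambda_{\rho n,n}=([-\rho n,\rho n]\times[-n,n])\cap\mathbb{Z}^2$, and let $\mathcal{H}_{h\ge0}(\Lambda_{\rho n,n})$ be the event that there is a path of vertices of $\Lambda_{\rho n,n}$, all satisfying $h\ge0$, from the left side $\{-\lfloor\rho n\rfloor\}\times[-n,n]$ to the right side $\{\lfloor\rho n\rfloor\}\times[-n,n]$. Proposition 4.1.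 For every $\rho>0$ there exists $c=c(\rho)>0$ such that, for every integer $n\ge 0$ and every even domain $D$ containing $\Lambda_{\rho n,n}$, $$\phi_D^0\big[\mathcal{H}_{h\ge0}(\Lambda_{\rho n,n})\big]\ge c.$$ -/

import Mathlib

namespace SquareIce

/-- The graph on `ℤ²` joining vertices at Euclidean distance `1` (the square lattice). -/
def latticeGraph : SimpleGraph (ℤ × ℤ) where
  Adj u v := (u.1 - v.1) ^ 2 + (u.2 - v.2) ^ 2 = 1
  symm := ⟨fun u v h => by linarith [sub_sq_comm u.1 v.1, sub_sq_comm u.2 v.2]⟩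
  loopless := ⟨fun u h => by simp at h⟩

/-- The graph on `ℤ²` joining vertices at Euclidean distance `√2`; its walks are the
`×`-paths, and its closed walks the `×`-circuits. -/
def crossGraph : SimpleGraph (ℤ × ℤ) where
  Adj u v := (u.1 - v.1) ^ 2 + (u.2 - v.2) ^ 2 = 2
  symm := ⟨fun u v h => by linarith [sub_sq_comm u.1 v.1, sub_sq_comm u.2 v.2]⟩
  loopless := ⟨fun u h => by simp at h⟩

/-- A vertex of `ℤ²` is even if the sum of its coordinates is even. -/
def IsEvenVertex (v : ℤ × ℤ) : Prop := Even (v.1 + v.2)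

/-- The boundary `∂D`: the vertices of `D` with at least one lattice neighbour outside `D`. -/
def boundary (D : Finset (ℤ × ℤ)) : Set (ℤ × ℤ) :=
  {v | v ∈ D ∧ ∃ w, latticeGraph.Adj v w ∧ w ∉ D}

/-- An even domain: a finite subset of `ℤ²` whose boundary is (the set of vertices of) a
`×`-circuit of even vertices. -/
def IsEvenDomain (D : Finset (ℤ × ℤ)) : Prop :=
  (∃ (v : ℤ × ℤ) (p : crossGraph.Walk v v), {w | w ∈ p.support} = boundary D) ∧
    ∀ v ∈ boundary D, IsEvenVertex v

/-- Height functions (homomorphisms) on `D`: neighbouring vertices of `D` have heights differing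
by exactly `1`, and heights are even exactly at the even vertices. -/
def IsHeightFunction (D : Finset (ℤ × ℤ)) (h : D → ℤ) : Prop :=
  (∀ u v : D, latticeGraph.Adj u v → |h u - h v| = 1) ∧
    ∀ v : D, Even (h v) ↔ IsEvenVertex v

/-- The height functions on `D` that vanish on `∂D`. -/
def zeroBoundaryHeights (D : Finset (ℤ × ℤ)) : Set (D → ℤ) :=
  {h | IsHeightFunction D h ∧ ∀ v : D, (v : ℤ × ℤ) ∈ boundary D → h v = 0}

/-- `φ_D^0`: the uniform distribution on the height functions on `D` equal to `0` on `∂D`. -/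
noncomputable def zeroBoundaryMeasure (D : Finset (ℤ × ℤ)) : MeasureTheory.Measure (D → ℤ) :=
  ProbabilityTheory.uniformOn (zeroBoundaryHeights D)

/-- The rectangle `Λ_{a,b} = [-a,a] × [-b,b]` of `ℤ²`. -/
noncomputable def rect (a b : ℕ) : Finset (ℤ × ℤ) :=
  Finset.Icc (-(a : ℤ)) a ×ˢ Finset.Icc (-(b : ℤ)) b

/-- The event `H_{h ∈ I}(Λ_{a,b})`: some lattice path in `Λ_{a,b}`, all of whose vertices have
height in `I`, goes from the left side to the right side of `Λ_{a,b}`. -/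
def horizontalCrossing (D : Finset (ℤ × ℤ)) (I : Set ℤ) (a b : ℕ) : Set (D → ℤ) :=
  {h | ∃ (u v : ℤ × ℤ) (p : latticeGraph.Walk u v),
    u.1 = -(a : ℤ) ∧ v.1 = (a : ℤ) ∧
      ∀ w ∈ p.support, w ∈ rect a b ∧ ∃ hw : w ∈ D, h ⟨w, hw⟩ ∈ I}

end SquareIce

/-! Rotating the lattice by 45 degrees turns the odd vertices into the sites, and the even vertices
into the faces, of another square lattice; a face has four sites as corners, sites carry odd heights
and faces even ones. A site is white if its height is at least `1`, black if it is at most `-1`.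
Neighbouring sites of a white 8-path share a face of nonnegative height, so such a path yields a
path with `h ≥ 0`. By planar duality a white 8-crossing exists as soon as no black 4-crossing runs
in the other direction. With the sign symmetry, it remains to bound below the probability that a
rectangle has no white 4-crossing (`Base.pr_no_white`); positive association then joins boundedly
many thin rectangles into a zigzag (`Base.pr_zigzag`).

The main estimate (`Region.sum_reps_le`) bounds the mean number of white clusters crossing a strip
when the prescribed heights are at most `1`. Call a pair of crossing clusters good if both cross a
common quad with a symmetry exchanging its crossing sides and its dual sides. Given the two
clusters, the cell between them is surrounded by heights `-1`. Comparison with antisymmetric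
boundary values shows that a third crossing cluster lies between them with probability at most `1/2`
(`SymQuad.pr_cell`, `Region.two_mul_between_le`). Besides monotonicity in the boundary values, this
uses a positive association property of absolute values (`GOm.fold`), which holds because the sign
patterns of a given absolute value form a vector space over `ZMod 2`. So good pairs are in mean at
most twice as many as consecutive pairs, hence at most twice as many as clusters. On the other hand,
among any `300 * N` crossings two form a good pair (`exists_common_quad`), so there are at least
three times as many good pairs as clusters, minus `1800 * N`. Comparing the two gives the bound.

The geometric input is a descent over scales (`SwingState.descend`). If 300 disjoint crossings start
in a short window and different sets of the family never cross a common quad, the crossings are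
forced to swing to the right and to the left in turn. They then traverse a vertical band so often
that 300 of the traversals start in a window that is again short for the band, at a quarter of the
scale. The descent stops because 300 distinct starting points need room.

To pass from the mean number of clusters to the absence of crossings, clusters must not be joined
around the strip. After exchanging sites and faces, the main estimate bounds the number of crossings
by faces of height at least `2`; reversing the sign of such clusters one at a time shows that there
are none with positive probability (`Base.ncard_le_no_high`). Hence, with positive probability, the
middle of a large box is not reached from outside by heights at least `2`. Conditionally on the
reached set, the clusters cut along it still obey the mean estimate. If white crossings were hard to
avoid, the bottom side would split into many intervals from which white and black crossings start
alternately with high probability, and this would produce too many clusters. -/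

namespace SquareIce
open Relation

/-! ### Connectivity inside a set -/

/-- `a` and `b` are joined by an `r`-path whose vertices all lie in `S`. -/
def Conn {α : Type*} (r : α → α → Prop) (S : Set α) (a b : α) : Prop :=
  a ∈ S ∧ ReflTransGen (fun u v => r u v ∧ v ∈ S) a b

namespace Conn
variable {α β : Type*} {r : α → α → Prop} {S T : Set α} {a b c : α}

theorem refl (h : a ∈ S) : Conn r S a a := ⟨h, .refl⟩

theorem left (h : Conn r S a b) : a ∈ S := h.1

theorem right (h : Conn r S a b) : b ∈ S := by
  obtain ⟨ha, h⟩ := h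
  induction h with
  | refl => exact ha
  | tail _ h _ => exact h.2

theorem tail (h : Conn r S a b) (hr : r b c) (hc : c ∈ S) : Conn r S a c :=
  ⟨h.1, h.2.tail ⟨hr, hc⟩⟩

theorem trans (h : Conn r S a b) (h' : Conn r S b c) : Conn r S a c := ⟨h.1, h.2.trans h'.2⟩

theorem single (ha : a ∈ S) (hr : r a b) (hb : b ∈ S) : Conn r S a b := (Conn.refl ha).tail hr hb

theorem head (ha : a ∈ S) (hr : r a b) (h : Conn r S b c) : Conn r S a c :=
  (Conn.single ha hr h.left).trans h

@[elab_as_elim]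
theorem rec' {p : α → Prop} (h : Conn r S a b) (h0 : p a)
    (hs : ∀ u v, Conn r S a u → r u v → v ∈ S → p u → p v) : p b := by
  obtain ⟨ha, h⟩ := h
  induction h with
  | refl => exact h0
  | tail h1 h2 ih => exact hs _ _ ⟨ha, h1⟩ h2.1 h2.2 ih

theorem symm (hr : ∀ u v, r u v → r v u) (h : Conn r S a b) : Conn r S b a :=
  h.rec' (p := fun b => Conn r S b a) (Conn.refl h.1)
    (fun _ _ _ h2 h3 ih => Conn.head h3 (hr _ _ h2) ih)

theorem mono (hST : S ⊆ T) (h : Conn r S a b) : Conn r T a b :=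
  h.rec' (p := fun b => Conn r T a b) (Conn.refl (hST h.1)) (fun _ _ _ h2 h3 ih => ih.tail h2 (hST h3))

theorem mono_rel {r' : α → α → Prop} (hrr : ∀ u v, r u v → r' u v) (h : Conn r S a b) :
    Conn r' S a b :=
  h.rec' (p := fun b => Conn r' S a b) (Conn.refl h.1) (fun _ _ _ h2 h3 ih => ih.tail (hrr _ _ h2) h3)

theorem map {r' : β → β → Prop} {T : Set β} (f : α → β) (hf : ∀ u ∈ S, f u ∈ T)
    (hr : ∀ u v, u ∈ S → v ∈ S → r u v → r' (f u) (f v)) (h : Conn r S a b) : Conn r' T (f a) (f b) :=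
  h.rec' (p := fun b => Conn r' T (f a) (f b)) (Conn.refl (hf _ h.1))
    (fun _ _ h1 h2 h3 ih => ih.tail (hr _ _ h1.right h3 h2) (hf _ h3))

/-- A path stays in the set of vertices reachable from its start. -/
theorem reach (h : Conn r S a b) : Conn r {v | Conn r S a v} a b :=
  h.rec' (p := fun b => Conn r {v | Conn r S a v} a b) (Conn.refl (Conn.refl h.1))
    (fun _ _ h1 h2 h3 ih => ih.tail h2 (h1.tail h2 h3))

/-- A path either avoids `P` or meets it. -/
theorem avoid_or_hit (P : Set α) (h : Conn r S a b) :
    Conn r (S \ P) a b ∨ ∃ w ∈ P, Conn r S a w := by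
  refine h.rec' (p := fun b => Conn r (S \ P) a b ∨ ∃ w ∈ P, Conn r S a w) ?_ ?_
  · by_cases ha : a ∈ P
    · exact .inr ⟨a, ha, .refl h.1⟩
    · exact .inl (.refl ⟨h.1, ha⟩)
  · rintro u v h1 h2 h3 (ih | ih)
    · by_cases hv : v ∈ P
      · exact .inr ⟨v, hv, h1.tail h2 h3⟩
      · exact .inl (ih.tail h2 ⟨h3, hv⟩)
    · exact .inr ih

/-- The last stretch of a path before it leaves `M` towards `Q`, having entered `M` from the
start or from `P`. -/
theorem passage {P M Q : Set α} {I F : α → Prop} (h : Conn r S a b) (hS : S ⊆ P ∪ M ∪ Q)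
    (ha : a ∈ P ∨ a ∈ M ∧ I a) (hb : b ∉ P ∧ (b ∈ M → F b))
    (hI : ∀ u ∈ P, ∀ v ∈ M, r u v → I v) (hF : ∀ u ∈ M, ∀ v ∈ Q, r u v → F u)
    (hPQ : ∀ u ∈ P, ∀ v ∈ Q, ¬ r u v) :
    ∃ u v, I u ∧ F v ∧ Conn r (S ∩ M) u v := by
  by_contra hcon
  push Not at hcon
  have key : b ∈ P ∨ b ∈ M ∧ ∃ u, I u ∧ Conn r (S ∩ M) u b := by
    refine h.rec' (p := fun b => b ∈ P ∨ b ∈ M ∧ ∃ u, I u ∧ Conn r (S ∩ M) u b) ?_ ?_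
    · rcases ha with ha | ⟨ha, hi⟩
      · exact .inl ha
      · exact .inr ⟨ha, a, hi, .refl ⟨h.1, ha⟩⟩
    · rintro u v h1 h2 h3 ih
      rcases ih with ih | ⟨ih, w, hw, hc⟩
      · rcases hS h3 with (hv | hv) | hv
        · exact .inl hv
        · exact .inr ⟨hv, v, hI _ ih _ hv h2, .refl ⟨h3, hv⟩⟩
        · exact absurd h2 (hPQ _ ih _ hv)
      · rcases hS h3 with (hv | hv) | hv
        · exact .inl hv
        · exact .inr ⟨hv, w, hw, hc.tail h2 ⟨h3, hv⟩⟩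
        · exact absurd hc (hcon _ _ hw (hF _ ih _ hv h2))
  rcases key with h | ⟨h, u, hu, hc⟩
  · exact hb.1 h
  · exact hcon _ _ hu (hb.2 h) hc

end Conn

/-! ### Planar lattice connectivity -/

/-- Equal or nearest neighbours on `ℤ²`. -/
def adj4 (u v : ℤ × ℤ) : Prop :=
  (u.1 = v.1 ∧ u.2 ≤ v.2 + 1 ∧ v.2 ≤ u.2 + 1) ∨ (u.2 = v.2 ∧ u.1 ≤ v.1 + 1 ∧ v.1 ≤ u.1 + 1)

/-- Distance at most one in the supremum norm. -/
def adj8 (u v : ℤ × ℤ) : Prop :=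
  u.1 ≤ v.1 + 1 ∧ v.1 ≤ u.1 + 1 ∧ u.2 ≤ v.2 + 1 ∧ v.2 ≤ u.2 + 1

theorem adj4_symm : ∀ u v, adj4 u v → adj4 v u := by unfold adj4; intros; omega
theorem adj8_symm : ∀ u v, adj8 u v → adj8 v u := by unfold adj8; intros; omega
theorem adj4_adj8 : ∀ u v, adj4 u v → adj8 u v := by unfold adj4 adj8; intros; omega

theorem Conn.symm4 {S a b} (h : Conn adj4 S a b) : Conn adj4 S b a := h.symm adj4_symm
theorem Conn.symm8 {S a b} (h : Conn adj8 S a b) : Conn adj8 S b a := h.symm adj8_symm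
theorem Conn.to8 {S a b} (h : Conn adj4 S a b) : Conn adj8 S a b := h.mono_rel adj4_adj8

/-- A vertical segment is 4-connected. -/
theorem conn_vertical {S : Set (ℤ × ℤ)} {x y z : ℤ} (hyz : y ≤ z)
    (h : ∀ s, y ≤ s → s ≤ z → (x, s) ∈ S) : Conn adj4 S (x, y) (x, z) := by
  obtain ⟨n, rfl⟩ := Int.le.dest hyz
  induction n with
  | zero => simpa using Conn.refl (h y le_rfl (by simp))
  | succ n ih =>
    have h1 := ih (by omega) (fun s h1 h2 => h s h1 (by push_cast; omega))
    have h2 : (x, y + ((n + 1 : ℕ) : ℤ)) ∈ S := h _ (by push_cast; omega) le_rfl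
    refine h1.tail (.inl ⟨rfl, ?_, ?_⟩) h2 <;> push_cast <;> omega

/-- A horizontal segment is 4-connected. -/
theorem conn_horizontal {S : Set (ℤ × ℤ)} {x z y : ℤ} (hxz : x ≤ z)
    (h : ∀ s, x ≤ s → s ≤ z → (s, y) ∈ S) : Conn adj4 S (x, y) (z, y) := by
  obtain ⟨n, rfl⟩ := Int.le.dest hxz
  induction n with
  | zero => simpa using Conn.refl (h x le_rfl (by simp))
  | succ n ih =>
    have h1 := ih (by omega) (fun s h1 h2 => h s h1 (by push_cast; omega))
    have h2 : (x + ((n + 1 : ℕ) : ℤ), y) ∈ S := h _ (by push_cast; omega) le_rfl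
    refine h1.tail (.inr ⟨rfl, ?_, ?_⟩) h2 <;> push_cast <;> omega

/-- The mod-2 chain of a 4-path: `E v` counts the edge from `v` to the right, `V v` the edge
upwards. -/
theorem exists_chain {S : Set (ℤ × ℤ)} {a b : ℤ × ℤ} (h : Conn adj4 S a b) :
    ∃ E V : ℤ → ℤ → ZMod 2, (∃ M, ∀ x y, E x y ≠ 0 → M ≤ x) ∧
      (∀ x y, E x y ≠ 0 → (x, y) ∈ S ∧ (x + 1, y) ∈ S) ∧
      (∀ x y, V x y ≠ 0 → (x, y) ∈ S ∧ (x, y + 1) ∈ S) ∧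
      ∀ x y, E x y + E (x - 1) y + V x y + V x (y - 1) =
        (if a = (x, y) then 1 else 0) + (if b = (x, y) then 1 else 0) := by
  refine h.rec' (p := fun b => ∃ E V : ℤ → ℤ → ZMod 2, (∃ M, ∀ x y, E x y ≠ 0 → M ≤ x) ∧
      (∀ x y, E x y ≠ 0 → (x, y) ∈ S ∧ (x + 1, y) ∈ S) ∧
      (∀ x y, V x y ≠ 0 → (x, y) ∈ S ∧ (x, y + 1) ∈ S) ∧
      ∀ x y, E x y + E (x - 1) y + V x y + V x (y - 1) =
        (if a = (x, y) then 1 else 0) + (if b = (x, y) then 1 else 0)) ?_ ?_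
  · refine ⟨0, 0, ⟨0, by simp⟩, by simp, by simp, fun x y => ?_⟩
    simp only [Pi.zero_apply, add_zero]
    split_ifs <;> rfl
  · rintro ⟨p, q⟩ ⟨p', q'⟩ h1 h2 h3 ⟨E, V, ⟨M, hM⟩, hE, hV, hb⟩
    have hu := h1.right
    have two : (1 : ZMod 2) + 1 = 0 := rfl
    have hor : ∀ m, (m, q) ∈ S → (m + 1, q) ∈ S → ∃ E' V' : ℤ → ℤ → ZMod 2,
        (∃ M, ∀ x y, E' x y ≠ 0 → M ≤ x) ∧
        (∀ x y, E' x y ≠ 0 → (x, y) ∈ S ∧ (x + 1, y) ∈ S) ∧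
        (∀ x y, V' x y ≠ 0 → (x, y) ∈ S ∧ (x, y + 1) ∈ S) ∧
        ∀ x y, E' x y + E' (x - 1) y + V' x y + V' x (y - 1) =
        E x y + E (x - 1) y + V x y + V x (y - 1) + (if (m, q) = (x, y) then 1 else 0) +
          (if (m + 1, q) = (x, y) then 1 else 0) := by
      intro m hm hm'
      refine ⟨fun x y => E x y + if (m, q) = (x, y) then 1 else 0, V, ⟨min M m, fun x y h => ?_⟩,
        fun x y h => ?_, hV, fun x y => ?_⟩
      · by_cases hh : (m, q) = (x, y)
        · obtain ⟨rfl, rfl⟩ := Prod.mk.inj hh; exact min_le_right _ _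
        · simp only [hh, if_false, add_zero] at h; exact (min_le_left _ _).trans (hM _ _ h)
      · by_cases hh : (m, q) = (x, y)
        · obtain ⟨rfl, rfl⟩ := Prod.mk.inj hh; exact ⟨hm, hm'⟩
        · simp only [hh, if_false, add_zero] at h; exact hE _ _ h
      · have : ((m, q) = (x - 1, y)) = ((m + 1, q) = (x, y)) := by
          simp only [Prod.mk.injEq, eq_iff_iff]; omega
        simp only [this]; ring
    have ver : ∀ m, (p, m) ∈ S → (p, m + 1) ∈ S → ∃ E' V' : ℤ → ℤ → ZMod 2,
        (∃ M, ∀ x y, E' x y ≠ 0 → M ≤ x) ∧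
        (∀ x y, E' x y ≠ 0 → (x, y) ∈ S ∧ (x + 1, y) ∈ S) ∧
        (∀ x y, V' x y ≠ 0 → (x, y) ∈ S ∧ (x, y + 1) ∈ S) ∧
        ∀ x y, E' x y + E' (x - 1) y + V' x y + V' x (y - 1) =
        E x y + E (x - 1) y + V x y + V x (y - 1) + (if (p, m) = (x, y) then 1 else 0) +
          (if (p, m + 1) = (x, y) then 1 else 0) := by
      intro m hm hm'
      refine ⟨E, fun x y => V x y + if (p, m) = (x, y) then 1 else 0, ⟨M, hM⟩,
        hE, fun x y h => ?_, fun x y => ?_⟩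
      · by_cases hh : (p, m) = (x, y)
        · obtain ⟨rfl, rfl⟩ := Prod.mk.inj hh; exact ⟨hm, hm'⟩
        · simp only [hh, if_false, add_zero] at h; exact hV _ _ h
      · have : ((p, m) = (x, y - 1)) = ((p, m + 1) = (x, y)) := by
          simp only [Prod.mk.injEq, eq_iff_iff]; omega
        simp only [this]; ring
    -- The previous endpoint is now counted twice and cancels mod 2, so the boundary of the chain
    -- moves to the new endpoint.
    have fin : ∀ α β γ : ZMod 2, α + β + β + γ = α + γ := by decide
    have fin' : ∀ α β γ : ZMod 2, α + β + γ + β = α + γ := by decide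
    by_cases heq : (p, q) = (p', q')
    · rw [← heq]; exact ⟨E, V, ⟨M, hM⟩, hE, hV, hb⟩
    have : (q' = q ∧ p' = p + 1) ∨ (q' = q ∧ p = p' + 1) ∨ (p' = p ∧ q' = q + 1) ∨
        (p' = p ∧ q = q' + 1) := by
      simp only [adj4] at h2; simp only [Prod.mk.injEq, not_and] at heq; omega
    rcases this with ⟨rfl, rfl⟩ | ⟨rfl, rfl⟩ | ⟨rfl, rfl⟩ | ⟨rfl, rfl⟩
    · obtain ⟨E', V', g1, g2, g3, g4⟩ := hor p hu h3
      exact ⟨E', V', g1, g2, g3, fun x y => by rw [g4, hb, fin]⟩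
    · obtain ⟨E', V', g1, g2, g3, g4⟩ := hor p' h3 hu
      exact ⟨E', V', g1, g2, g3, fun x y => by rw [g4, hb, fin']⟩
    · obtain ⟨E', V', g1, g2, g3, g4⟩ := ver q hu h3
      exact ⟨E', V', g1, g2, g3, fun x y => by rw [g4, hb, fin]⟩
    · obtain ⟨E', V', g1, g2, g3, g4⟩ := ver q' h3 hu
      exact ⟨E', V', g1, g2, g3, fun x y => by rw [g4, hb, fin']⟩

theorem zmod2_telescope (f : ℤ → ZMod 2) {a b : ℤ} (hab : a ≤ b) :
    ∑ s ∈ Finset.Ioc a b, (f s + f (s - 1)) = f b + f a := by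
  obtain ⟨n, rfl⟩ := Int.le.dest hab
  have two : ∀ α β : ZMod 2, α + β + (β + α) = 0 := by decide
  have fin : ∀ α β γ : ZMod 2, α + β + (β + γ) = α + γ := by decide
  have fin0 : ∀ α : ZMod 2, 0 = α + α := by decide
  clear hab
  induction n with
  | zero => simpa using fin0 (f a)
  | succ n ih =>
    have : Finset.Ioc a (a + (n + 1 : ℕ)) = insert (a + n + 1) (Finset.Ioc a (a + n)) := by
      ext s; simp only [Finset.mem_insert, Finset.mem_Ioc]; push_cast; omega
    rw [this, Finset.sum_insert (by simp), ih]
    have h2 : a + (n : ℤ) + 1 - 1 = a + n := by ring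
    rw [h2, fin]; congr 2; push_cast; ring

/-- A point of the strip lies to the left of a crossing from `(p, y0)` to `(q, y1)`; this is
decided on the two boundary rows. A path of the strip off the crossing keeps its side. -/
theorem no_cross_strip {X S : Set (ℤ × ℤ)} {y0 y1 p q : ℤ}
    (hX : Conn adj4 X (p, y0) (q, y1)) (hXs : ∀ v ∈ X, y0 ≤ v.2 ∧ v.2 ≤ y1)
    {a b : ℤ × ℤ} (h : Conn adj8 S a b) (hS : ∀ v ∈ S, y0 ≤ v.2 ∧ v.2 ≤ y1 ∧ v ∉ X)
    (ha : (a.2 = y0 ∧ a.1 ≤ p) ∨ (a.2 = y1 ∧ a.1 ≤ q))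
    (hb : (b.2 = y0 ∧ p ≤ b.1) ∨ (b.2 = y1 ∧ q ≤ b.1)) : False := by
  obtain ⟨E, V, ⟨M, hM⟩, hE, hV, hbd⟩ := exists_chain hX
  have hy : y0 ≤ y1 := (hXs _ hX.left).1.trans (hXs _ hX.left).2
  have hE0 : ∀ x y, (x, y) ∉ X → E x y = 0 := fun x y h => by
    by_contra h'; exact h (hE _ _ h').1
  have hE1 : ∀ x y, (x + 1, y) ∉ X → E x y = 0 := fun x y h => by
    by_contra h'; exact h (hE _ _ h').2
  have hV0 : ∀ x y, (x, y) ∉ X → V x y = 0 := fun x y h => by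
    by_contra h'; exact h (hV _ _ h').1
  have hV1 : ∀ x y, (x, y + 1) ∉ X → V x y = 0 := fun x y h => by
    by_contra h'; exact h (hV _ _ h').2
  have hlow : ∀ x, V x (y0 - 1) = 0 := fun x => hV0 _ _ (fun h => by have := (hXs _ h).1; simp at this)
  have htop : ∀ x, V x y1 = 0 := fun x => hV1 _ _ (fun h => by have := (hXs _ h).2; simp at this)
  -- the counting function of the upward ray
  obtain ⟨w, hw⟩ : ∃ w : ℤ → ℤ → ZMod 2, ∀ x y, w x y =
      ∑ s ∈ Finset.Ioc y y1, E x s + if q ≤ x then 1 else 0 := ⟨_, fun _ _ => rfl⟩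
  -- The term `q ≤ x` in `w` acts as if the crossing went on to the right from `(q, y1)`. Summing
  -- the boundary identity of the chain over `s ∈ (y, y1]` telescopes the vertical edges and leaves
  -- `V x y` and the two endpoints.
  have hor : ∀ x y, y0 - 1 ≤ y → y < y1 → w x y + w (x - 1) y = V x y +
      if x = p ∧ y < y0 then 1 else 0 := by
    intro x y h0 h1
    have e1 : ∑ s ∈ Finset.Ioc y y1, E x s + ∑ s ∈ Finset.Ioc y y1, E (x - 1) s =
        ∑ s ∈ Finset.Ioc y y1, (V x s + V x (s - 1)) + ∑ s ∈ Finset.Ioc y y1,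
          ((if (p, y0) = (x, s) then 1 else 0) + (if (q, y1) = (x, s) then 1 else 0)) := by
      rw [← Finset.sum_add_distrib, ← Finset.sum_add_distrib]
      refine Finset.sum_congr rfl fun s _ => ?_
      rw [← hbd x s]
      generalize E x s = α; generalize E (x - 1) s = β; generalize V x s = γ
      generalize V x (s - 1) = δ
      revert α β γ δ; decide
    rw [zmod2_telescope _ h1.le, htop, zero_add, Finset.sum_add_distrib] at e1
    have s1 : ∑ s ∈ Finset.Ioc y y1, (if (p, y0) = (x, s) then (1 : ZMod 2) else 0) =
        if x = p ∧ y < y0 then 1 else 0 := by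
      by_cases hp : x = p ∧ y < y0
      · obtain ⟨rfl, hp⟩ := hp
        simp [Prod.mk.injEq, hp, hy]
      · rw [if_neg hp]
        refine Finset.sum_eq_zero fun s hs => if_neg ?_
        simp only [Prod.mk.injEq, Finset.mem_Ioc] at hs ⊢
        rintro ⟨rfl, rfl⟩; exact hp ⟨rfl, hs.1⟩
    have s2 : ∑ s ∈ Finset.Ioc y y1, (if (q, y1) = (x, s) then (1 : ZMod 2) else 0) =
        if x = q then 1 else 0 := by
      by_cases hp : x = q
      · obtain rfl := hp
        simp [Prod.mk.injEq, h1]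
      · rw [if_neg hp]
        refine Finset.sum_eq_zero fun s hs => if_neg ?_
        simp only [Prod.mk.injEq, Finset.mem_Ioc] at hs ⊢
        rintro ⟨rfl, rfl⟩; exact hp rfl
    rw [s1, s2] at e1
    have e2 : ((if q ≤ x then 1 else 0) + (if q ≤ x - 1 then 1 else 0) : ZMod 2) =
        if x = q then 1 else 0 := by
      split_ifs <;> first | omega | rfl
    have fin : ∀ α β γ δ ε ζ η : ZMod 2, α + β = γ + (ζ + δ) → ε + η = δ →
        α + ε + (β + η) = γ + ζ := by decide
    rw [hw, hw]
    exact fin _ _ _ _ _ _ _ e1 e2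
  have vert : ∀ x y, (x, y) ∉ X → y ≤ y1 → w x (y - 1) = w x y := by
    intro x y hxy h1
    have : Finset.Ioc (y - 1) y1 = insert y (Finset.Ioc y y1) := by
      ext s; simp only [Finset.mem_insert, Finset.mem_Ioc]; omega
    simp only [hw, this]
    rw [Finset.sum_insert (by simp), hE0 _ _ hxy, zero_add]
  have fin2 : ∀ α β : ZMod 2, α + β = 0 → β = α := by decide
  have step : ∀ x ya yb, (x - 1, ya) ∉ X → (x, yb) ∉ X → ya ≤ yb + 1 → yb ≤ ya + 1 →
      y0 ≤ ya → ya ≤ y1 → y0 ≤ yb → yb ≤ y1 → w (x - 1) ya = w x yb := by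
    intro x ya yb ha' hb' h1 h2 h3 h4 h5 h6
    rcases lt_trichotomy ya yb with h | rfl | h
    · have := hor x ya (by omega) (by omega)
      rw [hV1 _ _ (by rwa [show ya + 1 = yb by omega]), if_neg (by omega), add_zero] at this
      rw [fin2 _ _ this, ← vert x yb hb' h6, show yb - 1 = ya by omega]
    · rcases h4.lt_or_eq with h4 | rfl
      · have := hor x ya (by omega) h4
        rw [hV0 _ _ hb', if_neg (by omega), add_zero] at this
        exact fin2 _ _ this
      · simp only [hw, Finset.Ioc_self, Finset.sum_empty, zero_add]
        have : x ≠ q := by rintro rfl; exact hb' hX.right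
        congr 1; simp only [eq_iff_iff]; omega
    · have := hor x yb (by omega) (by omega)
      rw [hV0 _ _ hb', if_neg (by omega), add_zero] at this
      rw [← fin2 _ _ this, ← vert _ ya ha' h4, show ya - 1 = yb by omega]
  have inv : w a.1 a.2 = w b.1 b.2 := by
    refine h.rec' (p := fun b => w a.1 a.2 = w b.1 b.2) rfl ?_
    rintro ⟨x, y⟩ ⟨x', y'⟩ h1 h2 h3 ih
    rw [ih]
    have hu := hS _ h1.right
    have hv := hS _ h3
    simp only [adj8] at h2 hu hv ⊢
    have : x' = x ∨ x = x' - 1 ∨ x' = x - 1 := by omega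
    rcases this with rfl | rfl | rfl
    · have : y' = y ∨ y = y' - 1 ∨ y' = y - 1 := by omega
      rcases this with rfl | rfl | rfl
      · rfl
      · exact vert _ _ hv.2.2 hv.2.1
      · exact (vert _ _ hu.2.2 hu.2.1).symm
    · exact step _ _ _ hu.2.2 hv.2.2 h2.2.2.1 h2.2.2.2 hu.1 hu.2.1 hv.1 hv.2.1
    · exact (step _ _ _ hv.2.2 hu.2.2 h2.2.2.2 h2.2.2.1 hv.1 hv.2.1 hu.1 hu.2.1).symm
  -- Far to the left the chain has no horizontal edge, so `w` vanishes there; moving right along the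
  -- row below the strip, `w` changes only at `p`.
  have bot : ∀ x, w x (y0 - 1) = if p ≤ x then 1 else 0 := by
    have low : ∀ x, x < M → x < p → x < q → w x (y0 - 1) = if p ≤ x then 1 else 0 := by
      intro x hxM hxp hxq
      simp only [hw]
      rw [Finset.sum_eq_zero, if_neg (by omega), if_neg (by omega), add_zero]
      intro s _
      by_contra h
      exact absurd (hM _ _ h) (by omega)
    intro x
    by_cases hx : x < min M (min p q)
    · exact low x (by omega) (by omega) (by omega)
    · have hx' : min M (min p q) - 1 ≤ x := by omega
      clear hx
      induction x, hx' using Int.leInduction with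
      | base => exact low _ (by omega) (by omega) (by omega)
      | succ n hn ih =>
        have := hor (n + 1) (y0 - 1) le_rfl (by omega)
        rw [hlow, add_sub_cancel_right, ih, zero_add] at this
        have e2 : ((if p ≤ n + 1 then 1 else 0) + (if p ≤ n then 1 else 0) : ZMod 2) =
          if n + 1 = p ∧ y0 - 1 < y0 then 1 else 0 := by
          split_ifs <;> first | omega | rfl
        rw [← e2] at this
        exact add_right_cancel this
  have val : ∀ v : ℤ × ℤ, v ∉ X → (v.2 = y0 → w v.1 v.2 = if p ≤ v.1 then 1 else 0) ∧
      (v.2 = y1 → w v.1 v.2 = if q ≤ v.1 then 1 else 0) := by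
    rintro ⟨x, y⟩ hv
    refine ⟨?_, ?_⟩
    · rintro rfl
      rw [← bot, vert _ _ hv hy]
    · rintro rfl
      simp [hw]
  have hax := (hS _ h.left).2.2
  have hbx := (hS _ h.right).2.2
  have hpq : ∀ v : ℤ × ℤ, v ∉ X → ¬ (v.1 = p ∧ v.2 = y0) ∧ ¬ (v.1 = q ∧ v.2 = y1) := by
    rintro ⟨x, y⟩ hv
    refine ⟨?_, ?_⟩
    · rintro ⟨rfl, rfl⟩; exact hv hX.left
    · rintro ⟨rfl, rfl⟩; exact hv hX.right
  have wa : w a.1 a.2 = 0 := by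
    have := hpq a hax
    rcases ha with ha | ha
    · rw [(val a hax).1 ha.1, if_neg (by omega)]
    · rw [(val a hax).2 ha.1, if_neg (by omega)]
  have wb : w b.1 b.2 = 1 := by
    have := hpq b hbx
    rcases hb with hb | hb
    · rw [(val b hbx).1 hb.1, if_pos (by omega)]
    · rw [(val b hbx).2 hb.1, if_pos (by omega)]
  rw [wa, wb] at inv
  exact absurd inv (by decide)

/-- The rectangle `[x0, x1] × [y0, y1]`. -/
def box (x0 x1 y0 y1 : ℤ) : Set (ℤ × ℤ) := {v | x0 ≤ v.1 ∧ v.1 ≤ x1 ∧ y0 ≤ v.2 ∧ v.2 ≤ y1}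

@[simp] theorem mem_box {x0 x1 y0 y1 : ℤ} {v : ℤ × ℤ} :
    v ∈ box x0 x1 y0 y1 ↔ x0 ≤ v.1 ∧ v.1 ≤ x1 ∧ y0 ≤ v.2 ∧ v.2 ≤ y1 := Iff.rfl

theorem adj4_swap {u v : ℤ × ℤ} : adj4 u.swap v.swap ↔ adj4 u v := by
  simp only [adj4, Prod.fst_swap, Prod.snd_swap]; omega

theorem adj8_swap {u v : ℤ × ℤ} : adj8 u.swap v.swap ↔ adj8 u v := by
  simp only [adj8, Prod.fst_swap, Prod.snd_swap]; omega

/-- A bottom-top 4-crossing and a left-right 8-crossing of a rectangle intersect. -/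
theorem no_cross_box {X S : Set (ℤ × ℤ)} {x0 x1 y0 y1 : ℤ} {p q a b : ℤ × ℤ}
    (hX : Conn adj4 X p q) (hXs : X ⊆ box x0 x1 y0 y1)
    (hp : p.2 = y0) (hq : q.2 = y1) (h : Conn adj8 S a b) (hS : S ⊆ box x0 x1 y0 y1 \ X)
    (ha : a.1 = x0) (hb : b.1 = x1) : False := by
  obtain ⟨p, _⟩ := p
  obtain ⟨q, _⟩ := q
  obtain ⟨_, a⟩ := a
  obtain ⟨_, b⟩ := b
  dsimp only at hp hq ha hb
  subst hp hq ha hb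
  have m1 := hXs hX.left
  have m2 := hXs hX.right
  have m3 := hS h.left
  have m4 := hS h.right
  simp only [mem_box, Set.mem_sdiff] at m1 m2 m3 m4
  rename_i y0 y1 x0 x1
  -- Columns added just outside the box lead both ends of the 8-path down to the bottom row, on
  -- either side of `p`.
  let S' : Set (ℤ × ℤ) := S ∪ {v | (v.1 = x0 - 1 ∨ v.1 = x1 + 1) ∧ y0 ≤ v.2 ∧ v.2 ≤ y1}
  have h1 : Conn adj8 S' (x0 - 1, y0) (x0 - 1, a) :=
    (conn_vertical (S := S') (x := x0 - 1) (by omega) (fun s h1 h2 => by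
      right; simp only [Set.mem_ofPred_eq, true_or, true_and]; omega)).to8
  have h2 : Conn adj8 S' (x1 + 1, y0) (x1 + 1, b) :=
    (conn_vertical (S := S') (x := x1 + 1) (by omega) (fun s h1 h2 => by
      right; simp only [Set.mem_ofPred_eq, or_true, true_and]; omega)).to8
  have h3 : Conn adj8 S' (x0 - 1, y0) (x1 + 1, y0) :=
    (((h1.tail (by simp [adj8]; omega) (.inl h.left)).trans (h.mono (fun _ h => .inl h))).tail
      (by simp [adj8]; omega) h2.right).trans h2.symm8
  refine no_cross_strip hX (fun v hv => (hXs hv).2.2) h3 ?_ (.inl ⟨rfl, by simp; omega⟩)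
    (.inl ⟨rfl, by simp; omega⟩)
  rintro v (hv | ⟨hv, hv1, hv2⟩)
  · have := hS hv; simp only [mem_box, Set.mem_sdiff] at this; exact ⟨this.1.2.2.1, this.1.2.2.2, this.2⟩
  · refine ⟨hv1, hv2, fun h => ?_⟩
    have := hXs h
    simp only [mem_box] at this; omega

/-- A left-right 4-crossing and a bottom-top 8-crossing of a rectangle intersect. -/
theorem no_cross_box' {X S : Set (ℤ × ℤ)} {x0 x1 y0 y1 : ℤ} {p q a b : ℤ × ℤ}
    (hX : Conn adj4 X p q) (hXs : X ⊆ box x0 x1 y0 y1)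
    (hp : p.1 = x0) (hq : q.1 = x1) (h : Conn adj8 S a b) (hS : S ⊆ box x0 x1 y0 y1 \ X)
    (ha : a.2 = y0) (hb : b.2 = y1) : False := by
  refine no_cross_box (X := Prod.swap ⁻¹' X) (S := Prod.swap ⁻¹' S) (x0 := y0) (x1 := y1) (y0 := x0)
    (y1 := x1) (p := p.swap) (q := q.swap) (a := a.swap) (b := b.swap)
    (hX.map _ (fun u hu => by simpa using hu) (fun u v _ _ h => adj4_swap.2 h)) ?_ hp hq
    (h.map _ (fun u hu => by simpa using hu) (fun u v _ _ h => adj8_swap.2 h)) ?_ ha hb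
  · intro v hv; have := hXs hv; simp only [mem_box, Prod.fst_swap, Prod.snd_swap] at this ⊢; omega
  · intro v hv; have := hS hv
    simp only [mem_box, Prod.fst_swap, Prod.snd_swap, Set.mem_sdiff, Set.mem_preimage] at this ⊢
    exact ⟨by omega, this.2⟩

/-- The local parity fact behind duality. The corners of a unit square are pairwise 8-adjacent, so
by `h5` either all or none of those in `N` are in `R`. If all are, the counted edges are those along
which membership in `A` changes, and a cycle has an even number of these. -/
theorem zmod2_face (A R N : Fin 4 → Prop)
    (h1 : ∀ i, A i → ¬ A (i + 1) → N (i + 1)) (h2 : ∀ i, A (i + 1) → ¬ A i → N i)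
    (h3 : ∀ i, R i → N i) (h4 : ∀ i, N i → ¬ A i) (h5 : ∀ i j, N i → N j → R i → R j) :
    ∀ [∀ i, Decidable (A i ∧ R (i + 1) ∨ A (i + 1) ∧ R i)],
    ∑ i : Fin 4, (if A i ∧ R (i + 1) ∨ A (i + 1) ∧ R i then (1 : ZMod 2) else 0) = 0 := by
  intro _
  classical
  by_cases hR : ∃ i, R i
  · obtain ⟨i0, hi0⟩ := hR
    have key : ∀ i, (if A i ∧ R (i + 1) ∨ A (i + 1) ∧ R i then (1 : ZMod 2) else 0) =
        (if A i then 1 else 0) + (if A (i + 1) then 1 else 0) := by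
      intro i
      have e1 : A i → ¬ A (i + 1) → R (i + 1) := fun a b => h5 _ _ (h3 _ hi0) (h1 _ a b) hi0
      have e2 : A (i + 1) → ¬ A i → R i := fun a b => h5 _ _ (h3 _ hi0) (h2 _ a b) hi0
      have e3 : R i → ¬ A i := fun h => h4 _ (h3 _ h)
      have e4 : R (i + 1) → ¬ A (i + 1) := fun h => h4 _ (h3 _ h)
      by_cases a : A i <;> by_cases b : A (i + 1)
      · rw [if_neg (by tauto)]; simp only [a, b, if_true]; rfl
      · rw [if_pos (by tauto)]; simp [a, b]
      · rw [if_pos (by tauto)]; simp [a, b]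
      · rw [if_neg (by tauto)]; simp [a, b]
    rw [Finset.sum_congr rfl (fun i _ => key i), Fin.sum_univ_four]
    have e : (3 : Fin 4) + 1 = 0 := rfl
    have e' : (2 : Fin 4) + 1 = 3 := rfl
    have e'' : (1 : Fin 4) + 1 = 2 := rfl
    rw [e, e', e'', zero_add]
    generalize (if A 0 then (1 : ZMod 2) else 0) = α
    generalize (if A 1 then (1 : ZMod 2) else 0) = β
    generalize (if A 2 then (1 : ZMod 2) else 0) = γ
    generalize (if A 3 then (1 : ZMod 2) else 0) = δ
    revert α β γ δ; decide
  · refine Finset.sum_eq_zero fun i _ => if_neg ?_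
    rintro (⟨_, h⟩ | ⟨_, h⟩) <;> exact hR ⟨_, h⟩

/-- Every 2-colouring of a rectangle has a bottom-top 4-crossing of one colour or a left-right
8-crossing of the other. -/
theorem exists_cross_box (S : Set (ℤ × ℤ)) {x0 x1 y0 y1 : ℤ} (hx : x0 ≤ x1) (hy : y0 ≤ y1) :
    (∃ p q : ℤ × ℤ, p.2 = y0 ∧ q.2 = y1 ∧ Conn adj4 (S ∩ box x0 x1 y0 y1) p q) ∨
    (∃ p q : ℤ × ℤ, p.1 = x0 ∧ q.1 = x1 ∧ Conn adj8 (box x0 x1 y0 y1 \ S) p q) := by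
  classical
  by_contra hcon
  push Not at hcon
  obtain ⟨hc1, hc2⟩ := hcon
  let R := box x0 x1 y0 y1
  -- `A` is what is reached from below, `N` its outer boundary in the box, `B` the part of `N`
  -- joined to the left side. By `zmod2_face` the number of vertical edges between `A` and `B` has
  -- the same parity in every column. It is odd in the left column, where all of `N` is in `B` and
  -- `A` holds below but not at the top. So `B` meets the right column.
  let A : Set (ℤ × ℤ) := {v | v.2 < y0 ∨ ∃ p : ℤ × ℤ, p.2 = y0 ∧ Conn adj4 (S ∩ R) p v}
  let N : Set (ℤ × ℤ) := {v | v ∈ R ∧ v ∉ A ∧ ∃ u ∈ A, adj4 u v}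
  let B : Set (ℤ × ℤ) := {v | ∃ l : ℤ × ℤ, l.1 = x0 ∧ Conn adj8 N l v}
  have hNS : N ⊆ R \ S := by
    rintro v ⟨hv, hvA, u, hu, huv⟩
    refine ⟨hv, fun hvS => hvA ?_⟩
    rcases hu with hu | ⟨p, hp, hu⟩
    · have h2 := hv.2.2.1
      refine .inr ⟨v, ?_, .refl ⟨hvS, hv⟩⟩
      simp only [adj4] at huv; omega
    · exact .inr ⟨p, hp, hu.tail huv ⟨hvS, hv⟩⟩
  have hBN : B ⊆ N := fun v ⟨l, _, h⟩ => h.right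
  have hBstep : ∀ u ∈ B, ∀ v ∈ N, adj8 u v → v ∈ B := fun u ⟨l, hl, h⟩ v hv huv =>
    ⟨l, hl, h.tail huv hv⟩
  have hAtop : ∀ x, (x, y1) ∉ A := by
    rintro x (h | ⟨p, hp, h⟩)
    · dsimp only at h; omega
    · exact hc1 p _ hp rfl h
  let e : ℤ × ℤ → ℤ × ℤ → ZMod 2 := fun u v => if u ∈ A ∧ v ∈ B ∨ v ∈ A ∧ u ∈ B then 1 else 0
  have face : ∀ x y, x0 ≤ x → x + 1 ≤ x1 → y0 - 1 ≤ y → y + 1 ≤ y1 →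
      e (x, y) (x, y + 1) + e (x + 1, y) (x + 1, y + 1) = e (x, y + 1) (x + 1, y + 1) +
        e (x, y) (x + 1, y) := by
    intro x y hx0 hx1 hy0 hy1
    let f : Fin 4 → ℤ × ℤ := ![(x, y), (x + 1, y), (x + 1, y + 1), (x, y + 1)]
    have hfR : ∀ i, f i ∉ A → f i ∈ R := by
      intro i hi
      have : ¬ (f i).2 < y0 := fun h => hi (.inl h)
      fin_cases i <;> simp [f, R] at this ⊢ <;> omega
    have hfadj : ∀ i, adj4 (f i) (f (i + 1)) := by
      intro i; fin_cases i <;> simp [f, adj4] <;> omega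
    have hfadj8 : ∀ i j, adj8 (f i) (f j) := by
      intro i j; fin_cases i <;> fin_cases j <;> simp [f, adj8] <;> omega
    have := zmod2_face (fun i => f i ∈ A) (fun i => f i ∈ B) (fun i => f i ∈ N)
      (fun i h h' => ⟨hfR _ h', h', _, h, hfadj i⟩)
      (fun i h h' => ⟨hfR _ h', h', _, h, adj4_symm _ _ (hfadj i)⟩)
      (fun i h => hBN h) (fun i h => h.2.1) (fun i j hi hj h => hBstep _ h _ hj (hfadj8 i j))
    rw [Fin.sum_univ_four] at this
    have comm : ∀ u v, e u v = e v u := fun u v => if_congr or_comm rfl rfl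
    have t : e (x, y) (x + 1, y) + e (x + 1, y) (x + 1, y + 1) + e (x + 1, y + 1) (x, y + 1) +
      e (x, y + 1) (x, y) = 0 := this
    rw [comm (x + 1, y + 1), comm (x, y + 1) (x, y)] at t
    have fin : ∀ α β γ δ : ZMod 2, α + β + γ + δ = 0 → δ + β = γ + α := by decide
    exact fin _ _ _ _ t
  have hA0 : ∀ x, (x, y0 - 1) ∈ A := fun x => .inl (by simp)
  let c : ℤ → ZMod 2 := fun x => ∑ s ∈ Finset.Ioc (y0 - 1) y1, e (x, s - 1) (x, s)
  have cstep : ∀ x, x0 ≤ x → x + 1 ≤ x1 → c (x + 1) = c x := by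
    intro x h0 h1
    have : c x + c (x + 1) = ∑ s ∈ Finset.Ioc (y0 - 1) y1,
        (e (x, s) (x + 1, s) + e (x, s - 1) (x + 1, s - 1)) := by
      simp only [c]
      rw [← Finset.sum_add_distrib]
      refine Finset.sum_congr rfl fun s hs => ?_
      rw [Finset.mem_Ioc] at hs
      have := face x (s - 1) h0 h1 (by omega) (by omega)
      simpa only [sub_add_cancel] using this
    rw [zmod2_telescope (fun s => e (x, s) (x + 1, s)) (by omega)] at this
    have e1 : e (x, y1) (x + 1, y1) = 0 := if_neg (by
      rintro (⟨h, _⟩ | ⟨h, _⟩) <;> exact hAtop _ h)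
    have e2 : e (x, y0 - 1) (x + 1, y0 - 1) = 0 := if_neg (by
      rintro (⟨_, h⟩ | ⟨_, h⟩) <;> exact (hBN h).2.1 (hA0 _))
    rw [e1, e2] at this
    revert this; generalize c x = α; generalize c (x + 1) = β; revert α β; decide
  have c0 : c x0 = 1 := by
    have : c x0 = ∑ s ∈ Finset.Ioc (y0 - 1) y1, ((if (x0, s) ∈ A then (1 : ZMod 2) else 0) +
        if (x0, s - 1) ∈ A then 1 else 0) := by
      refine Finset.sum_congr rfl fun s hs => ?_
      rw [Finset.mem_Ioc] at hs
      have k : ∀ t u, y0 - 1 ≤ t → t ≤ y1 → (x0, t) ∉ A → (x0, u) ∈ A → adj4 (x0, u) (x0, t) →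
          (x0, t) ∈ B := by
        intro t u h1 h2 h3 h4 h5
        have : t ≠ y0 - 1 := by rintro rfl; exact h3 (hA0 _)
        have : (x0, t) ∈ N := ⟨by simp [R]; omega, h3, _, h4, h5⟩
        exact ⟨_, rfl, .refl this⟩
      by_cases a : (x0, s) ∈ A <;> by_cases b : (x0, s - 1) ∈ A
      · simp only [e, a, b, if_true]
        rw [if_neg]
        · rfl
        · rintro (⟨_, h⟩ | ⟨_, h⟩)
          · exact (hBN h).2.1 a
          · exact (hBN h).2.1 b
      · have := k _ _ (by omega) (by omega) b a (by simp [adj4]; omega)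
        simp [e, a, b, this]
      · have := k _ _ (by omega) (by omega) a b (by simp [adj4]; omega)
        simp [e, a, b, this]
      · simp [e, a, b]
    rw [this, zmod2_telescope (fun s => if (x0, s) ∈ A then (1 : ZMod 2) else 0) (by omega)]
    simp [hA0, hAtop]
  have c1 : c x1 = 1 := by
    have : ∀ x, x0 ≤ x → x ≤ x1 → c x = 1 := by
      intro x h
      induction x, h using Int.leInduction with
      | base => exact fun _ => c0
      | succ n hn ih => exact fun h => (cstep n hn h).trans (ih (by omega))
    exact this x1 hx le_rfl
  obtain ⟨s, hs, hne⟩ : ∃ s ∈ Finset.Ioc (y0 - 1) y1, e (x1, s - 1) (x1, s) ≠ 0 := by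
    by_contra h
    push Not at h
    have : c x1 = 0 := Finset.sum_eq_zero h
    rw [this] at c1; exact absurd c1 (by decide)
  obtain ⟨z, l, hl, hz⟩ : ∃ z, (x1, z) ∈ B := by
    by_contra h
    push Not at h
    exact hne (if_neg (by rintro (⟨_, h'⟩ | ⟨_, h'⟩) <;> exact h _ h'))
  exact hc2 _ _ hl rfl (hz.mono hNS)

/-- Every 2-colouring of a rectangle has a left-right 4-crossing of one colour or a bottom-top
8-crossing of the other. -/
theorem exists_cross_box' (S : Set (ℤ × ℤ)) {x0 x1 y0 y1 : ℤ} (hx : x0 ≤ x1) (hy : y0 ≤ y1) :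
    (∃ p q : ℤ × ℤ, p.1 = x0 ∧ q.1 = x1 ∧ Conn adj4 (S ∩ box x0 x1 y0 y1) p q) ∨
    (∃ p q : ℤ × ℤ, p.2 = y0 ∧ q.2 = y1 ∧ Conn adj8 (box x0 x1 y0 y1 \ S) p q) := by
  rcases exists_cross_box (Prod.swap ⁻¹' S) hy hx with ⟨p, q, hp, hq, h⟩ | ⟨p, q, hp, hq, h⟩
  · refine .inl ⟨p.swap, q.swap, hp, hq, h.map _ ?_ (fun u v _ _ h => adj4_swap.2 h)⟩
    rintro u ⟨hu, hu'⟩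
    simp only [Set.mem_inter_iff, mem_box, Prod.fst_swap, Prod.snd_swap] at hu' ⊢
    exact ⟨hu, by omega⟩
  · refine .inr ⟨p.swap, q.swap, hp, hq, h.map _ ?_ (fun u v _ _ h => adj8_swap.2 h)⟩
    rintro u ⟨hu, hu'⟩
    simp only [Set.mem_sdiff, mem_box, Prod.fst_swap, Prod.snd_swap] at hu ⊢
    exact ⟨by omega, hu'⟩

end SquareIce

namespace SquareIce

/-! ### Topological quadrilaterals -/

/-- A set of sites with two pairs of opposite sides for which crossing duality holds: in every
2-colouring, exactly one of a 4-crossing from `A1` to `A2` and a dual 8-crossing from `Z1` to `Z2`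
occurs. -/
structure Quad where
  dom : Set (ℤ × ℤ)
  A1 : Set (ℤ × ℤ)
  A2 : Set (ℤ × ℤ)
  Z1 : Set (ℤ × ℤ)
  Z2 : Set (ℤ × ℤ)
  exists_cross : ∀ S : Set (ℤ × ℤ), (∃ a ∈ A1, ∃ b ∈ A2, Conn adj4 (S ∩ dom) a b) ∨
    ∃ a ∈ Z1, ∃ b ∈ Z2, Conn adj8 (dom \ S) a b
  no_cross : ∀ (S : Set (ℤ × ℤ)) (a b a' b' : ℤ × ℤ), a ∈ A1 → b ∈ A2 → Conn adj4 (S ∩ dom) a b →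
    a' ∈ Z1 → b' ∈ Z2 → Conn adj8 (dom \ S) a' b' → False

/-- `S` contains a 4-crossing of `q`. -/
def Quad.Crossed (q : Quad) (S : Set (ℤ × ℤ)) : Prop :=
  ∃ a ∈ q.A1, ∃ b ∈ q.A2, Conn adj4 (S ∩ q.dom) a b

/-- The part of the quad cut off from its dual sides by `P`. -/
def Quad.between (q : Quad) (P : Set (ℤ × ℤ)) : Set (ℤ × ℤ) :=
  {v | v ∈ q.dom ∧ v ∉ P ∧ ∀ z ∈ q.Z1 ∪ q.Z2, ¬ Conn adj8 (q.dom \ P) z v}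

/-- If `X` does not cross the region between the crossings `P` and `P'`, then these are joined
off `X`. -/
theorem Quad.cross_between (q : Quad) {P P' X : Set (ℤ × ℤ)} (hP : q.Crossed P) (hP' : q.Crossed P')
    (hXP : Disjoint X P) (hXP' : Disjoint X P') :
    q.Crossed (X ∩ q.between (P ∪ P')) ∨ ∃ u ∈ P, ∃ v ∈ P', Conn adj8 (q.dom \ X) u v := by
  rcases q.exists_cross (X ∩ q.between (P ∪ P')) with h | ⟨a, ha, b, hb, h⟩
  · exact .inl h
  right
  -- `C1` and `C2` are what the two dual sides reach off `P ∪ P'`. The dual crossing has a stretch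
  -- in `M` leading from `C1` to `C2`; prolonged inside these, it would be a dual crossing off `P`
  -- if it missed `P`, and likewise for `P'`. So the stretch meets both and joins them off `X`.
  let C1 : Set (ℤ × ℤ) := {v | ∃ z ∈ q.Z1, Conn adj8 (q.dom \ (P ∪ P')) z v}
  let C2 : Set (ℤ × ℤ) := {v | ∃ z ∈ q.Z2, Conn adj8 (q.dom \ (P ∪ P')) z v}
  have noPP : ∀ z ∈ q.Z1, ∀ z' ∈ q.Z2, ¬ Conn adj8 (q.dom \ (P ∪ P')) z z' := by
    intro z hz z' hz' h
    obtain ⟨a, ha, b, hb, hc⟩ := hP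
    exact q.no_cross P a b z z' ha hb hc hz hz'
      (h.mono (Set.sdiff_subset_sdiff_right Set.subset_union_left))
  let M : Set (ℤ × ℤ) := {v | v ∈ q.dom ∧ (v ∈ P ∪ P' ∨ v ∉ X ∧ v ∈ q.between (P ∪ P'))}
  let I : ℤ × ℤ → Prop := fun v => v ∈ q.Z1 ∨ ∃ u ∈ C1, adj8 u v
  let F : ℤ × ℤ → Prop := fun v => v ∈ q.Z2 ∨ ∃ u ∈ C2, adj8 v u
  have hcov : ∀ v ∈ q.dom, v ∉ X ∩ q.between (P ∪ P') → v ∈ C1 ∪ M ∪ C2 := by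
    intro v hv hvX
    by_cases h1 : v ∈ P ∪ P'
    · exact .inl (.inr ⟨hv, .inl h1⟩)
    by_cases h2 : v ∈ q.between (P ∪ P')
    · exact .inl (.inr ⟨hv, .inr ⟨fun h => hvX ⟨h, h2⟩, h2⟩⟩)
    · have : ∃ z ∈ q.Z1 ∪ q.Z2, Conn adj8 (q.dom \ (P ∪ P')) z v := by
        by_contra hcon
        push Not at hcon
        exact h2 ⟨hv, h1, hcon⟩
      obtain ⟨z, hz | hz, hc⟩ := this
      · exact .inl (.inl ⟨z, hz, hc⟩)
      · exact .inr ⟨z, hz, hc⟩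
  have hC : ∀ {v}, v ∈ C1 ∨ v ∈ C2 → v ∉ M := by
    rintro v hv ⟨hv1, hv2 | hv2⟩
    · rcases hv with ⟨z, _, hc⟩ | ⟨z, _, hc⟩ <;> exact hc.right.2 hv2
    · rcases hv with ⟨z, hz, hc⟩ | ⟨z, hz, hc⟩
      · exact hv2.2.2.2 z (.inl hz) hc
      · exact hv2.2.2.2 z (.inr hz) hc
  obtain ⟨u, v, hu, hv, hc⟩ := h.passage (P := C1) (M := M) (Q := C2) (I := I) (F := F)
    (fun v hv => hcov v hv.1 hv.2)
    (by
      rcases hcov a h.left.1 h.left.2 with (h1 | h1) | ⟨z, hz, h1⟩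
      · exact .inl h1
      · exact .inr ⟨h1, .inl ha⟩
      · exact absurd h1.symm8 (noPP a ha z hz))
    ⟨fun ⟨z, hz, h1⟩ => noPP z hz b hb h1, fun _ => .inl hb⟩
    (fun u hu v _ h => .inr ⟨u, hu, h⟩) (fun u _ v hv h => .inr ⟨v, hv, h⟩)
    (fun u ⟨z, hz, h1⟩ v ⟨z', hz', h2⟩ h => noPP z hz z' hz'
      ((h1.tail h h2.right).trans h2.symm8))
  have hsub : (q.dom \ (X ∩ q.between (P ∪ P'))) ∩ M ⊆ q.dom \ X := by
    rintro v ⟨hv, hv1, hv2 | hv2⟩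
    · refine ⟨hv1, fun hx => ?_⟩
      rcases hv2 with hv2 | hv2
      · exact hXP.le_bot ⟨hx, hv2⟩
      · exact hXP'.le_bot ⟨hx, hv2⟩
    · exact ⟨hv1, hv2.1⟩
  have hc' := hc.mono hsub
  -- the stretch meets every crossing contained in `P ∪ P'`
  have meets : ∀ Y ⊆ P ∪ P', q.Crossed Y → ∃ w ∈ Y, Conn adj8 (q.dom \ X) u w := by
    rintro Y hY ⟨a, ha, b, hb, hcr⟩
    rcases hc'.avoid_or_hit Y with h1 | h1
    · exfalso
      have hd : ∀ z v, Conn adj8 (q.dom \ (P ∪ P')) z v → Conn adj8 (q.dom \ Y) z v := fun z v h =>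
        h.mono (Set.sdiff_subset_sdiff_right hY)
      have h1' := h1.mono (fun v (hv : v ∈ (q.dom \ X) \ Y) => (⟨hv.1.1, hv.2⟩ : v ∈ q.dom \ Y))
      obtain ⟨z, hz, hzu⟩ : ∃ z ∈ q.Z1, Conn adj8 (q.dom \ Y) z u := by
        rcases hu with hu | ⟨t, ⟨z, hz, ht⟩, htu⟩
        · exact ⟨u, hu, .refl h1'.left⟩
        · exact ⟨z, hz, (hd _ _ ht).tail htu h1'.left⟩
      obtain ⟨z', hz', hzv⟩ : ∃ z ∈ q.Z2, Conn adj8 (q.dom \ Y) v z := by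
        rcases hv with hv | ⟨t, ⟨z, hz, ht⟩, htu⟩
        · exact ⟨v, hv, .refl h1'.right⟩
        · exact ⟨z, hz, Conn.head h1'.right htu (hd _ _ ht).symm8⟩
      exact q.no_cross Y a b z z' ha hb hcr hz hz' ((hzu.trans h1').trans hzv)
    · exact h1
  obtain ⟨w, hw, hwc⟩ := meets P Set.subset_union_left hP
  obtain ⟨w', hw', hwc'⟩ := meets P' Set.subset_union_right hP'
  exact ⟨w, hw, w', hw', hwc.symm8.trans hwc'⟩

/-- The face `c` has the site `v` as a corner. -/
def Inc (c v : ℤ × ℤ) : Prop := c.1 ≤ v.1 ∧ v.1 ≤ c.1 + 1 ∧ c.2 ≤ v.2 ∧ v.2 ≤ c.2 + 1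

/-- A symmetry of the lattice of sites and faces. -/
structure LatIso where
  f : ℤ × ℤ ≃ ℤ × ℤ
  g : ℤ × ℤ ≃ ℤ × ℤ
  adj4_f : ∀ u v, adj4 (f u) (f v) ↔ adj4 u v
  adj8_f : ∀ u v, adj8 (f u) (f v) ↔ adj8 u v
  inc : ∀ c v, Inc (g c) (f v) ↔ Inc c v

/-- The reflection `x ↦ m - x`. -/
def LatIso.reflect (m : ℤ) : LatIso where
  f := ⟨fun v => (m - v.1, v.2), fun v => (m - v.1, v.2), fun v => by simp, fun v => by simp⟩
  g := ⟨fun v => (m - 1 - v.1, v.2), fun v => (m - 1 - v.1, v.2), fun v => by simp, fun v => by simp⟩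
  adj4_f u v := by simp only [adj4, Equiv.coe_fn_mk]; omega
  adj8_f u v := by simp only [adj8, Equiv.coe_fn_mk]; omega
  inc u v := by simp only [Inc, Equiv.coe_fn_mk]; omega

theorem LatIso.reflect_f (m : ℤ) (v) : (LatIso.reflect m).f v = (m - v.1, v.2) := rfl
theorem LatIso.reflect_symm (m : ℤ) (v) : (LatIso.reflect m).f.symm v = (m - v.1, v.2) := rfl

/-- The diagonal reflection `(x, y) ↦ (y + m, x - m)`. -/
def LatIso.diag (m : ℤ) : LatIso where
  f := ⟨fun v => (v.2 + m, v.1 - m), fun v => (v.2 + m, v.1 - m), fun v => by simp, fun v => by simp⟩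
  g := ⟨fun v => (v.2 + m, v.1 - m), fun v => (v.2 + m, v.1 - m), fun v => by simp, fun v => by simp⟩
  adj4_f u v := by simp only [adj4, Equiv.coe_fn_mk]; omega
  adj8_f u v := by simp only [adj8, Equiv.coe_fn_mk]; omega
  inc u v := by simp only [Inc, Equiv.coe_fn_mk]; omega

theorem LatIso.diag_f (m : ℤ) (v) : (LatIso.diag m).f v = (v.2 + m, v.1 - m) := rfl
theorem LatIso.diag_symm (m : ℤ) (v) : (LatIso.diag m).f.symm v = (v.2 + m, v.1 - m) := rfl

theorem Conn.lat4 (φ : LatIso) {S : Set (ℤ × ℤ)} {a b} (h : Conn adj4 S a b) :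
    Conn adj4 (φ.f.symm ⁻¹' S) (φ.f a) (φ.f b) :=
  h.map _ (fun u hu => by simpa using hu) (fun u v _ _ h => (φ.adj4_f u v).2 h)

theorem Conn.lat8 (φ : LatIso) {S : Set (ℤ × ℤ)} {a b} (h : Conn adj8 S a b) :
    Conn adj8 (φ.f.symm ⁻¹' S) (φ.f a) (φ.f b) :=
  h.map _ (fun u hu => by simpa using hu) (fun u v _ _ h => (φ.adj8_f u v).2 h)

theorem Conn.lat4' (φ : LatIso) {S : Set (ℤ × ℤ)} {a b} (h : Conn adj4 S a b) :
    Conn adj4 (φ.f ⁻¹' S) (φ.f.symm a) (φ.f.symm b) :=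
  h.map _ (fun u hu => by simpa using hu) (fun u v _ _ h => by
    rw [← φ.adj4_f]; simpa using h)

theorem Conn.lat8' (φ : LatIso) {S : Set (ℤ × ℤ)} {a b} (h : Conn adj8 S a b) :
    Conn adj8 (φ.f ⁻¹' S) (φ.f.symm a) (φ.f.symm b) :=
  h.map _ (fun u hu => by simpa using hu) (fun u v _ _ h => by
    rw [← φ.adj8_f]; simpa using h)

/-- A quad with a symmetry exchanging its crossing sides with its dual sides. -/
structure SymQuad extends Quad where
  σ : LatIso
  finite : dom.Finite
  A_sub : A1 ∪ A2 ⊆ dom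
  Z_sub : Z1 ∪ Z2 ⊆ dom
  invol : ∀ v, σ.f (σ.f v) = v
  dom_σ : ∀ v ∈ dom, σ.f v ∈ dom
  -- A corner may lie on a crossing side and on a dual side at once, so only the rest of the
  -- crossing sides is required to be exchanged.
  A1_σ : ∀ v ∈ A1 \ (Z1 ∪ Z2), σ.f v ∈ Z1
  A2_σ : ∀ v ∈ A2 \ (Z1 ∪ Z2), σ.f v ∈ Z2
  -- Every site with a face sticking out of the quad is on one of the four sides; prescribing the
  -- sides therefore shields the inside.
  bdry : ∀ v ∈ dom, (∃ c, Inc c v ∧ ∃ u, Inc c u ∧ u ∉ dom) → v ∈ A1 ∪ A2 ∪ (Z1 ∪ Z2)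

/-- The image of a symmetric quad under a lattice symmetry. -/
def SymQuad.map (q : SymQuad) (φ : LatIso) : SymQuad where
  dom := φ.f.symm ⁻¹' q.dom
  A1 := φ.f.symm ⁻¹' q.A1
  A2 := φ.f.symm ⁻¹' q.A2
  Z1 := φ.f.symm ⁻¹' q.Z1
  Z2 := φ.f.symm ⁻¹' q.Z2
  exists_cross S := by
    rcases q.exists_cross (φ.f ⁻¹' S) with ⟨a, ha, b, hb, h⟩ | ⟨a, ha, b, hb, h⟩
    · refine .inl ⟨φ.f a, by simpa using ha, φ.f b, by simpa using hb, (h.lat4 φ).mono ?_⟩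
      rintro v ⟨h1, h2⟩; exact ⟨by simpa using h1, h2⟩
    · refine .inr ⟨φ.f a, by simpa using ha, φ.f b, by simpa using hb, (h.lat8 φ).mono ?_⟩
      rintro v ⟨h1, h2⟩; exact ⟨h1, by simpa using h2⟩
  no_cross S a b a' b' ha hb h ha' hb' h' :=
    q.no_cross (φ.f ⁻¹' S) _ _ _ _ ha hb ((h.lat4' φ).mono (by
      rintro v ⟨h1, h2⟩; exact ⟨h1, by simpa using h2⟩)) ha' hb' ((h'.lat8' φ).mono (by
      rintro v ⟨h1, h2⟩; exact ⟨by simpa using h1, h2⟩))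
  σ := { f := (φ.f.symm.trans q.σ.f).trans φ.f
         g := (φ.g.symm.trans q.σ.g).trans φ.g
         adj4_f := fun u v => by
          simp only [Equiv.trans_apply]; rw [φ.adj4_f, q.σ.adj4_f, ← φ.adj4_f]; simp
         adj8_f := fun u v => by
          simp only [Equiv.trans_apply]; rw [φ.adj8_f, q.σ.adj8_f, ← φ.adj8_f]; simp
         inc := fun u v => by
          simp only [Equiv.trans_apply]; rw [φ.inc, q.σ.inc, ← φ.inc]; simp }
  finite := q.finite.preimage (φ.f.symm.injective.injOn)
  A_sub := fun v hv => q.A_sub hv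
  Z_sub := fun v hv => q.Z_sub hv
  invol v := by simp [q.invol]
  dom_σ v hv := by simpa using q.dom_σ _ hv
  A1_σ v hv := by simpa using q.A1_σ _ hv
  A2_σ v hv := by simpa using q.A2_σ _ hv
  bdry v hv := by
    rintro ⟨c, hc, u, hu, hud⟩
    refine q.bdry _ hv ⟨φ.g.symm c, ?_, φ.f.symm u, ?_, hud⟩ <;> rw [← φ.inc] <;> simpa

theorem SymQuad.map_crossed (q : SymQuad) (φ : LatIso) (S : Set (ℤ × ℤ)) :
    (q.map φ).Crossed S ↔ q.Crossed (φ.f ⁻¹' S) := by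
  constructor
  · rintro ⟨a, ha, b, hb, h⟩
    refine ⟨_, ha, _, hb, (h.lat4' φ).mono ?_⟩
    rintro v ⟨h1, h2⟩; exact ⟨h1, by simpa [SymQuad.map] using h2⟩
  · rintro ⟨a, ha, b, hb, h⟩
    refine ⟨φ.f a, by simpa [SymQuad.map] using ha, φ.f b, by simpa [SymQuad.map] using hb,
      (h.lat4 φ).mono ?_⟩
    rintro v ⟨h1, h2⟩; exact ⟨by simpa using h1, h2⟩

theorem box_finite (x0 x1 y0 y1 : ℤ) : (box x0 x1 y0 y1).Finite :=
  ((Set.finite_Icc x0 x1).prod (Set.finite_Icc y0 y1)).subset (fun v hv => by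
    simp only [mem_box] at hv; simp only [Set.mem_prod, Set.mem_Icc]; omega)

/-- The square with its bottom and top as crossing sides. -/
def SymQuad.square (x0 y0 s : ℤ) (hs : 0 ≤ s) : SymQuad where
  dom := box x0 (x0 + s) y0 (y0 + s)
  A1 := {v | v ∈ box x0 (x0 + s) y0 (y0 + s) ∧ v.2 = y0}
  A2 := {v | v ∈ box x0 (x0 + s) y0 (y0 + s) ∧ v.2 = y0 + s}
  Z1 := {v | v ∈ box x0 (x0 + s) y0 (y0 + s) ∧ v.1 = x0}
  Z2 := {v | v ∈ box x0 (x0 + s) y0 (y0 + s) ∧ v.1 = x0 + s}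
  exists_cross S := by
    rcases exists_cross_box S (x0 := x0) (x1 := x0 + s) (y0 := y0) (y1 := y0 + s) (by omega) (by omega)
      with ⟨p, q, hp, hq, h⟩ | ⟨p, q, hp, hq, h⟩
    · exact .inl ⟨p, ⟨h.left.2, hp⟩, q, ⟨h.right.2, hq⟩, h⟩
    · exact .inr ⟨p, ⟨h.left.1, hp⟩, q, ⟨h.right.1, hq⟩, h⟩
  no_cross S a b a' b' ha hb h ha' hb' h' := by
    refine no_cross_box h Set.inter_subset_right ha.2 hb.2 h' ?_ ha'.2 hb'.2
    rintro v ⟨h1, h2⟩; exact ⟨h1, fun h => h2 h.1⟩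
  σ := LatIso.diag (x0 - y0)
  finite := box_finite _ _ _ _
  A_sub := by rintro v (h | h) <;> exact h.1
  Z_sub := by rintro v (h | h) <;> exact h.1
  invol v := by simp [LatIso.diag]
  dom_σ v hv := by simp only [LatIso.diag, Equiv.coe_fn_mk, mem_box] at hv ⊢; omega
  A1_σ v hv := by
    have := hv.1
    simp only [LatIso.diag, Equiv.coe_fn_mk, mem_box, Set.mem_ofPred_eq] at this ⊢; omega
  A2_σ v hv := by
    have := hv.1
    simp only [LatIso.diag, Equiv.coe_fn_mk, mem_box, Set.mem_ofPred_eq] at this ⊢; omega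
  bdry v hv := by
    rintro ⟨c, hc, u, hu, hud⟩
    simp only [Inc, mem_box, Set.mem_union, Set.mem_ofPred_eq] at *
    omega

/-- Duality in a rectangle with bottom side cut at `a` and top side cut at `a'`. -/
theorem exists_cross_arc (S : Set (ℤ × ℤ)) {x0 x1 y0 y1 a a' : ℤ} (h1 : x0 ≤ a + 1) (h2 : a + 1 ≤ x1)
    (h3 : x0 - 1 ≤ a') (h4 : a' ≤ x1) (hy : y0 ≤ y1) :
    (∃ p q, (p.2 = y0 ∧ a + 1 ≤ p.1) ∧ (q.1 = x0 ∨ q.2 = y1 ∧ q.1 ≤ a') ∧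
      Conn adj4 (S ∩ box x0 x1 y0 y1) p q) ∨
    (∃ p q, (p.2 = y0 ∧ p.1 ≤ a + 1) ∧ (q.1 = x1 ∨ q.2 = y1 ∧ a' ≤ q.1) ∧
      Conn adj8 (box x0 x1 y0 y1 \ S) p q) := by
  let R := box x0 x1 y0 y1
  -- In a larger rectangle, `P` is coloured below the right part of the bottom, and `Q` along the
  -- left side and above the left part of the top. This turns the two arcs into full sides, and
  -- `passage` cuts the resulting crossing down to the original rectangle.
  let P : Set (ℤ × ℤ) := {v | v.2 = y0 - 2 ∨ v.2 = y0 - 1 ∧ a + 1 ≤ v.1 ∧ v.1 ≤ x1}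
  let Q : Set (ℤ × ℤ) := {v | v.2 = y1 + 2 ∨ v.2 = y1 + 1 ∧ x0 - 1 ≤ v.1 ∧ v.1 ≤ a' ∨
    v.1 = x0 - 1 ∧ y0 ≤ v.2 ∧ v.2 ≤ y1}
  have hbox : box x0 x1 y0 y1 ⊆ box (x0 - 2) (x1 + 1) (y0 - 2) (y1 + 2) := by
    intro v hv; simp only [mem_box] at *; omega
  rcases exists_cross_box ((S ∩ R) ∪ P ∪ Q) (x0 := x0 - 2) (x1 := x1 + 1) (y0 := y0 - 2)
    (y1 := y1 + 2) (by omega) (by omega) with ⟨p, q, hp, hq, h⟩ | ⟨p, q, hp, hq, h⟩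
  · left
    obtain ⟨u, v, hu, hv, hc⟩ := h.passage (P := P) (M := S ∩ R) (Q := Q)
      (I := fun u => u.2 = y0 ∧ a + 1 ≤ u.1) (F := fun q => q.1 = x0 ∨ q.2 = y1 ∧ q.1 ≤ a')
      (by rintro v ⟨(h | h) | h, _⟩; exacts [.inl (.inr h), .inl (.inl h), .inr h])
      (.inl (.inl hp)) ⟨by simp only [P, Set.mem_ofPred_eq]; omega, by
        rintro ⟨_, hh⟩; simp only [R, mem_box] at hh; omega⟩
      (by
        rintro u hu v ⟨_, hv⟩ huv
        simp only [P, R, adj4, mem_box, Set.mem_ofPred_eq] at *; omega)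
      (by
        rintro u ⟨_, hu⟩ v hv huv
        simp only [Q, R, adj4, mem_box, Set.mem_ofPred_eq] at *; omega)
      (by
        rintro u hu v hv huv
        simp only [Q, P, adj4, Set.mem_ofPred_eq] at *; omega)
    exact ⟨u, v, hu, hv, hc.mono Set.inter_subset_right⟩
  · right
    let P' : Set (ℤ × ℤ) := {v | (v.1 = x0 - 2 ∨ v.2 = y0 - 1 ∧ v.1 ≤ a) ∧ y0 - 1 ≤ v.2 ∧ v.2 ≤ y1 + 1}
    let Q' : Set (ℤ × ℤ) := {v | (v.1 = x1 + 1 ∨ v.2 = y1 + 1 ∧ a' + 1 ≤ v.1) ∧ y0 - 1 ≤ v.2 ∧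
      v.2 ≤ y1 + 1}
    have hin : ∀ v ∈ box (x0 - 2) (x1 + 1) (y0 - 2) (y1 + 2) \ ((S ∩ R) ∪ P ∪ Q),
        v ∈ P' ∪ (R \ S) ∪ Q' := by
      rintro v ⟨hv1, hv2⟩
      have n1 : ¬ v ∈ P := fun h => hv2 (.inl (.inr h))
      have n2 : ¬ v ∈ Q := fun h => hv2 (.inr h)
      by_cases hR : v ∈ R
      · exact .inl (.inr ⟨hR, fun h => hv2 (.inl (.inl ⟨h, hR⟩))⟩)
      · simp only [Q, P, P', Q', R, mem_box, Set.mem_ofPred_eq, Set.mem_union] at *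
        omega
    have hp' := hin _ h.left
    have hq' := hin _ h.right
    obtain ⟨u, v, hu, hv, hc⟩ := h.passage (P := P') (M := R \ S) (Q := Q')
      (I := fun p => p.2 = y0 ∧ p.1 ≤ a + 1) (F := fun q => q.1 = x1 ∨ q.2 = y1 ∧ a' ≤ q.1)
      hin
      (by
        rcases hp' with (h | h) | h
        · exact .inl h
        · have := h.1; simp only [R, mem_box] at this; omega
        · simp only [Q', Set.mem_ofPred_eq] at h; omega)
      ⟨by simp only [P', Set.mem_ofPred_eq]; omega, by
        rintro ⟨hh, _⟩; simp only [R, mem_box] at hh; omega⟩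
      (by
        rintro u hu v ⟨hv, _⟩ huv
        simp only [P', R, adj8, mem_box, Set.mem_ofPred_eq] at *; omega)
      (by
        rintro u ⟨hu, _⟩ v hv huv
        simp only [Q', R, adj8, mem_box, Set.mem_ofPred_eq] at *; omega)
      (by
        rintro u hu v hv huv
        simp only [Q', P', adj8, Set.mem_ofPred_eq] at *; omega)
    exact ⟨u, v, hu, hv, hc.mono Set.inter_subset_right⟩

/-- Disjointness of a 4-crossing ending on the left or top side and an 8-path starting to the left
of it and ending on the right or further right on the top. -/
theorem no_cross_arc {X S : Set (ℤ × ℤ)} {x0 x1 y0 y1 a' : ℤ} {p q u v : ℤ × ℤ}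
    (hX : Conn adj4 X p q) (hXs : X ⊆ box x0 x1 y0 y1) (hp : p.2 = y0)
    (hq : q.1 = x0 ∨ q.2 = y1 ∧ q.1 ≤ a')
    (h : Conn adj8 S u v) (hS : S ⊆ box x0 x1 y0 y1 \ X) (hu : u.2 = y0) (hup : u.1 ≤ p.1)
    (hv : v.1 = x1 ∨ v.2 = y1 ∧ a' ≤ v.1) : False := by
  -- A column on the left for `X` and one on the right for `S` let both paths end on the top row, in
  -- the wrong order for paths that do not meet.
  let X' : Set (ℤ × ℤ) := X ∪ {w | w.1 = x0 - 1 ∧ y0 ≤ w.2 ∧ w.2 ≤ y1}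
  let S' : Set (ℤ × ℤ) := S ∪ {w | w.1 = x1 + 1 ∧ y0 ≤ w.2 ∧ w.2 ≤ y1}
  have bq := hXs hX.right
  have bv := (hS h.right).1
  simp only [mem_box] at bq bv
  obtain ⟨q', hq', hX'⟩ : ∃ q', (q' = q.1 ∧ q.2 = y1 ∧ q.1 ≤ a' ∨ q' = x0 - 1) ∧
      Conn adj4 X' p (q', y1) := by
    rcases hq with hq | hq
    · refine ⟨x0 - 1, .inr rfl, ((hX.mono (fun _ h => .inl h)).tail (c := (x0 - 1, q.2)) ?_ ?_).trans
        (conn_vertical (by omega) ?_)⟩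
      · exact .inr ⟨rfl, by dsimp only; omega, by dsimp only; omega⟩
      · exact .inr ⟨rfl, by dsimp only; omega, by dsimp only; omega⟩
      · intro s h1 h2; exact .inr ⟨rfl, by dsimp only; omega, by dsimp only; omega⟩
    · refine ⟨q.1, .inl ⟨rfl, hq⟩, ?_⟩
      rw [← hq.1]
      exact hX.mono (fun _ h => .inl h)
  obtain ⟨v', hv', hS'⟩ : ∃ v', (v' = v.1 ∧ v.2 = y1 ∧ a' ≤ v.1 ∨ v' = x1 + 1) ∧
      Conn adj8 S' u (v', y1) := by
    rcases hv with hv | hv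
    · refine ⟨x1 + 1, .inr rfl, ((h.mono (fun _ h => .inl h)).tail (c := (x1 + 1, v.2)) ?_ ?_).trans
        (conn_vertical (by omega) ?_).to8⟩
      · simp only [adj8]; omega
      · exact .inr ⟨rfl, by dsimp only; omega, by dsimp only; omega⟩
      · intro s h1 h2; exact .inr ⟨rfl, by dsimp only; omega, by dsimp only; omega⟩
    · refine ⟨v.1, .inl ⟨rfl, hv⟩, ?_⟩
      rw [← hv.1]
      exact h.mono (fun _ h => .inl h)
  obtain ⟨p, p2⟩ := p
  dsimp only at hp hup
  subst hp
  refine no_cross_strip hX' ?_ hS' ?_ (.inl ⟨hu, hup⟩) (.inr ⟨rfl, by dsimp only; omega⟩)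
  · rintro w (hw | hw)
    · exact (hXs hw).2.2
    · exact hw.2
  · rintro w (hw | hw)
    · have hb := (hS hw).1
      have hx := (hS hw).2
      simp only [mem_box] at hb
      refine ⟨hb.2.2.1, hb.2.2.2, ?_⟩
      rintro (h | h)
      · exact hx h
      · simp only [Set.mem_ofPred_eq] at h; omega
    · refine ⟨hw.2.1, hw.2.2, ?_⟩
      simp only [Set.mem_ofPred_eq] at hw
      rintro (h | h)
      · have := hXs h; simp only [mem_box] at this; omega
      · simp only [Set.mem_ofPred_eq] at h; omega

/-- The rectangle symmetric about `x = a + 1/2`, with crossing sides the right half of the bottom,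
and the left side together with the left half of the top. -/
def SymQuad.half (a s y0 y1 : ℤ) (hs : 1 ≤ s) (hy : y0 ≤ y1) : SymQuad where
  dom := box (a + 1 - s) (a + s) y0 y1
  A1 := {v | v ∈ box (a + 1 - s) (a + s) y0 y1 ∧ v.2 = y0 ∧ a + 1 ≤ v.1}
  A2 := {v | v ∈ box (a + 1 - s) (a + s) y0 y1 ∧ (v.1 = a + 1 - s ∨ v.2 = y1 ∧ v.1 ≤ a)}
  Z1 := {v | v ∈ box (a + 1 - s) (a + s) y0 y1 ∧ v.2 = y0 ∧ v.1 ≤ a + 1}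
  Z2 := {v | v ∈ box (a + 1 - s) (a + s) y0 y1 ∧ (v.1 = a + s ∨ v.2 = y1 ∧ a ≤ v.1)}
  exists_cross S := by
    rcases exists_cross_arc S (x0 := a + 1 - s) (x1 := a + s) (a := a) (a' := a) (by omega) (by omega)
      (by omega) (by omega) hy with ⟨p, q, hp, hq, h⟩ | ⟨p, q, hp, hq, h⟩
    · exact .inl ⟨p, ⟨h.left.2, hp⟩, q, ⟨h.right.2, hq⟩, h⟩
    · exact .inr ⟨p, ⟨h.left.1, hp⟩, q, ⟨h.right.1, hq⟩, h⟩
  no_cross S p q u v ha hb h ha' hb' h' := by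
    refine no_cross_arc h Set.inter_subset_right ha.2.1 hb.2 h' ?_ ha'.2.1
      (ha'.2.2.trans ha.2.2) hb'.2
    rintro v ⟨h1, h2⟩; exact ⟨h1, fun h => h2 h.1⟩
  σ := LatIso.reflect (2 * a + 1)
  finite := box_finite _ _ _ _
  A_sub := by rintro v (h | h) <;> exact h.1
  Z_sub := by rintro v (h | h) <;> exact h.1
  invol v := by simp [LatIso.reflect]
  dom_σ v hv := by simp only [LatIso.reflect, Equiv.coe_fn_mk, mem_box] at hv ⊢; omega
  A1_σ v hv := by
    have := hv.1
    simp only [LatIso.reflect, Equiv.coe_fn_mk, mem_box, Set.mem_ofPred_eq] at this ⊢; omega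
  A2_σ v hv := by
    have := hv.1
    simp only [LatIso.reflect, Equiv.coe_fn_mk, mem_box, Set.mem_ofPred_eq] at this ⊢; omega
  bdry v hv := by
    rintro ⟨c, hc, u, hu, hud⟩
    simp only [Inc, mem_box, Set.mem_union, Set.mem_ofPred_eq] at *
    omega

end SquareIce

namespace SquareIce

theorem Conn.first_exit {α : Type*} {r : α → α → Prop} {S : Set α} {a b : α} (C : Set α)
    (h : Conn r S a b) (ha : a ∈ C) :
    Conn r (S ∩ C) a b ∨ ∃ v w, Conn r (S ∩ C) a v ∧ r v w ∧ w ∈ S ∧ w ∉ C := by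
  refine h.rec' (p := fun b => Conn r (S ∩ C) a b ∨
    ∃ v w, Conn r (S ∩ C) a v ∧ r v w ∧ w ∈ S ∧ w ∉ C) (.inl (.refl ⟨h.1, ha⟩)) ?_
  rintro u v _ h2 h3 (ih | ih)
  · by_cases hv : v ∈ C
    · exact .inl (ih.tail h2 ⟨h3, hv⟩)
    · exact .inr ⟨u, v, ih, h2, h3, hv⟩
  · exact .inr ih

/-! ### Crossings of a strip avoiding common symmetric quads swing from side to side -/

/-- `P` is a set of the strip `0 ≤ y ≤ H` joining `(x, 0)` to its top. -/
structure StripCrossing (P : Set (ℤ × ℤ)) (x H : ℤ) : Prop where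
  rows : ∀ v ∈ P, 0 ≤ v.2 ∧ v.2 ≤ H
  cross : ∃ t, Conn adj4 P (x, 0) (t, H)

/-- `P` leaves the box from `(x, 0)` through the left side or the left half of the top. -/
def ExitsLeft (X s H : ℤ) (P : Set (ℤ × ℤ)) (x : ℤ) : Prop :=
  ∃ z, (z.1 = X - s ∨ z.2 = H ∧ z.1 ≤ X - 1) ∧ Conn adj4 (P ∩ box (X - s) (X + s - 1) 0 H) (x, 0) z

/-- `P'` starts to the left of `P`, and the stretch of `P` up to its exit on the left shuts `P'` off
from the right side and the right half of the top. As `P'` must leave the box or reach the top, it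
does so on the left as well. -/
theorem ExitsLeft.follow {X s H x x' : ℤ} {P P' : Set (ℤ × ℤ)} (h : ExitsLeft X s H P x)
    (hd : Disjoint P P') (hP' : StripCrossing P' x' H) (h1 : X ≤ x') (h2 : x' ≤ x)
    (h3 : x ≤ X + s - 1) (hs : 1 ≤ s) (hH : 0 ≤ H) : ExitsLeft X s H P' x' := by
  obtain ⟨z, hz, hc⟩ := h
  obtain ⟨t, ht⟩ := hP'.cross
  have bar : ∀ v, Conn adj4 (P' ∩ box (X - s) (X + s - 1) 0 H) (x', 0) v →
      ¬ (v.1 = X + s - 1 ∨ v.2 = H ∧ X - 1 ≤ v.1) := by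
    intro v hv hv'
    refine no_cross_arc hc Set.inter_subset_right rfl hz hv.to8 ?_ rfl h2 hv'
    rintro w ⟨hw1, hw2⟩
    exact ⟨hw2, fun h => hd.le_bot ⟨h.1, hw1⟩⟩
  rcases ht.first_exit (box (X - s) (X + s - 1) 0 H) (by simp only [mem_box]; omega) with h | ⟨v, w, h, hvw, hw, hwb⟩
  · refine ⟨_, .inr ⟨rfl, ?_⟩, h⟩
    by_contra hcon
    exact bar _ h (.inr ⟨rfl, by dsimp only; omega⟩)
  · have hr := hP'.rows w hw
    have hb := h.right.2
    have hn := bar v h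
    simp only [mem_box, adj4] at hwb hb hvw
    exact ⟨v, by omega, h⟩

theorem ExitsLeft.crossed {X s H x : ℤ} {P : Set (ℤ × ℤ)} (h : ExitsLeft X s H P x)
    (h1 : X ≤ x) (hs : 1 ≤ s) (hH : 0 ≤ H) : (SymQuad.half (X - 1) s 0 H hs hH).Crossed P := by
  obtain ⟨z, hz, hc⟩ := h
  have e : box (X - s) (X + s - 1) 0 H = box (X - 1 + 1 - s) (X - 1 + s) 0 H := by
    ext v; simp only [mem_box]; omega
  rw [e] at hc
  exact ⟨_, ⟨hc.left.2, rfl, by dsimp only; omega⟩, z, ⟨hc.right.2, by omega⟩, hc⟩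

/-- Suppose that `P0` does not reach the right side within the narrower box. If it exits left, so
does `P1` by `ExitsLeft.follow`, and both cross the half-rectangle quad. If it reaches the right
half of the top, it shuts `P1` off from the right side. Then either `P1` exits left, followed by
`P2`, so that these two cross the half-rectangle, or `P1` reaches the top as well, and `P0` and
`P1`, stopped at height `2 * s - 1`, both cross the square. -/
theorem swing_right {P0 P1 P2 : Set (ℤ × ℤ)} {x0 x1 x2 X s H : ℤ} (hP0 : StripCrossing P0 x0 H)
    (hP1 : StripCrossing P1 x1 H) (hP2 : StripCrossing P2 x2 H) (h01 : Disjoint P0 P1)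
    (h12 : Disjoint P1 P2) (hX : X ≤ x2) (hx2 : x2 ≤ x1) (hx1 : x1 ≤ x0) (hx0 : x0 ≤ X + s - 1)
    (hs : 1 ≤ s) (hsH : 2 * s - 1 ≤ H) :
    (∃ z, z.1 = X + s - 1 ∧ Conn adj4 (P0 ∩ box (X - s + 1) (X + s - 1) 0 H) (x0, 0) z) ∨
    ∃ q : SymQuad, q.dom ⊆ box (X - s) (X + s - 1) 0 H ∧
      (q.Crossed P0 ∧ q.Crossed P1 ∨ q.Crossed P1 ∧ q.Crossed P2) := by
  have hH : 0 ≤ H := by omega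
  by_contra hcon
  push Not at hcon
  obtain ⟨hc1, hc2⟩ := hcon
  have hhalf := hc2 (SymQuad.half (X - 1) s 0 H hs hH) (by
    intro v hv; simp only [SymQuad.half, mem_box] at hv ⊢; omega)
  have hsq := hc2 (SymQuad.square (X - s) 0 (2 * s - 1) (by omega)) (by
    intro v hv; simp only [SymQuad.square, mem_box] at hv ⊢; omega)
  -- where a strip crossing can go
  have main : ∀ P x, StripCrossing P x H → X ≤ x → x ≤ X + s - 1 →
      (∀ z, z.1 = X + s - 1 → ¬ Conn adj4 (P ∩ box (X - s + 1) (X + s - 1) 0 H) (x, 0) z) →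
      ExitsLeft X s H P x ∨
        ∃ t, X ≤ t ∧ Conn adj4 (P ∩ box (X - s + 1) (X + s - 1) 0 H) (x, 0) (t, H) := by
    intro P x hP h1 h2 hno
    obtain ⟨t, ht⟩ := hP.cross
    have hsub : P ∩ box (X - s + 1) (X + s - 1) 0 H ⊆ P ∩ box (X - s) (X + s - 1) 0 H := by
      rintro v ⟨hv, hv'⟩; refine ⟨hv, ?_⟩; simp only [mem_box] at hv' ⊢; omega
    rcases ht.first_exit (box (X - s + 1) (X + s - 1) 0 H) (by simp only [mem_box]; omega) with
      h | ⟨v, w, h, hvw, hw, hwb⟩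
    · by_cases htX : X ≤ t
      · exact .inr ⟨t, htX, h⟩
      · exact .inl ⟨_, .inr ⟨rfl, by dsimp only; omega⟩, h.mono hsub⟩
    · left
      have hr := hP.rows w hw
      have hb := h.right.2
      have hn : v.1 ≠ X + s - 1 := fun e => hno v e h
      have hvw' := hvw
      simp only [mem_box, adj4] at hwb hb hvw
      refine ⟨w, .inl (by omega), (h.mono hsub).tail hvw' ⟨hw, ?_⟩⟩
      simp only [mem_box]; omega
  have toSquare : ∀ P x t, Conn adj4 (P ∩ box (X - s + 1) (X + s - 1) 0 H) (x, 0) (t, H) →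
      (SymQuad.square (X - s) 0 (2 * s - 1) (by omega)).Crossed P := by
    intro P x t h
    have hsub : (P ∩ box (X - s + 1) (X + s - 1) 0 H) ∩ {v | v.2 ≤ 2 * s - 1} ⊆
        P ∩ box (X - s) (X - s + (2 * s - 1)) 0 (0 + (2 * s - 1)) := by
      rintro v ⟨⟨hv, hv'⟩, hv''⟩; refine ⟨hv, ?_⟩
      simp only [mem_box, Set.mem_ofPred_eq] at hv' hv'' ⊢; omega
    rcases h.first_exit {v | v.2 ≤ 2 * s - 1} (by simp only [Set.mem_ofPred_eq]; omega) with
      h' | ⟨v, w, h', hvw, hw, hwb⟩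
    · have := h'.right.2
      simp only [Set.mem_ofPred_eq] at this
      have h'' := h'.mono hsub
      exact ⟨_, ⟨h''.left.2, rfl⟩, _, ⟨h''.right.2, by dsimp only; omega⟩, h''⟩
    · have := h'.right.2
      simp only [Set.mem_ofPred_eq] at this hwb
      have h'' := h'.mono hsub
      refine ⟨_, ⟨h''.left.2, rfl⟩, v, ⟨h''.right.2, ?_⟩, h''⟩
      simp only [adj4] at hvw; omega
  rcases main P0 x0 hP0 (by omega) hx0 hc1 with h0 | ⟨t, ht, h0⟩
  · exact hhalf.1 (h0.crossed (by omega) hs hH)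
      ((h0.follow h01 hP1 (by omega) hx1 hx0 hs hH).crossed (by omega) hs hH)
  · rcases main P1 x1 hP1 (by omega) (by omega) (by
      intro z hz hcz
      refine no_cross_arc (a' := t) h0 Set.inter_subset_right rfl (.inr ⟨rfl, le_rfl⟩) hcz.to8 ?_ rfl
        hx1 (.inl hz)
      rintro w ⟨hw1, hw2⟩
      exact ⟨hw2, fun h => h01.le_bot ⟨h.1, hw1⟩⟩) with h1 | ⟨t', ht', h1⟩
    · exact hhalf.2 (h1.crossed (by omega) hs hH)
        ((h1.follow h12 hP2 hX hx2 (by omega) hs hH).crossed hX hs hH)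
    · exact hsq.1 (toSquare _ _ _ h0) (toSquare _ _ _ h1)

theorem StripCrossing.reflect {P : Set (ℤ × ℤ)} {x H : ℤ} (h : StripCrossing P x H) :
    StripCrossing ((LatIso.reflect 0).f ⁻¹' P) (-x) H := by
  refine ⟨fun v hv => by simpa [LatIso.reflect] using h.rows _ hv, ?_⟩
  obtain ⟨t, ht⟩ := h.cross
  have := ht.lat4' (LatIso.reflect 0)
  simp only [LatIso.reflect_symm, zero_sub] at this
  exact ⟨_, this⟩

/-- The mirror image of `swing_right` under `x ↦ -x`. -/
theorem swing_left {P0 P1 P2 : Set (ℤ × ℤ)} {x0 x1 x2 X s H : ℤ} (hP0 : StripCrossing P0 x0 H)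
    (hP1 : StripCrossing P1 x1 H) (hP2 : StripCrossing P2 x2 H) (h01 : Disjoint P0 P1)
    (h12 : Disjoint P1 P2) (hX : x2 ≤ X) (hx2 : x1 ≤ x2) (hx1 : x0 ≤ x1) (hx0 : X - s + 1 ≤ x0)
    (hs : 1 ≤ s) (hsH : 2 * s - 1 ≤ H) :
    (∃ z, z.1 = X - s + 1 ∧ Conn adj4 (P0 ∩ box (X - s + 1) (X + s - 1) 0 H) (x0, 0) z) ∨
    ∃ q : SymQuad, q.dom ⊆ box (X - s + 1) (X + s) 0 H ∧
      (q.Crossed P0 ∧ q.Crossed P1 ∨ q.Crossed P1 ∧ q.Crossed P2) := by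
  rcases swing_right hP0.reflect hP1.reflect hP2.reflect (h01.preimage _) (h12.preimage _)
    (X := -X) (s := s) (by omega) (by omega) (by omega) (by omega) hs hsH with
    ⟨z, hz, h⟩ | ⟨q, hq, h⟩
  · left
    have := h.lat4 (LatIso.reflect 0)
    simp only [LatIso.reflect_f, zero_sub, neg_neg] at this
    refine ⟨_, ?_, this.mono ?_⟩
    · dsimp only; omega
    · rintro v ⟨hv1, hv2⟩
      simp only [mem_box, Set.mem_preimage, LatIso.reflect_f, LatIso.reflect_symm, zero_sub, neg_neg] at hv1 hv2 ⊢
      refine ⟨hv1, ?_⟩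
      simp only [mem_box]; omega
  · right
    have e : ∀ P : Set (ℤ × ℤ), (q.map (LatIso.reflect 0)).Crossed P ↔
        q.Crossed ((LatIso.reflect 0).f ⁻¹' P) := fun P => q.map_crossed _ _
    refine ⟨q.map (LatIso.reflect 0), ?_, by simpa only [e] using h⟩
    intro v hv
    have := hq hv
    simp only [LatIso.reflect_symm, mem_box] at this ⊢
    omega
end SquareIce

namespace SquareIce

/-! ### Alternation in finite sequences -/

theorem exists_flip (Y : Finset ℤ) (p : ℤ → Prop) {y y' : ℤ} (hy : y ∈ Y) (hy' : y' ∈ Y) (hlt : y < y')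
    (hp : p y) (hp' : ¬ p y') : ∃ d ∈ Y, ∃ d' ∈ Y, y ≤ d ∧ d < d' ∧ d' ≤ y' ∧
      (∀ x ∈ Y, ¬ (d < x ∧ x < d')) ∧ p d ∧ ¬ p d' := by
  classical
  have h1 : (Y.filter fun x => y ≤ x ∧ x < y' ∧ p x).Nonempty :=
    ⟨y, by simp [hy, hlt, hp]⟩
  obtain ⟨d, hd, hdm⟩ := Finset.exists_max_image _ id h1
  simp only [Finset.mem_filter, id] at hd hdm
  have h2 : (Y.filter fun x => d < x ∧ x ≤ y').Nonempty := ⟨y', by simp [hy', hd.2.2.1]⟩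
  obtain ⟨d', hd', hdm'⟩ := Finset.exists_min_image _ id h2
  simp only [Finset.mem_filter, id] at hd' hdm'
  refine ⟨d, hd.1, d', hd'.1, hd.2.1, hd'.2.1, hd'.2.2, ?_, hd.2.2.2, ?_⟩
  · rintro x hx ⟨h3, h4⟩
    have := hdm' x ⟨hx, h3, by omega⟩
    omega
  · intro hpd
    rcases hd'.2.2.lt_or_eq with h | h
    · have := hdm d' ⟨hd'.1, by omega, h, hpd⟩
      omega
    · exact hp' (h ▸ hpd)

/-- A sequence with steps at most one, containing long alternations between `i` and `i + 1` for many
`i`, contains a long subsequence with steps exactly one. -/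
theorem exists_alternating (Y : Finset ℤ) (id : ℤ → ℤ)
    (hstep : ∀ y ∈ Y, ∀ y' ∈ Y, y < y' → (∀ x ∈ Y, ¬ (y < x ∧ x < y')) →
      id y ≤ id y' + 1 ∧ id y' ≤ id y + 1)
    (I : Finset ℤ) (m : ℤ → ℕ) (c : ℤ → ℕ → ℤ)
    (hc : ∀ i ∈ I, ∀ e ≤ m i, c i e ∈ Y ∧ id (c i e) = if Even e then i else i + 1)
    (hlt : ∀ i ∈ I, ∀ e < m i, c i e < c i (e + 1)) :
    ∃ D ⊆ Y, ∑ i ∈ I, m i ≤ D.card ∧ ∀ d ∈ D, ∀ d' ∈ D, d < d' → (∀ x ∈ D, ¬ (d < x ∧ x < d')) →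
      (id d' = id d + 1 ∨ id d = id d' + 1) := by
  classical
  let nxt : ℤ → ℤ → Prop := fun d d' => d' ∈ Y ∧ d < d' ∧ ∀ x ∈ Y, ¬ (d < x ∧ x < d')
  have nxt_unique : ∀ d a b, nxt d a → nxt d b → a = b := by
    rintro d a b ⟨h1, h2, h3⟩ ⟨h4, h5, h6⟩
    have := h3 b h4
    have := h6 a h1
    omega
  let D := Y.filter fun d => ∃ d', nxt d d' ∧ id d' ≠ id d
  refine ⟨D, Finset.filter_subset _ _, ?_, ?_⟩
  · have key : ∀ i ∈ I, ∀ e < m i, ∃ d ∈ Y, c i e ≤ d ∧ d < c i (e + 1) ∧ ∃ d', nxt d d' ∧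
        (id d = i ∧ id d' = i + 1 ∨ id d = i + 1 ∧ id d' = i) := by
      intro i hi e he
      obtain ⟨h1, h2⟩ := hc i hi e he.le
      obtain ⟨h3, h4⟩ := hc i hi (e + 1) he
      by_cases hev : Even e
      · rw [if_pos hev] at h2
        rw [if_neg (by rw [Nat.even_add_one]; exact not_not.2 hev)] at h4
        obtain ⟨d, hd, d', hd', g1, g2, g3, g4, g5, g6⟩ := exists_flip Y (fun x => id x ≤ i) h1 h3
          (hlt i hi e he) (by omega) (by omega)
        have := hstep d hd d' hd' g2 g4
        exact ⟨d, hd, g1, by omega, d', ⟨hd', g2, g4⟩, .inl (by omega)⟩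
      · rw [if_neg hev] at h2
        rw [if_pos (by rw [Nat.even_add_one]; exact hev)] at h4
        obtain ⟨d, hd, d', hd', g1, g2, g3, g4, g5, g6⟩ := exists_flip Y (fun x => i + 1 ≤ id x) h1 h3
          (hlt i hi e he) (by omega) (by omega)
        have := hstep d hd d' hd' g2 g4
        exact ⟨d, hd, g1, by omega, d', ⟨hd', g2, g4⟩, .inr (by omega)⟩
    choose! f hf1 hf2 hf3 g hg1 hg2 using key
    have mono : ∀ i ∈ I, ∀ e e', e ≤ e' → e' ≤ m i → c i e ≤ c i e' := by
      intro i hi e e' hee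
      induction e', hee using Nat.le_induction with
      | base => exact fun _ => le_rfl
      | succ n hn ih => exact fun h => (ih (by omega)).trans (hlt i hi n (by omega)).le
    have : (I.sigma fun i => Finset.range (m i)).card ≤ D.card := by
      refine Finset.card_le_card_of_injOn (fun s => f s.1 s.2) ?_ ?_
      · rintro ⟨i, e⟩ h
        simp only [Finset.coe_sigma, Set.mem_sigma_iff, Finset.mem_coe, Finset.mem_range] at h
        simp only [D, Finset.mem_coe, Finset.mem_filter]
        refine ⟨hf1 i h.1 e h.2, _, hg1 i h.1 e h.2, ?_⟩
        have := hg2 i h.1 e h.2; omega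
      · rintro ⟨i, e⟩ h ⟨i', e'⟩ h' heq
        simp only [Finset.coe_sigma, Set.mem_sigma_iff, Finset.mem_coe, Finset.mem_range] at h h'
        dsimp only at heq
        have a1 := hg2 i h.1 e h.2
        have a2 := hg2 i' h'.1 e' h'.2
        have a3 := nxt_unique _ _ _ (hg1 i h.1 e h.2) (heq ▸ hg1 i' h'.1 e' h'.2)
        rw [heq] at a1
        rw [a3] at a1
        obtain rfl : i = i' := by omega
        have b1 := hf2 i h.1 e h.2
        have b2 := hf3 i h.1 e h.2
        have b3 := hf2 i h.1 e' h'.2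
        have b4 := hf3 i h.1 e' h'.2
        rcases lt_trichotomy e e' with hl | rfl | hl
        · have := mono i h.1 (e + 1) e' hl h'.2.le; omega
        · rfl
        · have := mono i h.1 (e' + 1) e hl h.2.le; omega
    rwa [Finset.card_sigma, Finset.sum_congr rfl (fun i _ => Finset.card_range (m i))] at this
  · intro d hd d' hd' hdd hno
    simp only [D, Finset.mem_filter] at hd hd' hno
    obtain ⟨hdY, a, ha, hne⟩ := hd
    have had : a ≤ d' := by
      by_contra h; exact ha.2.2 d' hd'.1 ⟨hdd, by omega⟩
    -- The label is constant from the successor `a` of `d` up to `d'`, since a change in between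
    -- would give an element of `D` strictly between `d` and `d'`.
    have hid : id d' = id a := by
      by_contra hcon
      have hlt : a < d' := lt_of_le_of_ne had (by rintro rfl; exact hcon rfl)
      obtain ⟨x, hx, x', hx', g1, g2, g3, g4, g5, g6⟩ := exists_flip Y (fun x => id x = id a) ha.1 hd'.1
        hlt rfl hcon
      refine hno x ⟨hx, x', ⟨hx', g2, g4⟩, ?_⟩ ⟨ha.2.1.trans_le g1, by omega⟩
      rw [g5]; exact g6
    have := hstep d hdY a ha.1 ha.2.1 ha.2.2
    omega

/-- A large finite set of integers has many consecutive elements in a short window. -/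
theorem exists_window (D : Finset ℤ) {H w : ℤ} {K N : ℕ} (hD : ∀ d ∈ D, 0 ≤ d ∧ d ≤ H) (hw : 0 ≤ w)
    (hH : H < N * (w + 1)) (hN : 0 < N) (hK0 : 0 < K) (hK : N * K ≤ D.card) :
    ∃ (u : ℤ) (y : ℕ → ℤ), (∀ j < K, y j ∈ D ∧ u ≤ y j ∧ y j ≤ u + w) ∧
      (∀ i j, i < j → j < K → y i < y j) ∧
      (∀ j, j + 1 < K → ∀ x ∈ D, ¬ (y j < x ∧ x < y (j + 1))) ∧ 0 ≤ u ∧ u ≤ H := by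
  classical
  -- Pigeonhole over `N` blocks of length `w + 1`. Keeping all elements of one block makes its
  -- consecutive elements consecutive in `D` as well.
  obtain ⟨b, hb, hcard⟩ := Finset.exists_le_card_fiber_of_mul_le_card_of_maps_to (s := D)
    (t := Finset.Ico (0 : ℤ) N) (f := fun d => d / (w + 1)) (n := K) (by
      intro d hd
      have := hD d hd
      rw [Finset.mem_Ico]
      refine ⟨Int.ediv_nonneg this.1 (by omega), Int.ediv_lt_of_lt_mul (by omega) (by omega)⟩)
    ⟨0, by simp [hN]⟩ (by simpa using hK)
  let D' := D.filter fun d => d / (w + 1) = b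
  have hdiv : ∀ d ∈ D', (w + 1) * b ≤ d ∧ d ≤ (w + 1) * b + w := by
    intro d hd
    have h1 := (Finset.mem_filter.1 hd).2
    have h2 := Int.mul_ediv_add_emod d (w + 1)
    have h3 := Int.emod_nonneg d (show w + 1 ≠ 0 by omega)
    have h4 := Int.emod_lt_of_pos d (show 0 < w + 1 by omega)
    rw [h1] at h2
    omega
  let f := D'.orderEmbOfFin rfl
  have hf : ∀ i, f i ∈ D' := fun i => D'.orderEmbOfFin_mem rfl i
  have hne : D'.Nonempty := Finset.card_pos.1 (hK0.trans_le hcard)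
  obtain ⟨d0, hd0⟩ := hne
  have hb0 : 0 ≤ b := (Finset.mem_Ico.1 hb).1
  have hu := hdiv d0 hd0
  have hu' := hD d0 (Finset.mem_filter.1 hd0).1
  refine ⟨(w + 1) * b, fun j => if h : j < D'.card then f ⟨j, h⟩ else 0, ?_, ?_, ?_, by positivity, by omega⟩
  · intro j hj
    have h : j < D'.card := hj.trans_le hcard
    simp only [h, dif_pos]
    exact ⟨(Finset.mem_filter.1 (hf _)).1, hdiv _ (hf _)⟩
  · intro i j hij hj
    have h : j < D'.card := hj.trans_le hcard
    simp only [h, hij.trans h, dif_pos]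
    exact f.strictMono hij
  · intro j hj x hx hbet
    have h : j + 1 < D'.card := hj.trans_le hcard
    simp only [h, (Nat.lt_succ_self j).trans h, dif_pos] at hbet
    have hxD : x ∈ D' := by
      refine Finset.mem_filter.2 ⟨hx, ?_⟩
      have e1 := (Finset.mem_filter.1 (hf ⟨j, (Nat.lt_succ_self j).trans h⟩)).2
      have e2 := (Finset.mem_filter.1 (hf ⟨j + 1, h⟩)).2
      have l1 := Int.ediv_le_ediv (show 0 < w + 1 by omega) hbet.1.le
      have l2 := Int.ediv_le_ediv (show 0 < w + 1 by omega) hbet.2.le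
      omega
    obtain ⟨i, hi⟩ : x ∈ Set.range f := by
      rw [Finset.range_orderEmbOfFin]; exact hxD
    rw [← hi] at hbet
    have l1 := f.lt_iff_lt.1 hbet.1
    have l2 := f.lt_iff_lt.1 hbet.2
    simp only [Fin.lt_def] at l1 l2
    omega

/-! ### Crossings of a vertical band -/

theorem no_cross_strip' {X S : Set (ℤ × ℤ)} {x0 x1 p q : ℤ}
    (hX : Conn adj4 X (x0, p) (x1, q)) (hXs : ∀ v ∈ X, x0 ≤ v.1 ∧ v.1 ≤ x1)
    {a b : ℤ × ℤ} (h : Conn adj8 S a b) (hS : ∀ v ∈ S, x0 ≤ v.1 ∧ v.1 ≤ x1 ∧ v ∉ X)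
    (ha : (a.1 = x0 ∧ a.2 ≤ p) ∨ (a.1 = x1 ∧ a.2 ≤ q))
    (hb : (b.1 = x0 ∧ p ≤ b.2) ∨ (b.1 = x1 ∧ q ≤ b.2)) : False := by
  refine no_cross_strip (X := Prod.swap ⁻¹' X) (S := Prod.swap ⁻¹' S) (y0 := x0) (y1 := x1)
    (p := p) (q := q) (a := a.swap) (b := b.swap)
    (hX.map Prod.swap (fun u hu => by simpa using hu) (fun u v _ _ h => adj4_swap.2 h)) ?_
    (h.map _ (fun u hu => by simpa using hu) (fun u v _ _ h => adj8_swap.2 h)) ?_ ha hb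
  · intro v hv; exact hXs _ hv
  · intro v hv; exact hS _ hv

/-- `(L, y)` is the lowest left end of a component of `P` in the band `[L, R] × [0, H]` that crosses
the band. -/
def BandEnd (P : Set (ℤ × ℤ)) (L R H y : ℤ) : Prop :=
  (∃ z, z.1 = R ∧ Conn adj4 (P ∩ box L R 0 H) (L, y) z) ∧
    ∀ y', Conn adj4 (P ∩ box L R 0 H) (L, y) (L, y') → y ≤ y'

theorem exists_bandEnd {P : Set (ℤ × ℤ)} {L R H y : ℤ} {z : ℤ × ℤ} (hz : z.1 = R)
    (h : Conn adj4 (P ∩ box L R 0 H) (L, y) z) :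
    ∃ y', BandEnd P L R H y' ∧ Conn adj4 (P ∩ box L R 0 H) (L, y) (L, y') := by
  obtain ⟨y', h1, h2⟩ := Int.exists_least_of_bdd (P := fun y' => Conn adj4 (P ∩ box L R 0 H) (L, y) (L, y'))
    ⟨0, fun z hz => hz.right.2.2.2.1⟩ ⟨y, .refl h.left⟩
  exact ⟨y', ⟨⟨z, hz, h1.symm4.trans h⟩, fun z hz => h2 _ (h1.trans hz)⟩, h1⟩

/-- A set `I` that blocks `c` from the top of the band crosses the band above `c`. -/
theorem exists_band_above {I c : Set (ℤ × ℤ)} {L R H p : ℤ} {z : ℤ × ℤ} (hLR : L ≤ R) (hH : 0 ≤ H)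
    (hz : z.1 = R) (hc : Conn adj4 c (L, p) z) (hcB : c ⊆ box L R 0 H) (hd : Disjoint c I)
    (hblock : ∀ w ∈ c, ∀ t : ℤ × ℤ, t.2 = H → ¬ Conn adj8 (box L R 0 H \ I) w t) :
    ∃ y z, z.1 = R ∧ Conn adj4 (I ∩ box L R 0 H) (L, y) z ∧
      ∃ t, t.2 = H ∧ Conn adj8 (box L R 0 H \ c) (L, y) t := by
  -- `U` is the part of the band above `c`. Duality is applied to `I ∩ U` rather than `I`, so that
  -- the crossing obtained comes with its position relative to `c`.
  let U : Set (ℤ × ℤ) := {v | ∃ t : ℤ × ℤ, t.2 = H ∧ Conn adj8 (box L R 0 H \ c) v t}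
  have sep : ∀ b t : ℤ × ℤ, b.2 = 0 → t.2 = H → ¬ Conn adj8 (box L R 0 H \ c) b t := by
    intro b t hb ht h
    exact no_cross_box' hc hcB rfl hz h (fun v hv => hv) hb ht
  rcases exists_cross_box' (I ∩ U) hLR hH with ⟨⟨a, y⟩, q, hp, hq, h⟩ | ⟨b, t, hb, ht, h⟩
  · dsimp only at hp
    subst hp
    obtain ⟨t, ht, htc⟩ := h.left.1.2
    exact ⟨y, q, hq, h.mono (fun v hv => ⟨hv.1.1, hv.2⟩), t, ht, htc⟩
  · exfalso
    have hdis : ∀ v ∈ c, v ∉ I := fun v h1 h2 => hd.le_bot ⟨h1, h2⟩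
    -- The dual path is followed down from the top. While it is in `U` and off `I` it cannot step
    -- onto `c`, by `hblock`; so it stays in `U`, hence off `I`, and its lower end is joined to the
    -- top off `c`, contradicting `sep`.
    have key : b ∈ U ∧ Conn adj8 (box L R 0 H \ I) b t := by
      refine h.symm8.rec' (p := fun v => v ∈ U ∧ Conn adj8 (box L R 0 H \ I) v t) ?_ ?_
      · by_cases htc : t ∈ c
        · exact absurd (Conn.refl (S := box L R 0 H \ I) ⟨h.right.1, hdis _ htc⟩) (hblock t htc t ht)
        · have htU : t ∈ U := ⟨t, ht, .refl ⟨h.right.1, htc⟩⟩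
          exact ⟨htU, .refl ⟨h.right.1, fun hI => h.right.2 ⟨hI, htU⟩⟩⟩
      · rintro u v h1 h2 h3 ⟨⟨t', ht', ihc⟩, ih2⟩
        have h2' := adj8_symm _ _ h2
        by_cases hvc : v ∈ c
        · exact absurd (Conn.head (S := box L R 0 H \ I) ⟨h3.1, hdis _ hvc⟩ h2' ih2) (hblock v hvc t ht)
        · have hvU : v ∈ U := ⟨t', ht', Conn.head ⟨h3.1, hvc⟩ h2' ihc⟩
          exact ⟨hvU, Conn.head ⟨h3.1, fun hI => h3.2 ⟨hI, hvU⟩⟩ h2' ih2⟩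
    obtain ⟨⟨t', ht', hbt⟩, _⟩ := key
    exact sep b t' hb ht' hbt

/-- A left end joined to the top off the crossing `c` lies above the left end of `c`. -/
theorem band_lt {c : Set (ℤ × ℤ)} {L R H p y : ℤ} {z t : ℤ × ℤ}
    (hz : z.1 = R) (hc : Conn adj4 c (L, p) z) (hcB : c ⊆ box L R 0 H)
    (ht : t.2 = H) (h : Conn adj8 (box L R 0 H \ c) (L, y) t) : p < y := by
  by_contra hcon
  obtain ⟨z, q⟩ := z
  dsimp only at hz
  subst hz
  have hb := h.right.1
  have hp := hcB hc.left
  simp only [mem_box] at hb hp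
  let S : Set (ℤ × ℤ) := (box L z 0 H \ c) ∪ {v | v.2 = H + 1 ∧ L ≤ v.1 ∧ v.1 ≤ z}
  have h1 : Conn adj8 S (L, H + 1) (t.1, H + 1) :=
    (conn_horizontal (S := S) hb.1 (fun s h1 h2 => .inr ⟨rfl, h1, h2.trans hb.2.1⟩)).to8
  have h2 : Conn adj8 S (L, y) (L, H + 1) :=
    ((h.mono (fun _ h => .inl h)).tail (by simp only [adj8]; omega) h1.right).trans h1.symm8
  refine no_cross_strip' hc (fun v hv => ⟨(hcB hv).1, (hcB hv).2.1⟩) h2 ?_ (.inl ⟨rfl, by dsimp only; omega⟩)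
    (.inl ⟨rfl, by dsimp only; omega⟩)
  rintro v (hv | ⟨hv1, hv2, hv3⟩)
  · exact ⟨hv.1.1, hv.1.2.1, hv.2⟩
  · refine ⟨hv2, hv3, fun h => ?_⟩
    have := hcB h
    simp only [mem_box] at this; omega

/-- The rectangle with its left and right sides as crossing sides. -/
def Quad.band (L R H : ℤ) (hLR : L ≤ R) (hH : 0 ≤ H) : Quad where
  dom := box L R 0 H
  A1 := {v | v.1 = L}
  A2 := {v | v.1 = R}
  Z1 := {v | v.2 = 0}
  Z2 := {v | v.2 = H}
  exists_cross S := by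
    rcases exists_cross_box' S hLR hH with ⟨p, q, hp, hq, h⟩ | ⟨p, q, hp, hq, h⟩
    · exact .inl ⟨p, hp, q, hq, h⟩
    · exact .inr ⟨p, hp, q, hq, h⟩
  no_cross S a b a' b' ha hb h ha' hb' h' :=
    no_cross_box' h Set.inter_subset_right ha hb h' (fun v hv => ⟨hv.1, fun h => hv.2 h.1⟩) ha' hb'

/-- A strip crossing starting between those of `P` and `P'` crosses every band between components of
these. -/
theorem exists_bandEnd_between {P P' Q : Set (ℤ × ℤ)} {L R H x x' x'' y y' : ℤ} (hLR : L ≤ R) (hH : 0 ≤ H)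
    (hP : ∀ v ∈ P, 0 ≤ v.2 ∧ v.2 ≤ H) (hP' : ∀ v ∈ P', 0 ≤ v.2 ∧ v.2 ≤ H) (hQ : StripCrossing Q x'' H)
    (hcP : ∀ v ∈ P, Conn adj4 P (x, 0) v) (hcP' : ∀ v ∈ P', Conn adj4 P' (x', 0) v)
    (hPQ : Disjoint P Q) (hPQ' : Disjoint P' Q)
    (hx : x < x'' ∧ x'' < x' ∨ x' < x'' ∧ x'' < x)
    (hy : BandEnd P L R H y) (hy' : BandEnd P' L R H y') (hlt : y < y') :
    ∃ y'', BandEnd Q L R H y'' ∧ y < y'' ∧ y'' < y' := by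
  let C : Set (ℤ × ℤ) := {v | Conn adj4 (P ∩ box L R 0 H) (L, y) v}
  let C' : Set (ℤ × ℤ) := {v | Conn adj4 (P' ∩ box L R 0 H) (L, y') v}
  obtain ⟨⟨z, hz, hyz⟩, hymin⟩ := hy
  obtain ⟨⟨z', hz', hyz'⟩, hymin'⟩ := hy'
  have hCP : C ⊆ P := fun v hv => hv.right.1
  have hCP' : C' ⊆ P' := fun v hv => hv.right.1
  have hCB : C ⊆ box L R 0 H := fun v hv => hv.right.2
  have hCB' : C' ⊆ box L R 0 H := fun v hv => hv.right.2
  have c1 : (Quad.band L R H hLR hH).Crossed C :=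
    ⟨_, rfl, z, hz, hyz.reach.mono (fun v hv => ⟨hv, hCB hv⟩)⟩
  have c2 : (Quad.band L R H hLR hH).Crossed C' :=
    ⟨_, rfl, z', hz', hyz'.reach.mono (fun v hv => ⟨hv, hCB' hv⟩)⟩
  -- Either `Q` crosses the band in the region between the two components, or these are joined off
  -- `Q`. The latter is impossible, since `Q` starts between `P` and `P'` and so separates them in
  -- the strip.
  rcases (Quad.band L R H hLR hH).cross_between c1 c2 (X := Q) (hPQ.symm.mono_right hCP)
    (hPQ'.symm.mono_right hCP') with ⟨⟨a, y1⟩, ha, b, hb, hc⟩ | ⟨u, hu, v, hv, hc⟩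
  · have ha' : a = L := ha
    subst ha'
    have hc0 : Conn adj4 (Q ∩ box a R 0 H) (a, y1) b := hc.mono (fun v hv => ⟨hv.1.1, hv.2⟩)
    obtain ⟨y'', hend, hyy⟩ := exists_bandEnd hb hc0
    obtain ⟨hbB, hbP, hbz⟩ := hc.left.1.2
    have hoff : ∀ v ∈ Q, v ∉ C ∪ C' := by
      rintro v hv (h | h)
      · exact hPQ.le_bot ⟨hCP h, hv⟩
      · exact hPQ'.le_bot ⟨hCP' h, hv⟩
    have hyy8 : Conn adj8 (box a R 0 H \ (C ∪ C')) (a, y1) (a, y'') :=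
      hyy.to8.mono (fun v hv => ⟨hv.2, hoff v hv.1⟩)
    have hnz : ∀ w : ℤ × ℤ, w.2 = 0 ∨ w.2 = H → ¬ Conn adj8 (box a R 0 H \ (C ∪ C')) (a, y'') w := by
      rintro w hw h
      exact hbz w hw ((hyy8.trans h).symm8)
    have hyB := hyy.right.2
    simp only [mem_box] at hyB
    have hyQ := hyy.right.1
    have mem : ∀ s, 0 ≤ s → s ≤ H → (a, s) ∈ box a R 0 H := fun s h1 h2 => by
      simp only [mem_box]; omega
    have hne : y'' ≠ y := by rintro rfl; exact hoff _ hyQ (.inl (.refl hyz.left))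
    have hne' : y'' ≠ y' := by rintro rfl; exact hoff _ hyQ (.inr (.refl hyz'.left))
    refine ⟨y'', hend, ?_, ?_⟩
    -- By minimality of `y` and `y'`, the left side below `y''` would be free of `C ∪ C'`, and `(a,
    -- y'')` would be joined to the bottom, which is excluded between the components.
    · by_contra hcon
      refine hnz (a, 0) (.inl rfl) (conn_vertical hyB.2.2.1 ?_).symm4.to8
      intro s h1 h2
      refine ⟨mem s h1 (by omega), ?_⟩
      rintro (h | h)
      · have := hymin s h; omega
      · have := hymin' s h; omega
    -- If `C` or `C'` had a point of the left side above `y''`, it would join it to its lowest end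
    -- below `y''` and thus meet the crossing by `Q`. Otherwise `(a, y'')` is joined to the top
    -- along the left side.
    · by_contra hcon
      obtain ⟨⟨⟨z'', q⟩, hz'', hcz⟩, _⟩ := hend
      dsimp only at hz''
      subst hz''
      have hX := hcz.reach
      have hXQ : ∀ v ∈ {v | Conn adj4 (Q ∩ box a z'' 0 H) (a, y'') v}, v ∈ Q ∧ v ∈ box a z'' 0 H :=
        fun v hv => hv.right
      by_cases hex : ∃ s, y'' < s ∧ s ≤ H ∧ (a, s) ∈ C ∪ C'
      · obtain ⟨s, hs1, hs2, hs | hs⟩ := hex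
        · refine no_cross_strip' hX (fun v hv => ⟨(hXQ v hv).2.1, (hXQ v hv).2.2.1⟩) hs.to8 ?_
            (.inl ⟨rfl, by dsimp only; omega⟩) (.inl ⟨rfl, hs1.le⟩)
          intro v hv
          exact ⟨hv.2.1, hv.2.2.1, fun h => hPQ.le_bot ⟨hv.1, (hXQ v h).1⟩⟩
        · refine no_cross_strip' hX (fun v hv => ⟨(hXQ v hv).2.1, (hXQ v hv).2.2.1⟩) hs.to8 ?_
            (.inl ⟨rfl, by dsimp only; omega⟩) (.inl ⟨rfl, hs1.le⟩)
          intro v hv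
          exact ⟨hv.2.1, hv.2.2.1, fun h => hPQ'.le_bot ⟨hv.1, (hXQ v h).1⟩⟩
      · push Not at hex
        refine hnz (a, H) (.inr rfl) (conn_vertical hyB.2.2.2 ?_).to8
        intro s h1 h2
        refine ⟨mem s (by omega) h2, ?_⟩
        rcases h1.lt_or_eq with h1 | rfl
        · exact hex s h1 h2
        · exact hoff _ hyQ
  · exfalso
    obtain ⟨t, ht⟩ := hQ.cross
    let S : Set (ℤ × ℤ) := (P ∪ P' ∪ box L R 0 H) \ Q
    have s1 : Conn adj8 S (x, 0) u := (hcP u (hCP hu)).to8.mono (fun v hv =>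
      ⟨.inl (.inl hv), fun h => hPQ.le_bot ⟨hv, h⟩⟩)
    have s2 : Conn adj8 S (x', 0) v := (hcP' v (hCP' hv)).to8.mono (fun v hv =>
      ⟨.inl (.inr hv), fun h => hPQ'.le_bot ⟨hv, h⟩⟩)
    have s3 : Conn adj8 S (x, 0) (x', 0) :=
      (s1.trans (hc.mono (fun v hv => ⟨.inr hv.1, hv.2⟩))).trans s2.symm8
    have hS : ∀ v ∈ S, 0 ≤ v.2 ∧ v.2 ≤ H ∧ v ∉ Q := by
      rintro v ⟨(hv | hv) | hv, hv'⟩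
      · exact ⟨(hP v hv).1, (hP v hv).2, hv'⟩
      · exact ⟨(hP' v hv).1, (hP' v hv).2, hv'⟩
      · exact ⟨hv.2.2.1, hv.2.2.2, hv'⟩
    rcases hx with hx | hx
    · exact no_cross_strip ht hQ.rows s3 hS (.inl ⟨rfl, hx.1.le⟩) (.inl ⟨rfl, hx.2.le⟩)
    · exact no_cross_strip ht hQ.rows s3.symm8 hS (.inl ⟨rfl, hx.1.le⟩) (.inl ⟨rfl, hx.2.le⟩)

end SquareIce

/-! ### Oscillation of crossings through a vertical band. -/

namespace SquareIce

/-- Prolonged upwards along the column `c1 + 1`, `I` crosses the strip, and it separates the bottom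
points to the right of `x` from the top of the box. -/
theorem block_right {I S : Set (ℤ × ℤ)} {c0 c1 H x : ℤ} {z a t : ℤ × ℤ} (hI : Conn adj4 I (x, 0) z)
    (hIb : I ⊆ box c0 c1 0 H) (hz : z.1 = c1) (h : Conn adj8 S a t) (hS : S ⊆ box c0 c1 0 H \ I)
    (ha : a.2 = 0) (hxa : x ≤ a.1) (ht : t.2 = H) : False := by
  let X : Set (ℤ × ℤ) := I ∪ {w | w.1 = c1 + 1 ∧ 0 ≤ w.2 ∧ w.2 ≤ H}
  have bz := hIb hI.right
  have bt := (hS h.right).1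
  simp only [mem_box] at bz bt
  have hX : Conn adj4 X (x, 0) (c1 + 1, H) :=
    ((hI.mono (fun _ h => .inl h)).tail (c := (c1 + 1, z.2))
      (.inr ⟨rfl, by dsimp only; omega, by dsimp only; omega⟩) (.inr ⟨rfl, bz.2.2⟩)).trans
      (conn_vertical bz.2.2.2 fun s h1 h2 => .inr ⟨rfl, by dsimp only; omega, h2⟩)
  refine no_cross_strip hX ?_ h.symm8 ?_ (.inr ⟨ht, by omega⟩) (.inl ⟨ha, hxa⟩)
  · rintro w (hw | hw)
    · exact (hIb hw).2.2
    · exact hw.2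
  · intro w hw
    have hb := (hS hw).1
    have hx := (hS hw).2
    simp only [mem_box] at hb
    refine ⟨hb.2.2.1, hb.2.2.2, ?_⟩
    rintro (h | h)
    · exact hx h
    · have := h.1; omega

/-- One oscillation. `hblk` says that what `Q` reaches in the box encloses the start of `P`. The
component of `P` in the band, being attached to that start, is thus cut off from the top by `Q`,
which must traverse the band above it. -/
theorem next_bandEnd {P Q : Set (ℤ × ℤ)} {c0 c1 L R H xP xQ y : ℤ} (hLR : L ≤ R) (hH : 0 ≤ H)
    (hd : Disjoint P Q) (hB : box L R 0 H ⊆ box c0 c1 0 H)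
    (hP : Conn adj4 (P ∩ box c0 c1 0 H) (xP, 0) (L, y)) (hy : BandEnd P L R H y)
    (hblk : ∀ S t, S ⊆ box c0 c1 0 H \ {v | Conn adj4 (Q ∩ box c0 c1 0 H) (xQ, 0) v} →
      Conn adj8 S (xP, 0) t → t.2 = H → False) :
    ∃ y', y < y' ∧ BandEnd Q L R H y' ∧ Conn adj4 (Q ∩ box c0 c1 0 H) (xQ, 0) (L, y') := by
  obtain ⟨⟨z, hz, hyz⟩, hmin⟩ := hy
  let c : Set (ℤ × ℤ) := {v | Conn adj4 (P ∩ box L R 0 H) (L, y) v}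
  let I : Set (ℤ × ℤ) := {v | Conn adj4 (Q ∩ box c0 c1 0 H) (xQ, 0) v}
  have hcP : ∀ v ∈ c, v ∈ P ∧ v ∈ box L R 0 H := fun v hv => hv.right
  have hIQ : ∀ v ∈ I, v ∈ Q := fun v hv => hv.right.1
  have hPI : ∀ v ∈ P, v ∉ I := fun v h h' => hd.le_bot ⟨h, hIQ v h'⟩
  obtain ⟨y1, z1, hz1, h1, t, ht, h2⟩ := exists_band_above (I := I) hLR hH hz hyz.reach
    (fun v hv => (hcP v hv).2)
    (hd.mono (fun v hv => (hcP v hv).1) hIQ) (by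
      intro w hw t ht hwt
      refine hblk (((P ∪ box L R 0 H) ∩ box c0 c1 0 H) \ I) t (fun v hv => ⟨hv.1.2, hv.2⟩) ?_ ht
      have s1 := hP.to8.mono (T := ((P ∪ box L R 0 H) ∩ box c0 c1 0 H) \ I)
        (fun v hv => ⟨⟨.inl hv.1, hv.2⟩, hPI v hv.1⟩)
      have s2 := (Conn.to8 hw).mono (T := ((P ∪ box L R 0 H) ∩ box c0 c1 0 H) \ I)
        (fun v hv => ⟨⟨.inl hv.1, hB hv.2⟩, hPI v hv.1⟩)
      have s3 := hwt.mono (T := ((P ∪ box L R 0 H) ∩ box c0 c1 0 H) \ I)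
        (fun v hv => ⟨⟨.inr hv.1, hB hv.1⟩, hv.2⟩)
      exact (s1.trans s2).trans s3)
  have h1' : Conn adj4 (Q ∩ box L R 0 H) (L, y1) z1 := h1.mono (fun v hv => ⟨hIQ v hv.1, hv.2⟩)
  obtain ⟨y', hend, hyy⟩ := exists_bandEnd hz1 h1'
  refine ⟨y', ?_, hend, ?_⟩
  · refine band_lt hz hyz.reach (fun v hv => (hcP v hv).2) ht
      ((hyy.symm4.to8.mono (T := box L R 0 H \ c) (fun v hv =>
        ⟨hv.2, fun h => hd.le_bot ⟨(hcP v h).1, hv.1⟩⟩)).trans h2)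
  · exact h1.left.1.trans (hyy.mono (fun v hv => ⟨hv.1, hB hv.2⟩))

theorem Quad.Crossed.mono {q : Quad} {S T : Set (ℤ × ℤ)} (h : q.Crossed S) (hST : S ⊆ T) :
    q.Crossed T := by
  obtain ⟨a, ha, b, hb, hc⟩ := h
  exact ⟨a, ha, b, hb, hc.mono (Set.inter_subset_inter_left _ hST)⟩

/-- `K` disjoint connected crossings of the strip `0 ≤ y ≤ H`, starting in a short window, consecutive
ones belonging to different sets of the family `A`. -/
structure SwingState {ι : Type*} (A : ι → Set (ℤ × ℤ)) (K : ℕ) (u H : ℤ) where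
  p : ℕ → Set (ℤ × ℤ)
  x : ℕ → ℤ
  l : ℕ → ι
  sub : ∀ i < K, p i ⊆ A (l i)
  disj : ∀ i j, i < j → j < K → Disjoint (p i) (p j)
  lab : ∀ i, i + 1 < K → l i ≠ l (i + 1)
  strip : ∀ i < K, StripCrossing (p i) (x i) H
  conn : ∀ i < K, ∀ v ∈ p i, Conn adj4 (p i) (x i, 0) v
  mono : ∀ i j, i < j → j < K → x i < x j
  win : ∀ i < K, u ≤ x i ∧ x i ≤ u + H / 16

/-- Some symmetric quad inside `E` is crossed by two different sets of the family. -/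
def CommonQuad {ι : Type*} (A : ι → Set (ℤ × ℤ)) (E : Set (ℤ × ℤ)) : Prop :=
  ∃ q : SymQuad, q.dom ⊆ E ∧ ∃ l l', l ≠ l' ∧ q.Crossed (A l) ∧ q.Crossed (A l')

namespace SwingState
variable {ι : Type*} {A : ι → Set (ℤ × ℤ)} {u H : ℤ}

theorem disj' {K : ℕ} (σ : SwingState A K u H) {i j : ℕ} (hij : i ≠ j) (hi : i < K) (hj : j < K) :
    Disjoint (σ.p i) (σ.p j) := by
  rcases lt_or_gt_of_ne hij with h | h
  · exact σ.disj i j h hj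
  · exact (σ.disj j i h hi).symm

theorem no_common {K : ℕ} (σ : SwingState A K u H) {E : Set (ℤ × ℤ)} (hno : ¬ CommonQuad A E) {i : ℕ}
    (hi : i + 1 < K) {q : SymQuad} (hq : q.dom ⊆ E) (h1 : q.Crossed (σ.p i))
    (h2 : q.Crossed (σ.p (i + 1))) : False :=
  hno ⟨q, hq, _, _, σ.lab i hi, h1.mono (σ.sub i (by omega)), h2.mono (σ.sub _ hi)⟩

/-- The 300 starting points are distinct integers in a window of length `H / 16`. This ends the
descent over scales and absorbs all rounding errors in the estimates. -/
theorem width (σ : SwingState A 300 u H) : 299 ≤ H / 16 := by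
  have key : ∀ i, i < 300 → σ.x 0 + i ≤ σ.x i := by
    intro i
    induction i with
    | zero => simp
    | succ n ih =>
      intro hn
      have h1 := ih (by omega)
      have h2 := σ.mono n (n + 1) (by omega) hn
      push_cast; omega
  have h1 := key 299 (by omega)
  have h2 := σ.win 0 (by omega)
  have h3 := σ.win 299 (by omega)
  omega

/-- Consecutive crossings `n`, `n + 1` alternate many times along a vertical line. -/
theorem exists_chain (σ : SwingState A 300 u H) (hno : ¬ CommonQuad A (box (u - 2 * H) (u + 2 * H) (-H) (2 * H)))
    {n m : ℕ} (hn2 : 2 ≤ n) (hn : n + 3 < 300) (hm : m * (σ.x (n + 3) - σ.x (n - 2)) ≤ 2 * (H / 16)) :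
    ∃ c : ℕ → ℤ, (∀ e ≤ m, BandEnd (σ.p (if Even e then n else n + 1)) (u + H / 16 + 1)
      (u + H / 16 + 1 + H / 4) H (c e)) ∧ ∀ e < m, c e < c (e + 1) := by
  have hW := σ.width
  obtain ⟨k, rfl⟩ : ∃ k, n = k + 2 := ⟨n - 2, by omega⟩
  simp only [Nat.add_sub_cancel] at hm
  set W := H / 16 with hWdef
  set H' := H / 4 with hH'
  set L := u + W + 1 with hL
  have hH0 : 0 ≤ H := by omega
  have win := fun i hi => σ.win i hi
  rw [← hWdef] at win
  have w0 := win k (by omega)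
  have w1 := win (k + 1) (by omega)
  have w2 := win (k + 2) (by omega)
  have w3 := win (k + 3) (by omega)
  have w4 := win (k + 4) (by omega)
  have w5 := win (k + 5) (by omega)
  have m0 := σ.mono k (k + 1) (by omega) (by omega)
  have m1 := σ.mono (k + 1) (k + 2) (by omega) (by omega)
  have m2 := σ.mono (k + 2) (k + 3) (by omega) (by omega)
  have m3 := σ.mono (k + 3) (k + 4) (by omega) (by omega)
  have m4 := σ.mono (k + 4) (k + 5) (by omega) (by omega)
  change m * (σ.x (k + 5) - σ.x k) ≤ 2 * W at hm
  set D := σ.x (k + 5) - σ.x k with hD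
  have hstage : ∀ e : ℕ, e ≤ m → (e : ℤ) * D ≤ 2 * W := fun e he =>
    (mul_le_mul_of_nonneg_right (by exact_mod_cast he) (by omega)).trans hm
  have bandin : ∀ X s, u ≤ X → X ≤ u + W → W + H' + 3 ≤ s →
      box L (L + H') 0 H ⊆ box (X - s + 1) (X + s - 1) 0 H := by
    intro X s h1 h2 h3 v hv
    simp only [mem_box] at hv ⊢; omega
  -- the two kinds of stages
  have right : ∀ s, W + H' + 3 ≤ s → 2 * s - 1 ≤ H → ∀ S a t,
      S ⊆ box (σ.x k - s + 1) (σ.x k + s - 1) 0 H \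
        {v | Conn adj4 (σ.p (k + 2) ∩ box (σ.x k - s + 1) (σ.x k + s - 1) 0 H) (σ.x (k + 2), 0) v} →
      Conn adj8 S a t → a.2 = 0 → σ.x (k + 2) ≤ a.1 → t.2 = H → False := by
    intro s hs1 hs2 S a t hS h ha hxa ht
    rcases swing_right (σ.strip (k + 2) (by omega)) (σ.strip (k + 1) (by omega)) (σ.strip k (by omega))
      (σ.disj' (by omega) (by omega) (by omega)) (σ.disj' (by omega) (by omega) (by omega))
      (X := σ.x k) (s := s) (by omega) (by omega) (by omega) (by omega) (by omega) hs2 with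
      ⟨z, hz, hc⟩ | ⟨q, hq, hc⟩
    · exact block_right hc.reach (fun v hv => (Conn.right hv).2) hz h hS ha hxa ht
    · have hq' : q.dom ⊆ box (u - 2 * H) (u + 2 * H) (-H) (2 * H) := by
        intro v hv; have := hq hv; simp only [mem_box] at this ⊢; omega
      rcases hc with hc | hc
      · exact σ.no_common hno (i := k + 1) (by omega) hq' hc.2 hc.1
      · exact σ.no_common hno (i := k) (by omega) hq' hc.2 hc.1
  have left : ∀ s, W + H' + 3 ≤ s → 2 * s - 1 ≤ H → ∀ S a t,
      S ⊆ box (σ.x (k + 5) - s + 1) (σ.x (k + 5) + s - 1) 0 H \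
        {v | Conn adj4 (σ.p (k + 3) ∩ box (σ.x (k + 5) - s + 1) (σ.x (k + 5) + s - 1) 0 H)
          (σ.x (k + 3), 0) v} →
      Conn adj8 S a t → a.2 = 0 → a.1 ≤ σ.x (k + 3) → t.2 = H → False := by
    intro s hs1 hs2 S a t hS h ha hxa ht
    rcases swing_left (σ.strip (k + 3) (by omega)) (σ.strip (k + 4) (by omega)) (σ.strip (k + 5) (by omega))
      (σ.disj' (by omega) (by omega) (by omega)) (σ.disj' (by omega) (by omega) (by omega))
      (X := σ.x (k + 5)) (s := s) (by omega) (by omega) (by omega) (by omega) (by omega) hs2 with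
      ⟨z, hz, hc⟩ | ⟨q, hq, hc⟩
    · exact no_cross_arc (a' := t.1) hc.reach (fun v hv => (Conn.right hv).2) rfl (.inl hz) h hS ha hxa
        (.inr ⟨ht, le_rfl⟩)
    · have hq' : q.dom ⊆ box (u - 2 * H) (u + 2 * H) (-H) (2 * H) := by
        intro v hv; have := hq hv; simp only [mem_box] at this ⊢; omega
      rcases hc with hc | hc
      · exact σ.no_common hno (i := k + 3) (by omega) hq' hc.1 hc.2
      · exact σ.no_common hno (i := k + 4) (by omega) hq' hc.1 hc.2
  -- The centre of the box alternates between `σ.x k` and `σ.x (k + 5)`, at distance `D`, so letting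
  -- the half-width grow by `D` at each stage makes the boxes nested. The bound `m * D ≤ 2 * W`
  -- keeps `2 * s e - 1` below `H`, as the swing lemmas require.
  let s : ℕ → ℤ := fun e => W + H' + 3 + e * D
  let X : ℕ → ℤ := fun e => if Even e then σ.x k else σ.x (k + 5)
  let j : ℕ → ℕ := fun e => if Even e then k + 2 else k + 3
  -- Even stages concern the crossing `k + 2`, pushed to the right by `k` and `k + 1`; odd stages
  -- concern `k + 3`, pushed to the left by `k + 4` and `k + 5`.
  let Inv : ℕ → ℤ → Prop := fun e y => BandEnd (σ.p (j e)) L (L + H') H y ∧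
    Conn adj4 (σ.p (j e) ∩ box (X e - s e + 1) (X e + s e - 1) 0 H) (σ.x (j e), 0) (L, y)
  have hs1 : ∀ e, W + H' + 3 ≤ s e := fun e => by
    have : 0 ≤ (e : ℤ) * D := mul_nonneg (by positivity) (by omega)
    simp only [s]; omega
  have hs2 : ∀ e ≤ m, 2 * s e - 1 ≤ H := fun e he => by
    have := hstage e he
    simp only [s]; omega
  have hX : ∀ e, u ≤ X e ∧ X e ≤ u + W := fun e => by
    simp only [X]; split_ifs <;> assumption
  have base : ∃ y, Inv 0 y := by
    have e0 : j 0 = k + 2 := rfl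
    have e1 : X 0 = σ.x k := rfl
    simp only [Inv, e0, e1]
    have hb := bandin (X 0) (s 0) (hX 0).1 (hX 0).2 (hs1 0)
    rw [e1] at hb
    rcases exists_cross_box' {v | Conn adj4 (σ.p (k + 2) ∩ box (σ.x k - s 0 + 1) (σ.x k + s 0 - 1) 0 H)
      (σ.x (k + 2), 0) v} (x0 := L) (x1 := L + H') (by omega) hH0 with ⟨⟨a, y⟩, q, hp, hq, h⟩ |
      ⟨b, t, hb', ht, h⟩
    · dsimp only at hp
      subst hp
      obtain ⟨y', h1, h2⟩ := exists_bandEnd (P := σ.p (k + 2)) hq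
        (h.mono (fun v hv => ⟨(Conn.right hv.1).1, hv.2⟩))
      exact ⟨y', h1, Conn.trans h.left.1 (h2.mono (fun v hv => ⟨hv.1, hb hv.2⟩))⟩
    · exfalso
      have := h.left.1
      simp only [mem_box] at this
      exact right (s 0) (hs1 0) (hs2 0 (Nat.zero_le _)) _ b t
        (fun v hv => ⟨hb hv.1, hv.2⟩) h hb' (by omega) ht
  have step : ∀ e y, e + 1 ≤ m → Inv e y → ∃ y', y < y' ∧ Inv (e + 1) y' := by
    rintro e y he ⟨h1, h2⟩
    have hsucc : s (e + 1) = s e + D := by simp only [s]; push_cast; ring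
    have hb := bandin (X (e + 1)) (s (e + 1)) (hX _).1 (hX _).2 (hs1 _)
    have hnest : box (X e - s e + 1) (X e + s e - 1) 0 H ⊆
        box (X (e + 1) - s (e + 1) + 1) (X (e + 1) + s (e + 1) - 1) 0 H := by
      have : X (e + 1) - X e ≤ D ∧ X e - X (e + 1) ≤ D := by
        simp only [X]; split_ifs <;> constructor <;> omega
      intro v hv
      simp only [mem_box, hsucc] at hv ⊢; omega
    have h2' := h2.mono (Set.inter_subset_inter_right _ hnest)
    refine next_bandEnd (by omega) hH0 (σ.disj' ?_ ?_ ?_) hb h2' h1 ?_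
    · simp only [j, Nat.even_add_one]; split_ifs <;> omega
    · simp only [j]; split_ifs <;> omega
    · simp only [j]; split_ifs <;> omega
    · intro S t hS h ht
      by_cases hev : Even e
      · have e1 : j e = k + 2 := if_pos hev
        have e2 : j (e + 1) = k + 3 := if_neg (by rw [Nat.even_add_one]; exact not_not.2 hev)
        have e3 : X (e + 1) = σ.x (k + 5) := if_neg (by rw [Nat.even_add_one]; exact not_not.2 hev)
        rw [e2, e3] at hS
        rw [e1] at h
        exact left _ (hs1 _) (hs2 _ he) S _ t hS h rfl (by dsimp only; omega) ht
      · have e1 : j e = k + 3 := if_neg hev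
        have e2 : j (e + 1) = k + 2 := if_pos (by rw [Nat.even_add_one]; exact hev)
        have e3 : X (e + 1) = σ.x k := if_pos (by rw [Nat.even_add_one]; exact hev)
        rw [e2, e3] at hS
        rw [e1] at h
        exact right _ (hs1 _) (hs2 _ he) S _ t hS h rfl (by dsimp only; omega) ht
  obtain ⟨y0, hy0⟩ := base
  -- The new end is chosen for all `e` and `y`, with dummy value `0` where the hypotheses fail, so
  -- that the chain can be defined by plain recursion.
  have step' : ∀ e y, ∃ y', e + 1 ≤ m → Inv e y → y < y' ∧ Inv (e + 1) y' := by
    intro e y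
    by_cases h : e + 1 ≤ m ∧ Inv e y
    · obtain ⟨y', h'⟩ := step e y h.1 h.2
      exact ⟨y', fun _ _ => h'⟩
    · exact ⟨0, fun h1 h2 => absurd ⟨h1, h2⟩ h⟩
  choose g hg using step'
  let c : ℕ → ℤ := fun e => Nat.rec y0 (fun e y => g e y) e
  have hc : ∀ e ≤ m, Inv e (c e) := by
    intro e
    induction e with
    | zero => exact fun _ => hy0
    | succ e ih => exact fun h => (hg e (c e) h (ih (by omega))).2
  exact ⟨c, fun e he => (hc e he).1, fun e he => (hg e (c e) he (hc e he.le)).1⟩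

end SwingState
end SquareIce

/-! ### Counting oscillations and descending to a quarter of the scale. -/

namespace SquareIce

namespace SwingState
variable {ι : Type*} {A : ι → Set (ℤ × ℤ)} {u H : ℤ}

/-- A gap over five indices splits into five unit gaps, and each of the five resulting sums
telescopes to a difference bounded by `W`. -/
theorem sum_gaps_le {x : ℕ → ℤ} {W : ℤ} (n : ℕ) (hx : ∀ i j, i < n + 5 → j < n + 5 → x j - x i ≤ W) :
    ∑ j ∈ Finset.range n, (x (j + 5) - x j) ≤ 5 * W := by
  rcases Nat.eq_zero_or_pos n with rfl | hn
  · have := hx 0 0 (by omega) (by omega)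
    simp only [sub_self] at this
    simp; omega
  have h : ∀ k < 5, ∑ j ∈ Finset.range n, (x (j + 1 + k) - x (j + k)) ≤ W := by
    intro k hk
    rw [Finset.sum_range_sub (fun j => x (j + k))]
    exact hx _ _ (by omega) (by omega)
  have e : ∑ j ∈ Finset.range n, (x (j + 5) - x j) =
      ∑ j ∈ Finset.range n, (x (j + 1 + 0) - x (j + 0)) + ∑ j ∈ Finset.range n, (x (j + 1 + 1) - x (j + 1)) +
      ∑ j ∈ Finset.range n, (x (j + 1 + 2) - x (j + 2)) + ∑ j ∈ Finset.range n, (x (j + 1 + 3) - x (j + 3)) +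
      ∑ j ∈ Finset.range n, (x (j + 1 + 4) - x (j + 4)) := by
    rw [← Finset.sum_add_distrib, ← Finset.sum_add_distrib, ← Finset.sum_add_distrib,
      ← Finset.sum_add_distrib]
    refine Finset.sum_congr rfl fun j _ => ?_
    simp only [Nat.add_assoc, Nat.reduceAdd, Nat.add_zero]
    ring
  rw [e]
  have := h 0 (by omega); have := h 1 (by omega); have := h 2 (by omega); have := h 3 (by omega)
  have := h 4 (by omega)
  linarith

/-- Many gaps of small total length allow many oscillations. -/
theorem oscillations_le (σ : SwingState A 300 u H) :
    ∃ m : ℕ → ℕ, (∀ j < 295, m j * (σ.x (j + 5) - σ.x j) ≤ 2 * (H / 16)) ∧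
      64 * 300 ≤ ∑ j ∈ Finset.range 295, m j := by
  have hW := σ.width
  set W := H / 16 with hWdef
  have hpos : ∀ j < 295, 0 < σ.x (j + 5) - σ.x j := fun j hj => by
    have := σ.mono j (j + 5) (by omega) (by omega); omega
  refine ⟨fun j => (2 * W / (σ.x (j + 5) - σ.x j)).toNat, ?_, ?_⟩
  · intro j hj
    have := hpos j hj
    rw [Int.toNat_of_nonneg (Int.ediv_nonneg (by omega) this.le)]
    exact Int.ediv_mul_le _ this.ne'
  -- A tangent-line bound for `2 * W / d`. The 295 gaps have total at most `5 * W`, hence mean at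
  -- most `W / 59`, and `118` is the value of `2 * W / d` at `d = W / 59`. Summing gives at least
  -- `34810 - 295` oscillations, more than `64 * 300`.
  · have key : ∀ j ∈ Finset.range 295, 2 * 118 * (2 * W) - 118 ^ 2 * (σ.x (j + 5) - σ.x j) ≤
        2 * W * ((2 * W / (σ.x (j + 5) - σ.x j)).toNat + 1 : ℤ) := by
      intro j hj
      have hp := hpos j (Finset.mem_range.1 hj)
      rw [Int.toNat_of_nonneg (Int.ediv_nonneg (by omega) hp.le)]
      generalize σ.x (j + 5) - σ.x j = d at hp
      have h1 : 2 * W < (2 * W / d + 1) * d := Int.lt_ediv_add_one_mul_self _ hp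
      generalize 2 * W / d + 1 = k at h1
      have h2 : 0 ≤ (118 * d - 2 * W) ^ 2 := sq_nonneg _
      have h3 : 2 * W * (2 * W) ≤ 2 * W * (k * d) := mul_le_mul_of_nonneg_left h1.le (by omega)
      refine le_of_mul_le_mul_right ?_ hp
      nlinarith
    have hs := Finset.sum_le_sum key
    have hg := sum_gaps_le (x := σ.x) (W := W) 295 (fun i j hi hj => by
      have := σ.win i hi; have := σ.win j hj; omega)
    simp only [Finset.sum_sub_distrib (f := fun _ => 2 * 118 * (2 * W)), ← Finset.mul_sum,
      Finset.sum_add_distrib] at hs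
    simp only [Finset.sum_const, Finset.card_range, nsmul_eq_mul] at hs
    have h4 : W * 69620 ≤ W * (2 * (∑ j ∈ Finset.range 295, ((2 * W / (σ.x (j + 5) - σ.x j)).toNat : ℤ)) + 590) := by
      push_cast at hs
      linarith
    have h5 := le_of_mul_le_mul_left h4 (by omega)
    have h6 : (64 * 300 : ℤ) ≤ ((∑ j ∈ Finset.range 295, (2 * W / (σ.x (j + 5) - σ.x j)).toNat : ℕ) : ℤ) := by
      push_cast; omega
    exact_mod_cast h6

/-- Without a common quad, the crossings produce a state of the same size at a quarter of the
scale. -/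
theorem descend (σ : SwingState A 300 u H)
    (hno : ¬ CommonQuad A (box (u - 2 * H) (u + 2 * H) (-H) (2 * H))) :
    ∃ v, 0 ≤ v ∧ v ≤ H ∧ Nonempty (SwingState (fun l => (LatIso.diag (u + H / 16 + 1)).f.symm ⁻¹' A l) 300
      (v + (u + H / 16 + 1)) (H / 4)) := by
  classical
  have hW := σ.width
  have hH0 : 0 ≤ H := by omega
  obtain ⟨m, hm1, hm2⟩ := σ.oscillations_le
  set L := u + H / 16 + 1 with hL
  set R := L + H / 4 with hR
  -- The index of the crossing through `(L, y)`, unique by disjointness; the value `0` elsewhere is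
  -- a dummy.
  let idn : ℤ → ℕ := fun y => if h : ∃ i, i < 300 ∧ (L, y) ∈ σ.p i then h.choose else 0
  have hid : ∀ i y, i < 300 → (L, y) ∈ σ.p i → idn y = i := by
    intro i y hi h
    have hex : ∃ i, i < 300 ∧ (L, y) ∈ σ.p i := ⟨i, hi, h⟩
    simp only [idn, dif_pos hex]
    by_contra hne
    exact (σ.disj' hne hex.choose_spec.1 hi).le_bot ⟨hex.choose_spec.2, h⟩
  have hmem : ∀ {P : Set (ℤ × ℤ)} {y : ℤ}, BandEnd P L R H y → (L, y) ∈ P ∧ 0 ≤ y ∧ y ≤ H := by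
    rintro P y ⟨⟨z, _, h⟩, _⟩
    exact ⟨h.left.1, h.left.2.2.2⟩
  let Y : Finset ℤ := (Finset.Icc 0 H).filter fun y => ∃ i, i < 300 ∧ BandEnd (σ.p i) L R H y
  have hY : ∀ y, y ∈ Y ↔ ∃ i, i < 300 ∧ BandEnd (σ.p i) L R H y := by
    intro y
    simp only [Y, Finset.mem_filter, Finset.mem_Icc, and_iff_right_iff_imp]
    rintro ⟨i, _, h⟩
    exact (hmem h).2
  have hYid : ∀ y ∈ Y, idn y < 300 ∧ BandEnd (σ.p (idn y)) L R H y := by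
    intro y hy
    obtain ⟨i, hi, h⟩ := (hY y).1 hy
    rw [hid i y hi (hmem h).1]
    exact ⟨hi, h⟩
  -- A crossing of intermediate index starts between the two, so by `exists_bandEnd_between` it has
  -- an end between theirs; consecutive ends therefore have indices differing by at most one.
  have hstep : ∀ y ∈ Y, ∀ y' ∈ Y, y < y' → (∀ x ∈ Y, ¬ (y < x ∧ x < y')) →
      (idn y : ℤ) ≤ (idn y' : ℤ) + 1 ∧ (idn y' : ℤ) ≤ (idn y : ℤ) + 1 := by
    intro y hy y' hy' hlt hbet
    obtain ⟨hi, hyE⟩ := hYid y hy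
    obtain ⟨hi', hyE'⟩ := hYid y' hy'
    by_contra hcon
    obtain ⟨k, hk, hkk⟩ : ∃ k < 300, idn y < k ∧ k < idn y' ∨ idn y' < k ∧ k < idn y := by
      by_cases h : idn y < idn y'
      · exact ⟨idn y + 1, by omega, by omega⟩
      · exact ⟨idn y' + 1, by omega, by omega⟩
    obtain ⟨y'', h1, h2, h3⟩ := exists_bandEnd_between (show L ≤ R by omega) hH0
      (σ.strip _ hi).rows (σ.strip _ hi').rows (σ.strip k hk) (σ.conn _ hi) (σ.conn _ hi')
      (σ.disj' (by omega) hi hk) (σ.disj' (by omega) hi' hk)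
      (by
        rcases hkk with h | h
        · exact .inl ⟨σ.mono _ _ h.1 hk, σ.mono _ _ h.2 hi'⟩
        · exact .inr ⟨σ.mono _ _ h.1 hk, σ.mono _ _ h.2 hi⟩) hyE hyE' hlt
    exact hbet y'' ((hY y'').2 ⟨k, hk, h1⟩) ⟨h2, h3⟩
  have hchain : ∀ j, ∃ c : ℕ → ℤ, j < 295 →
      (∀ e ≤ m j, BandEnd (σ.p (if Even e then j + 2 else j + 3)) L R H (c e)) ∧
        ∀ e < m j, c e < c (e + 1) := by
    intro j
    by_cases hj : j < 295
    · obtain ⟨c, h1, h2⟩ := σ.exists_chain hno (n := j + 2) (m := m j) (by omega) (by omega) (hm1 j hj)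
      exact ⟨c, fun _ => ⟨h1, h2⟩⟩
    · exact ⟨0, fun h => absurd h hj⟩
  choose c hc using hchain
  -- The chain numbered `j` alternates between the crossings `j + 2` and `j + 3`, because two
  -- further crossings are needed on each side to push them.
  let emb : ℕ → ℤ := fun j => (j : ℤ) + 2
  have hemb : ∀ j : ℕ, (emb j - 2).toNat = j := fun j => by simp [emb]
  obtain ⟨D, hDY, hDc, hD⟩ := exists_alternating Y (fun y => (idn y : ℤ)) hstep
    ((Finset.range 295).image emb) (fun i => m (i - 2).toNat) (fun i => c (i - 2).toNat)
    (by
      intro i hi e he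
      obtain ⟨j, hj, rfl⟩ := Finset.mem_image.1 hi
      have hj' := Finset.mem_range.1 hj
      rw [hemb] at he ⊢
      have hb := (hc j hj').1 e he
      by_cases hev : Even e
      · rw [if_pos hev] at hb ⊢
        refine ⟨(hY _).2 ⟨_, by omega, hb⟩, ?_⟩
        rw [hid _ _ (by omega) (hmem hb).1]; simp [emb]
      · rw [if_neg hev] at hb ⊢
        refine ⟨(hY _).2 ⟨_, by omega, hb⟩, ?_⟩
        rw [hid _ _ (by omega) (hmem hb).1]; simp only [emb]; push_cast; ring)
    (by
      intro i hi e he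
      obtain ⟨j, hj, rfl⟩ := Finset.mem_image.1 hi
      have hj' := Finset.mem_range.1 hj
      rw [hemb] at he ⊢
      exact (hc j hj').2 e he)
  rw [Finset.sum_image (by intro a _ b _ h; simp only [emb] at h; omega)] at hDc
  simp only [hemb] at hDc
  -- The `64 * 300` ends on a line of length `H` leave 300 in a window of length `H / 4 / 16`, which
  -- is the window allowed at scale `H / 4`.
  obtain ⟨v, y, hy1, hy2, hy3, hv0, hvH⟩ := exists_window D (H := H) (w := H / 4 / 16) (K := 300) (N := 64)
    (fun d hd => by
      have := hYid d (hDY hd)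
      exact (hmem this.2).2) (by omega) (by push_cast; omega) (by omega) (by omega) (hm2.trans hDc)
  have hend : ∀ j < 300, idn (y j) < 300 ∧ BandEnd (σ.p (idn (y j))) L R H (y j) := fun j hj =>
    hYid _ (hDY (hy1 j hj).1)
  let Q : ℕ → Set (ℤ × ℤ) := fun j => {v | Conn adj4 (σ.p (idn (y j)) ∩ box L R 0 H) (L, y j) v}
  have hQ : ∀ j, ∀ v ∈ Q j, v ∈ σ.p (idn (y j)) ∧ v ∈ box L R 0 H := fun j v hv => hv.right
  -- The diagonal reflection turns the vertical band of width `H / 4` into a horizontal strip of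
  -- that height. Consecutive ends have neighbouring indices, hence lie in different sets of the
  -- family.
  let φ := LatIso.diag L
  refine ⟨v, hv0, hvH, ⟨{
    p := fun j => φ.f.symm ⁻¹' Q j
    x := fun j => y j + L
    l := fun j => σ.l (idn (y j))
    sub := ?_
    disj := ?_
    lab := ?_
    strip := ?_
    conn := ?_
    mono := ?_
    win := ?_ }⟩⟩
  · intro j hj w hw
    exact σ.sub _ (hend j hj).1 (hQ j _ hw).1
  · intro i j hij hj
    refine Set.disjoint_left.2 fun w hw hw' => ?_
    change Conn _ _ _ _ at hw
    change Conn _ _ _ _ at hw'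
    have hi := hij.trans hj
    have hlt := hy2 i j hij hj
    by_cases he : idn (y i) = idn (y j)
    · rw [← he] at hw'
      have := (hend j hj).2.2 (y i) (by rw [← he]; exact hw'.trans hw.symm4)
      omega
    · exact (σ.disj' he (hend i hi).1 (hend j hj).1).le_bot ⟨hw.right.1, hw'.right.1⟩
  · intro j hj
    have h1 := hD _ (hy1 j (by omega)).1 _ (hy1 (j + 1) hj).1 (hy2 j (j + 1) (by omega) hj) (hy3 j hj)
    have b1 := (hend j (by omega)).1
    have b2 := (hend (j + 1) hj).1
    rcases h1 with h1 | h1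
    · have e : idn (y (j + 1)) = idn (y j) + 1 := by omega
      rw [e]; exact σ.lab _ (by omega)
    · have e : idn (y j) = idn (y (j + 1)) + 1 := by omega
      rw [e]; exact (σ.lab _ (by omega)).symm
  · intro j hj
    refine ⟨?_, ?_⟩
    · intro w hw
      have := (hQ j _ hw).2
      simp only [φ, LatIso.diag_symm, mem_box] at this
      omega
    · obtain ⟨z, hz, hc⟩ := (hend j hj).2.1
      have h1 := hc.reach.lat4 φ
      simp only [φ, LatIso.diag_f, sub_self] at h1
      refine ⟨z.2 + L, ?_⟩
      rw [show H / 4 = z.1 - L by omega]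
      exact h1
  · intro j hj w hw
    have h1 := (Conn.reach hw).lat4 φ
    rw [Equiv.apply_symm_apply] at h1
    simp only [φ, LatIso.diag_f, sub_self] at h1
    exact h1
  · intro i j hij hj
    have := hy2 i j hij hj
    omega
  · intro j hj
    have := (hy1 j hj).2
    omega

/-- Three hundred crossings starting in a short window, consecutive ones in different sets, give
two sets crossing a common symmetric quad. -/
theorem exists_commonQuad (n : ℕ) : ∀ {A : ι → Set (ℤ × ℤ)} {u H : ℤ}, H ≤ n → SwingState A 300 u H →
    CommonQuad A (box (u - 2 * H) (u + 2 * H) (-H) (2 * H)) := by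
  induction n with
  | zero => intro A u H hH σ; have := σ.width; push_cast at hH; omega
  | succ n ih =>
    intro A u H hH σ
    have hW := σ.width
    by_contra hno
    obtain ⟨v, hv0, hvH, ⟨τ⟩⟩ := σ.descend hno
    push_cast at hH
    obtain ⟨q, hq, l, l', hne, h1, h2⟩ := ih (by omega) τ
    refine hno ⟨q.map (LatIso.diag (u + H / 16 + 1)), ?_, l, l', hne, ?_, ?_⟩
    · intro w hw
      have := hq hw
      simp only [LatIso.diag_symm, mem_box] at this ⊢
      omega
    · exact (q.map_crossed _ _).2 h1
    · exact (q.map_crossed _ _).2 h2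

end SwingState
end SquareIce

namespace SquareIce
open Sum

/-! ### Height functions on the lattice of sites and faces -/

abbrev Vtx := (ℤ × ℤ) ⊕ (ℤ × ℤ)

/-- Functions varying by at most one between a face and its corners. -/
def Lip : Set (Vtx → ℤ) :=
  {k | ∀ c v, Inc c v → k (inl v) ≤ k (inr c) + 1 ∧ k (inr c) ≤ k (inl v) + 1}

theorem lip_row {f : ℤ → ℤ} (hf : ∀ a, f a ≤ f (a + 1) + 2 ∧ f (a + 1) ≤ f a + 2) (a : ℤ) (n : ℕ) :
    f (a + n) ≤ f a + 2 * n ∧ f a ≤ f (a + n) + 2 * n := by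
  induction n with
  | zero => simp
  | succ n ih =>
    have := hf (a + n)
    rw [show a + (n + 1 : ℕ) = a + n + 1 by push_cast; ring]
    push_cast; omega

theorem lip_row' {f : ℤ → ℤ} (hf : ∀ a, f a ≤ f (a + 1) + 2 ∧ f (a + 1) ≤ f a + 2) (a b : ℤ) :
    |f a - f b| ≤ 2 * |a - b| := by
  rcases le_total a b with h | h
  · obtain ⟨n, rfl⟩ := Int.le.dest h
    have := lip_row hf a n
    rw [abs_le, abs_of_nonpos (a := a - (a + n)) (by omega)]; omega
  · obtain ⟨n, rfl⟩ := Int.le.dest h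
    have := lip_row hf b n
    rw [abs_le, abs_of_nonneg (a := b + n - b) (by omega)]; omega

theorem Lip.bound {k : Vtx → ℤ} (hk : k ∈ Lip) (u v : ℤ × ℤ) :
    |k (inl u) - k (inl v)| ≤ 2 * |u.1 - v.1| + 2 * |u.2 - v.2| := by
  have h1 := lip_row' (f := fun a => k (inl (a, u.2))) (fun a => by
    have h1 := hk (a, u.2) (a, u.2) (by simp [Inc])
    have h2 := hk (a, u.2) (a + 1, u.2) (by simp [Inc])
    omega) u.1 v.1
  have h2 := lip_row' (f := fun b => k (inl (v.1, b))) (fun b => by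
    have h1 := hk (v.1, b) (v.1, b) (by simp [Inc])
    have h2 := hk (v.1, b) (v.1, b + 1) (by simp [Inc])
    omega) u.2 v.2
  have h3 := abs_sub_le (k (inl (u.1, u.2))) (k (inl (v.1, u.2))) (k (inl (v.1, v.2)))
  simp only [Prod.mk.eta] at *
  linarith

theorem Lip.finite {F : Set Vtx} (hF : Fᶜ.Finite) (ξ : Vtx → ℤ) :
    {k | k ∈ Lip ∧ ∀ v ∈ F, k v = ξ v}.Finite := by
  classical
  obtain ⟨v0, hv0⟩ : ∃ v : ℤ × ℤ, (inl v : Vtx) ∈ F := by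
    by_contra h
    push Not at h
    exact Set.infinite_of_injective_forall_mem (f := (inl : ℤ × ℤ → Vtx)) inl_injective h hF
  let b : Vtx → ℤ := fun x => 2 * |(Sum.elim id id x).1 - v0.1| + 2 * |(Sum.elim id id x).2 - v0.2| + 1
  have hb : ∀ k ∈ Lip, k (inl v0) = ξ (inl v0) → ∀ x, k x ∈ Set.Icc (ξ (inl v0) - b x) (ξ (inl v0) + b x) := by
    rintro k hk h0 (v | c)
    · have := Lip.bound hk v v0
      rw [h0, abs_le] at this
      simp only [b, Sum.elim_inl, id, Set.mem_Icc]; omega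
    · have := Lip.bound hk c v0
      have h2 := hk c c (by simp [Inc])
      rw [h0, abs_le] at this
      simp only [b, Sum.elim_inr, id, Set.mem_Icc]; omega
  have : Finite ↥Fᶜ := hF
  refine Set.Finite.of_finite_image (f := fun k (x : ↥Fᶜ) => k x) ?_ ?_
  · refine (Set.Finite.pi' (t := fun x : ↥Fᶜ => Set.Icc (ξ (inl v0) - b x) (ξ (inl v0) + b x))
      (fun x => Set.finite_Icc _ _)).subset ?_
    rintro _ ⟨k, ⟨hk, hkF⟩, rfl⟩ x
    exact hb k hk (hkF _ hv0) x
  · rintro k ⟨_, hk⟩ k' ⟨_, hk'⟩ h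
    funext x
    by_cases hx : x ∈ F
    · rw [hk x hx, hk' x hx]
    · exact congrFun h ⟨x, hx⟩

/-- Height functions: odd on sites, even on faces, varying by one. -/
def Hom : Set (Vtx → ℤ) := {k | k ∈ Lip ∧ (∀ v, Odd (k (inl v))) ∧ ∀ c, Even (k (inr c))}

/-- The height functions with prescribed values `ξ` on `F`. -/
def Om (F : Set Vtx) (ξ : Vtx → ℤ) : Set (Vtx → ℤ) := {k | k ∈ Hom ∧ ∀ v ∈ F, k v = ξ v}

theorem Om.finite {F : Set Vtx} (hF : Fᶜ.Finite) (ξ : Vtx → ℤ) : (Om F ξ).Finite :=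
  (Lip.finite hF ξ).subset fun _ hk => ⟨hk.1.1, hk.2⟩

theorem Hom.sup {k k' : Vtx → ℤ} (h : k ∈ Hom) (h' : k' ∈ Hom) : k ⊔ k' ∈ Hom := by
  refine ⟨fun c v hcv => ?_, fun v => ?_, fun c => ?_⟩
  · have := h.1 c v hcv; have := h'.1 c v hcv
    simp only [Pi.sup_apply]; omega
  · simp only [Pi.sup_apply]; rcases max_choice (k (inl v)) (k' (inl v)) with e | e <;> rw [e]
    exacts [h.2.1 v, h'.2.1 v]
  · simp only [Pi.sup_apply]; rcases max_choice (k (inr c)) (k' (inr c)) with e | e <;> rw [e]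
    exacts [h.2.2 c, h'.2.2 c]

theorem Hom.inf {k k' : Vtx → ℤ} (h : k ∈ Hom) (h' : k' ∈ Hom) : k ⊓ k' ∈ Hom := by
  refine ⟨fun c v hcv => ?_, fun v => ?_, fun c => ?_⟩
  · have := h.1 c v hcv; have := h'.1 c v hcv
    simp only [Pi.inf_apply]; omega
  · simp only [Pi.inf_apply]; rcases min_choice (k (inl v)) (k' (inl v)) with e | e <;> rw [e]
    exacts [h.2.1 v, h'.2.1 v]
  · simp only [Pi.inf_apply]; rcases min_choice (k (inr c)) (k' (inr c)) with e | e <;> rw [e]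
    exacts [h.2.2 c, h'.2.2 c]

open scoped FinsetFamily in
/-- Daykin's inequality for sets of functions closed under suitable lattice operations. -/
theorem ncard_mul_ncard_le {A B C D : Set (Vtx → ℤ)} (hA : A.Finite) (hB : B.Finite) (hC : C.Finite)
    (hD : D.Finite) (h : ∀ x ∈ A, ∀ y ∈ B, x ⊓ y ∈ C ∧ x ⊔ y ∈ D) :
    A.ncard * B.ncard ≤ C.ncard * D.ncard := by
  classical
  rw [Set.ncard_eq_toFinset_card _ hA, Set.ncard_eq_toFinset_card _ hB, Set.ncard_eq_toFinset_card _ hC,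
    Set.ncard_eq_toFinset_card _ hD]
  refine (Finset.le_card_infs_mul_card_sups _ _).trans (Nat.mul_le_mul ?_ ?_)
  · refine Finset.card_le_card fun z hz => ?_
    obtain ⟨x, hx, y, hy, rfl⟩ := Finset.mem_infs.1 hz
    exact hC.mem_toFinset.2 (h x (hA.mem_toFinset.1 hx) y (hB.mem_toFinset.1 hy)).1
  · refine Finset.card_le_card fun z hz => ?_
    obtain ⟨x, hx, y, hy, rfl⟩ := Finset.mem_sups.1 hz
    exact hD.mem_toFinset.2 (h x (hA.mem_toFinset.1 hx) y (hB.mem_toFinset.1 hy)).2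

/-- Increasing events are positively correlated. -/
theorem Om.fkg {F : Set Vtx} (hF : Fᶜ.Finite) (ξ : Vtx → ℤ) {U U' : Set (Vtx → ℤ)} (hU : IsUpperSet U)
    (hU' : IsUpperSet U') :
    (Om F ξ ∩ U).ncard * (Om F ξ ∩ U').ncard ≤ (Om F ξ).ncard * (Om F ξ ∩ (U ∩ U')).ncard := by
  have hf := Om.finite hF ξ
  refine ncard_mul_ncard_le (hf.inter_of_left _) (hf.inter_of_left _) hf (hf.inter_of_left _) ?_
  rintro x ⟨hx, hxU⟩ y ⟨hy, hyU⟩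
  refine ⟨⟨Hom.inf hx.1 hy.1, fun v hv => ?_⟩, ⟨Hom.sup hx.1 hy.1, fun v hv => ?_⟩, hU le_sup_left hxU,
    hU' le_sup_right hyU⟩
  · simp only [Pi.inf_apply, hx.2 v hv, hy.2 v hv, min_self]
  · simp only [Pi.sup_apply, hx.2 v hv, hy.2 v hv, max_self]

/-- Raising prescribed values raises the probability of increasing events. -/
theorem Om.holley {F : Set Vtx} (hF : Fᶜ.Finite) {ξ ξ' : Vtx → ℤ} (hξ : ∀ v ∈ F, ξ v ≤ ξ' v)
    {U : Set (Vtx → ℤ)} (hU : IsUpperSet U) :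
    (Om F ξ ∩ U).ncard * (Om F ξ').ncard ≤ (Om F ξ).ncard * (Om F ξ' ∩ U).ncard := by
  have hf := Om.finite hF ξ
  have hf' := Om.finite hF ξ'
  refine ncard_mul_ncard_le (hf.inter_of_left _) hf' hf (hf'.inter_of_left _) ?_
  rintro x ⟨hx, hxU⟩ y hy
  refine ⟨⟨Hom.inf hx.1 hy.1, fun v hv => ?_⟩, ⟨Hom.sup hx.1 hy.1, fun v hv => ?_⟩, hU le_sup_left hxU⟩
  · simp only [Pi.inf_apply, hx.2 v hv, hy.2 v hv]; exact min_eq_left (hξ v hv)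
  · simp only [Pi.sup_apply, hx.2 v hv, hy.2 v hv]; exact max_eq_right (hξ v hv)

/-- Given the values on the interface `B`, the inside `I` and the outside are independent: an event of
the inside with prescribed interface values may be replaced by any prescribed values inside. -/
theorem Om.glue {F I B : Set Vtx} (hF : Fᶜ.Finite) {ξ ξ' : Vtx → ℤ}
    (hIB1 : ∀ v c, Inc c v → (inl v : Vtx) ∈ I → (inr c : Vtx) ∈ I ∪ B)
    (hIB2 : ∀ v c, Inc c v → (inr c : Vtx) ∈ I → (inl v : Vtx) ∈ I ∪ B)
    (hξF : ∀ v ∈ F \ (I ∪ B), ξ' v = ξ v) {𝒜 W : Set (Vtx → ℤ)}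
    (hB : ∀ k ∈ Om F ξ, k ∈ 𝒜 → ∀ v ∈ B, k v = ξ' v)
    (h𝒜 : ∀ k ∈ 𝒜, ∀ k', (∀ v ∈ I ∪ B, k' v = k v) → k' ∈ 𝒜)
    (hW : ∀ k ∈ W, ∀ k', (∀ v ∉ I, k' v = k v) → k' ∈ W) :
    (Om F ξ ∩ 𝒜 ∩ W).ncard * (Om (F ∪ (I ∪ B)) ξ').ncard =
      (Om F ξ ∩ 𝒜).ncard * (Om (F ∪ (I ∪ B)) ξ' ∩ W).ncard := by
  classical
  have hf := Om.finite hF ξ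
  have hf' := Om.finite (F := F ∪ (I ∪ B)) (hF.subset (Set.compl_subset_compl.2 Set.subset_union_left)) ξ'
  -- Exchanging the values inside `I` between two functions is an involution on pairs. Agreement on
  -- `B` keeps both height functions, and the exchange carries `W` from one factor to the other.
  let mix : (Vtx → ℤ) → (Vtx → ℤ) → Vtx → ℤ := fun k k' v => if v ∈ I then k v else k' v
  have mix_mix : ∀ k k', mix (mix k k') (mix k' k) = k := by
    intro k k'; funext v; simp only [mix]; split_ifs <;> rfl
  have mixHom : ∀ k ∈ Hom, ∀ k' ∈ Hom, (∀ v ∈ B, k v = k' v) → mix k k' ∈ Hom := by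
    intro k hk k' hk' hkk
    refine ⟨fun c v hcv => ?_, fun v => ?_, fun c => ?_⟩
    · have h1 := hk.1 c v hcv
      have h2 := hk'.1 c v hcv
      simp only [mix]
      by_cases hv : (inl v : Vtx) ∈ I <;> by_cases hc : (inr c : Vtx) ∈ I
      · simpa only [hv, hc, if_true] using h1
      · have hb := hkk _ ((hIB1 v c hcv hv).resolve_left hc)
        simp only [hv, hc, if_true, if_false]; omega
      · have hb := hkk _ ((hIB2 v c hcv hc).resolve_left hv)
        simp only [hv, hc, if_true, if_false]; omega
      · simpa only [hv, hc, if_false] using h2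
    · simp only [mix]; split_ifs
      exacts [hk.2.1 v, hk'.2.1 v]
    · simp only [mix]; split_ifs
      exacts [hk.2.2 c, hk'.2.2 c]
  have main : ∀ k ∈ Om F ξ ∩ 𝒜, ∀ k' ∈ Om (F ∪ (I ∪ B)) ξ',
      mix k k' ∈ Om F ξ ∩ 𝒜 ∧ mix k' k ∈ Om (F ∪ (I ∪ B)) ξ' := by
    rintro k ⟨hk, hkA⟩ k' hk'
    have e : ∀ v ∈ B, k v = k' v := fun v hv => by
      rw [hB k hk hkA v hv, hk'.2 v (.inr (.inr hv))]
    refine ⟨⟨⟨mixHom k hk.1 k' hk'.1 e, fun v hv => ?_⟩, h𝒜 k hkA _ fun v hv => ?_⟩,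
      mixHom k' hk'.1 k hk.1 (fun v hv => (e v hv).symm), fun v hv => ?_⟩
    · simp only [mix]
      split_ifs with h
      · exact hk.2 v hv
      · by_cases hb : v ∈ B
        · rw [← e v hb]; exact hk.2 v hv
        · rw [hk'.2 v (.inl hv)]; exact hξF v ⟨hv, by rintro (h' | h') <;> contradiction⟩
    · simp only [mix]
      split_ifs with h
      · rfl
      · exact (e v (hv.resolve_left h)).symm
    · simp only [mix]
      split_ifs with h
      · exact hk'.2 v hv
      · by_cases hb : v ∈ B
        · exact hB k hk hkA v hb
        · have : v ∈ F := by
            rcases hv with hv | hv | hv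
            · exact hv
            · exact absurd hv h
            · exact absurd hv hb
          rw [hk.2 v this]; exact (hξF v ⟨this, by rintro (h' | h') <;> contradiction⟩).symm
  rw [← Set.ncard_prod, ← Set.ncard_prod]
  refine Set.ncard_congr (fun p _ => (mix p.1 p.2, mix p.2 p.1)) ?_ ?_ ?_
  · rintro ⟨k, k'⟩ ⟨⟨hk, hkW⟩, hk'⟩
    obtain ⟨h1, h2⟩ := main k hk k' hk'
    refine ⟨h1, h2, hW k hkW _ fun v hv => ?_⟩
    simp only [mix, if_neg hv]
  · rintro ⟨k, k'⟩ ⟨l, l'⟩ _ _ h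
    simp only [Prod.mk.injEq] at h
    have e1 := mix_mix k k'
    have e2 := mix_mix k' k
    rw [h.1, h.2] at e1 e2
    rw [mix_mix] at e1 e2
    rw [e1, e2]
  · rintro ⟨k, k'⟩ ⟨hk, hk', hkW⟩
    obtain ⟨h1, h2⟩ := main k hk k' hk'
    refine ⟨(mix k k', mix k' k), ⟨⟨h1, hW k' hkW _ fun v hv => ?_⟩, h2⟩, ?_⟩
    · simp only [mix, if_neg hv]
    · simp only [mix_mix]

end SquareIce

namespace SquareIce
open Sum

/-! ### Folding -/

/-- Functions varying by one, even on sites and odd on faces. -/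
def GHom : Set (Vtx → ℤ) := {g | g ∈ Lip ∧ (∀ v, Even (g (inl v))) ∧ ∀ c, Odd (g (inr c))}

def GOm (F : Set Vtx) (γ : Vtx → ℤ) : Set (Vtx → ℤ) := {g | g ∈ GHom ∧ ∀ v ∈ F, g v = γ v}

theorem GOm.finite {F : Set Vtx} (hF : Fᶜ.Finite) (γ : Vtx → ℤ) : (GOm F γ).Finite :=
  (Lip.finite hF γ).subset fun _ hk => ⟨hk.1.1, hk.2⟩

/-- The pointwise absolute value. -/
def ab (g : Vtx → ℤ) : Vtx → ℤ := fun v => |g v|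

/-- Sign patterns on faces compatible with the absolute value `x` and with negative prescribed values. -/
def Sg (F : Set Vtx) (x : Vtx → ℤ) : Set (ℤ × ℤ → ZMod 2) :=
  {ε | (∀ c, (inr c : Vtx) ∈ F → ε c = 0) ∧ ∀ v, 0 < x (inl v) →
    (∀ c c', Inc c v → Inc c' v → ε c = ε c') ∧ ((inl v : Vtx) ∈ F → ∀ c, Inc c v → ε c = 0)}

theorem Sg.finite {F : Set Vtx} (hF : Fᶜ.Finite) (x : Vtx → ℤ) : (Sg F x).Finite := by
  have hfin : {c : ℤ × ℤ | (inr c : Vtx) ∉ F}.Finite :=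
    hF.preimage (f := (inr : ℤ × ℤ → Vtx)) (inr_injective.injOn)
  have : Finite ↥{c : ℤ × ℤ | (inr c : Vtx) ∉ F} := hfin
  refine Set.Finite.of_finite_image
    (f := fun ε (c : ↥{c : ℤ × ℤ | (inr c : Vtx) ∉ F}) => ε c) (Set.toFinite _) ?_
  rintro ε hε ε' hε' h
  funext c
  by_cases hc : (inr c : Vtx) ∈ F
  · rw [hε.1 c hc, hε'.1 c hc]
  · exact congrFun h ⟨c, hc⟩

/-- Each `Sg F x` is a vector space over `ZMod 2`. Sums of patterns for `x` and `y` are patterns for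
`x ⊓ y`, where fewer sites impose constraints. Two pairs with the same sum differ by a pattern
satisfying both sets of constraints, that is, one for `x ⊔ y`. So each fibre of addition has at most
`(Sg F (x ⊔ y)).ncard` elements. -/
theorem Sg.mul_le {F : Set Vtx} (hF : Fᶜ.Finite) {x y : Vtx → ℤ} :
    (Sg F x).ncard * (Sg F y).ncard ≤ (Sg F (x ⊓ y)).ncard * (Sg F (x ⊔ y)).ncard := by
  classical
  have hx := Sg.finite hF x
  have hy := Sg.finite hF y
  have h1 := Sg.finite hF (x ⊓ y)
  have h2 := Sg.finite hF (x ⊔ y)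
  rw [Set.ncard_eq_toFinset_card _ hx, Set.ncard_eq_toFinset_card _ hy, Set.ncard_eq_toFinset_card _ h1,
    Set.ncard_eq_toFinset_card _ h2, ← Finset.card_product, mul_comm]
  have hmaps : ∀ p ∈ hx.toFinset ×ˢ hy.toFinset, p.1 + p.2 ∈ h1.toFinset := by
    rintro ⟨ε, ε'⟩ h
    simp only [Finset.mem_product, Set.Finite.mem_toFinset] at h ⊢
    obtain ⟨hε, hε'⟩ := h
    refine ⟨fun c hc => ?_, fun v hv => ⟨fun c c' hc hc' => ?_, fun hvF c hc => ?_⟩⟩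
    · simp only [Pi.add_apply, hε.1 c hc, hε'.1 c hc, add_zero]
    all_goals
      simp only [Pi.inf_apply, lt_inf_iff] at hv
    · simp only [Pi.add_apply, (hε.2 v hv.1).1 c c' hc hc', (hε'.2 v hv.2).1 c c' hc hc']
    · simp only [Pi.add_apply, (hε.2 v hv.1).2 hvF c hc, (hε'.2 v hv.2).2 hvF c hc, add_zero]
  refine Finset.card_le_mul_card_image_of_maps_to hmaps _ fun s _ => ?_
  by_cases hne : ((hx.toFinset ×ˢ hy.toFinset).filter fun p => p.1 + p.2 = s).Nonempty
  · obtain ⟨⟨α, β⟩, hαβ⟩ := hne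
    simp only [Finset.mem_filter, Finset.mem_product, Set.Finite.mem_toFinset] at hαβ
    refine Finset.card_le_card_of_injOn (fun p => p.1 + α) ?_ ?_
    · rintro ⟨ε, ε'⟩ h
      simp only [Finset.coe_filter, Finset.mem_product, Set.Finite.mem_toFinset, Set.mem_ofPred_eq,
        Set.Finite.coe_toFinset] at h ⊢
      have heq : ∀ c, ε c + α c = ε' c + β c := by
        intro c
        have e := congrFun (h.2.trans hαβ.2.symm) c
        simp only [Pi.add_apply] at e
        revert e
        generalize ε c = a; generalize ε' c = b; generalize α c = d; generalize β c = f
        revert a b d f; decide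
      refine ⟨fun c hc => ?_, fun v hv => ?_⟩
      · simp only [Pi.add_apply, h.1.1.1 c hc, hαβ.1.1.1 c hc, add_zero]
      · simp only [Pi.sup_apply, lt_sup_iff] at hv
        rcases hv with hv | hv
        · refine ⟨fun c c' hc hc' => ?_, fun hvF c hc => ?_⟩
          · simp only [Pi.add_apply, (h.1.1.2 v hv).1 c c' hc hc', (hαβ.1.1.2 v hv).1 c c' hc hc']
          · simp only [Pi.add_apply, (h.1.1.2 v hv).2 hvF c hc, (hαβ.1.1.2 v hv).2 hvF c hc, add_zero]
        · refine ⟨fun c c' hc hc' => ?_, fun hvF c hc => ?_⟩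
          · simp only [Pi.add_apply, heq]
            rw [(h.1.2.2 v hv).1 c c' hc hc', (hαβ.1.2.2 v hv).1 c c' hc hc']
          · simp only [Pi.add_apply, heq]
            rw [(h.1.2.2 v hv).2 hvF c hc, (hαβ.1.2.2 v hv).2 hvF c hc, add_zero]
    · rintro ⟨ε, ε'⟩ h ⟨δ, δ'⟩ h' he
      simp only [Finset.coe_filter, Set.mem_ofPred_eq] at h h'
      have e1 : ε = δ := add_right_cancel he
      subst e1
      have e2 := h.2.trans h'.2.symm
      rw [add_left_cancel e2]
  · rw [Finset.not_nonempty_iff_eq_empty.1 hne]; simp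

theorem GHom.sup {k k' : Vtx → ℤ} (h : k ∈ GHom) (h' : k' ∈ GHom) : k ⊔ k' ∈ GHom := by
  refine ⟨fun c v hcv => ?_, fun v => ?_, fun c => ?_⟩
  · have := h.1 c v hcv; have := h'.1 c v hcv
    simp only [Pi.sup_apply]; omega
  · simp only [Pi.sup_apply]; rcases max_choice (k (inl v)) (k' (inl v)) with e | e <;> rw [e]
    exacts [h.2.1 v, h'.2.1 v]
  · simp only [Pi.sup_apply]; rcases max_choice (k (inr c)) (k' (inr c)) with e | e <;> rw [e]
    exacts [h.2.2 c, h'.2.2 c]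

theorem GHom.inf {k k' : Vtx → ℤ} (h : k ∈ GHom) (h' : k' ∈ GHom) : k ⊓ k' ∈ GHom := by
  refine ⟨fun c v hcv => ?_, fun v => ?_, fun c => ?_⟩
  · have := h.1 c v hcv; have := h'.1 c v hcv
    simp only [Pi.inf_apply]; omega
  · simp only [Pi.inf_apply]; rcases min_choice (k (inl v)) (k' (inl v)) with e | e <;> rw [e]
    exacts [h.2.1 v, h'.2.1 v]
  · simp only [Pi.inf_apply]; rcases min_choice (k (inr c)) (k' (inr c)) with e | e <;> rw [e]
    exacts [h.2.2 c, h'.2.2 c]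

theorem GOm.neg_ab {F : Set Vtx} {γ : Vtx → ℤ} (hγ : ∀ v ∈ F, γ v ≤ 0) {g : Vtx → ℤ} (hg : g ∈ GOm F γ) :
    -ab g ∈ GOm F γ := by
  refine ⟨⟨fun c v hcv => ?_, fun v => ?_, fun c => ?_⟩, fun v hv => ?_⟩
  · have := hg.1.1 c v hcv
    simp only [ab, Pi.neg_apply]
    rcases abs_cases (g (inl v)) with h | h <;> rcases abs_cases (g (inr c)) with h' | h' <;> omega
  · simp only [ab, Pi.neg_apply, even_neg, even_abs]; exact hg.1.2.1 v
  · simp only [ab, Pi.neg_apply, odd_neg, odd_abs]; exact hg.1.2.2 c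
  · have := hγ v hv
    simp only [ab, Pi.neg_apply, hg.2 v hv]
    rw [abs_of_nonpos this, neg_neg]

/-- The number of functions with a given absolute value is the number of sign patterns. -/
theorem GOm.ncard_fiber {F : Set Vtx} {γ : Vtx → ℤ} (hγ : ∀ v ∈ F, γ v ≤ 0) {x : Vtx → ℤ}
    (hx0 : ∀ v, 0 ≤ x v) (hx : -x ∈ GOm F γ) : {g | g ∈ GOm F γ ∧ ab g = x}.ncard = (Sg F x).ncard := by
  classical
  have hodd : ∀ {n : ℤ}, Odd n → n ≠ 0 := by rintro n h rfl; exact absurd h (by decide)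
  -- Face values are odd, hence nonzero, and a site of nonzero even value has the sign of all its
  -- faces. So the signs on faces determine the function, and the constraints in `Sg` are the only
  -- ones.
  refine Set.ncard_congr (fun g _ c => if 0 < g (inr c) then 1 else 0) ?_ ?_ ?_
  · rintro g ⟨hg, rfl⟩
    refine ⟨fun c hc => if_neg ?_, fun v hv => ⟨fun c c' hc hc' => ?_, fun hvF c hc => if_neg ?_⟩⟩
    · have := hγ _ hc; rw [hg.2 _ hc]; omega
    · have h1 := hg.1.1 c v hc
      have h2 := hg.1.1 c' v hc'
      have h3 := hodd (hg.1.2.2 c)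
      have h4 := hodd (hg.1.2.2 c')
      have h5 := hg.1.2.1 v
      simp only [ab, abs_pos] at hv
      have : (0 < g (inr c)) ↔ (0 < g (inr c')) := by omega
      simp only [this]
    · have h1 := hg.1.1 c v hc
      have h2 := hγ _ hvF
      have h3 := hg.2 _ hvF
      simp only [ab, abs_pos] at hv
      omega
  · rintro g g' ⟨hg, hgx⟩ ⟨hg', hgx'⟩ h
    have ha : ∀ v, |g v| = |g' v| := fun v => congrFun (hgx.trans hgx'.symm) v
    have hface : ∀ c, g (inr c) = g' (inr c) := by
      intro c
      have h1 := congrFun h c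
      have h2 := ha (inr c)
      have h3 := hodd (hg.1.2.2 c)
      have h4 := hodd (hg'.1.2.2 c)
      have h5 : (0 < g (inr c)) ↔ (0 < g' (inr c)) := by
        by_cases p : 0 < g (inr c) <;> by_cases q : 0 < g' (inr c) <;> simp [p, q] at h1 ⊢
      rcases abs_eq_abs.1 h2 with h6 | h6 <;> omega
    funext v
    rcases v with v | c
    · have h1 := hg.1.1 v v (by simp [Inc])
      have h2 := hg'.1.1 v v (by simp [Inc])
      have h3 := hface v
      have h4 := hodd (hg.1.2.2 v)
      rcases abs_eq_abs.1 (ha (inl v)) with h6 | h6 <;> omega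
    · exact hface c
  · rintro ε hε
    let g : Vtx → ℤ := fun v => Sum.elim (fun v => if ε v = 0 then - x (inl v) else x (inl v))
      (fun c => if ε c = 0 then - x (inr c) else x (inr c)) v
    have hgx : ∀ v, g v = x v ∨ g v = - x v := by
      rintro (v | c) <;> simp only [g, Sum.elim_inl, Sum.elim_inr] <;> split_ifs <;> simp
    refine ⟨g, ⟨⟨⟨fun c v hcv => ?_, fun v => ?_, fun c => ?_⟩, ?_⟩, ?_⟩, ?_⟩
    · have h1 := hx.1.1 c v hcv
      have h2 := hx0 (inl v)
      simp only [Pi.neg_apply] at h1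
      rcases h2.lt_or_eq with h2 | h2
      · have := (hε.2 v h2).1 c v hcv (by simp [Inc])
        simp only [g, Sum.elim_inl, Sum.elim_inr, this]
        split_ifs <;> omega
      · have := hx0 (inr c)
        simp only [g, Sum.elim_inl, Sum.elim_inr, ← h2]
        split_ifs <;> omega
    · have := hx.1.2.1 v
      simp only [Pi.neg_apply, even_neg] at this
      rcases hgx (inl v) with e | e <;> rw [e]
      exacts [this, this.neg]
    · have := hx.1.2.2 c
      simp only [Pi.neg_apply, odd_neg] at this
      rcases hgx (inr c) with e | e <;> rw [e]
      exacts [this, this.neg]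
    · rintro (v | c) hv
      · have h1 := hx.2 _ hv
        simp only [Pi.neg_apply] at h1
        have h2 := hx0 (inl v)
        rcases h2.lt_or_eq with h2 | h2
        · have := (hε.2 v h2).2 hv v (by simp [Inc])
          simp only [g, Sum.elim_inl, this, if_true, h1]
        · simp only [g, Sum.elim_inl, ← h1, ← h2]; simp
      · have h1 := hx.2 _ hv
        simp only [Pi.neg_apply] at h1
        simp only [g, Sum.elim_inr, hε.1 c hv, if_true, h1]
    · funext v
      simp only [ab]
      rcases hgx v with e | e <;> rw [e]
      · exact abs_of_nonneg (hx0 v)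
      · rw [abs_neg, abs_of_nonneg (hx0 v)]
    · funext c
      have h1 := hx0 (inr c)
      have h2 := hodd (hx.1.2.2 c)
      simp only [Pi.neg_apply] at h2
      simp only [g, Sum.elim_inr]
      by_cases h : ε c = 0
      · simp only [h, if_true]; rw [if_neg (by omega)]
      · simp only [h, if_false]; rw [if_pos (by omega)]
        revert h; generalize ε c = a; revert a; decide

/-- The lattice condition of the four functions theorem for the law of the absolute value: fibres
are counted by sign patterns, and an empty fibre on the left is trivial. -/
theorem GOm.fiber_mul_le {F : Set Vtx} (hF : Fᶜ.Finite) {γ : Vtx → ℤ} (hγ : ∀ v ∈ F, γ v ≤ 0)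
    (x y : Vtx → ℤ) :
    {g | g ∈ GOm F γ ∧ ab g = x}.ncard * {g | g ∈ GOm F γ ∧ ab g = y}.ncard ≤
      {g | g ∈ GOm F γ ∧ ab g = x ⊓ y}.ncard * {g | g ∈ GOm F γ ∧ ab g = x ⊔ y}.ncard := by
  rcases {g | g ∈ GOm F γ ∧ ab g = x}.eq_empty_or_nonempty with h | ⟨g, hg, hgx⟩
  · rw [h]; simp
  rcases {g | g ∈ GOm F γ ∧ ab g = y}.eq_empty_or_nonempty with h | ⟨g', hg', hgy⟩
  · rw [h]; simp
  have n1 := GOm.neg_ab hγ hg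
  have n2 := GOm.neg_ab hγ hg'
  have hx0 : ∀ v, 0 ≤ x v := fun v => by rw [← hgx]; exact abs_nonneg _
  have hy0 : ∀ v, 0 ≤ y v := fun v => by rw [← hgy]; exact abs_nonneg _
  rw [hgx] at n1
  rw [hgy] at n2
  have e1 : -(x ⊓ y) = -x ⊔ -y := neg_inf x y
  have e2 : -(x ⊔ y) = -x ⊓ -y := neg_sup x y
  have n3 : -(x ⊓ y) ∈ GOm F γ := by
    rw [e1]
    refine ⟨GHom.sup n1.1 n2.1, fun v hv => ?_⟩
    rw [Pi.sup_apply, n1.2 v hv, n2.2 v hv, sup_idem]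
  have n4 : -(x ⊔ y) ∈ GOm F γ := by
    rw [e2]
    refine ⟨GHom.inf n1.1 n2.1, fun v hv => ?_⟩
    rw [Pi.inf_apply, n1.2 v hv, n2.2 v hv, inf_idem]
  rw [GOm.ncard_fiber hγ hx0 n1, GOm.ncard_fiber hγ hy0 n2,
    GOm.ncard_fiber (x := x ⊓ y) hγ (fun v => le_inf (hx0 v) (hy0 v)) n3,
    GOm.ncard_fiber (x := x ⊔ y) hγ (fun v => (hx0 v).trans le_sup_left) n4]
  exact Sg.mul_le hF

open scoped FinsetFamily in
/-- If all prescribed values are at most `0`, conditioning on zeros makes the absolute value smaller. -/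
theorem GOm.fold {F : Set Vtx} (hF : Fᶜ.Finite) {γ : Vtx → ℤ} (hγ : ∀ v ∈ F, γ v ≤ 0)
    {B : Set (Vtx → ℤ)} (hB : IsUpperSet B) (A : Set Vtx) :
    {g | g ∈ GOm F γ ∧ ab g ∈ B ∧ ∀ v ∈ A, g v = 0}.ncard * (GOm F γ).ncard ≤
      {g | g ∈ GOm F γ ∧ ab g ∈ B}.ncard * {g | g ∈ GOm F γ ∧ ∀ v ∈ A, g v = 0}.ncard := by
  classical
  have hf := GOm.finite hF γ
  let G := hf.toFinset
  let w : (Vtx → ℤ) → ℕ := fun x => (G.filter fun g => ab g = x).card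
  have hw : ∀ x, w x = {g | g ∈ GOm F γ ∧ ab g = x}.ncard := by
    intro x
    show (G.filter fun g => ab g = x).card = _
    rw [← Set.ncard_coe_finset]
    congr 1; ext g; simp [G]
  have hsum : ∀ s : Finset (Vtx → ℤ), ∑ x ∈ s, w x = (G.filter fun g => ab g ∈ s).card := by
    intro s
    rw [Finset.card_eq_sum_card_fiberwise (f := ab) (t := s) (by intro g hg; simpa using (Finset.mem_filter.1 hg).2)]
    refine Finset.sum_congr rfl fun x hx => ?_
    simp only [w, Finset.filter_filter]
    congr 1; ext g
    simp only [Finset.mem_filter]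
    constructor
    · rintro ⟨h1, rfl⟩; exact ⟨h1, hx, rfl⟩
    · rintro ⟨h1, _, h2⟩; exact ⟨h1, h2⟩
  let X := G.image ab
  let s := X.filter fun x => x ∈ B ∧ ∀ v ∈ A, x v = 0
  have hzero : ∀ g : Vtx → ℤ, (∀ v ∈ A, ab g v = 0) ↔ ∀ v ∈ A, g v = 0 := by
    intro g; simp [ab]
  have hX : ∀ x ∈ X, ∀ v, 0 ≤ x v := by
    intro x hx v
    obtain ⟨g, _, rfl⟩ := Finset.mem_image.1 hx
    exact abs_nonneg _
  -- The theorem is applied to the absolute values in `B` vanishing on `A`, and to all absolute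
  -- values. A supremum of members of the two families is still in `B`, and an infimum still
  -- vanishes on `A`.
  have key := four_functions_theorem (α := Vtx → ℤ) (f₁ := w) (f₂ := w) (f₃ := w) (f₄ := w) (fun _ => Nat.zero_le _) (fun _ => Nat.zero_le _)
    (fun _ => Nat.zero_le _) (fun _ => Nat.zero_le _) (fun x y => by
      rw [hw, hw, hw, hw]; exact GOm.fiber_mul_le hF hγ x y) s X
  rw [hsum, hsum, hsum, hsum] at key
  have c1 : {g | g ∈ GOm F γ ∧ ab g ∈ B ∧ ∀ v ∈ A, g v = 0}.ncard =
      (G.filter fun g => ab g ∈ s).card := by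
    rw [← Set.ncard_coe_finset]
    congr 1; ext g
    simp only [Set.mem_ofPred_eq, Finset.coe_filter, G, Set.Finite.mem_toFinset, s, Finset.mem_filter, hzero]
    constructor
    · rintro ⟨h1, h2, h3⟩
      exact ⟨h1, Finset.mem_image_of_mem _ (hf.mem_toFinset.2 h1), h2, h3⟩
    · rintro ⟨h1, _, h2, h3⟩; exact ⟨h1, h2, h3⟩
  have c2 : (GOm F γ).ncard = (G.filter fun g => ab g ∈ X).card := by
    rw [← Set.ncard_coe_finset]
    congr 1; ext g
    simp only [Finset.coe_filter, Set.mem_ofPred_eq, G, Set.Finite.mem_toFinset]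
    exact ⟨fun h => ⟨h, Finset.mem_image_of_mem _ (hf.mem_toFinset.2 h)⟩, fun h => h.1⟩
  rw [c1, c2, mul_comm]
  rw [mul_comm] at key
  refine key.trans ?_
  rw [mul_comm]
  refine Nat.mul_le_mul ?_ ?_
  · rw [← Set.ncard_coe_finset]
    refine Set.ncard_le_ncard ?_ (hf.subset fun g h => h.1)
    intro g hg
    simp only [Finset.coe_filter, Set.mem_ofPred_eq, G, Set.Finite.mem_toFinset] at hg
    obtain ⟨x, hx, y, hy, he⟩ := Finset.mem_sups.1 hg.2
    refine ⟨hg.1, ?_⟩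
    rw [← he]
    exact hB le_sup_left (Finset.mem_filter.1 hx).2.1
  · rw [← Set.ncard_coe_finset]
    refine Set.ncard_le_ncard ?_ (hf.subset fun g h => h.1)
    intro g hg
    simp only [Finset.coe_filter, Set.mem_ofPred_eq, G, Set.Finite.mem_toFinset] at hg
    obtain ⟨x, hx, y, hy, he⟩ := Finset.mem_infs.1 hg.2
    refine ⟨hg.1, ?_⟩
    rw [← hzero, ← he]
    intro v hv
    rw [Pi.inf_apply, (Finset.mem_filter.1 hx).2.2 v hv]
    exact inf_eq_left.2 (hX y hy v)

/-- Conditioning on `k = 1` on some sites makes the absolute value of `k - 1` smaller. -/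
theorem Om.fold_one {F : Set Vtx} (hF : Fᶜ.Finite) {ξ : Vtx → ℤ} (hξ : ∀ v ∈ F, ξ v ≤ 1)
    {B : Set (Vtx → ℤ)} (hB : IsUpperSet B) (A : Set Vtx) :
    {k | k ∈ Om F ξ ∧ ab (k - 1) ∈ B ∧ ∀ v ∈ A, k v = 1}.ncard * (Om F ξ).ncard ≤
      {k | k ∈ Om F ξ ∧ ab (k - 1) ∈ B}.ncard * {k | k ∈ Om F ξ ∧ ∀ v ∈ A, k v = 1}.ncard := by
  have tr : ∀ Q : (Vtx → ℤ) → Prop, {k | k ∈ Om F ξ ∧ Q (k - 1)}.ncard =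
      {g | g ∈ GOm F (ξ - 1) ∧ Q g}.ncard := by
    intro Q
    have hmem : ∀ k, k ∈ Om F ξ ↔ k - 1 ∈ GOm F (ξ - 1) := by
      intro k
      simp only [Om, GOm, Hom, GHom, Lip, Set.mem_ofPred_eq, Pi.sub_apply, Pi.one_apply]
      refine and_congr (and_congr ?_ (and_congr ?_ ?_)) ?_
      · exact forall_congr' fun c => forall_congr' fun v => imp_congr_right fun _ => by omega
      · exact forall_congr' fun v => by rw [Int.even_sub_one, Int.not_even_iff_odd]
      · exact forall_congr' fun v => by
          rw [← Int.not_even_iff_odd, Int.even_sub_one, not_not]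
      · exact forall_congr' fun v => imp_congr_right fun _ => by omega
    rw [← Set.ncard_image_of_injective _ (sub_left_injective (b := (1 : Vtx → ℤ)))]
    congr 1; ext g
    simp only [Set.mem_image, Set.mem_ofPred_eq, hmem]
    constructor
    · rintro ⟨k, h, rfl⟩; exact h
    · rintro h; exact ⟨g + 1, by simpa using h, by simp⟩
  have e : ∀ k : Vtx → ℤ, (∀ v ∈ A, k v = 1) ↔ ∀ v ∈ A, (k - 1) v = 0 := fun k =>
    forall_congr' fun v => imp_congr_right fun _ => by simp only [Pi.sub_apply, Pi.one_apply]; omega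
  have e0 : (Om F ξ).ncard = (GOm F (ξ - 1)).ncard := by simpa using tr (fun _ => True)
  simp only [e]
  rw [tr (fun g => ab g ∈ B ∧ ∀ v ∈ A, g v = 0), tr (fun g => ab g ∈ B),
    tr (fun g => ∀ v ∈ A, g v = 0), e0]
  exact GOm.fold hF (fun v hv => by have := hξ v hv; simp only [Pi.sub_apply, Pi.one_apply]; omega) hB A

/-- Negation of heights. -/
theorem Om.neg_mem {F : Set Vtx} {ξ k : Vtx → ℤ} : -k ∈ Om F (-ξ) ↔ k ∈ Om F ξ := by
  simp only [Om, Hom, Lip, Set.mem_ofPred_eq, Pi.neg_apply, odd_neg, even_neg, neg_inj]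
  refine and_congr_left fun _ => and_congr_left fun _ => ?_
  exact forall_congr' fun c => forall_congr' fun v => imp_congr_right fun _ => by omega

/-- Conditioning on `k = -1` on some sites makes the absolute value of `k + 1` smaller. -/
theorem Om.fold_neg_one {F : Set Vtx} (hF : Fᶜ.Finite) {ξ : Vtx → ℤ} (hξ : ∀ v ∈ F, -1 ≤ ξ v)
    {B : Set (Vtx → ℤ)} (hB : IsUpperSet B) (A : Set Vtx) :
    {k | k ∈ Om F ξ ∧ ab (k + 1) ∈ B ∧ ∀ v ∈ A, k v = -1}.ncard * (Om F ξ).ncard ≤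
      {k | k ∈ Om F ξ ∧ ab (k + 1) ∈ B}.ncard * {k | k ∈ Om F ξ ∧ ∀ v ∈ A, k v = -1}.ncard := by
  have tr : ∀ Q : (Vtx → ℤ) → Prop, {k | k ∈ Om F ξ ∧ Q k}.ncard = {k | k ∈ Om F (-ξ) ∧ Q (-k)}.ncard := by
    intro Q
    rw [← Set.ncard_image_of_injective _ (neg_injective (G := Vtx → ℤ))]
    congr 1; ext g
    simp only [Set.mem_image, Set.mem_ofPred_eq]
    constructor
    · rintro ⟨k, h, rfl⟩; rw [neg_neg]; exact ⟨Om.neg_mem.2 h.1, h.2⟩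
    · rintro h; exact ⟨-g, ⟨by rw [← Om.neg_mem, neg_neg]; exact h.1, h.2⟩, neg_neg _⟩
  have e : ∀ k : Vtx → ℤ, (∀ v ∈ A, (-k) v = -1) ↔ ∀ v ∈ A, k v = 1 := fun k =>
    forall_congr' fun v => imp_congr_right fun _ => by simp only [Pi.neg_apply]; omega
  have e' : ∀ k : Vtx → ℤ, ab (-k + 1) = ab (k - 1) := fun k => by
    funext v; simp only [ab, Pi.add_apply, Pi.neg_apply, Pi.sub_apply, Pi.one_apply]
    rw [← abs_neg]; congr 1; ring
  have e0 : (Om F ξ).ncard = (Om F (-ξ)).ncard := by simpa using tr (fun _ => True)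
  rw [tr (fun k => ab (k + 1) ∈ B ∧ ∀ v ∈ A, k v = -1), tr (fun k => ab (k + 1) ∈ B),
    tr (fun k => ∀ v ∈ A, k v = -1), e0]
  simp only [e, e']
  exact Om.fold_one hF (fun v hv => by have := hξ v hv; simp only [Pi.neg_apply]; omega) hB A

end SquareIce

namespace SquareIce
open Sum

/-! ### Probabilities -/

/-- The proportion of the functions of `Om F ξ` lying in `U`. -/
noncomputable def pr (F : Set Vtx) (ξ : Vtx → ℤ) (U : Set (Vtx → ℤ)) : ℝ :=
  ((Om F ξ ∩ U).ncard : ℝ) / (Om F ξ).ncard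

theorem pr_mono {F : Set Vtx} (hF : Fᶜ.Finite) {ξ : Vtx → ℤ} {U U' : Set (Vtx → ℤ)}
    (h : ∀ k ∈ Om F ξ, k ∈ U → k ∈ U') : pr F ξ U ≤ pr F ξ U' := by
  refine div_le_div_of_nonneg_right ?_ (Nat.cast_nonneg _)
  have hsub : Om F ξ ∩ U ⊆ Om F ξ ∩ U' := fun k hk => ⟨hk.1, h k hk.1 hk.2⟩
  exact_mod_cast Set.ncard_le_ncard hsub ((Om.finite hF ξ).inter_of_left _)

theorem pr_congr {F : Set Vtx} {ξ : Vtx → ℤ} {U U' : Set (Vtx → ℤ)}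
    (h : ∀ k ∈ Om F ξ, k ∈ U ↔ k ∈ U') : pr F ξ U = pr F ξ U' := by
  have : Om F ξ ∩ U = Om F ξ ∩ U' := by
    ext k; exact and_congr_right (h k)
  rw [pr, pr, this]

theorem Om.ncard_pos {F : Set Vtx} (hF : Fᶜ.Finite) {ξ : Vtx → ℤ} (h : (Om F ξ).Nonempty) :
    (0 : ℝ) < (Om F ξ).ncard := by
  exact_mod_cast (Set.ncard_pos (Om.finite hF ξ)).2 h

theorem Om.self_mem {F : Set Vtx} {ξ : Vtx → ℤ} (h : ξ ∈ Hom) : (Om F ξ).Nonempty :=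
  ⟨ξ, h, fun _ _ => rfl⟩

theorem pr_compl {F : Set Vtx} (hF : Fᶜ.Finite) {ξ : Vtx → ℤ} (h : (Om F ξ).Nonempty)
    (U : Set (Vtx → ℤ)) : pr F ξ U + pr F ξ Uᶜ = 1 := by
  have hf := Om.finite hF ξ
  have h0 := Om.ncard_pos hF h
  rw [pr, pr, ← add_div, div_eq_one_iff_eq h0.ne']
  have := Set.ncard_inter_add_ncard_sdiff_eq_ncard (Om F ξ) U hf
  rw [Set.sdiff_eq] at this
  exact_mod_cast this

theorem pr_holley {F : Set Vtx} (hF : Fᶜ.Finite) {ξ ξ' : Vtx → ℤ} (hξ : ∀ v ∈ F, ξ v ≤ ξ' v)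
    (hne : (Om F ξ').Nonempty) {U : Set (Vtx → ℤ)} (hU : IsUpperSet U) : pr F ξ U ≤ pr F ξ' U := by
  rcases (Om F ξ).eq_empty_or_nonempty with h | h
  · rw [pr, h]; simp only [Set.empty_inter, Set.ncard_empty, Nat.cast_zero, zero_div]
    exact div_nonneg (Nat.cast_nonneg _) (Nat.cast_nonneg _)
  · rw [pr, pr, div_le_div_iff₀ (Om.ncard_pos hF h) (Om.ncard_pos hF hne)]
    have := Om.holley hF hξ hU
    rw [mul_comm (Om F ξ).ncard] at this
    exact_mod_cast this

theorem Om.eq_cond {F A : Set Vtx} {ξ ξ' : Vtx → ℤ} (h : ∀ v ∈ F, ξ' v = ξ v) (P : (Vtx → ℤ) → Prop) :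
    {k | k ∈ Om F ξ ∧ P k ∧ ∀ v ∈ A, k v = ξ' v} = Om (F ∪ A) ξ' ∩ {k | P k} := by
  ext k
  simp only [Om, Set.mem_ofPred_eq, Set.mem_inter_iff, Set.mem_union]
  constructor
  · rintro ⟨⟨h1, h2⟩, h3, h4⟩
    exact ⟨⟨h1, fun v hv => hv.elim (fun hv => by rw [h2 v hv, h v hv]) (h4 v)⟩, h3⟩
  · rintro ⟨⟨h1, h2⟩, h3⟩
    exact ⟨⟨h1, fun v hv => by rw [h2 v (.inl hv), h v hv]⟩, h3, fun v hv => h2 v (.inr hv)⟩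

theorem Om.eq_cond' {F A : Set Vtx} {ξ ξ' : Vtx → ℤ} (h : ∀ v ∈ F, ξ' v = ξ v) :
    {k | k ∈ Om F ξ ∧ ∀ v ∈ A, k v = ξ' v} = Om (F ∪ A) ξ' := by
  have := Om.eq_cond (A := A) h (fun _ => True)
  simpa using this

theorem fold_pr {a b c d : ℕ} (h : a * b ≤ c * d) (hb : 0 < (b : ℝ)) (hd : 0 < (d : ℝ)) :
    (a : ℝ) / d ≤ c / b := by
  rw [div_le_div_iff₀ hd hb]; exact_mod_cast h

/-- `Om.fold_one` in terms of boundary values: `ξ'` turns the conditioning on `k = 1` on `A` into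
values prescribed on `F ∪ A`. -/
theorem pr_fold_one {F A : Set Vtx} (hF : Fᶜ.Finite) {ξ ξ' : Vtx → ℤ} (hξ : ∀ v ∈ F, ξ v ≤ 1)
    (hξ' : ξ' ∈ Hom) (h1 : ∀ v ∈ F, ξ' v = ξ v) (h2 : ∀ v ∈ A, ξ' v = 1) {B : Set (Vtx → ℤ)}
    (hB : IsUpperSet B) : pr (F ∪ A) ξ' {k | ab (k - 1) ∈ B} ≤ pr F ξ {k | ab (k - 1) ∈ B} := by
  have hF' : (F ∪ A)ᶜ.Finite := hF.subset (Set.compl_subset_compl.2 Set.subset_union_left)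
  have key := Om.fold_one hF hξ hB A
  have e : ∀ k : Vtx → ℤ, (∀ v ∈ A, k v = 1) ↔ ∀ v ∈ A, k v = ξ' v := fun k =>
    forall_congr' fun v => ⟨fun h hv => by rw [h hv, h2 v hv], fun h hv => by rw [h hv, h2 v hv]⟩
  simp only [e] at key
  rw [Om.eq_cond h1 (fun k => ab (k - 1) ∈ B), Om.eq_cond' h1] at key
  exact fold_pr key (Om.ncard_pos hF ⟨ξ', hξ', h1⟩) (Om.ncard_pos hF' (Om.self_mem hξ'))

theorem pr_fold_neg_one {F A : Set Vtx} (hF : Fᶜ.Finite) {ξ ξ' : Vtx → ℤ} (hξ : ∀ v ∈ F, -1 ≤ ξ v)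
    (hξ' : ξ' ∈ Hom) (h1 : ∀ v ∈ F, ξ' v = ξ v) (h2 : ∀ v ∈ A, ξ' v = -1) {B : Set (Vtx → ℤ)}
    (hB : IsUpperSet B) : pr (F ∪ A) ξ' {k | ab (k + 1) ∈ B} ≤ pr F ξ {k | ab (k + 1) ∈ B} := by
  have hF' : (F ∪ A)ᶜ.Finite := hF.subset (Set.compl_subset_compl.2 Set.subset_union_left)
  have key := Om.fold_neg_one hF hξ hB A
  have e : ∀ k : Vtx → ℤ, (∀ v ∈ A, k v = -1) ↔ ∀ v ∈ A, k v = ξ' v := fun k =>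
    forall_congr' fun v => ⟨fun h hv => by rw [h hv, h2 v hv], fun h hv => by rw [h hv, h2 v hv]⟩
  simp only [e] at key
  rw [Om.eq_cond h1 (fun k => ab (k + 1) ∈ B), Om.eq_cond' h1] at key
  exact fold_pr key (Om.ncard_pos hF ⟨ξ', hξ', h1⟩) (Om.ncard_pos hF' (Om.self_mem hξ'))

/-- An event of the inside depends only on the values prescribed there and on the interface. -/
theorem pr_glue {F I B : Set Vtx} (hF : Fᶜ.Finite) {ξ ξ' : Vtx → ℤ}
    (hI1 : ∀ v c, Inc c v → (inl v : Vtx) ∈ I → (inr c : Vtx) ∈ I ∪ B)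
    (hI2 : ∀ v c, Inc c v → (inr c : Vtx) ∈ I → (inl v : Vtx) ∈ I ∪ B) (hBF : B ⊆ F)
    (hξI : ∀ v ∈ F, v ∈ I ∪ B → ξ' v = ξ v) (hξ : ξ ∈ Hom) (hξ' : ξ' ∈ Hom) {U : Set (Vtx → ℤ)}
    (hU : ∀ k ∈ U, ∀ k', (∀ v ∈ I ∪ B, k' v = k v) → k' ∈ U) :
    pr F ξ U = pr (F ∪ Iᶜ) ξ' U := by
  have hF' : (F ∪ Iᶜ)ᶜ.Finite := hF.subset (Set.compl_subset_compl.2 Set.subset_union_left)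
  -- The gluing is used with the complement of `I ∪ B` as inside: the values there are replaced,
  -- while `U` only looks at `I ∪ B`.
  have key := Om.glue (I := (I ∪ B)ᶜ) (B := B) hF (ξ := ξ) (ξ' := ξ') (𝒜 := Set.univ) (W := U)
    (fun v c hcv hv => ?_) (fun v c hcv hc => ?_) (fun v hv => ?_) (fun k hk _ v hv => ?_)
    (fun _ _ _ _ => trivial) (fun k hk k' h => ?_)
  · have e : F ∪ ((I ∪ B)ᶜ ∪ B) = F ∪ Iᶜ := by
      ext v; have := @hBF v
      simp only [Set.mem_union, Set.mem_compl_iff]; tauto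
    rw [e, Set.inter_univ] at key
    rw [pr, pr, div_eq_div_iff (Om.ncard_pos hF (Om.self_mem hξ)).ne' (Om.ncard_pos hF' (Om.self_mem hξ')).ne']
    rw [mul_comm (Om F ξ).ncard] at key
    exact_mod_cast key
  · by_contra hc
    have h1 : (inr c : Vtx) ∈ I ∪ B := by_contra fun h => hc (.inl h)
    rcases h1 with h | h
    · exact hv (hI2 v c hcv h)
    · exact hc (.inr h)
  · by_contra hv
    have h1 : (inl v : Vtx) ∈ I ∪ B := by_contra fun h => hv (.inl h)
    rcases h1 with h | h
    · exact hc (hI1 v c hcv h)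
    · exact hv (.inr h)
  · refine hξI v hv.1 ?_
    by_contra h
    exact hv.2 (.inl h)
  · rw [hk.2 v (hBF hv), hξI v (hBF hv) (.inr hv)]
  · exact hU k hk k' fun v hv => h v (fun h' => h' hv)

/-! ### White crossings of cells -/

def white (k : Vtx → ℤ) : Set (ℤ × ℤ) := {v | 1 ≤ k (inl v)}

theorem white_mono {k k' : Vtx → ℤ} (h : k ≤ k') : white k ⊆ white k' := fun v hv =>
  le_trans (show 1 ≤ k (inl v) from hv) (h (inl v))

open Classical in
/-- Height `1` on `P`, `-1` at the other sites, `0` on faces. -/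
noncomputable def flat (P : Set (ℤ × ℤ)) : Vtx → ℤ :=
  Sum.elim (fun v => if v ∈ P then 1 else -1) fun _ => 0

theorem flat_of_mem {P : Set (ℤ × ℤ)} {v : ℤ × ℤ} (h : v ∈ P) : flat P (inl v) = 1 := if_pos h
theorem flat_of_notMem {P : Set (ℤ × ℤ)} {v : ℤ × ℤ} (h : v ∉ P) : flat P (inl v) = -1 := if_neg h
theorem flat_inr {P : Set (ℤ × ℤ)} {c : ℤ × ℤ} : flat P (inr c) = 0 := rfl

theorem flat_cases (P : Set (ℤ × ℤ)) (v : ℤ × ℤ) : flat P (inl v) = 1 ∨ flat P (inl v) = -1 := by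
  by_cases h : v ∈ P
  · exact .inl (flat_of_mem h)
  · exact .inr (flat_of_notMem h)

theorem flat_hom (P : Set (ℤ × ℤ)) : flat P ∈ Hom := by
  refine ⟨fun c v _ => ?_, fun v => ?_, fun c => ?_⟩
  · rw [flat_inr]; rcases flat_cases P v with h | h <;> rw [h] <;> omega
  · rcases flat_cases P v with h | h <;> rw [h] <;> decide
  · rw [flat_inr]; exact Even.zero

theorem flat_mono {P P' : Set (ℤ × ℤ)} (h : P ⊆ P') (v : Vtx) : flat P v ≤ flat P' v := by
  rcases v with v | c
  · by_cases hv : v ∈ P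
    · rw [flat_of_mem hv, flat_of_mem (h hv)]
    · rw [flat_of_notMem hv]; rcases flat_cases P' v with h | h <;> omega
  · rfl

theorem Inc.of_adj8 {u v : ℤ × ℤ} (h : adj8 u v) : ∃ c, Inc c u ∧ Inc c v :=
  ⟨(min u.1 v.1, min u.2 v.2), by simp only [adj8, Inc] at *; omega⟩

theorem Inc.adj8 {c u v : ℤ × ℤ} (h : Inc c u) (h' : Inc c v) : adj8 u v := by
  simp only [SquareIce.adj8, Inc] at *; omega

theorem Inc.self (c : ℤ × ℤ) : Inc c c := by simp only [Inc]; omega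

theorem Inc.unique {c c' : ℤ × ℤ} (h : ∀ v, Inc c v ↔ Inc c' v) : c = c' := by
  have h1 := (h c).1 (Inc.self c)
  have h2 := (h c').2 (Inc.self c')
  simp only [Inc] at h1 h2
  ext <;> omega

theorem Hom.near {k : Vtx → ℤ} (hk : k ∈ Hom) {u v : ℤ × ℤ} (h : adj8 u v) :
    k (inl u) ≤ k (inl v) + 2 ∧ k (inl v) ≤ k (inl u) + 2 := by
  obtain ⟨c, h1, h2⟩ := Inc.of_adj8 h
  have := hk.1 c u h1
  have := hk.1 c v h2
  omega

theorem Hom.odd_lt {k : Vtx → ℤ} (hk : k ∈ Hom) (v : ℤ × ℤ) : ¬ k (inl v) = 0 ∧ ¬ k (inl v) = 2 ∧ ¬ k (inl v) = -2 := by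
  obtain ⟨m, hm⟩ := hk.2.1 v
  omega

/-- The crossing sides without the dual sides. -/
def SymQuad.side (q : SymQuad) : Set (ℤ × ℤ) := (q.A1 ∪ q.A2) \ (q.Z1 ∪ q.Z2)

/-- The vertices prescribed by the boundary condition `1` on the crossing sides and `-1` on their images. -/
def SymQuad.frame (q : SymQuad) : Set Vtx :=
  {x | Sum.elim (fun v => v ∉ q.dom ∨ v ∈ q.side ∨ q.σ.f v ∈ q.side) (fun c => ∃ u, Inc c u ∧ u ∉ q.dom) x}

theorem SymQuad.frame_inl (q : SymQuad) (v : ℤ × ℤ) :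
    (inl v : Vtx) ∈ q.frame ↔ v ∉ q.dom ∨ v ∈ q.side ∨ q.σ.f v ∈ q.side := Iff.rfl
theorem SymQuad.frame_finite (q : SymQuad) : q.frameᶜ.Finite := by
  refine ((q.finite.image inl).union (q.finite.image inr)).subset ?_
  rintro (v | c) h
  · refine .inl ⟨v, ?_, rfl⟩
    by_contra hv; exact h (.inl hv)
  · refine .inr ⟨c, ?_, rfl⟩
    by_contra hc; exact h ⟨c, Inc.self c, hc⟩

theorem SymQuad.σ_side (q : SymQuad) {v : ℤ × ℤ} (h : v ∈ q.side) : q.σ.f v ∈ q.Z1 ∪ q.Z2 := by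
  rcases h with ⟨h | h, h'⟩
  · exact .inl (q.A1_σ v ⟨h, h'⟩)
  · exact .inr (q.A2_σ v ⟨h, h'⟩)

/-- Under the antisymmetric boundary condition, a crossing by large values has probability at most `1/2`. -/
theorem SymQuad.pr_frame (q : SymQuad) :
    pr q.frame (flat q.side) {k | ∃ a ∈ q.A1 \ (q.Z1 ∪ q.Z2), ∃ b ∈ q.A2 \ (q.Z1 ∪ q.Z2),
      Conn adj4 {v | v ∈ q.dom ∧ 2 ≤ ab (k + 1) (inl v)} a b} ≤ 1 / 2 := by
  classical
  set W : Set (Vtx → ℤ) := {k | ∃ a ∈ q.A1 \ (q.Z1 ∪ q.Z2), ∃ b ∈ q.A2 \ (q.Z1 ∪ q.Z2),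
      Conn adj4 {v | v ∈ q.dom ∧ 2 ≤ ab (k + 1) (inl v)} a b} with hW
  have hF := q.frame_finite
  have hf := Om.finite hF (flat q.side)
  have hdom : ∀ v, q.σ.f v ∈ q.dom ↔ v ∈ q.dom := fun v =>
    ⟨fun h => by have := q.dom_σ _ h; rwa [q.invol] at this, q.dom_σ v⟩
  have hint : ∀ c, (∃ u, Inc (q.σ.g c) u ∧ u ∉ q.dom) ↔ ∃ u, Inc c u ∧ u ∉ q.dom := by
    intro c
    constructor
    · rintro ⟨u, h, hu⟩
      refine ⟨q.σ.f u, ?_, by rwa [hdom]⟩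
      rw [← q.σ.inc, q.invol]; exact h
    · rintro ⟨u, h, hu⟩
      exact ⟨q.σ.f u, (q.σ.inc _ _).2 h, by rwa [hdom]⟩
  -- `k ↦ -k ∘ σ` inside the quad. The prescribed values `1` on `q.side` and `-1` on its image are
  -- exchanged by `σ` and by the sign, so they are preserved.
  let φ : (Vtx → ℤ) → Vtx → ℤ := fun k => Sum.elim
    (fun v => if v ∈ q.dom then -k (inl (q.σ.f v)) else -1)
    (fun c => if ∃ u, Inc c u ∧ u ∉ q.dom then 0 else -k (inr (q.σ.g c)))
  have φl : ∀ k v, v ∈ q.dom → φ k (inl v) = -k (inl (q.σ.f v)) := fun k v h => if_pos h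
  have φl' : ∀ k v, v ∉ q.dom → φ k (inl v) = -1 := fun k v h => if_neg h
  have φr : ∀ k c, (∃ u, Inc c u ∧ u ∉ q.dom) → φ k (inr c) = 0 := fun k v h => if_pos h
  have φr' : ∀ k c, (¬ ∃ u, Inc c u ∧ u ∉ q.dom) → φ k (inr c) = -k (inr (q.σ.g c)) :=
    fun k v h => if_neg h
  have hφ : ∀ k ∈ Om q.frame (flat q.side), φ k ∈ Om q.frame (flat q.side) := by
    rintro k ⟨hk, hkF⟩
    refine ⟨⟨fun c v hcv => ?_, fun v => ?_, fun c => ?_⟩, ?_⟩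
    · by_cases hc : ∃ u, Inc c u ∧ u ∉ q.dom
      · rw [φr k c hc]
        by_cases hv : v ∈ q.dom
        · rw [φl k v hv]
          have h0 := hkF (inr (q.σ.g c)) ((hint c).2 hc)
          rw [flat_inr] at h0
          have := hk.1 (q.σ.g c) (q.σ.f v) ((q.σ.inc _ _).2 hcv)
          omega
        · rw [φl' k v hv]; omega
      · have hv : v ∈ q.dom := by by_contra hv; exact hc ⟨v, hcv, hv⟩
        rw [φl k v hv, φr' k c hc]
        have := hk.1 (q.σ.g c) (q.σ.f v) ((q.σ.inc _ _).2 hcv)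
        omega
    · by_cases hv : v ∈ q.dom
      · rw [φl k v hv, odd_neg]; exact hk.2.1 _
      · rw [φl' k v hv]; decide
    · by_cases hc : ∃ u, Inc c u ∧ u ∉ q.dom
      · rw [φr k c hc]; exact Even.zero
      · rw [φr' k c hc, even_neg]; exact hk.2.2 _
    · rintro (v | c) hv
      · by_cases hd : v ∈ q.dom
        · rw [φl k v hd]
          rcases (q.frame_inl v).1 hv with h | h | h
          · exact absurd hd h
          · rw [hkF (inl (q.σ.f v)) (.inr (.inr (by rwa [q.invol]))), flat_of_mem h, flat_of_notMem, neg_neg]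
            exact fun h' => h'.2 (q.σ_side h)
          · rw [hkF (inl (q.σ.f v)) (.inr (.inl h)), flat_of_mem h, flat_of_notMem]
            intro h'
            have := q.σ_side h
            rw [q.invol] at this
            exact h'.2 this
        · rw [φl' k v hd, flat_of_notMem fun h => hd (q.A_sub h.1)]
      · rw [φr k c hv, flat_inr]
  have hinj : Set.InjOn φ (Om q.frame (flat q.side)) := by
    rintro k hk k' hk' h
    funext x
    rcases x with v | c
    · by_cases hv : v ∈ q.dom
      · have := congrFun h (inl (q.σ.f v))
        rw [φl _ _ ((hdom v).2 hv), φl _ _ ((hdom v).2 hv), q.invol] at this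
        omega
      · rw [hk.2 (inl v) (.inl hv), hk'.2 (inl v) (.inl hv)]
    · by_cases hc : ∃ u, Inc c u ∧ u ∉ q.dom
      · rw [hk.2 (inr c) hc, hk'.2 (inr c) hc]
      · have hg : q.σ.g (q.σ.g c) = c := Inc.unique fun v => by
          rw [← q.invol v, q.σ.inc, q.σ.inc, q.invol]
        have := congrFun h (inr (q.σ.g c))
        rw [φr' _ _ (by rwa [hint]), φr' _ _ (by rwa [hint]), hg] at this
        omega
  -- large values along a crossing are positive
  have hpos : ∀ k ∈ Om q.frame (flat q.side), ∀ a ∈ q.A1 \ (q.Z1 ∪ q.Z2), ∀ b,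
      Conn adj4 {v | v ∈ q.dom ∧ 2 ≤ ab (k + 1) (inl v)} a b → Conn adj4 (white k ∩ q.dom) a b := by
    intro k hk a ha b hc
    have ha' : a ∈ white k := by
      have := hk.2 (inl a) (.inr (.inl ⟨.inl ha.1, ha.2⟩))
      have hs : a ∈ q.side := ⟨.inl ha.1, ha.2⟩
      rw [flat_of_mem hs] at this
      exact this.ge
    refine hc.rec' (p := fun b => Conn adj4 (white k ∩ q.dom) a b) (.refl ⟨ha', hc.left.1⟩) ?_
    rintro u v _ huv ⟨hv1, hv2⟩ ih
    refine ih.tail huv ⟨?_, hv1⟩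
    have h1 := Hom.near hk.1 (adj4_adj8 _ _ huv)
    have h2 : 1 ≤ k (inl u) := ih.right.1
    have h3 := Hom.odd_lt hk.1 v
    simp only [ab, Pi.add_apply, Pi.one_apply] at hv2
    rcases abs_cases (k (inl v) + 1) with h | h <;> simp only [white, Set.mem_ofPred_eq] <;> omega
  -- If `φ k` has a crossing and so does `k`, then the image by `σ` of the white crossing of `k` is
  -- a dual crossing off the white sites of `φ k`, contrary to `no_cross`. So the event and its
  -- image are disjoint and the event has at most half of the elements.
  have hdisj : Disjoint (Om q.frame (flat q.side) ∩ W) (φ '' (Om q.frame (flat q.side) ∩ W)) := by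
    rw [Set.disjoint_left]
    rintro _ ⟨hk1, hk2⟩ ⟨k, ⟨hk3, hk4⟩, rfl⟩
    obtain ⟨a, ha, b, hb, hc⟩ := hk2
    obtain ⟨a', ha', b', hb', hc'⟩ := hk4
    refine q.no_cross (white (φ k)) a b (q.σ.f a') (q.σ.f b') ha.1 hb.1 (hpos _ hk1 a ha b hc)
      (q.A1_σ a' ha') (q.A2_σ b' hb') (((hpos _ hk3 a' ha' b' hc').to8.lat8 q.σ).mono ?_)
    intro v hv
    have hs : q.σ.f.symm v = q.σ.f v := by rw [Equiv.symm_apply_eq, q.invol]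
    rw [Set.mem_preimage, hs] at hv
    have hv' := (hdom v).1 hv.2
    refine ⟨hv', fun h => ?_⟩
    have h1 : 1 ≤ k (inl (q.σ.f v)) := hv.1
    have h2 : 1 ≤ φ k (inl v) := h
    rw [φl k v hv'] at h2
    omega
  have hfin := hf.inter_of_left W
  have hcard : 2 * (Om q.frame (flat q.side) ∩ W).ncard ≤ (Om q.frame (flat q.side)).ncard := by
    rw [two_mul]
    nth_rw 2 [← (hinj.mono Set.inter_subset_left).ncard_image]
    rw [← Set.ncard_union_eq hdisj hfin (hfin.image _)]
    refine Set.ncard_le_ncard ?_ hf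
    rintro k (h | ⟨k, h, rfl⟩)
    · exact h.1
    · exact hφ k h.1
  rw [pr, div_le_div_iff₀ (Om.ncard_pos hF (Om.self_mem (flat_hom _))) two_pos]
  have : ((2 * (Om q.frame (flat q.side) ∩ W).ncard : ℕ) : ℝ) ≤ (Om q.frame (flat q.side)).ncard := by
    exact_mod_cast hcard
  push_cast at this
  linarith

theorem isUpperSet_crossed (q : Quad) (T : Set (ℤ × ℤ)) : IsUpperSet {k | q.Crossed (T ∩ white k)} :=
  fun _ _ h hk => Quad.Crossed.mono hk (Set.inter_subset_inter_right _ (white_mono h))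

/-- A cell of a symmetric quad surrounded by prescribed heights `-1` is crossed with probability at
most `1/2`. -/
theorem SymQuad.pr_cell (q : SymQuad) {F : Set Vtx} (hF : Fᶜ.Finite) {ξ : Vtx → ℤ} (hξ : ξ ∈ Hom)
    (hξF : ∀ v ∈ F, ξ v ≤ 1) {T : Set (ℤ × ℤ)} (hT : T ⊆ q.dom) (hTZ : Disjoint T (q.Z1 ∪ q.Z2))
    (hTF : ∀ v ∈ T, (inl v : Vtx) ∈ F → ξ (inl v) ≤ -1) (hTc : ∀ v ∈ T, ∀ c, Inc c v → (inr c : Vtx) ∉ F)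
    (hring : ∀ v ∈ q.dom \ T, ∀ u ∈ T, adj8 u v → (inl v : Vtx) ∈ F ∧ ξ (inl v) = -1) :
    pr F ξ {k | q.Crossed (T ∩ white k)} ≤ 1 / 2 := by
  set U : Set (Vtx → ℤ) := {k | q.Crossed (T ∩ white k)} with hU
  have hUup : IsUpperSet U := isUpperSet_crossed _ _
  have hTZ' : ∀ v ∈ T, v ∉ q.Z1 ∪ q.Z2 := fun v hv h => hTZ.le_bot ⟨hv, h⟩
  -- Raising the prescribed values can only help white crossings, and afterwards they are `1` or
  -- `-1` on sites and `0` on faces.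
  let ξ1 := ξ ⊔ flat ∅
  have hξ1 : ξ1 ∈ Hom := Hom.sup hξ (flat_hom _)
  have ξL : ∀ v, ξ1 (inl v) = max (ξ (inl v)) (-1) := fun v => by
    show max _ _ = _; rw [flat_of_notMem (Set.notMem_empty v)]
  have ξR : ∀ c, (inr c : Vtx) ∈ F → ξ1 (inr c) = 0 := fun c hc => by
    show max _ _ = _; rw [flat_inr]
    have := hξF _ hc
    obtain ⟨m, hm⟩ := hξ.2.2 c
    omega
  have ξFix : ∀ v, (inl v : Vtx) ∈ F → ξ1 (inl v) = 1 ∨ ξ1 (inl v) = -1 := fun v hv => by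
    have := hξF _ hv
    obtain ⟨m, hm⟩ := hξ.2.1 v
    rw [ξL]; omega
  have ξLe : ∀ v ∈ F, ξ1 v ≤ 1 := by
    rintro (v | c) hv
    · rcases ξFix v hv with h | h <;> omega
    · rw [ξR c hv]; omega
  refine (pr_holley hF (ξ' := ξ1) (fun v _ => le_sup_left) (Om.self_mem hξ1) hUup).trans ?_
  -- the sites of the crossing sides are capped at one
  let A : Set Vtx := {x | ∃ v, x = inl v ∧ v ∈ T ∧ v ∈ q.side ∧ (inl v : Vtx) ∉ F}
  let P2 : Set (ℤ × ℤ) := {v | (inl v : Vtx) ∈ A ∨ (inl v : Vtx) ∈ F ∧ ξ1 (inl v) = 1}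
  have hFA : (F ∪ A)ᶜ.Finite := hF.subset (Set.compl_subset_compl.2 Set.subset_union_left)
  have hAl : ∀ v, (inl v : Vtx) ∈ A ↔ v ∈ T ∧ v ∈ q.side ∧ (inl v : Vtx) ∉ F := by
    intro v
    constructor
    · rintro ⟨w, h, h'⟩; rw [inl_injective h]; exact h'
    · rintro h; exact ⟨v, rfl, h⟩
  let B1 : Set (Vtx → ℤ) := {g | ∃ a ∈ q.Z1, ∃ b ∈ q.Z2,
    Conn adj8 {v | v ∈ q.dom ∧ (v ∉ T ∨ 2 ≤ g (inl v))} a b}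
  have hB1 : IsUpperSet B1 := by
    rintro g g' h ⟨a, ha, b, hb, hc⟩
    refine ⟨a, ha, b, hb, hc.mono ?_⟩
    rintro v ⟨hv, hv'⟩
    exact ⟨hv, hv'.imp_right fun h' => h'.trans (h _)⟩
  -- Inside `T`, `|k - 1| ≥ 2` means height at most `-1` or at least `3`. A dual path starts outside
  -- `T`, enters it from the ring of heights `-1`, and changes the height by at most `2` at each
  -- step, so it cannot get to `3`. Thus the absence of a crossing is an increasing event for `|k -
  -- 1|`.
  have hcompl : ∀ k ∈ Om F ξ1, k ∈ U ↔ k ∉ {k | ab (k - 1) ∈ B1} := by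
    intro k hk
    have hb : ∀ v, v ∈ T → v ∉ white k → 2 ≤ ab (k - 1) (inl v) := by
      intro v hv hw
      simp only [white, Set.mem_ofPred_eq] at hw
      have := Hom.odd_lt hk.1 v
      simp only [ab, Pi.sub_apply, Pi.one_apply]
      rcases abs_cases (k (inl v) - 1) with h | h <;> omega
    constructor
    · rintro ⟨a, ha, b, hb', hc⟩ ⟨a', ha', b', hb'', hc'⟩
      refine q.no_cross _ a b a' b' ha hb' hc ha' hb'' ?_
      have hblack : ∀ v, Conn adj8 {v | v ∈ q.dom ∧ (v ∉ T ∨ 2 ≤ ab (k - 1) (inl v))} a' v →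
          v ∉ T ∩ white k := by
        intro v hv
        refine hv.rec' (p := fun v => v ∉ T ∩ white k) (fun h => hTZ' _ h.1 (.inl ha')) ?_
        rintro u v hu huv ⟨hvd, hv'⟩ ih ⟨h1, h2⟩
        replace hv' := hv'.resolve_left (fun h => h h1)
        have h2' : 1 ≤ k (inl v) := h2
        have h3 : 3 ≤ k (inl v) := by
          simp only [ab, Pi.sub_apply, Pi.one_apply] at hv'
          rcases abs_cases (k (inl v) - 1) with h | h <;> omega
        have h4 := Hom.near hk.1 huv
        by_cases huT : u ∈ T
        · exact ih ⟨huT, by simp only [white, Set.mem_ofPred_eq]; omega⟩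
        · obtain ⟨huF, hu1⟩ := hring u ⟨hu.right.1, huT⟩ v h1 (adj8_symm _ _ huv)
          have h5 := hk.2 _ huF
          rw [ξL, hu1] at h5
          omega
      exact hc'.reach.mono fun v hv => ⟨(Conn.right hv).1, hblack v hv⟩
    · intro h
      rcases q.exists_cross (T ∩ white k) with h' | ⟨a, ha, b, hb', hc⟩
      · exact h'
      · refine absurd ⟨a, ha, b, hb', hc.mono ?_⟩ h
        rintro v ⟨hv1, hv2⟩
        refine ⟨hv1, ?_⟩
        by_cases hvT : v ∈ T
        · exact .inr (hb v hvT fun h => hv2 ⟨hvT, h⟩)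
        · exact .inl hvT
  have hξFlat : ∀ v ∈ F, flat P2 v = ξ1 v := by
    rintro (v | c) hv
    · have hnA : (inl v : Vtx) ∉ A := fun h => ((hAl v).1 h).2.2 hv
      rcases ξFix v hv with h | h
      · rw [h, flat_of_mem (.inr ⟨hv, h⟩)]
      · rw [h, flat_of_notMem]
        rintro (h' | h')
        · exact hnA h'
        · omega
    · rw [flat_inr, ξR c hv]
  -- Prescribing `1` on the crossing sides makes `|k - 1|` smaller, hence dual crossings less likely
  -- and crossings more likely.
  have step2 : pr F ξ1 U ≤ pr (F ∪ A) (flat P2) U := by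
    have h1 := pr_fold_one (A := A) hF ξLe (flat_hom P2) hξFlat (by
      rintro _ ⟨v, rfl, h⟩; exact flat_of_mem (.inl ((hAl v).2 h))) hB1
    have h2 := pr_compl hF (Om.self_mem hξ1) {k | ab (k - 1) ∈ B1}
    have h3 := pr_compl hFA (Om.self_mem (flat_hom P2)) {k | ab (k - 1) ∈ B1}
    rw [pr_congr (U := U) (U' := {k | ab (k - 1) ∈ B1}ᶜ) hcompl,
      pr_congr (F := F ∪ A) (U := U) (U' := {k | ab (k - 1) ∈ B1}ᶜ) fun k hk => hcompl k
        ⟨hk.1, fun v hv => by rw [hk.2 v (.inl hv), hξFlat v hv]⟩]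
    linarith
  refine step2.trans ?_
  -- only the cell and its surroundings matter
  let ring : Set (ℤ × ℤ) := {v | v ∈ q.dom \ T ∧ ∃ u ∈ T, adj8 u v}
  let I : Set Vtx := {x | Sum.elim (fun v => v ∈ T ∧ v ∉ q.side)
    (fun c => (∃ u ∈ T, Inc c u) ∧ ∀ u, Inc c u → u ∈ q.dom) x}
  let B : Set Vtx := {x | Sum.elim (fun v => v ∈ T ∧ v ∈ q.side ∨ v ∈ ring) (fun _ => False) x}
  -- New outer values agreeing with the present ones on the cell and its interface, and bounded by
  -- those of `q.frame` with `1` on `q.side`.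
  let P3 : Set (ℤ × ℤ) := {v | v ∈ q.side ∧ v ∉ ring ∧ (v ∈ T → (inl v : Vtx) ∉ F)}
  have hI1 : ∀ v c, Inc c v → (inl v : Vtx) ∈ I → (inr c : Vtx) ∈ I ∪ B := by
    rintro v c hcv ⟨hv, hv'⟩
    refine .inl ⟨⟨v, hv, hcv⟩, fun u hu => ?_⟩
    by_contra hud
    rcases q.bdry v (hT hv) ⟨c, hcv, u, hu, hud⟩ with h | h
    · exact hv' ⟨h, hTZ' v hv⟩
    · exact hTZ' v hv h
  have hI2 : ∀ v c, Inc c v → (inr c : Vtx) ∈ I → (inl v : Vtx) ∈ I ∪ B := by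
    rintro v c hcv ⟨⟨u, hu, hcu⟩, hd⟩
    by_cases hv : v ∈ T
    · by_cases hs : v ∈ q.side
      · exact .inr (.inl ⟨hv, hs⟩)
      · exact .inl ⟨hv, hs⟩
    · exact .inr (.inr ⟨⟨hd v hcv, hv⟩, u, hu, hcu.adj8 hcv⟩)
  have hTIB : ∀ v ∈ T, (inl v : Vtx) ∈ I ∪ B := by
    intro v hv
    by_cases hs : v ∈ q.side
    · exact .inr (.inl ⟨hv, hs⟩)
    · exact .inl ⟨hv, hs⟩
  have hUdet : ∀ k ∈ U, ∀ k', (∀ v ∈ I ∪ B, k' v = k v) → k' ∈ U := by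
    intro k hk k' h
    refine Quad.Crossed.mono hk ?_
    rintro v ⟨hv, hw⟩
    refine ⟨hv, ?_⟩
    simp only [white, Set.mem_ofPred_eq] at hw ⊢
    rwa [h _ (hTIB v hv)]
  have hringF : ∀ v ∈ ring, (inl v : Vtx) ∈ F ∧ ξ (inl v) = -1 := by
    rintro v ⟨hv, u, hu, huv⟩; exact hring v hv u hu huv
  have hBF : B ⊆ F ∪ A := by
    rintro (v | c) hv
    · rcases hv with hv | hv
      · by_cases hvF : (inl v : Vtx) ∈ F
        · exact .inl hvF
        · exact .inr ((hAl v).2 ⟨hv.1, hv.2, hvF⟩)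
      · exact .inl (hringF v hv).1
    · exact hv.elim
  have h32 : ∀ v ∈ F ∪ A, v ∈ I ∪ B → flat P3 v = flat P2 v := by
    rintro (v | c) hv hvI
    · have hr : v ∈ ring → flat P3 (inl v) = flat P2 (inl v) := by
        intro hr
        rw [flat_of_notMem fun h => h.2.1 hr, flat_of_notMem]
        rintro (h | h)
        · exact hr.1.2 ((hAl v).1 h).1
        · have := h.2; rw [ξL, (hringF v hr).2] at this; omega
      have hT' : v ∈ T → flat P3 (inl v) = flat P2 (inl v) := by
        intro hvT
        have hFn : (inl v : Vtx) ∈ F → ξ1 (inl v) ≠ 1 := by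
          intro hvF h
          have := hTF v hvT hvF
          rw [ξL] at h; omega
        have : v ∈ P3 ↔ v ∈ P2 := by
          constructor
          · rintro ⟨h1, h2, h3⟩; exact .inl ((hAl v).2 ⟨hvT, h1, h3 hvT⟩)
          · rintro (h | h)
            · obtain ⟨h1, h2, h3⟩ := (hAl v).1 h
              exact ⟨h2, fun h => h.1.2 h1, fun _ => h3⟩
            · exact absurd h.2 (hFn h.1)
        by_cases h : v ∈ P3
        · rw [flat_of_mem h, flat_of_mem (this.1 h)]
        · rw [flat_of_notMem h, flat_of_notMem (fun h' => h (this.2 h'))]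
      rcases hvI with h | h | h
      · exact hT' h.1
      · exact hT' h.1
      · exact hr h
    · rfl
  rw [pr_glue hFA hI1 hI2 hBF h32 (flat_hom P2) (flat_hom P3) hUdet]
  -- The sites other than those of `q.side` on which the values `-1` remain prescribed. They will be
  -- dropped by `pr_fold_neg_one`: a white crossing forces one by `|k + 1| ≥ 2`, an increasing event
  -- that conditioning on `-1` makes less likely.
  let E : Set Vtx := {x | Sum.elim (fun v => v ∉ q.side ∧ (v ∈ ring ∨ v ∈ T ∧ (inl v : Vtx) ∈ F)) (fun _ => False) x}
  have hGE : (q.frame ∪ E)ᶜ.Finite :=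
    q.frame_finite.subset (Set.compl_subset_compl.2 Set.subset_union_left)
  have heq : (F ∪ A) ∪ Iᶜ = (q.frame ∪ E) ∪ Iᶜ := by
    ext x
    simp only [Set.mem_union, Set.mem_compl_iff]
    by_cases hx : x ∈ I
    · simp only [hx, not_true_eq_false, or_false]
      rcases x with v | c
      · have h1 : (inl v : Vtx) ∉ A := fun h => hx.2 ((hAl v).1 h).2.1
        have h2 : (inl v : Vtx) ∉ q.frame := by
          rintro (h | h | h)
          · exact h (hT hx.1)
          · exact hx.2 h
          · have := q.σ_side h; rw [q.invol] at this; exact hTZ' v hx.1 this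
        have h3 : (inl v : Vtx) ∈ E ↔ (inl v : Vtx) ∈ F := by
          constructor
          · rintro ⟨_, h | h⟩
            · exact absurd hx.1 h.1.2
            · exact h.2
          · intro h; exact ⟨hx.2, .inr ⟨hx.1, h⟩⟩
        simp only [h1, h2, h3, or_false, false_or]
      · obtain ⟨⟨u, hu, hcu⟩, hd⟩ := hx
        have h0 := hTc u hu c hcu
        have h1 : (inr c : Vtx) ∉ A := by rintro ⟨v, h, _⟩; exact absurd h (by simp)
        have h2 : (inr c : Vtx) ∉ q.frame := by
          rintro ⟨u, h, h'⟩; exact h' (hd u h)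
        have h3 : (inr c : Vtx) ∉ E := fun h => h
        simp only [h0, h1, h2, h3]
    · simp only [hx, not_false_eq_true, or_true]
  have hBE : B ⊆ q.frame ∪ E := by
    rintro (v | c) hv
    · by_cases hs : v ∈ q.side
      · exact .inl (.inr (.inl hs))
      · rcases hv with hv | hv
        · exact absurd hv.2 hs
        · exact .inr ⟨hs, .inl hv⟩
    · exact hv.elim
  rw [heq, ← pr_glue hGE hI1 hI2 hBE (fun _ _ _ => rfl) (flat_hom P3) (flat_hom P3) hUdet]
  have hP3 : P3 ⊆ q.side := fun v hv => hv.1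
  refine (pr_holley hGE (fun v _ => flat_mono hP3 v) (Om.self_mem (flat_hom q.side)) hUup).trans ?_
  -- forgetting the values prescribed inside the quad
  let B2 : Set (Vtx → ℤ) := {g | ∃ a ∈ q.A1 \ (q.Z1 ∪ q.Z2), ∃ b ∈ q.A2 \ (q.Z1 ∪ q.Z2),
      Conn adj4 {v | v ∈ q.dom ∧ 2 ≤ g (inl v)} a b}
  have hB2 : IsUpperSet B2 := by
    rintro g g' h ⟨a, ha, b, hb, hc⟩
    exact ⟨a, ha, b, hb, hc.mono fun v hv => ⟨hv.1, hv.2.trans (h _)⟩⟩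
  refine (pr_mono (U' := {k | ab (k + 1) ∈ B2}) hGE ?_).trans
    ((pr_fold_neg_one q.frame_finite ?_ (flat_hom q.side) (fun _ _ => rfl) ?_ hB2).trans q.pr_frame)
  · rintro k hk ⟨a, ha, b, hb, hc⟩
    refine ⟨a, ⟨ha, hTZ' a hc.left.1.1⟩, b, ⟨hb, hTZ' b hc.right.1.1⟩, hc.mono ?_⟩
    rintro v ⟨⟨hv1, hv2⟩, hv3⟩
    refine ⟨hv3, ?_⟩
    have : 1 ≤ k (inl v) := hv2
    simp only [ab, Pi.add_apply, Pi.one_apply]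
    rw [abs_of_nonneg] <;> omega
  · rintro (v | c) _
    · rcases flat_cases q.side v with h | h <;> rw [h]; omega
    · rw [flat_inr]; omega
  · rintro (v | c) hv
    · exact flat_of_notMem hv.1
    · exact hv.elim

end SquareIce

namespace SquareIce
open Sum

/-! ### Many disjoint crossings of a strip contain a pair crossing a common symmetric quad -/

def rows (y0 y1 : ℤ) : Set (ℤ × ℤ) := {v | y0 ≤ v.2 ∧ v.2 ≤ y1}

@[simp] theorem mem_rows {y0 y1 : ℤ} {v : ℤ × ℤ} : v ∈ rows y0 y1 ↔ y0 ≤ v.2 ∧ v.2 ≤ y1 := Iff.rfl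

/-- A crossing of a strip contains a crossing of a thinner strip. -/
theorem Conn.sub_rows {S : Set (ℤ × ℤ)} {a b : ℤ × ℤ} (h : Conn adj4 S a b) {y y' : ℤ} (hy : y ≤ y')
    (ha : a.2 ≤ y) (hb : y' ≤ b.2) : ∃ x t, Conn adj4 (S ∩ rows y y') (x, y) (t, y') := by
  obtain ⟨u, v, hu, hv, hc⟩ := h.passage (P := {v | v.2 < y}) (M := rows y y') (Q := {v | y' < v.2})
    (I := fun u => u.2 = y) (F := fun v => v.2 = y')
    (by
      intro v _
      simp only [Set.mem_union, Set.mem_ofPred_eq, mem_rows]; omega)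
    (by simp only [Set.mem_ofPred_eq, mem_rows]; omega)
    (by simp only [Set.mem_ofPred_eq, mem_rows]; omega)
    (by simp only [Set.mem_ofPred_eq, mem_rows, adj4]; intros; omega)
    (by simp only [Set.mem_ofPred_eq, mem_rows, adj4]; intros; omega)
    (by simp only [Set.mem_ofPred_eq, adj4]; intros; omega)
  obtain ⟨u1, u2⟩ := u
  obtain ⟨v1, v2⟩ := v
  dsimp only at hu hv
  subst hu hv
  exact ⟨u1, v1, hc⟩

theorem exists_common_quad {A : ℤ → Set (ℤ × ℤ)} {H w : ℤ} {N : ℕ} (hH : 0 ≤ H) (hN : 0 < N)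
    (hw : w < N * (H / 16 + 1)) {s : Finset ℤ} (hcard : 300 * N ≤ s.card)
    (hdisj : ∀ i ∈ s, ∀ j ∈ s, i ≠ j → Disjoint (A i) (A j))
    (hcr : ∀ i ∈ s, ∃ x t, 0 ≤ x ∧ x ≤ w ∧ Conn adj4 (A i ∩ rows 0 H) (x, 0) (t, H)) :
    ∃ i ∈ s, ∃ j ∈ s, i < j ∧ ∃ q : SymQuad, q.dom ⊆ rows (-H) (2 * H) ∧ q.Crossed (A i) ∧ q.Crossed (A j) := by
  classical
  choose! x t hx0 hxw hc using hcr
  have hinj : ∀ i ∈ s, ∀ j ∈ s, x i = x j → i = j := by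
    intro i hi j hj h
    by_contra hij
    have h1 := (hc i hi).left.1
    have h2 := (hc j hj).left.1
    rw [← h] at h2
    exact (hdisj i hi j hj hij).le_bot ⟨h1, h2⟩
  -- With `N` windows of length `H / 16`, one of them contains 300 of the starting points.
  obtain ⟨u, y, hy, hmono, -, -, -⟩ := exists_window (s.image x) (H := w) (w := H / 16) (K := 300) (N := N)
    (by
      intro d hd
      obtain ⟨i, hi, rfl⟩ := Finset.mem_image.1 hd
      exact ⟨hx0 i hi, hxw i hi⟩) (by omega) hw hN (by norm_num)
    (by rw [Finset.card_image_of_injOn fun i hi j hj h => hinj i hi j hj h]; omega)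
  have hlab : ∀ j : ℕ, ∃ i : s, j < 300 → x i = y j := by
    intro j
    by_cases hj : j < 300
    · obtain ⟨i, hi, h⟩ := Finset.mem_image.1 (hy j hj).1
      exact ⟨⟨i, hi⟩, fun _ => h⟩
    · obtain ⟨i, hi⟩ : s.Nonempty := Finset.card_pos.1 (by omega)
      exact ⟨⟨i, hi⟩, fun h => absurd h hj⟩
  choose l hl using hlab
  have hlne : ∀ i j, i < j → j < 300 → (l i : ℤ) ≠ l j := by
    intro i j hij hj h
    have h1 := hl i (by omega)
    have h2 := hl j hj
    have h3 := hmono i j hij hj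
    rw [h] at h1
    omega
  let p : ℕ → Set (ℤ × ℤ) := fun j => {v | Conn adj4 (A (l j) ∩ rows 0 H) (x (l j), 0) v}
  have hp : ∀ j, ∀ v ∈ p j, v ∈ A (l j) ∩ rows 0 H := fun j v hv => Conn.right hv
  have st : SwingState (fun i : s => A i) 300 u H :=
    { p := p
      x := fun j => x (l j)
      l := l
      sub := fun i _ v hv => (hp i v hv).1
      disj := fun i j hij hj => by
        rw [Set.disjoint_left]
        intro v h1 h2
        exact (hdisj _ (l i).2 _ (l j).2 (hlne i j hij hj)).le_bot ⟨(hp i v h1).1, (hp j v h2).1⟩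
      lab := fun i hi h => hlne i (i + 1) (by omega) hi (by rw [h])
      strip := fun i _ => ⟨fun v hv => (hp i v hv).2, t (l i), (hc _ (l i).2).reach⟩
      conn := fun i _ v hv => Conn.reach hv
      mono := fun i j hij hj => by
        rw [hl i (by omega), hl j hj]; exact hmono i j hij hj
      win := fun i hi => by
        rw [hl i hi]; exact (hy i hi).2 }
  obtain ⟨q, hq, i, j, hij, h1, h2⟩ := st.exists_commonQuad H.toNat (by omega)
  have hq' : q.dom ⊆ rows (-H) (2 * H) := fun v hv => by
    have := hq hv; simp only [mem_box] at this; exact this.2.2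
  have hij' : (i : ℤ) ≠ j := fun h => hij (Subtype.ext h)
  rcases lt_or_gt_of_ne hij' with h | h
  · exact ⟨i, i.2, j, j.2, h, q, hq', h1, h2⟩
  · exact ⟨j, j.2, i, i.2, h, q, hq', h2, h1⟩

/-! ### Graphs without large independent sets -/

open Classical in
/-- The pairs of `s` related by `r`, in increasing order. -/
noncomputable def edges (r : ℤ → ℤ → Prop) (s : Finset ℤ) : Finset (ℤ × ℤ) :=
  (s ×ˢ s).filter fun p => p.1 < p.2 ∧ r p.1 p.2

theorem mem_edges {r : ℤ → ℤ → Prop} {s : Finset ℤ} {p : ℤ × ℤ} :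
    p ∈ edges r s ↔ (p.1 ∈ s ∧ p.2 ∈ s) ∧ p.1 < p.2 ∧ r p.1 p.2 := by
  simp [edges]

/-- A maximal set `I` without edges has fewer than `L` elements, and every vertex off `I` has an
edge to `I`. These edges are distinct and disappear when `I` is removed, so at least one edge is
lost per remaining vertex. -/
theorem edges_remove {r : ℤ → ℤ → Prop} {L : ℕ} (s : Finset ℤ)
    (h : ∀ t ⊆ s, L ≤ t.card → (edges r t).Nonempty) :
    ∃ s' ⊆ s, s.card ≤ s'.card + L ∧ (edges r s').card + s'.card ≤ (edges r s).card := by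
  classical
  obtain ⟨I, hI, hmax⟩ := Finset.exists_max_image (s.powerset.filter fun t => edges r t = ∅) Finset.card
    ⟨∅, by simp [edges]⟩
  simp only [Finset.mem_filter, Finset.mem_powerset, and_imp] at hI hmax
  have hIL : I.card < L := by
    by_contra hcon
    have := h I hI.1 (not_lt.1 hcon)
    rw [hI.2] at this
    exact Finset.not_nonempty_empty this
  refine ⟨s \ I, Finset.sdiff_subset, ?_, ?_⟩
  · have := Finset.card_sdiff_add_card_eq_card hI.1
    omega
  have hex : ∀ v ∈ s \ I, ∃ p ∈ edges r s, (p.1 = v ∧ p.2 ∈ I) ∨ (p.2 = v ∧ p.1 ∈ I) := by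
    intro v hv
    rw [Finset.mem_sdiff] at hv
    by_contra hcon
    push Not at hcon
    have hins : insert v I ⊆ s := Finset.insert_subset hv.1 hI.1
    have := hmax (insert v I) hins (by
      rw [Finset.eq_empty_iff_forall_notMem]
      intro p hp
      have hp' : p ∈ edges r s := by
        rw [mem_edges] at hp ⊢; exact ⟨⟨hins hp.1.1, hins hp.1.2⟩, hp.2⟩
      obtain ⟨c1, c2⟩ := hcon p hp'
      rw [mem_edges] at hp
      simp only [Finset.mem_insert] at hp
      have hpI : p ∉ edges r I := by rw [hI.2]; simp
      rw [mem_edges] at hpI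
      rcases hp.1.1 with h1 | h1
      · rcases hp.1.2 with h2 | h2
        · omega
        · exact c1 h1 h2
      · rcases hp.1.2 with h2 | h2
        · exact c2 h2 h1
        · exact hpI ⟨⟨h1, h2⟩, hp.2⟩)
    rw [Finset.card_insert_of_notMem hv.2] at this
    omega
  choose! e he1 he2 using hex
  have hdisj : Disjoint (edges r (s \ I)) ((s \ I).image e) := by
    rw [Finset.disjoint_left]
    intro p hp hp'
    obtain ⟨v, hv, rfl⟩ := Finset.mem_image.1 hp'
    rw [mem_edges, Finset.mem_sdiff, Finset.mem_sdiff] at hp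
    rcases he2 v hv with h | h
    · exact hp.1.2.2 h.2
    · exact hp.1.1.2 h.2
  have hinj : Set.InjOn e (s \ I : Finset ℤ) := by
    intro v hv v' hv' h
    have n1 := (Finset.mem_sdiff.1 hv).2
    have n2 := (Finset.mem_sdiff.1 hv').2
    have h1 := he2 v hv
    have h2 := he2 v' hv'
    rw [h] at h1
    rcases h1 with h1 | h1 <;> rcases h2 with h2 | h2
    · rw [← h1.1, h2.1]
    · exact absurd (h1.1 ▸ h2.2) n1
    · exact absurd (h1.1 ▸ h2.2) n1
    · rw [← h1.1, h2.1]
  rw [← Finset.card_image_of_injOn hinj, ← Finset.card_union_of_disjoint hdisj]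
  refine Finset.card_le_card (Finset.union_subset ?_ ?_)
  · intro p hp
    rw [mem_edges, Finset.mem_sdiff, Finset.mem_sdiff] at hp
    rw [mem_edges]
    exact ⟨⟨hp.1.1.1, hp.1.2.1⟩, hp.2⟩
  · intro p hp
    obtain ⟨v, hv, rfl⟩ := Finset.mem_image.1 hp
    exact he1 v hv

/-- Three removals cost at most `L`, `2 * L` and `3 * L` in the vertex counts, whence `6 * L`. The
factor `3` is what beats the factor `2` relating good pairs to consecutive pairs. -/
theorem le_card_edges {r : ℤ → ℤ → Prop} {L : ℕ} {s : Finset ℤ}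
    (h : ∀ t ⊆ s, L ≤ t.card → (edges r t).Nonempty) : 3 * s.card ≤ (edges r s).card + 6 * L := by
  obtain ⟨s1, h1, c1, e1⟩ := edges_remove s h
  obtain ⟨s2, h2, c2, e2⟩ := edges_remove s1 fun t ht => h t (ht.trans h1)
  obtain ⟨s3, h3, c3, e3⟩ := edges_remove s2 fun t ht => h t (ht.trans (h2.trans h1))
  omega

/-- A consecutive pair is determined by its left element. -/
theorem card_edges_consecutive_le (s : Finset ℤ) :
    (edges (fun x y => ∀ z ∈ s, ¬ (x < z ∧ z < y)) s).card ≤ s.card := by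
  refine Finset.card_le_card_of_injOn Prod.fst (fun p hp => ?_) ?_
  · exact (mem_edges.1 hp).1.1
  · rintro ⟨x, y⟩ hp ⟨x', y'⟩ hp' h
    rw [Finset.mem_coe, mem_edges] at hp hp'
    dsimp only at hp hp' h
    subst h
    have h1 := hp.2.2 y' hp'.1.2
    have h2 := hp'.2.2 y hp.1.2
    have : y = y' := by omega
    rw [this]

end SquareIce

namespace SquareIce
open Sum

/-! ### Clusters -/

/-- Two sites share a face outside `Kf`. -/
def adjK (Kf : Set (ℤ × ℤ)) (u v : ℤ × ℤ) : Prop := ∃ c, c ∉ Kf ∧ Inc c u ∧ Inc c v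

theorem adjK_symm (Kf : Set (ℤ × ℤ)) : ∀ u v, adjK Kf u v → adjK Kf v u :=
  fun _ _ ⟨c, h, h1, h2⟩ => ⟨c, h, h2, h1⟩

/-- The white cluster of `x`. -/
def cluster (Kf : Set (ℤ × ℤ)) (k : Vtx → ℤ) (x : ℤ × ℤ) : Set (ℤ × ℤ) := {v | Conn (adjK Kf) (white k) x v}

theorem cluster_white {Kf : Set (ℤ × ℤ)} {k : Vtx → ℤ} {x v : ℤ × ℤ} (h : v ∈ cluster Kf k x) : v ∈ white k :=
  Conn.right h

theorem cluster_mem {Kf : Set (ℤ × ℤ)} {k : Vtx → ℤ} {x u v : ℤ × ℤ} (hu : u ∈ cluster Kf k x)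
    (huv : adjK Kf u v) (hv : v ∈ white k) : v ∈ cluster Kf k x := Conn.tail hu huv hv

theorem cluster_eq {Kf : Set (ℤ × ℤ)} {k : Vtx → ℤ} {x y v : ℤ × ℤ} (hx : v ∈ cluster Kf k x)
    (hy : v ∈ cluster Kf k y) : cluster Kf k x = cluster Kf k y := by
  have h : Conn (adjK Kf) (white k) x y := Conn.trans hx (Conn.symm (adjK_symm Kf) hy)
  ext w
  exact ⟨fun hw => (h.symm (adjK_symm Kf)).trans hw, fun hw => h.trans hw⟩

/-- A cluster is found by exploration and depends only on the heights of its sites and of their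
neighbours; this is what allows conditioning on it. -/
theorem cluster_congr {Kf : Set (ℤ × ℤ)} {k k' : Vtx → ℤ} {x : ℤ × ℤ} (hx : x ∈ white k)
    (h : ∀ v, (v ∈ cluster Kf k x ∨ ∃ u ∈ cluster Kf k x, adjK Kf u v) → k' (inl v) = k (inl v)) :
    cluster Kf k' x = cluster Kf k x := by
  ext w
  have hx' : x ∈ cluster Kf k x := .refl hx
  constructor
  · intro hw
    refine hw.rec' (p := fun w => w ∈ cluster Kf k x) hx' ?_
    intro u v _ huv hv ih
    refine cluster_mem ih huv ?_
    have := h v (.inr ⟨u, ih, huv⟩)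
    simp only [white, Set.mem_ofPred_eq] at hv ⊢
    omega
  · intro hw
    refine (Conn.reach hw).mono ?_
    intro v hv
    have h1 := h v (.inl hv)
    have h2 : 1 ≤ k (inl v) := cluster_white hv
    simp only [white, Set.mem_ofPred_eq]
    omega

/-- `S` is crossed from `(x, y0)` to the top row. -/
def CrossFrom (S : Set (ℤ × ℤ)) (y0 y1 x : ℤ) : Prop := ∃ t, Conn adj4 S (x, y0) (t, y1)

/-- `x` is the leftmost starting point of a crossing of `R` by `C`. -/
def IsRep (R : Set (ℤ × ℤ)) (y0 y1 : ℤ) (C : Set (ℤ × ℤ)) (x : ℤ) : Prop :=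
  CrossFrom (C ∩ R) y0 y1 x ∧ ∀ x' < x, ¬ CrossFrom (C ∩ R) y0 y1 x'

theorem IsRep.unique {R : Set (ℤ × ℤ)} {y0 y1 : ℤ} {C : Set (ℤ × ℤ)} {x x' : ℤ} (h : IsRep R y0 y1 C x)
    (h' : IsRep R y0 y1 C x') : x = x' := by
  rcases lt_trichotomy x x' with hlt | rfl | hlt
  · exact absurd h.1 (h'.2 x hlt)
  · rfl
  · exact absurd h'.1 (h.2 x' hlt)

/-- The part of `C` in `R` connected to `x`. -/
def arm (R : Set (ℤ × ℤ)) (y0 : ℤ) (C : Set (ℤ × ℤ)) (x : ℤ) : Set (ℤ × ℤ) := {v | Conn adj4 (C ∩ R) (x, y0) v}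

theorem arm_sub {R : Set (ℤ × ℤ)} {y0 : ℤ} {C : Set (ℤ × ℤ)} {x : ℤ} {v : ℤ × ℤ} (h : v ∈ arm R y0 C x) :
    v ∈ C ∩ R := Conn.right h

theorem CrossFrom.arm {R : Set (ℤ × ℤ)} {y0 y1 : ℤ} {C : Set (ℤ × ℤ)} {x : ℤ} (h : CrossFrom (C ∩ R) y0 y1 x) :
    CrossFrom (arm R y0 C x) y0 y1 x := by
  obtain ⟨t, h⟩ := h
  exact ⟨t, h.reach⟩

theorem arm_conn {R : Set (ℤ × ℤ)} {y0 : ℤ} {C : Set (ℤ × ℤ)} {x : ℤ} {v : ℤ × ℤ} (h : v ∈ arm R y0 C x) :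
    Conn adj4 (arm R y0 C x) (x, y0) v := Conn.reach h

/-- The regions of the strip in which crossings are counted. -/
structure Region (y0 y1 w : ℤ) where
  R : Set (ℤ × ℤ)
  sub : R ⊆ box 0 w y0 y1
  -- Rows of `R` are intervals: from any missing site one can leave to the left or to the right
  -- without meeting `R`.
  convex : ∀ v, v ∉ R → (∀ x ≤ v.1, (x, v.2) ∉ R) ∨ ∀ x, v.1 ≤ x → (x, v.2) ∉ R

/-- The sites of `R` all of whose neighbours are in `R`. -/
def core (R : Set (ℤ × ℤ)) : Set (ℤ × ℤ) := {v | ∀ u, adj8 u v → u ∈ R}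

/-- The boundary conditions for which crossing clusters are counted. -/
structure Admissible (F : Set Vtx) (ξ : Vtx → ℤ) (Kf R : Set (ℤ × ℤ)) : Prop where
  finite : Fᶜ.Finite
  hom : ξ ∈ Hom
  le_one : ∀ v ∈ F, ξ v ≤ 1
  disabled : ∀ c ∈ Kf, (inr c : Vtx) ∈ F
  site : ∀ v ∈ core R, (inl v : Vtx) ∈ F → ξ (inl v) ≤ -1
  face : ∀ v ∈ core R, ∀ c, Inc c v → (inr c : Vtx) ∉ F

/-- The starting points of the crossing clusters. -/
def reps (Kf R : Set (ℤ × ℤ)) (y0 y1 : ℤ) (k : Vtx → ℤ) : Set ℤ :=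
  {x | IsRep R y0 y1 (cluster Kf k (x, y0)) x}

theorem reps_mem {Kf R : Set (ℤ × ℤ)} {y0 y1 : ℤ} {k : Vtx → ℤ} {x : ℤ} (h : x ∈ reps Kf R y0 y1 k) :
    (x, y0) ∈ cluster Kf k (x, y0) ∧ (x, y0) ∈ R := by
  obtain ⟨t, h⟩ := h.1
  exact h.left

theorem reps_disjoint {Kf R : Set (ℤ × ℤ)} {y0 y1 : ℤ} {k : Vtx → ℤ} {x x' : ℤ} (h : x ∈ reps Kf R y0 y1 k)
    (h' : x' ∈ reps Kf R y0 y1 k) (hne : x ≠ x') {v : ℤ × ℤ} (hv : v ∈ cluster Kf k (x, y0)) :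
    v ∉ cluster Kf k (x', y0) := by
  intro hv'
  have e := cluster_eq hv hv'
  have h1 : IsRep R y0 y1 (cluster Kf k (x', y0)) x := e ▸ h
  exact hne (h1.unique h')

/-- Barrier on the left: an 8-path of the strip off a crossing cannot start outside the region to its
left and end to its right. -/
theorem Region.barrier {y0 y1 w : ℤ} (Rg : Region y0 y1 w) {X X' S : Set (ℤ × ℤ)} {x x' p : ℤ}
    (hX : CrossFrom X y0 y1 x) (hXR : X ⊆ Rg.R) (hX' : CrossFrom X' y0 y1 x') (hXR' : X' ⊆ Rg.R)
    (h1 : x ≤ p) (h2 : p ≤ x') {z : ℤ × ℤ} (hz : z ∈ rows y0 y1) (hzR : z ∉ Rg.R)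
    (hS : S = rows y0 y1 \ (X ∪ X')) (hc : Conn adj8 S z (p, y0)) : False := by
  obtain ⟨t, ht⟩ := hX
  obtain ⟨t', ht'⟩ := hX'
  have b1 := Rg.sub (hXR ht.left)
  have b2 := Rg.sub (hXR' ht'.left)
  have hrow : ∀ v ∈ Rg.R, y0 ≤ v.2 ∧ v.2 ≤ y1 := fun v hv => by
    have := Rg.sub hv; simp only [mem_box] at this; omega
  simp only [mem_box, mem_rows] at b1 b2 hz
  have off : ∀ v, (y0 ≤ v.2 ∧ v.2 ≤ y1) → v ∉ Rg.R → v ∈ S := by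
    intro v hv hvR
    rw [hS]
    exact ⟨hv, by rintro (h | h); exacts [hvR (hXR h), hvR (hXR' h)]⟩
  have hcol : ∀ v : ℤ × ℤ, (v.1 < 0 ∨ w < v.1) → v ∉ Rg.R := by
    intro v hv h
    have := Rg.sub h; simp only [mem_box] at this; omega
  -- From `z` one leaves horizontally off `R`, beyond the columns `0` to `w`, then goes down to the
  -- bottom row; the path would then pass from one side of `X` or `X'` to the other.
  rcases Rg.convex z hzR with hL | hL
  · have c1 : Conn adj4 S (min z.1 (-1), z.2) z := by
      refine (conn_horizontal (z := z.1) (by omega) ?_)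
      intro s _ hs; exact off _ hz (hL s hs)
    have c2 : Conn adj4 S (min z.1 (-1), y0) (min z.1 (-1), z.2) :=
      conn_vertical (by omega) fun s h1 h2 => off _ (by dsimp only; omega) (hcol _ (.inl (by dsimp only; omega)))
    refine no_cross_strip ht (fun v hv => hrow v (hXR hv)) ((c2.trans c1).to8.trans hc) ?_
      (.inl ⟨rfl, by dsimp only; omega⟩) (.inl ⟨rfl, h1⟩)
    intro v hv
    rw [hS] at hv
    exact ⟨hv.1.1, hv.1.2, fun h => hv.2 (.inl h)⟩
  · have c1 : Conn adj4 S z (max z.1 (w + 1), z.2) := by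
      refine (conn_horizontal (x := z.1) (by omega) ?_)
      intro s hs _; exact off _ hz (hL s hs)
    have c2 : Conn adj4 S (max z.1 (w + 1), y0) (max z.1 (w + 1), z.2) :=
      conn_vertical (by omega) fun s h1 h2 => off _ (by dsimp only; omega) (hcol _ (.inr (by dsimp only; omega)))
    refine no_cross_strip ht' (fun v hv => hrow v (hXR' hv)) (hc.symm8.trans (c1.trans c2.symm4).to8) ?_
      (.inl ⟨rfl, h2⟩) (.inl ⟨rfl, by dsimp only; omega⟩)
    intro v hv
    rw [hS] at hv
    exact ⟨hv.1.1, hv.1.2, fun h => hv.2 (.inr h)⟩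

/-- Two crossing clusters cross a common symmetric quad. -/
def Good (R : Set (ℤ × ℤ)) (y0 y1 : ℤ) (C C' : Set (ℤ × ℤ)) (x x' : ℤ) : Prop :=
  ∃ q : SymQuad, q.dom ⊆ rows (y0 + 1) (y1 - 1) ∧ q.Crossed (arm R y0 C x) ∧ q.Crossed (arm R y0 C' x')

/-- Given two clusters crossing a common quad, with probability at least `1/2` no crossing cluster
lies between them. -/
theorem Region.two_mul_between_le {y0 y1 w : ℤ} (Rg : Region y0 y1 w) {F : Set Vtx} {ξ : Vtx → ℤ}
    {Kf : Set (ℤ × ℤ)} (hA : Admissible F ξ Kf Rg.R) {C C' : Set (ℤ × ℤ)} {x x' : ℤ}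
    (hC : IsRep Rg.R y0 y1 C x) (hC' : IsRep Rg.R y0 y1 C' x') (hg : Good Rg.R y0 y1 C C' x x') :
    2 * {k | k ∈ Om F ξ ∧ (cluster Kf k (x, y0) = C ∧ cluster Kf k (x', y0) = C') ∧
      ∃ z ∈ reps Kf Rg.R y0 y1 k, x < z ∧ z < x'}.ncard ≤
    {k | k ∈ Om F ξ ∧ cluster Kf k (x, y0) = C ∧ cluster Kf k (x', y0) = C'}.ncard := by
  classical
  set 𝒜 : Set (Vtx → ℤ) := {k | cluster Kf k (x, y0) = C ∧ cluster Kf k (x', y0) = C'} with h𝒜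
  rcases (Om F ξ ∩ 𝒜).eq_empty_or_nonempty with hemp | ⟨κ, hκ, hκC, hκC'⟩
  · have : {k | k ∈ Om F ξ ∧ (cluster Kf k (x, y0) = C ∧ cluster Kf k (x', y0) = C') ∧
      ∃ z ∈ reps Kf Rg.R y0 y1 k, x < z ∧ z < x'} = ∅ := by
      rw [Set.eq_empty_iff_forall_notMem] at hemp ⊢
      rintro k ⟨h1, h2, _⟩
      exact hemp k ⟨h1, h2⟩
    rw [this]; simp
  obtain ⟨q, hq1, hqC, hqC'⟩ := hg
  have hq : q.dom ⊆ rows y0 y1 := fun v hv => by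
    have := hq1 hv; simp only [mem_rows] at this ⊢; omega
  have hF := hA.finite
  let Q : Set (ℤ × ℤ) := C ∪ C'
  let ring : Set (ℤ × ℤ) := {v | v ∉ Q ∧ ∃ u ∈ Q, adjK Kf u v}
  let I : Set Vtx := {y | Sum.elim (fun v => v ∈ Q) (fun c => c ∉ Kf ∧ ∃ u ∈ Q, Inc c u) y}
  let B : Set Vtx := {y | Sum.elim (fun v => v ∈ ring) (fun c => c ∈ Kf ∧ ∃ u ∈ Q, Inc c u) y}
  have Qwhite : ∀ k ∈ 𝒜, ∀ v ∈ Q, 1 ≤ k (inl v) := by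
    rintro k ⟨h1, h2⟩ v (hv | hv)
    · rw [← h1] at hv; exact cluster_white hv
    · rw [← h2] at hv; exact cluster_white hv
  have Qadj : ∀ k ∈ 𝒜, ∀ u ∈ Q, ∀ v, adjK Kf u v → v ∈ white k → v ∈ Q := by
    rintro k ⟨h1, h2⟩ u (hu | hu) v huv hv
    · rw [← h1] at hu; exact .inl (h1 ▸ cluster_mem hu huv hv)
    · rw [← h2] at hu; exact .inr (h2 ▸ cluster_mem hu huv hv)
  have ringval : ∀ k ∈ Om F ξ, k ∈ 𝒜 → ∀ v ∈ ring, k (inl v) = -1 := by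
    rintro k hk hkA v ⟨hv, u, hu, huv⟩
    have h1 : ¬ 1 ≤ k (inl v) := fun h => hv (Qadj k hkA u hu v huv h)
    have h2 := Qwhite k hkA u hu
    obtain ⟨c, _, hcu, hcv⟩ := huv
    have h3 := Hom.near hk.1 (hcu.adj8 hcv)
    have h4 := Hom.odd_lt hk.1 v
    omega
  have hκA : κ ∈ 𝒜 := ⟨hκC, hκC'⟩
  -- Given the clusters, heights inside them are irrelevant for what lies between. Reversing their
  -- sign yields prescribed values at most `1`; it is compatible with the ring of heights `-1`
  -- around, and with disabled faces, whose height next to a cluster is `0`.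
  let ξ' : Vtx → ℤ := fun v => if v ∈ I then -κ v else κ v
  have ξ'I : ∀ v ∈ I, ξ' v = -κ v := fun v hv => if_pos hv
  have ξ'O : ∀ v, v ∉ I → ξ' v = κ v := fun v hv => if_neg hv
  have hI1 : ∀ v c, Inc c v → (inl v : Vtx) ∈ I → (inr c : Vtx) ∈ I ∪ B := by
    intro v c hcv hv
    by_cases hc : c ∈ Kf
    · exact .inr ⟨hc, v, hv, hcv⟩
    · exact .inl ⟨hc, v, hv, hcv⟩
  have hI2 : ∀ v c, Inc c v → (inr c : Vtx) ∈ I → (inl v : Vtx) ∈ I ∪ B := by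
    rintro v c hcv ⟨hc, u, hu, hcu⟩
    by_cases hv : v ∈ Q
    · exact .inl hv
    · exact .inr ⟨hv, u, hu, c, hc, hcu, hcv⟩
  have ringI : ∀ v ∈ ring, (inl v : Vtx) ∉ I := fun v hv h => hv.1 h
  have Bξ' : ∀ k ∈ Om F ξ, k ∈ 𝒜 → ∀ v ∈ B, k v = ξ' v := by
    rintro k hk hkA (v | c) hv
    · rw [ξ'O _ (ringI v hv), ringval k hk hkA v hv, ringval κ hκ hκA v hv]
    · have hcI : (inr c : Vtx) ∉ I := fun h => h.1 hv.1
      rw [ξ'O _ hcI, hk.2 _ (hA.disabled c hv.1), hκ.2 _ (hA.disabled c hv.1)]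
  have Iface : ∀ c, (inr c : Vtx) ∈ I → 0 ≤ κ (inr c) := by
    rintro c ⟨_, u, hu, hcu⟩
    have := Qwhite κ hκA u hu
    have := hκ.1.1 c u hcu
    omega
  have ξ'F : ∀ v ∈ F \ (I ∪ B), ξ' v = ξ v := by
    rintro v ⟨hv, hv'⟩
    rw [ξ'O v (fun h => hv' (.inl h)), hκ.2 v hv]
  have ξ'le : ∀ v ∈ F ∪ (I ∪ B), ξ' v ≤ 1 := by
    intro v hv
    by_cases hI : v ∈ I
    · rw [ξ'I v hI]
      rcases v with v | c
      · have := Qwhite κ hκA v hI; omega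
      · have := Iface c hI; omega
    · rw [ξ'O v hI]
      rcases hv with hv | hv | hv
      · rw [hκ.2 v hv]; exact hA.le_one v hv
      · exact absurd hv hI
      · rcases v with v | c
        · rw [ringval κ hκ hκA v hv]; omega
        · rw [hκ.2 _ (hA.disabled c hv.1)]; exact hA.le_one _ (hA.disabled c hv.1)
  have ξ'hom : ξ' ∈ Hom := by
    refine ⟨fun c v hcv => ?_, fun v => ?_, fun c => ?_⟩
    · have h0 := hκ.1.1 c v hcv
      by_cases hv : (inl v : Vtx) ∈ I <;> by_cases hc : (inr c : Vtx) ∈ I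
      · rw [ξ'I _ hv, ξ'I _ hc]; omega
      · have hcB := (hI1 v c hcv hv).resolve_left hc
        have h1 := hA.le_one _ (hA.disabled c hcB.1)
        rw [← hκ.2 _ (hA.disabled c hcB.1)] at h1
        have h2 := Qwhite κ hκA v hv
        obtain ⟨m, hm⟩ := hκ.1.2.2 c
        rw [ξ'I _ hv, ξ'O _ hc]; omega
      · have hvB := (hI2 v c hcv hc).resolve_left hv
        have h1 := ringval κ hκ hκA v hvB
        have h2 := Iface c hc
        rw [ξ'O _ hv, ξ'I _ hc]; omega
      · rw [ξ'O _ hv, ξ'O _ hc]; exact h0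
    · by_cases hv : (inl v : Vtx) ∈ I
      · rw [ξ'I _ hv, odd_neg]; exact hκ.1.2.1 v
      · rw [ξ'O _ hv]; exact hκ.1.2.1 v
    · by_cases hv : (inr c : Vtx) ∈ I
      · rw [ξ'I _ hv, even_neg]; exact hκ.1.2.2 c
      · rw [ξ'O _ hv]; exact hκ.1.2.2 c
  have h𝒜det : ∀ k ∈ 𝒜, ∀ k', (∀ v ∈ I ∪ B, k' v = k v) → k' ∈ 𝒜 := by
    rintro k hk k' h
    have hx : (x, y0) ∈ C := by obtain ⟨t, ht⟩ := hC.1; exact ht.left.1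
    have hx' : (x', y0) ∈ C' := by obtain ⟨t, ht⟩ := hC'.1; exact ht.left.1
    have key : ∀ v, (v ∈ Q ∨ ∃ u ∈ Q, adjK Kf u v) → k' (inl v) = k (inl v) := by
      rintro v (hv | hv)
      · exact h _ (.inl hv)
      · by_cases hvQ : v ∈ Q
        · exact h _ (.inl hvQ)
        · exact h _ (.inr ⟨hvQ, hv⟩)
    constructor
    · rw [cluster_congr (k := k), hk.1]
      · exact cluster_white (hk.1.symm ▸ hx)
      · rw [hk.1]
        exact fun v hv => key v (hv.imp .inl fun ⟨u, hu, huv⟩ => ⟨u, .inl hu, huv⟩)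
    · rw [cluster_congr (k := k), hk.2]
      · exact cluster_white (hk.2.symm ▸ hx')
      · rw [hk.2]
        exact fun v hv => key v (hv.imp .inr fun ⟨u, hu, huv⟩ => ⟨u, .inr hu, huv⟩)
  -- the cell between the clusters
  let P := arm Rg.R y0 C x
  let P' := arm Rg.R y0 C' x'
  have hPQ : ∀ v ∈ P ∪ P', v ∈ Q := by
    rintro v (hv | hv)
    exacts [.inl (arm_sub hv).1, .inr (arm_sub hv).1]
  have hPR : P ⊆ Rg.R := fun v hv => (arm_sub hv).2
  have hPR' : P' ⊆ Rg.R := fun v hv => (arm_sub hv).2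
  -- The part of the quad between the arms, less the two clusters, their rings, and everything that
  -- the outside of `R` reaches off the arms. The last condition puts `T` in the core of `R`, where
  -- faces are free.
  let T : Set (ℤ × ℤ) := {v | v ∈ q.between (P ∪ P') ∧ v ∉ Q ∧ v ∉ ring ∧
    ∀ z ∈ rows y0 y1, z ∉ Rg.R → ¬ Conn adj8 (rows y0 y1 \ (P ∪ P')) z v}
  have hTd : T ⊆ q.dom := fun v hv => hv.1.1
  have hTR : ∀ v ∈ T, v ∈ core Rg.R := by
    intro v hv u huv
    by_contra huR
    have hur : u ∈ rows y0 y1 := by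
      have := hq1 hv.1.1
      simp only [mem_rows, adj8] at this huv ⊢; omega
    have hu : u ∉ P ∪ P' := by rintro (h | h); exacts [huR (hPR h), huR (hPR' h)]
    exact hv.2.2.2 u hur huR (.single ⟨hur, hu⟩ huv ⟨hq hv.1.1, hv.1.2.1⟩)
  have henab : ∀ v ∈ T, ∀ c, Inc c v → c ∉ Kf := fun v hv c hcv hc =>
    hA.face v (hTR v hv) c hcv (hA.disabled c hc)
  -- The boundary of `T` within the quad consists of ring sites only: any other site next to `T`
  -- would satisfy the defining conditions of `T`.
  have hcell : pr (F ∪ (I ∪ B)) ξ' {k | q.Crossed (T ∩ white k)} ≤ 1 / 2 := by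
    refine q.pr_cell (hF.subset (Set.compl_subset_compl.2 Set.subset_union_left)) ξ'hom ξ'le hTd ?_ ?_ ?_ ?_
    · rw [Set.disjoint_left]
      intro v hv hz
      exact hv.1.2.2 v hz (.refl ⟨hv.1.1, hv.1.2.1⟩)
    · rintro v hv (h | h | h)
      · rw [ξ'O (inl v) hv.2.1, hκ.2 _ h]; exact hA.site v (hTR v hv) h
      · exact absurd h hv.2.1
      · exact absurd h hv.2.2.1
    · rintro v hv c hcv (h | h | h)
      · exact hA.face v (hTR v hv) c hcv h
      · obtain ⟨hc, u, hu, hcu⟩ := h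
        exact hv.2.2.1 ⟨hv.2.1, u, hu, c, hc, hcu, hcv⟩
      · exact henab v hv c hcv h.1
    · rintro v ⟨hvd, hvT⟩ u hu hvu
      obtain ⟨c, hcu, hcv⟩ := Inc.of_adj8 hvu
      have hcK := henab u hu c hcu
      have hvQ : v ∉ Q := fun h => hu.2.2.1 ⟨hu.2.1, v, h, c, hcK, hcv, hcu⟩
      by_cases hvr : v ∈ ring
      · refine ⟨.inr (.inr hvr), ?_⟩
        rw [ξ'O _ (ringI v hvr)]; exact ringval κ hκ hκA v hvr
      · refine absurd (⟨⟨hvd, fun h => hvQ (hPQ v h), fun z hz h => ?_⟩, hvQ, hvr, fun z hz hzR h => ?_⟩ : v ∈ T) hvT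
        · exact hu.1.2.2 z hz (h.tail (adj8_symm _ _ hvu) ⟨hu.1.1, hu.1.2.1⟩)
        · exact hu.2.2.2 z hz hzR (h.tail (adj8_symm _ _ hvu) ⟨hq hu.1.1, hu.1.2.1⟩)
  have hglue := Om.glue hF (I := I) (B := B) (ξ := ξ) (ξ' := ξ') hI1 hI2 ξ'F (𝒜 := 𝒜)
    (W := {k | q.Crossed (T ∩ white k)}) Bξ' h𝒜det (by
      intro k hk k' h
      refine Quad.Crossed.mono hk ?_
      rintro v ⟨hv, hw⟩
      refine ⟨hv, ?_⟩
      simp only [white, Set.mem_ofPred_eq] at hw ⊢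
      rwa [h (inl v) hv.2.1])
  have hF' : (F ∪ (I ∪ B))ᶜ.Finite := hF.subset (Set.compl_subset_compl.2 Set.subset_union_left)
  have hpos : 0 < (Om (F ∪ (I ∪ B)) ξ').ncard := (Set.ncard_pos (Om.finite hF' ξ')).2 (Om.self_mem ξ'hom)
  have hcell' : 2 * (Om (F ∪ (I ∪ B)) ξ' ∩ {k | q.Crossed (T ∩ white k)}).ncard ≤ (Om (F ∪ (I ∪ B)) ξ').ncard := by
    rw [pr, div_le_div_iff₀ (by exact_mod_cast hpos) two_pos] at hcell
    have : ((2 * (Om (F ∪ (I ∪ B)) ξ' ∩ {k | q.Crossed (T ∩ white k)}).ncard : ℕ) : ℝ) ≤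
      ((Om (F ∪ (I ∪ B)) ξ').ncard : ℕ) := by push_cast; linarith
    exact_mod_cast this
  have hmain : 2 * (Om F ξ ∩ 𝒜 ∩ {k | q.Crossed (T ∩ white k)}).ncard ≤ (Om F ξ ∩ 𝒜).ncard := by
    refine Nat.le_of_mul_le_mul_right ?_ hpos
    rw [mul_assoc, hglue, mul_left_comm]
    exact Nat.mul_le_mul_left _ hcell'
  have hfin := Om.finite hF ξ
  refine le_trans (Nat.mul_le_mul_left 2 (Set.ncard_le_ncard (t := Om F ξ ∩ 𝒜 ∩ {k | q.Crossed (T ∩ white k)}) ?_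
    ((hfin.inter_of_left _).inter_of_left _))) hmain
  rintro k ⟨hk, hkA, z, hz, hxz, hzx⟩
  refine ⟨⟨hk, hkA⟩, ?_⟩
  have hxr : x ∈ reps Kf Rg.R y0 y1 k := by show IsRep _ _ _ _ _; rw [hkA.1]; exact hC
  have hxr' : x' ∈ reps Kf Rg.R y0 y1 k := by show IsRep _ _ _ _ _; rw [hkA.2]; exact hC'
  set C'' := cluster Kf k (z, y0)
  have hd : ∀ v ∈ C'', v ∉ Q := by
    rintro v hv (h | h)
    · rw [← hkA.1] at h; exact reps_disjoint hz hxr hxz.ne' hv h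
    · rw [← hkA.2] at h; exact reps_disjoint hz hxr' hzx.ne hv h
  let X := arm Rg.R y0 C'' z
  have hXC : ∀ v ∈ X, v ∈ C'' := fun v hv => (arm_sub hv).1
  have hXcr : CrossFrom X y0 y1 z := hz.1.arm
  have hXR : ∀ v ∈ X, v ∈ Rg.R := fun v hv => (arm_sub hv).2
  have hrow : ∀ v ∈ Rg.R, v ∈ rows y0 y1 := fun v hv => by
    have := Rg.sub hv; simp only [mem_box] at this; exact this.2.2
  have hXP : Disjoint X P := Set.disjoint_left.2 fun v hv h => hd v (hXC v hv) (hPQ v (.inl h))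
  have hXP' : Disjoint X P' := Set.disjoint_left.2 fun v hv h => hd v (hXC v hv) (hPQ v (.inr h))
  -- The arm of a third cluster starting between `x` and `x'` separates the other two arms, so it
  -- must cross the quad between them. The part doing so lies in `T`: the barrier lemma keeps it
  -- away from the outside of `R`.
  rcases q.cross_between hqC hqC' hXP hXP' with h | ⟨u, hu, v, hv, h⟩
  · refine Quad.Crossed.mono h ?_
    rintro v ⟨hvX, hvb⟩
    have hvw : v ∈ white k := cluster_white (hXC v hvX)
    refine ⟨⟨hvb, hd v (hXC v hvX), ?_, ?_⟩, hvw⟩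
    · rintro ⟨hvQ, u, hu, huv⟩
      exact hvQ (Qadj k hkA u hu v huv hvw)
    · intro p hp hpR hcon
      have c2 : Conn adj8 (rows y0 y1 \ (P ∪ P')) v (z, y0) := by
        refine ((arm_conn hvX).symm4.to8).mono fun u hu => ⟨hrow u (hXR u hu), ?_⟩
        exact fun h => hd u (hXC u hu) (hPQ u h)
      exact Rg.barrier hC.1.arm hPR hC'.1.arm hPR' hxz.le hzx.le hp hpR rfl (hcon.trans c2)
  · exfalso
    obtain ⟨t, ht⟩ := hXcr
    have c1 : Conn adj8 (rows y0 y1 \ X) (x, y0) u :=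
      ((arm_conn hu).to8).mono fun w hw => ⟨hrow w (hPR hw), fun h => hXP.le_bot ⟨h, hw⟩⟩
    have c2 : Conn adj8 (rows y0 y1 \ X) v (x', y0) :=
      ((arm_conn hv).symm4.to8).mono fun w hw => ⟨hrow w (hPR' hw), fun h => hXP'.le_bot ⟨h, hw⟩⟩
    have c3 : Conn adj8 (rows y0 y1 \ X) u v := h.mono fun w hw => ⟨hq hw.1, hw.2⟩
    refine no_cross_strip ht (fun v hv => hrow v (hXR v hv)) ((c1.trans c3).trans c2) ?_
      (.inl ⟨rfl, hxz.le⟩) (.inl ⟨rfl, hzx.le⟩)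
    intro w hw
    exact ⟨hw.1.1, hw.1.2, hw.2⟩

end SquareIce

/-! ### The mean number of crossing clusters. -/

namespace SquareIce
open Sum

theorem card_le_two_mul_of_fibers {α β : Type*} [DecidableEq β] (G : Finset α) (f : α → β) (P Q : α → Prop)
    [DecidablePred P] [DecidablePred Q]
    (h : ∀ b, ((G.filter fun a => f a = b).filter P).card ≤ 2 * ((G.filter fun a => f a = b).filter Q).card) :
    (G.filter P).card ≤ 2 * (G.filter Q).card := by
  have key : ∀ (R : α → Prop) [DecidablePred R], (G.filter R).card = ∑ b ∈ G.image f, ((G.filter fun a => f a = b).filter R).card := by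
    intro R _
    rw [Finset.card_eq_sum_card_fiberwise (f := f) (t := G.image f)
      (fun a ha => Finset.mem_coe.2 (Finset.mem_image_of_mem f (Finset.mem_filter.1 ha).1))]
    refine Finset.sum_congr rfl fun b _ => ?_
    rw [Finset.filter_filter, Finset.filter_filter]
    simp only [and_comm]
  rw [key P, key Q, Finset.mul_sum]
  exact Finset.sum_le_sum fun b _ => h b

theorem reps_sub {y0 y1 w : ℤ} (Rg : Region y0 y1 w) {Kf : Set (ℤ × ℤ)} {k : Vtx → ℤ} :
    reps Kf Rg.R y0 y1 k ⊆ Set.Icc 0 w := by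
  intro x hx
  have := Rg.sub (reps_mem hx).2
  simp only [mem_box] at this
  exact ⟨this.1, this.2.1⟩

theorem reps_finite {y0 y1 w : ℤ} (Rg : Region y0 y1 w) {Kf : Set (ℤ × ℤ)} {k : Vtx → ℤ} :
    (reps Kf Rg.R y0 y1 k).Finite := (Set.finite_Icc 0 w).subset (reps_sub Rg)

/-- The number of crossing clusters is bounded in mean. -/
theorem Region.sum_reps_le {y0 y1 w : ℤ} (Rg : Region y0 y1 w) {F : Set Vtx} {ξ : Vtx → ℤ}
    {Kf : Set (ℤ × ℤ)} (hA : Admissible F ξ Kf Rg.R) {H : ℤ} {N : ℕ} (hH : 0 ≤ H) (h0 : y0 < -H)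
    (h1 : 2 * H < y1) (hN : 0 < N) (hw : w < N * (H / 16 + 1)) :
    ∑ k ∈ (Om.finite hA.finite ξ).toFinset, (reps Kf Rg.R y0 y1 k).ncard ≤ 1800 * N * (Om F ξ).ncard := by
  classical
  set G := (Om.finite hA.finite ξ).toFinset with hG
  let good : (Vtx → ℤ) → ℤ → ℤ → Prop := fun k x x' =>
    Good Rg.R y0 y1 (cluster Kf k (x, y0)) (cluster Kf k (x', y0)) x x'
  let s : (Vtx → ℤ) → Finset ℤ := fun k => (reps_finite Rg (Kf := Kf) (k := k)).toFinset
  have hs : ∀ k x, x ∈ s k ↔ x ∈ reps Kf Rg.R y0 y1 k := fun k x => Set.Finite.mem_toFinset _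
  have hcard : ∀ k, (reps Kf Rg.R y0 y1 k).ncard = (s k).card := fun k => Set.ncard_eq_toFinset_card _ _
  let con : (Vtx → ℤ) → ℤ → ℤ → Prop := fun k x x' => ∀ z ∈ s k, ¬ (x < z ∧ z < x')
  let xs : Finset (ℤ × ℤ) := Finset.Icc 0 w ×ˢ Finset.Icc 0 w
  have hxs : ∀ k r, edges r (s k) ⊆ xs := by
    intro k r p hp
    rw [mem_edges, hs, hs] at hp
    have := reps_sub Rg hp.1.1
    have := reps_sub Rg hp.1.2
    simp only [Set.mem_Icc] at *
    simp only [xs, Finset.mem_product, Finset.mem_Icc]; omega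
  -- Any `300 * N` of the clusters contain a good pair, so the graph of good pairs has no large
  -- independent set.
  have hlow : ∀ k ∈ G, 3 * (s k).card ≤ (edges (good k) (s k)).card + 6 * (300 * N) := by
    intro k hk
    refine le_card_edges fun t ht htc => ?_
    obtain ⟨i, hi, j, hj, hij, q, hq, hqi, hqj⟩ := exists_common_quad (A := fun x => arm Rg.R y0 (cluster Kf k (x, y0)) x)
      hH hN hw htc
      (by
        intro i hi j hj hij
        rw [Set.disjoint_left]
        intro v h1 h2
        exact reps_disjoint ((hs k i).1 (ht hi)) ((hs k j).1 (ht hj)) hij (arm_sub h1).1 (arm_sub h2).1)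
      (by
        intro i hi
        obtain ⟨t', ht'⟩ := ((hs k i).1 (ht hi)).1.arm
        obtain ⟨a, b, hab⟩ := ht'.sub_rows (y := 0) (y' := H) hH (by dsimp only; omega) (by dsimp only; omega)
        have := Rg.sub (arm_sub hab.left.1).2
        simp only [mem_box] at this
        exact ⟨a, b, this.1, this.2.1, hab⟩)
    refine ⟨(i, j), mem_edges.2 ⟨⟨hi, hj⟩, hij, q, hq.trans ?_, hqi, hqj⟩⟩
    intro v hv
    simp only [mem_rows] at hv ⊢; omega
  have hup : ∀ k, (edges (con k) (s k)).card ≤ (s k).card := fun k => card_edges_consecutive_le (s k)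
  -- For fixed starting points, configurations are grouped by the two clusters. Being a good pair
  -- depends on the clusters alone, and in each group at least half of the configurations have no
  -- crossing cluster in between, making the pair consecutive.
  have hpair : ∀ p ∈ xs, (G.filter fun k => p ∈ edges (good k) (s k)).card ≤
      2 * (G.filter fun k => p ∈ edges (con k) (s k)).card := by
    rintro ⟨x, x'⟩ _
    refine card_le_two_mul_of_fibers G (fun k => (cluster Kf k (x, y0), cluster Kf k (x', y0))) _ _ ?_
    rintro ⟨C, C'⟩
    set Φ := G.filter fun k => (cluster Kf k (x, y0), cluster Kf k (x', y0)) = (C, C') with hΦ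
    have hmem : ∀ k, k ∈ Φ ↔ k ∈ Om F ξ ∧ cluster Kf k (x, y0) = C ∧ cluster Kf k (x', y0) = C' := by
      intro k
      simp only [hΦ, hG, Finset.mem_filter, Set.Finite.mem_toFinset, Prod.mk.injEq]
    rcases (Φ.filter fun k => (x, x') ∈ edges (good k) (s k)).eq_empty_or_nonempty with he | ⟨κ, hκ⟩
    · rw [he]; simp
    obtain ⟨hκΦ, hκe⟩ := Finset.mem_filter.1 hκ
    rw [mem_edges, hs, hs] at hκe
    obtain ⟨⟨e1, e2⟩, e3, e4⟩ := hκe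
    obtain ⟨-, r1, r2⟩ := (hmem κ).1 hκΦ
    have e1' : IsRep Rg.R y0 y1 (cluster Kf κ (x, y0)) x := e1
    have e2' : IsRep Rg.R y0 y1 (cluster Kf κ (x', y0)) x' := e2
    have e4' : Good Rg.R y0 y1 (cluster Kf κ (x, y0)) (cluster Kf κ (x', y0)) x x' := e4
    rw [r1] at e1'
    rw [r2] at e2'
    rw [r1, r2] at e4'
    have key := Rg.two_mul_between_le hA e1' e2' e4'
    have c1 : {k | k ∈ Om F ξ ∧ cluster Kf k (x, y0) = C ∧ cluster Kf k (x', y0) = C'}.ncard = Φ.card := by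
      rw [← Set.ncard_coe_finset]
      congr 1; ext k; rw [Finset.mem_coe, hmem]; rfl
    have c2 : {k | k ∈ Om F ξ ∧ (cluster Kf k (x, y0) = C ∧ cluster Kf k (x', y0) = C') ∧
      ∃ z ∈ reps Kf Rg.R y0 y1 k, x < z ∧ z < x'}.ncard =
        (Φ.filter fun k => ∃ z ∈ reps Kf Rg.R y0 y1 k, x < z ∧ z < x').card := by
      rw [← Set.ncard_coe_finset]
      congr 1; ext k
      rw [Finset.mem_coe, Finset.mem_filter, hmem, and_assoc]; rfl
    rw [c1, c2] at key
    have c3 : ∀ k ∈ Φ, ¬ (∃ z ∈ reps Kf Rg.R y0 y1 k, x < z ∧ z < x') → (x, x') ∈ edges (con k) (s k) := by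
      intro k hk hno
      obtain ⟨-, q1, q2⟩ := (hmem k).1 hk
      rw [mem_edges, hs, hs]
      refine ⟨⟨?_, ?_⟩, e3, ?_⟩
      · show IsRep _ _ _ _ _; rw [q1]; exact e1'
      · show IsRep _ _ _ _ _; rw [q2]; exact e2'
      · intro z hz h; exact hno ⟨z, (hs k z).1 hz, h⟩
    have c4 := Finset.card_filter_add_card_filter_not (s := Φ) (fun k => ∃ z ∈ reps Kf Rg.R y0 y1 k, x < z ∧ z < x')
    have c5 : (Φ.filter fun k => ¬ ∃ z ∈ reps Kf Rg.R y0 y1 k, x < z ∧ z < x').card ≤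
        (Φ.filter fun k => (x, x') ∈ edges (con k) (s k)).card := by
      refine Finset.card_le_card fun k hk => ?_
      rw [Finset.mem_filter] at hk ⊢
      exact ⟨hk.1, c3 k hk.1 hk.2⟩
    have c6 := Finset.card_filter_le Φ fun k => (x, x') ∈ edges (good k) (s k)
    omega
  have hdc : ∀ r : (Vtx → ℤ) → ℤ → ℤ → Prop, ∑ k ∈ G, (edges (r k) (s k)).card =
      ∑ p ∈ xs, (G.filter fun k => p ∈ edges (r k) (s k)).card := by
    intro r
    have : ∀ k, (edges (r k) (s k)).card = ∑ p ∈ xs, if p ∈ edges (r k) (s k) then 1 else 0 := by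
      intro k
      rw [← Finset.card_filter]
      congr 1; ext p
      rw [Finset.mem_filter]
      exact ⟨fun h => ⟨hxs k _ h, h⟩, fun h => h.2⟩
    simp only [this, Finset.card_filter]
    exact Finset.sum_comm
  -- With `S` the total number of clusters, `3 * S` is at most the number of good pairs plus `1800 *
  -- N * G.card`, and good pairs number at most `2 * S`.
  have t1 : ∑ k ∈ G, (edges (good k) (s k)).card ≤ 2 * ∑ k ∈ G, (edges (con k) (s k)).card := by
    rw [hdc good, hdc con, Finset.mul_sum]
    exact Finset.sum_le_sum hpair
  have t2 : ∑ k ∈ G, (edges (con k) (s k)).card ≤ ∑ k ∈ G, (s k).card := Finset.sum_le_sum fun k _ => hup k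
  have t3 : ∑ k ∈ G, 3 * (s k).card ≤ ∑ k ∈ G, ((edges (good k) (s k)).card + 6 * (300 * N)) :=
    Finset.sum_le_sum hlow
  rw [← Finset.mul_sum, Finset.sum_add_distrib, Finset.sum_const, smul_eq_mul] at t3
  rw [Finset.sum_congr rfl fun k _ => hcard k, Set.ncard_eq_toFinset_card _ (Om.finite hA.finite ξ), ← hG]
  have t4 : G.card * (6 * (300 * N)) = 1800 * N * G.card := by ring
  rw [t4] at t3
  omega

end SquareIce

namespace SquareIce
open Sum

/-! ### Heights with free values in a finite region -/

/-- The prescribed vertices when the faces of `D` and the sites of `M` are free. -/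
def baseF (D M : Set (ℤ × ℤ)) : Set Vtx := {x | Sum.elim (fun v => v ∉ M) (fun c => c ∉ D) x}

/-- By `corner`, a prescribed site only touches faces of height `0`, so reversing all free values
keeps a height function although the prescribed sites have height `-1`. -/
structure Base (D M : Set (ℤ × ℤ)) : Prop where
  finD : D.Finite
  finM : M.Finite
  corner : ∀ c ∈ D, ∀ v, Inc c v → v ∈ M

variable {D M : Set (ℤ × ℤ)}

theorem Base.finite (hB : Base D M) : (baseF D M)ᶜ.Finite := by
  refine ((hB.finM.image inl).union (hB.finD.image inr)).subset ?_
  rintro (v | c) h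
  · exact .inl ⟨v, by_contra h, rfl⟩
  · exact .inr ⟨c, by_contra h, rfl⟩

theorem base_inl {k : Vtx → ℤ} (hk : k ∈ Om (baseF D M) (flat ∅)) {v : ℤ × ℤ} (hv : v ∉ M) : k (inl v) = -1 := by
  rw [hk.2 (inl v) hv, flat_of_notMem (Set.notMem_empty v)]

theorem base_inr {k : Vtx → ℤ} (hk : k ∈ Om (baseF D M) (flat ∅)) {c : ℤ × ℤ} (hc : c ∉ D) : k (inr c) = 0 := by
  rw [hk.2 (inr c) hc, flat_inr]

open Classical in
/-- Change of sign of the free values. -/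
noncomputable def ng (D M : Set (ℤ × ℤ)) (k : Vtx → ℤ) : Vtx → ℤ := fun x => if x ∈ baseF D M then k x else -k x

theorem ng_of_mem {k : Vtx → ℤ} {x : Vtx} (h : x ∈ baseF D M) : ng D M k x = k x := if_pos h
theorem ng_of_notMem {k : Vtx → ℤ} {x : Vtx} (h : x ∉ baseF D M) : ng D M k x = -k x := if_neg h

theorem ng_ng (k : Vtx → ℤ) : ng D M (ng D M k) = k := by
  funext x
  by_cases h : x ∈ baseF D M
  · rw [ng_of_mem h, ng_of_mem h]
  · rw [ng_of_notMem h, ng_of_notMem h, neg_neg]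

theorem ng_inr {k : Vtx → ℤ} (hk : k ∈ Om (baseF D M) (flat ∅)) (c : ℤ × ℤ) : ng D M k (inr c) = -k (inr c) := by
  by_cases h : (inr c : Vtx) ∈ baseF D M
  · rw [ng_of_mem h, base_inr hk h]; rfl
  · rw [ng_of_notMem h]

theorem ng_inl {k : Vtx → ℤ} {v : ℤ × ℤ} (hv : v ∈ M) : ng D M k (inl v) = -k (inl v) :=
  ng_of_notMem fun h => h hv

theorem Base.ng_mem (hB : Base D M) {k : Vtx → ℤ} (hk : k ∈ Om (baseF D M) (flat ∅)) :
    ng D M k ∈ Om (baseF D M) (flat ∅) := by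
  refine ⟨⟨fun c v hcv => ?_, fun v => ?_, fun c => ?_⟩, fun x hx => by rw [ng_of_mem hx, hk.2 x hx]⟩
  · have h := hk.1.1 c v hcv
    rw [ng_inr hk]
    by_cases hv : v ∈ M
    · rw [ng_inl hv]; omega
    · have h1 : c ∉ D := fun hc => hv (hB.corner c hc v hcv)
      rw [ng_of_mem (show (inl v : Vtx) ∈ baseF D M from hv), base_inl hk hv, base_inr hk h1]; omega
  · by_cases h : (inl v : Vtx) ∈ baseF D M
    · rw [ng_of_mem h]; exact hk.1.2.1 v
    · rw [ng_of_notMem h, odd_neg]; exact hk.1.2.1 v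
  · rw [ng_inr hk, even_neg]; exact hk.1.2.2 c

/-- Probabilities are invariant under change of sign. -/
theorem Base.pr_ng (hB : Base D M) (U : Set (Vtx → ℤ)) :
    pr (baseF D M) (flat ∅) {k | ng D M k ∈ U} = pr (baseF D M) (flat ∅) U := by
  rw [pr, pr]
  congr 2
  refine Set.ncard_congr (fun k _ => ng D M k) ?_ ?_ ?_
  · rintro k ⟨h1, h2⟩; exact ⟨hB.ng_mem h1, h2⟩
  · rintro k k' _ _ h; rw [← ng_ng (D := D) (M := M) k, h, ng_ng]
  · rintro k ⟨h1, h2⟩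
    exact ⟨ng D M k, ⟨hB.ng_mem h1, by rw [Set.mem_ofPred_eq, ng_ng]; exact h2⟩, ng_ng k⟩

/-! ### Exchanging sites and faces -/

/-- Faces become sites and sites become faces, with a shift of one to fit the incidence. Subtracting
`1` restores the parities and makes the faces of height at least `2` white. -/
def dual (k : Vtx → ℤ) : Vtx → ℤ :=
  Sum.elim (fun a => k (inr a) - 1) (fun a => k (inl (a.1 + 1, a.2 + 1)) - 1)

def undual (k : Vtx → ℤ) : Vtx → ℤ :=
  Sum.elim (fun a => k (inr (a.1 - 1, a.2 - 1)) + 1) (fun a => k (inl a) + 1)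

theorem undual_dual (k : Vtx → ℤ) : undual (dual k) = k := by
  funext x; rcases x with v | c <;> simp [dual, undual]

theorem dual_undual (k : Vtx → ℤ) : dual (undual k) = k := by
  funext x; rcases x with v | c <;> simp [dual, undual]

theorem dual_hom {k : Vtx → ℤ} (hk : k ∈ Hom) : dual k ∈ Hom := by
  refine ⟨fun c v hcv => ?_, fun v => ?_, fun c => ?_⟩
  · have := hk.1 v (c.1 + 1, c.2 + 1) (by simp only [Inc] at *; omega)
    simp only [dual, Sum.elim_inl, Sum.elim_inr]; omega
  · simp only [dual, Sum.elim_inl]; exact (hk.2.2 v).sub_odd odd_one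
  · simp only [dual, Sum.elim_inr]; exact (hk.2.1 _).sub_odd odd_one

theorem undual_hom {k : Vtx → ℤ} (hk : k ∈ Hom) : undual k ∈ Hom := by
  refine ⟨fun c v hcv => ?_, fun v => ?_, fun c => ?_⟩
  · have := hk.1 (v.1 - 1, v.2 - 1) c (by simp only [Inc] at *; omega)
    simp only [undual, Sum.elim_inl, Sum.elim_inr]; omega
  · simp only [undual, Sum.elim_inl]; exact (hk.2.2 _).add_odd odd_one
  · simp only [undual, Sum.elim_inr]; exact (hk.2.1 _).add_odd odd_one

def dualF (F : Set Vtx) : Set Vtx :=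
  {x | Sum.elim (fun a => (inr a : Vtx) ∈ F) (fun a => (inl (a.1 + 1, a.2 + 1) : Vtx) ∈ F) x}

theorem dualF_finite {F : Set Vtx} (hF : Fᶜ.Finite) : (dualF F)ᶜ.Finite := by
  let f : Vtx → Vtx := Sum.elim inr fun a => inl (a.1 + 1, a.2 + 1)
  have hf : Function.Injective f := by
    rintro (⟨a, b⟩ | ⟨a, b⟩) (⟨a', b'⟩ | ⟨a', b'⟩) h <;> simp [f] at h ⊢ <;> exact h
  refine (hF.preimage (f := f) hf.injOn).subset ?_
  rintro (v | c) h <;> exact h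

theorem dual_mem {F : Set Vtx} {ξ k : Vtx → ℤ} : dual k ∈ Om (dualF F) (dual ξ) ↔ k ∈ Om F ξ := by
  constructor
  · rintro ⟨h1, h2⟩
    refine ⟨by rw [← undual_dual k]; exact undual_hom h1, ?_⟩
    rintro (v | c) hv
    · have := h2 (inr (v.1 - 1, v.2 - 1)) (by simpa [dualF] using hv)
      simpa [dual] using this
    · have := h2 (inl c) hv
      simpa [dual] using this
  · rintro ⟨h1, h2⟩
    refine ⟨dual_hom h1, ?_⟩
    rintro (v | c) hv
    · simp only [dual, Sum.elim_inl]; rw [h2 (inr v) hv]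
    · simp only [dual, Sum.elim_inr]; rw [h2 _ hv]

/-! ### High crossings -/

def repsS (Kf R : Set (ℤ × ℤ)) (y0 y1 : ℤ) (W : Set (ℤ × ℤ)) : Set ℤ :=
  {x | IsRep R y0 y1 {v | Conn (adjK Kf) W (x, y0) v} x}

theorem reps_eq (Kf R : Set (ℤ × ℤ)) (y0 y1 : ℤ) (k : Vtx → ℤ) : reps Kf R y0 y1 k = repsS Kf R y0 y1 (white k) := rfl

/-- The faces of height at least `2`. -/
def high (k : Vtx → ℤ) : Set (ℤ × ℤ) := {c | 2 ≤ k (inr c)}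

/-- The faces of height at most `-2`. -/
def low (k : Vtx → ℤ) : Set (ℤ × ℤ) := {c | k (inr c) ≤ -2}

theorem white_dual (k : Vtx → ℤ) : white (dual k) = high k := by
  ext c; simp only [white, high, dual, Sum.elim_inl, Set.mem_ofPred_eq]; omega

theorem high_ng {k : Vtx → ℤ} (hk : k ∈ Om (baseF D M) (flat ∅)) : high (ng D M k) = low k := by
  ext c; simp only [high, low, Set.mem_ofPred_eq, ng_inr hk]; omega

/-- The main estimate for the dual heights. The prescribed values `0` on faces and `-1` on sites
become `-1` and `-2`, so the dual boundary condition is admissible with no disabled face. -/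
theorem Base.sum_high_le (hB : Base D M) {y0 y1 w : ℤ} (Rg : Region y0 y1 w)
    (hM : ∀ v ∈ core Rg.R, ∀ c, Inc c v → (c.1 + 1, c.2 + 1) ∈ M) {H : ℤ} {N : ℕ} (hH : 0 ≤ H)
    (h0 : y0 < -H) (h1 : 2 * H < y1) (hN : 0 < N) (hw : w < N * (H / 16 + 1)) :
    ∑ k ∈ (Om.finite hB.finite (flat ∅)).toFinset, (repsS ∅ Rg.R y0 y1 (high k)).ncard ≤
      1800 * N * (Om (baseF D M) (flat ∅)).ncard := by
  have hA : Admissible (dualF (baseF D M)) (dual (flat ∅)) ∅ Rg.R :=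
    { finite := dualF_finite hB.finite
      hom := dual_hom (flat_hom _)
      le_one := by
        rintro (v | c) _
        · simp [dual, flat]
        · simp [dual, flat]
      disabled := fun c hc => hc.elim
      site := fun v _ _ => by simp [dual, flat]
      face := fun v hv c hcv h => h (hM v hv c hcv) }
  have key := Rg.sum_reps_le hA hH h0 h1 hN hw
  have e1 : (Om (dualF (baseF D M)) (dual (flat ∅))).ncard = (Om (baseF D M) (flat ∅)).ncard := by
    symm
    refine Set.ncard_congr (fun k _ => dual k) (fun k hk => dual_mem.2 hk) ?_ ?_
    · intro k k' _ _ h; rw [← undual_dual k, h, undual_dual]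
    · intro k hk; exact ⟨undual k, by rw [← dual_mem, dual_undual]; exact hk, dual_undual k⟩
  rw [e1] at key
  refine le_trans (le_of_eq ?_) key
  refine Finset.sum_nbij' dual undual ?_ ?_ (fun k _ => undual_dual k) (fun k _ => dual_undual k) ?_
  · intro k hk
    rw [Set.Finite.mem_toFinset] at hk ⊢; exact dual_mem.2 hk
  · intro k hk
    rw [Set.Finite.mem_toFinset] at hk ⊢; rw [← dual_mem, dual_undual]; exact hk
  · intro k _; rw [reps_eq, white_dual]

theorem Base.sum_low (hB : Base D M) (R : Set (ℤ × ℤ)) (y0 y1 : ℤ) :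
    ∑ k ∈ (Om.finite hB.finite (flat ∅)).toFinset, (repsS ∅ R y0 y1 (low k)).ncard =
    ∑ k ∈ (Om.finite hB.finite (flat ∅)).toFinset, (repsS ∅ R y0 y1 (high k)).ncard := by
  refine Finset.sum_nbij' (ng D M) (ng D M) ?_ ?_ (fun k _ => ng_ng k) (fun k _ => ng_ng k) ?_
  · intro k hk
    rw [Set.Finite.mem_toFinset] at hk ⊢; exact hB.ng_mem hk
  · intro k hk
    rw [Set.Finite.mem_toFinset] at hk ⊢; exact hB.ng_mem hk
  · intro k hk
    rw [Set.Finite.mem_toFinset] at hk; rw [high_ng hk]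

/-- Crossing clusters of a union of two sets far apart. -/
theorem repsS_union {Kf R W W' : Set (ℤ × ℤ)} {y0 y1 : ℤ} (h : ∀ u ∈ W, ∀ v ∈ W', ¬ adjK Kf u v) :
    repsS Kf R y0 y1 (W ∪ W') = repsS Kf R y0 y1 W ∪ repsS Kf R y0 y1 W' := by
  have key : ∀ {A B : Set (ℤ × ℤ)}, (∀ u ∈ A, ∀ v ∈ B, ¬ adjK Kf u v) → ∀ x ∈ A,
      {v | Conn (adjK Kf) (A ∪ B) x v} = {v | Conn (adjK Kf) A x v} := by
    intro A B hAB x hx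
    ext v
    refine ⟨fun hv => ?_, fun hv => (show Conn (adjK Kf) A x v from hv).mono Set.subset_union_left⟩
    refine Conn.rec' (p := fun v => Conn (adjK Kf) A x v) hv (.refl hx) ?_
    rintro a b _ hab hb ih
    exact ih.tail hab (hb.resolve_right fun hb => hAB a ih.right b hb hab)
  have start : ∀ {A : Set (ℤ × ℤ)} {x}, x ∈ repsS Kf R y0 y1 A → (x, y0) ∈ A := by
    intro A x hx
    obtain ⟨t, ht⟩ := hx.1
    exact Conn.right ht.left.1
  have key2 : ∀ {x}, (x, y0) ∈ W → {v | Conn (adjK Kf) (W ∪ W') (x, y0) v} = {v | Conn (adjK Kf) W (x, y0) v} :=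
    fun hx => key h _ hx
  have key3 : ∀ {x}, (x, y0) ∈ W' → {v | Conn (adjK Kf) (W ∪ W') (x, y0) v} = {v | Conn (adjK Kf) W' (x, y0) v} := by
    intro x hx
    rw [Set.union_comm]
    exact key (fun u hu v hv huv => h v hv u hu (adjK_symm _ _ _ huv)) _ hx
  ext x
  constructor
  · intro hx
    have hx' : IsRep R y0 y1 {v | Conn (adjK Kf) (W ∪ W') (x, y0) v} x := hx
    rcases start hx with hs | hs
    · rw [key2 hs] at hx'; exact .inl hx'
    · rw [key3 hs] at hx'; exact .inr hx'
  · rintro (hx | hx)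
    · show IsRep _ _ _ _ _; rw [key2 (start hx)]; exact hx
    · show IsRep _ _ _ _ _; rw [key3 (start hx)]; exact hx

theorem repsS_finite {y0 y1 w : ℤ} (Rg : Region y0 y1 w) {Kf W : Set (ℤ × ℤ)} : (repsS Kf Rg.R y0 y1 W).Finite := by
  refine (Set.finite_Icc 0 w).subset fun x hx => ?_
  obtain ⟨t, ht⟩ := hx.1
  have := Rg.sub ht.left.2
  simp only [mem_box] at this
  exact ⟨this.1, this.2.1⟩

/-- A cluster has at most one starting point. -/
theorem repsS_cluster {Kf R W : Set (ℤ × ℤ)} {y0 y1 x : ℤ} (hx : x ∈ repsS Kf R y0 y1 W) :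
    repsS Kf R y0 y1 {v | Conn (adjK Kf) W (x, y0) v} = {x} := by
  set C := {v | Conn (adjK Kf) W (x, y0) v} with hC
  have hxC : (x, y0) ∈ C := by obtain ⟨t, ht⟩ := hx.1; exact ht.left.1
  have e : ∀ z ∈ C, {v | Conn (adjK Kf) C z v} = C := by
    intro z hz
    ext v
    have h1 : ∀ v, v ∈ C → Conn (adjK Kf) C (x, y0) v := fun v hv => Conn.reach hv
    exact ⟨fun hv => Conn.right hv, fun hv => ((h1 z hz).symm (adjK_symm Kf)).trans (h1 v hv)⟩
  ext z
  constructor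
  · intro hz
    have hz' : IsRep R y0 y1 {v | Conn (adjK Kf) C (z, y0) v} z := hz
    have hzC : (z, y0) ∈ C := by obtain ⟨t, ht⟩ := hz.1; exact Conn.right ht.left.1
    rw [e _ hzC] at hz'
    exact hz'.unique hx
  · rintro rfl
    show IsRep _ _ _ _ _
    rw [e _ hxC]; exact hx

/-- If some cluster crosses then there is a starting point. -/
theorem exists_rep {y0 y1 w : ℤ} (Rg : Region y0 y1 w) {Kf W : Set (ℤ × ℤ)} (hK : ∀ v ∈ Rg.R, v ∉ Kf) {x : ℤ}
    (h : CrossFrom (W ∩ Rg.R) y0 y1 x) : ∃ z ∈ repsS Kf Rg.R y0 y1 W, Conn (adjK Kf) W (x, y0) (z, y0) := by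
  classical
  have four : ∀ u v, u ∈ Rg.R → v ∈ Rg.R → adj4 u v → adjK Kf u v := by
    intro u v hu hv huv
    simp only [adj4] at huv
    by_cases hle : u.1 ≤ v.1 ∧ u.2 ≤ v.2
    · exact ⟨u, hK u hu, Inc.self u, by simp only [Inc]; omega⟩
    · exact ⟨v, hK v hv, by simp only [Inc]; omega, Inc.self v⟩
  set C := {v | Conn (adjK Kf) W (x, y0) v} with hC
  have hx : CrossFrom (C ∩ Rg.R) y0 y1 x := by
    obtain ⟨t, ht⟩ := h
    refine ⟨t, (Conn.reach ht).mono fun v hv => ⟨?_, (Conn.right hv).2⟩⟩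
    exact Conn.map (T := W) (r' := adjK Kf) id (fun u hu => hu.1) (fun u v hu hv huv => four u v hu.2 hv.2 huv) hv
  have hfin : {z | CrossFrom (C ∩ Rg.R) y0 y1 z}.Finite := (Set.finite_Icc 0 w).subset fun z hz => by
    obtain ⟨t, ht⟩ := hz
    have := Rg.sub ht.left.2
    simp only [mem_box] at this
    exact ⟨this.1, this.2.1⟩
  obtain ⟨z, hz, hmin⟩ := hfin.exists_minimal ⟨x, hx⟩
  have hzC : Conn (adjK Kf) W (x, y0) (z, y0) := by obtain ⟨t, ht⟩ := hz; exact ht.left.1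
  refine ⟨z, ?_, hzC⟩
  have e : {v | Conn (adjK Kf) W (z, y0) v} = C := by
    ext v
    exact ⟨fun hv => hzC.trans hv, fun hv => (hzC.symm (adjK_symm Kf)).trans hv⟩
  show IsRep _ _ _ _ _
  rw [e]
  exact ⟨hz, fun z' hz' h => absurd (hmin h hz'.le) (not_le.2 hz')⟩

open Classical in
/-- Change of sign on the faces of `C` and around. -/
noncomputable def flip (C : Set (ℤ × ℤ)) (k : Vtx → ℤ) : Vtx → ℤ :=
  Sum.elim (fun v => if ∃ c ∈ C, Inc c v then -k (inl v) else k (inl v))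
    (fun c => if c ∈ C then -k (inr c) else k (inr c))

theorem flip_flip (C : Set (ℤ × ℤ)) (k : Vtx → ℤ) : flip C (flip C k) = k := by
  funext x
  rcases x with v | c
  · by_cases h : ∃ c ∈ C, Inc c v <;> simp [flip, h]
  · by_cases h : c ∈ C <;> simp [flip, h]

theorem adjK_empty {u v : ℤ × ℤ} : adjK ∅ u v ↔ adj8 u v := by
  constructor
  · rintro ⟨c, _, h1, h2⟩; exact h1.adj8 h2
  · intro h; obtain ⟨c, h1, h2⟩ := Inc.of_adj8 h; exact ⟨c, id, h1, h2⟩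

/-- Two touching faces share a site. -/
theorem exists_common_site {c c' : ℤ × ℤ} (h : adj8 c c') : ∃ v, Inc c v ∧ Inc c' v :=
  ⟨(max c.1 c'.1, max c.2 c'.2), by simp only [adj8, Inc] at *; omega⟩

theorem adj8_of_inc {c c' v : ℤ × ℤ} (h : Inc c v) (h' : Inc c' v) : adj8 c c' := by
  simp only [adj8, Inc] at *; omega

/-- Flipping a high crossing cluster. -/
theorem Base.flip_mem {k : Vtx → ℤ} (hk : k ∈ Om (baseF D M) (flat ∅)) {z : ℤ × ℤ} :
    flip {v | Conn (adjK ∅) (high k) z v} k ∈ Om (baseF D M) (flat ∅) := by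
  set C := {v | Conn (adjK ∅) (high k) z v} with hC
  have hCh : ∀ c ∈ C, 2 ≤ k (inr c) := fun c hc => show c ∈ high k from Conn.right hc
  -- Where a corner of `C` meets a face off `C`, the corner has height `1` and the face height `0`,
  -- so reversing the sign of the corner alone is allowed.
  have near : ∀ v c, (∃ c ∈ C, Inc c v) → Inc c v → c ∉ C → k (inl v) = 1 ∧ k (inr c) = 0 := by
    rintro v c ⟨c', hc', hcv'⟩ hcv hc
    have h1 := hCh c' hc'
    have h2 := hk.1.1 c' v hcv'
    have h3 := hk.1.1 c v hcv
    have h4 : ¬ 2 ≤ k (inr c) := fun h => hc (Conn.tail hc' (adjK_empty.2 (adj8_of_inc hcv' hcv)) h)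
    obtain ⟨m, hm⟩ := hk.1.2.2 c
    omega
  refine ⟨⟨fun c v hcv => ?_, fun v => ?_, fun c => ?_⟩, ?_⟩
  · have h := hk.1.1 c v hcv
    by_cases hc : c ∈ C
    · have hv : ∃ c ∈ C, Inc c v := ⟨c, hc, hcv⟩
      simp only [flip, Sum.elim_inl, Sum.elim_inr, if_pos hc, if_pos hv]; omega
    · by_cases hv : ∃ c ∈ C, Inc c v
      · have := near v c hv hcv hc
        simp only [flip, Sum.elim_inl, Sum.elim_inr, if_neg hc, if_pos hv]; omega
      · simpa only [flip, Sum.elim_inl, Sum.elim_inr, if_neg hc, if_neg hv] using h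
  · simp only [flip, Sum.elim_inl]
    split_ifs
    exacts [(hk.1.2.1 v).neg, hk.1.2.1 v]
  · simp only [flip, Sum.elim_inr]
    split_ifs
    exacts [(hk.1.2.2 c).neg, hk.1.2.2 c]
  · rintro (v | c) hx
    · have hno : ¬ ∃ c ∈ C, Inc c v := by
        rintro ⟨c, hc, hcv⟩
        have h1 := hCh c hc
        have h2 := hk.1.1 c v hcv
        have h3 := base_inl hk hx
        omega
      simp only [flip, Sum.elim_inl, if_neg hno]; exact hk.2 _ hx
    · have hno : c ∉ C := by
        intro hc
        have h1 := hCh c hc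
        have h3 := base_inr hk hx
        omega
      simp only [flip, Sum.elim_inr, if_neg hno]; exact hk.2 _ hx

theorem high_flip {k : Vtx → ℤ} {C : Set (ℤ × ℤ)} (hC : C ⊆ high k) : high (flip C k) = high k \ C := by
  ext c
  by_cases h : c ∈ C
  · have : 2 ≤ k (inr c) := hC h
    simp only [high, flip, Sum.elim_inr, Set.mem_ofPred_eq, Set.mem_sdiff, h, not_true_eq_false, and_false,
      iff_false, if_true]
    omega
  · simp [high, flip, h]

theorem low_flip {k : Vtx → ℤ} {C : Set (ℤ × ℤ)} (hC : C ⊆ high k) : low (flip C k) = low k ∪ C := by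
  ext c
  by_cases h : c ∈ C
  · have : 2 ≤ k (inr c) := hC h
    simp only [low, flip, Sum.elim_inr, Set.mem_ofPred_eq, Set.mem_union, h, or_true, iff_true, if_true]
    omega
  · simp [low, flip, h]

/-- Faces of height at least `2` and at most `-2` share no site, so the reversed cluster becomes a
cluster of low faces by itself and the other clusters are unchanged. In particular it can be
recovered from its starting point. -/
theorem flip_reps {k : Vtx → ℤ} (hk : k ∈ Hom) {y0 y1 w : ℤ} (Rg : Region y0 y1 w) {x : ℤ}
    (hx : x ∈ repsS ∅ Rg.R y0 y1 (high k)) :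
    let C := {v | Conn (adjK ∅) (high k) (x, y0) v}
    (repsS ∅ Rg.R y0 y1 (high (flip C k))).ncard + 1 = (repsS ∅ Rg.R y0 y1 (high k)).ncard ∧
    (repsS ∅ Rg.R y0 y1 (low (flip C k))).ncard ≤ (repsS ∅ Rg.R y0 y1 (low k)).ncard + 1 ∧
    x ∈ repsS ∅ Rg.R y0 y1 (low (flip C k)) ∧ {v | Conn (adjK ∅) (low (flip C k)) (x, y0) v} = C := by
  intro C
  have hCh : C ⊆ high k := fun c hc => Conn.right hc
  have hxC : (x, y0) ∈ C := by obtain ⟨t, ht⟩ := hx.1; exact ht.left.1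
  have s1 : ∀ u ∈ C, ∀ v ∈ high k \ C, ¬ adjK ∅ u v := fun u hu v hv huv => hv.2 (Conn.tail hu huv hv.1)
  have s2 : ∀ u ∈ low k, ∀ v ∈ C, ¬ adjK ∅ u v := by
    intro u hu v hv huv
    obtain ⟨p, h1, h2⟩ := exists_common_site (adjK_empty.1 huv)
    have h3 := hk.1 u p h1
    have h4 := hk.1 v p h2
    have h5 : k (inr u) ≤ -2 := hu
    have h6 : 2 ≤ k (inr v) := hCh hv
    omega
  have e1 := repsS_union (R := Rg.R) (y0 := y0) (y1 := y1) s1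
  rw [Set.union_sdiff_cancel hCh, repsS_cluster hx] at e1
  have e2 := repsS_union (R := Rg.R) (y0 := y0) (y1 := y1) s2
  rw [repsS_cluster hx] at e2
  rw [high_flip hCh, low_flip hCh, e2, e1]
  have hxn : x ∉ repsS ∅ Rg.R y0 y1 (high k \ C) := by
    intro h
    obtain ⟨t, ht⟩ := h.1
    exact (Conn.right ht.left.1).2 hxC
  refine ⟨?_, ?_, .inr rfl, ?_⟩
  · rw [Set.singleton_union, Set.ncard_insert_of_notMem hxn (repsS_finite Rg)]
  · rw [Set.union_singleton]; exact Set.ncard_insert_le _ _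
  · ext v
    constructor
    · intro hv
      refine Conn.rec' (p := fun v => v ∈ C) hv hxC ?_
      rintro a b _ hab hb ih
      exact hb.resolve_left fun hb => s2 b hb a ih (adjK_symm _ _ _ hab)
    · intro hv
      exact (Conn.reach hv).mono Set.subset_union_right

/-- High crossings are absent with a probability bounded below. -/
theorem Base.ncard_le_no_high (hB : Base D M) {y0 y1 w : ℤ} (Rg : Region y0 y1 w)
    (hM : ∀ v ∈ core Rg.R, ∀ c, Inc c v → (c.1 + 1, c.2 + 1) ∈ M) {H : ℤ} {N m : ℕ} (hH : 0 ≤ H)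
    (h0 : y0 < -H) (h1 : 2 * H < y1) (hN : 0 < N) (hw : w < N * (H / 16 + 1)) (hm : m = 7200 * N) :
    (Om (baseF D M) (flat ∅)).ncard ≤ 2 * ((m + 1) * m ^ m) *
      (Om (baseF D M) (flat ∅) ∩ {k | repsS ∅ Rg.R y0 y1 (high k) = ∅}).ncard := by
  classical
  have hfin := Om.finite hB.finite (flat ∅)
  set G := hfin.toFinset with hG
  have memG : ∀ k, k ∈ G ↔ k ∈ Om (baseF D M) (flat ∅) := fun k => Set.Finite.mem_toFinset _
  let a : (Vtx → ℤ) → ℕ := fun k => (repsS ∅ Rg.R y0 y1 (high k)).ncard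
  let b : (Vtx → ℤ) → ℕ := fun k => (repsS ∅ Rg.R y0 y1 (low k)).ncard
  have hGc : (Om (baseF D M) (flat ∅)).ncard = G.card := Set.ncard_eq_toFinset_card _ _
  have hsum : ∑ k ∈ G, (a k + b k) ≤ 3600 * N * G.card := by
    have e1 := hB.sum_high_le Rg hM hH h0 h1 hN hw
    have e2 := hB.sum_low Rg.R y0 y1
    rw [hGc] at e1
    rw [Finset.sum_add_distrib]
    have e3 : ∑ k ∈ G, b k = ∑ k ∈ G, a k := e2
    rw [e3]
    have e4 : ∑ k ∈ G, a k ≤ 1800 * N * G.card := e1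
    calc _ ≤ 1800 * N * G.card + 1800 * N * G.card := Nat.add_le_add e4 e4
      _ = _ := by ring
  -- Markov's inequality: `m` is twice the bound on the mean number of high and low crossing
  -- clusters together.
  let L := G.filter fun k => a k + b k ≤ m
  have hhalf : G.card ≤ 2 * L.card := by
    have e1 : (G.filter fun k => ¬ a k + b k ≤ m).card * (m + 1) ≤ ∑ k ∈ G, (a k + b k) := by
      calc _ = ∑ k ∈ G.filter (fun k => ¬ a k + b k ≤ m), (m + 1) := by rw [Finset.sum_const, smul_eq_mul]
        _ ≤ ∑ k ∈ G.filter (fun k => ¬ a k + b k ≤ m), (a k + b k) :=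
          Finset.sum_le_sum fun k hk => by have := (Finset.mem_filter.1 hk).2; omega
        _ ≤ _ := Finset.sum_le_sum_of_subset (Finset.filter_subset _ _)
    have e2 : (G.filter fun k => ¬ a k + b k ≤ m).card * (m + 1) ≤ 3600 * N * G.card := e1.trans hsum
    have e3 := Finset.card_filter_add_card_filter_not (s := G) (fun k => a k + b k ≤ m)
    have e4 : 2 * (G.filter fun k => ¬ a k + b k ≤ m).card ≤ G.card := by
      have hpos : 0 < 3600 * N := by omega
      refine Nat.le_of_mul_le_mul_left ?_ hpos
      calc 3600 * N * (2 * (G.filter fun k => ¬ a k + b k ≤ m).card)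
          = (G.filter fun k => ¬ a k + b k ≤ m).card * m := by rw [hm]; ring
        _ ≤ (G.filter fun k => ¬ a k + b k ≤ m).card * (m + 1) := Nat.mul_le_mul_left _ (Nat.le_succ m)
        _ ≤ _ := e2
    show G.card ≤ 2 * (G.filter fun k => a k + b k ≤ m).card
    omega
  let A : ℕ → Finset (Vtx → ℤ) := fun j => L.filter fun k => a k = j
  -- Reversing one high crossing cluster maps `A (j + 1)` to `A j`, and the total number of clusters
  -- does not grow. The preimage is determined by which low crossing cluster of the image was
  -- reversed, and there are at most `m` of these.
  have hstep : ∀ j, (A (j + 1)).card ≤ m * (A j).card := by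
    intro j
    have hex : ∀ k ∈ A (j + 1), ∃ x, x ∈ repsS ∅ Rg.R y0 y1 (high k) := by
      intro k hk
      have h := (Finset.mem_filter.1 hk).2
      have : (repsS ∅ Rg.R y0 y1 (high k)).Nonempty := by
        rw [Set.nonempty_iff_ne_empty]
        intro h'
        have : a k = 0 := by show Set.ncard _ = 0; rw [h']; simp
        omega
      exact this
    choose! x hx using hex
    let Φ : (Vtx → ℤ) → Vtx → ℤ := fun k => flip {v | Conn (adjK ∅) (high k) (x k, y0) v} k
    have hΦ : ∀ k ∈ A (j + 1), Φ k ∈ A j := by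
      intro k hk
      obtain ⟨hkL, hkj⟩ := Finset.mem_filter.1 hk
      obtain ⟨hkG, hkm⟩ := Finset.mem_filter.1 hkL
      have hkO := (memG k).1 hkG
      obtain ⟨r1, r2, r3, r4⟩ := flip_reps hkO.1 Rg (hx k hk)
      have r1' : a (Φ k) + 1 = a k := r1
      have r2' : b (Φ k) ≤ b k + 1 := r2
      refine Finset.mem_filter.2 ⟨Finset.mem_filter.2 ⟨(memG _).2 (Base.flip_mem hkO), ?_⟩, ?_⟩ <;> omega
    refine (Finset.card_le_mul_card_image_of_maps_to hΦ m fun g hg => ?_)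
    obtain ⟨hgL, hgj⟩ := Finset.mem_filter.1 hg
    obtain ⟨hgG, hgm⟩ := Finset.mem_filter.1 hgL
    have hb : b g ≤ m := by omega
    have hbc : b g = ((repsS_finite Rg (Kf := ∅) (W := low g)).toFinset).card := Set.ncard_eq_toFinset_card _ _
    rw [hbc] at hb
    refine le_trans (Finset.card_le_card_of_injOn x ?_ ?_) hb
    · intro k hk
      obtain ⟨hk1, hk2⟩ := Finset.mem_filter.1 hk
      have hkO := (memG k).1 (Finset.mem_filter.1 (Finset.mem_filter.1 hk1).1).1
      obtain ⟨r1, r2, r3, r4⟩ := flip_reps hkO.1 Rg (hx k hk1)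
      rw [Finset.mem_coe, Set.Finite.mem_toFinset, ← hk2]
      exact r3
    · intro k hk k' hk' hxx
      obtain ⟨hk1, hk2⟩ := Finset.mem_filter.1 hk
      obtain ⟨hk1', hk2'⟩ := Finset.mem_filter.1 hk'
      have hkO := (memG k).1 (Finset.mem_filter.1 (Finset.mem_filter.1 hk1).1).1
      have hkO' := (memG k').1 (Finset.mem_filter.1 (Finset.mem_filter.1 hk1').1).1
      obtain ⟨-, -, -, r4⟩ := flip_reps hkO.1 Rg (hx k hk1)
      obtain ⟨-, -, -, r4'⟩ := flip_reps hkO'.1 Rg (hx k' hk1')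
      have e1 : Φ k = Φ k' := hk2.trans hk2'.symm
      change {v | Conn (adjK ∅) (low (Φ k)) (x k, y0) v} = _ at r4
      change {v | Conn (adjK ∅) (low (Φ k')) (x k', y0) v} = _ at r4'
      rw [e1, hxx, r4'] at r4
      have e2 : flip {v | Conn (adjK ∅) (high k) (x k, y0) v} k =
        flip {v | Conn (adjK ∅) (high k') (x k', y0) v} k' := e1
      rw [hxx] at e2
      rw [← r4] at e2
      rw [← flip_flip {v | Conn (adjK ∅) (high k') (x k', y0) v} k, e2, flip_flip]
  -- At most `m` reversals remove all high crossing clusters, at a cost of a factor `m` each.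
  have hpow : ∀ j, (A j).card ≤ m ^ j * (A 0).card := by
    intro j
    induction j with
    | zero => simp
    | succ j ih =>
      calc _ ≤ m * (A j).card := hstep j
        _ ≤ m * (m ^ j * (A 0).card) := Nat.mul_le_mul_left _ ih
        _ = _ := by ring
  have hm1 : 1 ≤ m := by omega
  have hL : L.card ≤ (m + 1) * m ^ m * (A 0).card := by
    rw [Finset.card_eq_sum_card_fiberwise (f := a) (t := Finset.range (m + 1))]
    · calc ∑ j ∈ Finset.range (m + 1), (A j).card ≤ ∑ j ∈ Finset.range (m + 1), m ^ m * (A 0).card := by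
            refine Finset.sum_le_sum fun j hj => (hpow j).trans (Nat.mul_le_mul_right _ ?_)
            exact Nat.pow_le_pow_right hm1 (by have := Finset.mem_range.1 hj; omega)
        _ = _ := by rw [Finset.sum_const, Finset.card_range, smul_eq_mul]; ring
    · intro k hk
      have := (Finset.mem_filter.1 hk).2
      simp only [Finset.coe_range, Set.mem_Iio]
      omega
  have hA0 : (A 0).card ≤ (Om (baseF D M) (flat ∅) ∩ {k | repsS ∅ Rg.R y0 y1 (high k) = ∅}).ncard := by
    rw [← Set.ncard_coe_finset]
    refine Set.ncard_le_ncard ?_ (hfin.inter_of_left _)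
    intro k hk
    obtain ⟨hkL, hk0⟩ := Finset.mem_filter.1 (Finset.mem_coe.1 hk)
    refine ⟨(memG k).1 (Finset.mem_filter.1 hkL).1, ?_⟩
    exact (Set.ncard_eq_zero (repsS_finite Rg)).1 hk0
  rw [hGc]
  calc G.card ≤ 2 * L.card := hhalf
    _ ≤ 2 * ((m + 1) * m ^ m * (A 0).card) := Nat.mul_le_mul_left _ hL
    _ ≤ 2 * ((m + 1) * m ^ m * (Om (baseF D M) (flat ∅) ∩ {k | repsS ∅ Rg.R y0 y1 (high k) = ∅}).ncard) :=
      Nat.mul_le_mul_left _ (Nat.mul_le_mul_left _ hA0)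
    _ = _ := by ring

/-- The lower bound for the probability that there is no high crossing. -/
noncomputable def highConst (N : ℕ) : ℝ := 1 / (2 * ((7200 * N + 1 : ℕ) * (7200 * N : ℕ) ^ (7200 * N)))

theorem highConst_pos {N : ℕ} (hN : 0 < N) : 0 < highConst N := by
  have : (0 : ℝ) < (7200 * N : ℕ) := by exact_mod_cast (by omega : 0 < 7200 * N)
  have h2 : (0 : ℝ) < (7200 * N + 1 : ℕ) := by exact_mod_cast (by omega : 0 < 7200 * N + 1)
  unfold highConst; positivity

theorem Base.pr_no_high (hB : Base D M) {y0 y1 w : ℤ} (Rg : Region y0 y1 w)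
    (hM : ∀ v ∈ core Rg.R, ∀ c, Inc c v → (c.1 + 1, c.2 + 1) ∈ M) {H : ℤ} {N : ℕ} (hH : 0 ≤ H)
    (h0 : y0 < -H) (h1 : 2 * H < y1) (hN : 0 < N) (hw : w < N * (H / 16 + 1)) :
    highConst N ≤ pr (baseF D M) (flat ∅) {k | ∀ x, ¬ CrossFrom (high k ∩ Rg.R) y0 y1 x} := by
  have key := hB.ncard_le_no_high Rg hM hH h0 h1 hN hw rfl
  have hpos := Om.ncard_pos hB.finite (Om.self_mem (F := baseF D M) (flat_hom ∅))
  have hle : pr (baseF D M) (flat ∅) {k | repsS ∅ Rg.R y0 y1 (high k) = ∅} ≤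
      pr (baseF D M) (flat ∅) {k | ∀ x, ¬ CrossFrom (high k ∩ Rg.R) y0 y1 x} := by
    refine pr_mono hB.finite fun k _ hk x hx => ?_
    obtain ⟨z, hz, -⟩ := exists_rep Rg (Kf := ∅) (fun v _ h => h) hx
    rw [Set.mem_ofPred_eq] at hk
    rw [hk] at hz
    exact hz
  refine le_trans ?_ hle
  have hc : (0 : ℝ) < 2 * ((7200 * N + 1 : ℕ) * (7200 * N : ℕ) ^ (7200 * N)) := by
    have : (0 : ℝ) < (7200 * N : ℕ) := by exact_mod_cast (by omega : 0 < 7200 * N)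
    have h2 : (0 : ℝ) < (7200 * N + 1 : ℕ) := by exact_mod_cast (by omega : 0 < 7200 * N + 1)
    positivity
  rw [highConst, pr, div_le_div_iff₀ hc hpos, one_mul, mul_comm]
  exact_mod_cast key

end SquareIce

namespace SquareIce
open Sum

/-! ### Transport under lattice isometries -/

def LatIso.shift (a b : ℤ) : LatIso where
  f := ⟨fun v => (v.1 + a, v.2 + b), fun v => (v.1 - a, v.2 - b), fun v => by simp, fun v => by simp⟩
  g := ⟨fun v => (v.1 + a, v.2 + b), fun v => (v.1 - a, v.2 - b), fun v => by simp, fun v => by simp⟩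
  adj4_f u v := by simp only [adj4, Equiv.coe_fn_mk]; omega
  adj8_f u v := by simp only [adj8, Equiv.coe_fn_mk]; omega
  inc u v := by simp only [Inc, Equiv.coe_fn_mk]; omega

def LatIso.pull (φ : LatIso) (k : Vtx → ℤ) : Vtx → ℤ := fun x => k (Sum.map φ.f φ.g x)

theorem LatIso.pull_mem (φ : LatIso) {D M : Set (ℤ × ℤ)} {k : Vtx → ℤ} :
    φ.pull k ∈ Om (baseF (φ.g ⁻¹' D) (φ.f ⁻¹' M)) (flat ∅) ↔ k ∈ Om (baseF D M) (flat ∅) := by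
  have e1 : (∀ c v, Inc c v → φ.pull k (inl v) ≤ φ.pull k (inr c) + 1 ∧ φ.pull k (inr c) ≤ φ.pull k (inl v) + 1) ↔
      ∀ c v, Inc c v → k (inl v) ≤ k (inr c) + 1 ∧ k (inr c) ≤ k (inl v) + 1 := by
    refine Iff.trans ?_ (φ.g.forall_congr_right (q := fun c => ∀ v, Inc c v →
      k (inl v) ≤ k (inr c) + 1 ∧ k (inr c) ≤ k (inl v) + 1))
    refine forall_congr' fun c => ?_
    refine Iff.trans ?_ (φ.f.forall_congr_right (q := fun v => Inc (φ.g c) v →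
      k (inl v) ≤ k (inr (φ.g c)) + 1 ∧ k (inr (φ.g c)) ≤ k (inl v) + 1))
    refine forall_congr' fun v => ?_
    rw [φ.inc]; rfl
  have e2 : (∀ v, Odd (φ.pull k (inl v))) ↔ ∀ v, Odd (k (inl v)) :=
    φ.f.forall_congr_right (q := fun v => Odd (k (inl v)))
  have e3 : (∀ c, Even (φ.pull k (inr c))) ↔ ∀ c, Even (k (inr c)) :=
    φ.g.forall_congr_right (q := fun c => Even (k (inr c)))
  have e4 : (∀ x ∈ baseF (φ.g ⁻¹' D) (φ.f ⁻¹' M), φ.pull k x = flat ∅ x) ↔ ∀ x ∈ baseF D M, k x = flat ∅ x := by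
    rw [Sum.forall, Sum.forall]
    refine and_congr (Iff.trans ?_ (φ.f.forall_congr_right (q := fun v => (inl v : Vtx) ∈ baseF D M →
      k (inl v) = flat ∅ (inl v)))) (φ.g.forall_congr_right (q := fun c => (inr c : Vtx) ∈ baseF D M →
      k (inr c) = flat ∅ (inr c)))
    refine forall_congr' fun v => ?_
    rw [flat_of_notMem (Set.notMem_empty _), flat_of_notMem (Set.notMem_empty _)]; rfl
  exact and_congr (and_congr e1 (and_congr e2 e3)) e4

theorem Base.pull {D M : Set (ℤ × ℤ)} (hB : Base D M) (φ : LatIso) : Base (φ.g ⁻¹' D) (φ.f ⁻¹' M) where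
  finD := hB.finD.preimage φ.g.injective.injOn
  finM := hB.finM.preimage φ.f.injective.injOn
  corner c hc v hcv := hB.corner _ hc _ ((φ.inc c v).2 hcv)

theorem LatIso.pr_pull (φ : LatIso) {D M : Set (ℤ × ℤ)} (U : Set (Vtx → ℤ)) :
    pr (baseF (φ.g ⁻¹' D) (φ.f ⁻¹' M)) (flat ∅) U = pr (baseF D M) (flat ∅) {k | φ.pull k ∈ U} := by
  have key : ∀ U, (Om (baseF (φ.g ⁻¹' D) (φ.f ⁻¹' M)) (flat ∅) ∩ U).ncard =
      (Om (baseF D M) (flat ∅) ∩ {k | φ.pull k ∈ U}).ncard := by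
    intro U
    have inj : ∀ k k', φ.pull k = φ.pull k' → k = k' := by
      intro k k' h
      funext x
      have := congrFun h (Sum.map φ.f.symm φ.g.symm x)
      rcases x with v | c <;> simpa [LatIso.pull] using this
    refine (Set.ncard_congr (fun k _ => φ.pull k) ?_ (fun k k' _ _ h => inj k k' h) ?_).symm
    · rintro k ⟨h1, h2⟩; exact ⟨φ.pull_mem.2 h1, h2⟩
    · rintro k ⟨h1, h2⟩
      have e : φ.pull (fun x => k (Sum.map φ.f.symm φ.g.symm x)) = k := by
        funext x; rcases x with v | c <;> simp [LatIso.pull]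
      refine ⟨fun x => k (Sum.map φ.f.symm φ.g.symm x), ⟨φ.pull_mem.1 (by rw [e]; exact h1), ?_⟩, e⟩
      rw [Set.mem_ofPred_eq, e]; exact h2
  have h1 := key U
  have h2 := key Set.univ
  rw [Set.inter_univ, show {k | φ.pull k ∈ Set.univ} = Set.univ from Set.eq_univ_of_forall fun _ => trivial,
    Set.inter_univ] at h2
  rw [pr, pr, h1, h2]

/-! ### Positive association -/

theorem pr_nonneg {F : Set Vtx} {ξ : Vtx → ℤ} {U : Set (Vtx → ℤ)} : 0 ≤ pr F ξ U :=
  div_nonneg (Nat.cast_nonneg _) (Nat.cast_nonneg _)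

theorem pr_union_add_inter {F : Set Vtx} (hF : Fᶜ.Finite) {ξ : Vtx → ℤ} (U U' : Set (Vtx → ℤ)) :
    pr F ξ (U ∪ U') + pr F ξ (U ∩ U') = pr F ξ U + pr F ξ U' := by
  have hf := Om.finite hF ξ
  have h := Set.ncard_union_add_ncard_inter (Om F ξ ∩ U) (Om F ξ ∩ U') (hf.inter_of_left _) (hf.inter_of_left _)
  rw [← Set.inter_union_distrib_left, ← Set.inter_inter_distrib_left] at h
  simp only [pr, ← add_div]
  congr 1
  exact_mod_cast h

theorem pr_mul_le_of_upper {F : Set Vtx} (hF : Fᶜ.Finite) {ξ : Vtx → ℤ} (hξ : ξ ∈ Hom) {U U' : Set (Vtx → ℤ)}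
    (hU : IsUpperSet U) (hU' : IsUpperSet U') : pr F ξ U * pr F ξ U' ≤ pr F ξ (U ∩ U') := by
  have h0 := Om.ncard_pos hF (Om.self_mem (F := F) hξ)
  rw [pr, pr, pr, div_mul_div_comm, div_le_div_iff₀ (mul_pos h0 h0) h0]
  have h : ((Om F ξ ∩ U).ncard : ℝ) * (Om F ξ ∩ U').ncard ≤ (Om F ξ).ncard * (Om F ξ ∩ (U ∩ U')).ncard := by
    exact_mod_cast Om.fkg hF ξ hU hU'
  nlinarith

theorem pr_mul_le_of_lower {F : Set Vtx} (hF : Fᶜ.Finite) {ξ : Vtx → ℤ} (hξ : ξ ∈ Hom) {U U' : Set (Vtx → ℤ)}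
    (hU : IsLowerSet U) (hU' : IsLowerSet U') : pr F ξ U * pr F ξ U' ≤ pr F ξ (U ∩ U') := by
  have h1 := pr_mul_le_of_upper hF hξ hU.compl hU'.compl
  have h2 := pr_union_add_inter hF (ξ := ξ) Uᶜ U'ᶜ
  have hne := Om.self_mem (F := F) hξ
  have e1 := pr_compl hF hne U
  have e2 := pr_compl hF hne U'
  have e3 := pr_compl hF hne (U ∩ U')
  rw [Set.compl_inter] at e3
  rw [show pr F ξ Uᶜ = 1 - pr F ξ U by linarith, show pr F ξ U'ᶜ = 1 - pr F ξ U' by linarith] at h1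
  linarith [show (1 - pr F ξ U) * (1 - pr F ξ U') = 1 - pr F ξ U - pr F ξ U' + pr F ξ U * pr F ξ U' by ring]

/-! ### High crossings of boxes -/

def CrossY (S : Set (ℤ × ℤ)) (x0 x1 y0 y1 : ℤ) : Prop :=
  ∃ p q : ℤ × ℤ, p.2 = y0 ∧ q.2 = y1 ∧ Conn adj4 (S ∩ box x0 x1 y0 y1) p q

def CrossX (S : Set (ℤ × ℤ)) (x0 x1 y0 y1 : ℤ) : Prop :=
  ∃ p q : ℤ × ℤ, p.1 = x0 ∧ q.1 = x1 ∧ Conn adj4 (S ∩ box x0 x1 y0 y1) p q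

theorem CrossY.mono {S S' : Set (ℤ × ℤ)} {x0 x1 y0 y1 : ℤ} (h : S ⊆ S') :
    CrossY S x0 x1 y0 y1 → CrossY S' x0 x1 y0 y1 := fun ⟨p, q, h1, h2, hc⟩ =>
  ⟨p, q, h1, h2, hc.mono (Set.inter_subset_inter_left _ h)⟩

theorem CrossX.mono {S S' : Set (ℤ × ℤ)} {x0 x1 y0 y1 : ℤ} (h : S ⊆ S') :
    CrossX S x0 x1 y0 y1 → CrossX S' x0 x1 y0 y1 := fun ⟨p, q, h1, h2, hc⟩ =>
  ⟨p, q, h1, h2, hc.mono (Set.inter_subset_inter_left _ h)⟩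

theorem high_mono {k k' : Vtx → ℤ} (h : k ≤ k') : high k ⊆ high k' := fun c hc => le_trans hc (h (inr c))

def Region.ofBox (w y0 y1 : ℤ) : Region y0 y1 w where
  R := box 0 w y0 y1
  sub := le_rfl
  convex v hv := by simp only [mem_box] at *; by_cases h : v.1 < 0
                    · left; intros; omega
                    · by_cases h' : w < v.1
                      · right; intros; omega
                      · left; intros; omega

/-- The shift sends the bottom row to `-H - 1` and the top row to at least `2 * H + 1`, the margins
that `Base.pr_no_high` asks for. -/
theorem Base.pr_no_crossY {D M : Set (ℤ × ℤ)} (hB : Base D M) {x0 x1 y0 y1 : ℤ} (hM : box x0 x1 y0 y1 ⊆ M) {H : ℤ}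
    {N : ℕ} (hH : 0 ≤ H) (hy : y0 + 3 * H + 2 ≤ y1) (hN : 0 < N) (hw : x1 - x0 < N * (H / 16 + 1)) :
    highConst N ≤ pr (baseF D M) (flat ∅) {k | ¬ CrossY (high k) x0 x1 y0 y1} := by
  set φ := LatIso.shift x0 (y0 + H + 1) with hφ
  have h := (hB.pull φ).pr_no_high (Region.ofBox (x1 - x0) (-H - 1) (y1 - y0 - H - 1)) (H := H) (N := N)
    (fun v hv c hcv => hM (by
      have h1 := hv (v.1 - 1, v.2 - 1) (by simp only [adj8]; omega)
      have h2 := hv (v.1 + 1, v.2 + 1) (by simp only [adj8]; omega)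
      simp only [Region.ofBox, mem_box, Inc, hφ, LatIso.shift, Equiv.coe_fn_mk] at *
      omega)) hH (by omega) (by omega) hN hw
  rw [φ.pr_pull] at h
  refine h.trans (pr_mono hB.finite fun k _ hk => ?_)
  rintro ⟨⟨p1, p2⟩, ⟨q1, q2⟩, hp, hq, hc⟩
  dsimp only at hp hq
  subst hp hq
  refine hk (p1 - x0) ⟨q1 - x0, ?_⟩
  have := hc.map (T := high (φ.pull k) ∩ (Region.ofBox (x1 - x0) (-H - 1) (q2 - p2 - H - 1)).R) (r' := adj4)
    (fun v => (v.1 - x0, v.2 - (p2 + H + 1))) (fun u hu => ⟨?_, ?_⟩) (fun u v _ _ h => by simp only [adj4] at *; omega)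
  · convert this using 2 <;> ring
  · have e : φ.g (u.1 - x0, u.2 - (p2 + H + 1)) = u := by ext <;> simp [hφ, LatIso.shift]
    simp only [high, LatIso.pull, Set.mem_ofPred_eq, Sum.map_inr, e]; exact hu.1
  · have := hu.2
    simp only [Region.ofBox, mem_box] at *; omega

theorem Base.pr_no_crossX {D M : Set (ℤ × ℤ)} (hB : Base D M) {x0 x1 y0 y1 : ℤ} (hM : box x0 x1 y0 y1 ⊆ M) {H : ℤ}
    {N : ℕ} (hH : 0 ≤ H) (hx : x0 + 3 * H + 2 ≤ x1) (hN : 0 < N) (hw : y1 - y0 < N * (H / 16 + 1)) :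
    highConst N ≤ pr (baseF D M) (flat ∅) {k | ¬ CrossX (high k) x0 x1 y0 y1} := by
  set φ := LatIso.diag 0 with hφ
  have h := (hB.pull φ).pr_no_crossY (x0 := y0) (x1 := y1) (y0 := x0) (y1 := x1) (fun v hv => hM (by
      simp only [mem_box, hφ, LatIso.diag, Equiv.coe_fn_mk] at *; omega)) hH hx hN hw
  rw [φ.pr_pull] at h
  refine h.trans (pr_mono hB.finite fun k _ hk => ?_)
  rintro ⟨p, q, hp, hq, hc⟩
  refine hk ⟨p.swap, q.swap, hp, hq, ?_⟩
  refine hc.map (r' := adj4) Prod.swap (fun u hu => ⟨?_, ?_⟩) (fun u v _ _ h => adj4_swap.2 h)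
  · have e : φ.g u.swap = u := by ext <;> simp [hφ, LatIso.diag]
    simp only [high, LatIso.pull, Set.mem_ofPred_eq, Sum.map_inr, e]; exact hu.1
  · have := hu.2
    simp only [mem_box, Prod.fst_swap, Prod.snd_swap] at *; omega

/-! ### Vertices reached from outside a box by heights at least `2` -/

def adjV (x y : Vtx) : Prop := ∃ c v, Inc c v ∧ (x = inl v ∧ y = inr c ∨ x = inr c ∧ y = inl v)

/-- The sites not in `B` and their faces. -/
def outer (B : Set (ℤ × ℤ)) : Set Vtx := {x | Sum.elim (fun v => v ∉ B) (fun c => ∃ v, Inc c v ∧ v ∉ B) x}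

/-- What is revealed by exploring from the outside of `B` along heights at least `2`. It stops at
vertices of height at most `1`, which provide the upper bound on boundary values needed for the main
estimate. -/
def hull (B : Set (ℤ × ℤ)) (k : Vtx → ℤ) : Set Vtx := {x | ∃ o ∈ outer B, Conn adjV (outer B ∪ {x | 2 ≤ k x}) o x}

theorem conn_faces {S : Set (ℤ × ℤ)} {v c c' : ℤ × ℤ} (h : Inc c v) (h' : Inc c' v) (hS : ∀ c, Inc c v → c ∈ S) :
    Conn adj4 S c c' := by
  refine ((Conn.refl (hS c h)).tail (b := c) (c := (c.1, c'.2)) ?_ (hS _ ?_)).tail ?_ (hS _ h') <;>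
    simp only [Inc, adj4, true_and] at * <;> omega

/-- A site of height at least `2` has height at least `3` by parity, so its four faces all have
height at least `2`. Passing through a site is thus replaced by a 4-path of high faces around it. -/
theorem exists_high_path {B : Set (ℤ × ℤ)} {k : Vtx → ℤ} (hk : k ∈ Hom) {c0 : ℤ × ℤ} (h : (inr c0 : Vtx) ∈ hull B k)
    (h0 : ∀ v, Inc c0 v → v ∈ B) : ∃ c1, (∃ v, Inc c1 v ∧ v ∉ B) ∧ Conn adj4 (high k) c1 c0 := by
  obtain ⟨o, ho, hc⟩ := h
  have key := hc.rec' (p := fun x => x ∉ outer B → ∀ c, (x = inr c ∨ ∃ v, x = inl v ∧ Inc c v) →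
    ∃ c1, (∃ v, Inc c1 v ∧ v ∉ B) ∧ Conn adj4 (high k) c1 c) (fun h => absurd ho h) ?_
  · exact key (fun ⟨v, hv, hvB⟩ => hvB (h0 v hv)) c0 (.inl rfl)
  rintro x y - ⟨c', v, hcv, ⟨rfl, rfl⟩ | ⟨rfl, rfl⟩⟩ hy ih hyo c hc
  · have hv : v ∈ B := by_contra fun h => hyo ⟨v, hcv, h⟩
    obtain rfl : c' = c := by
      rcases hc with h | ⟨v, h, -⟩
      · exact Sum.inr.inj h
      · cases h
    exact ih (fun h => h hv) c' (.inr ⟨v, rfl, hcv⟩)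
  · have h2 : 2 ≤ k (inl v) := hy.resolve_left hyo
    obtain ⟨m, hm⟩ := hk.2.1 v
    have hS : ∀ c, Inc c v → c ∈ high k := fun c h => by
      have := hk.1 c v h
      simp only [high, Set.mem_ofPred_eq]; omega
    have hcv' : Inc c v := by
      rcases hc with h | ⟨v, h, h'⟩
      · cases h
      · cases h; exact h'
    by_cases hx : (inr c' : Vtx) ∈ outer B
    · exact ⟨c', hx, conn_faces hcv hcv' hS⟩
    · obtain ⟨c1, h1, h2⟩ := ih hx c' (.inl rfl)
      exact ⟨c1, h1, h2.trans (conn_faces hcv hcv' hS)⟩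

/-- No face around the inner box is reached. -/
def Sealed (B : Set (ℤ × ℤ)) (R : Set (ℤ × ℤ)) (k : Vtx → ℤ) : Prop := ∀ v ∈ R, ∀ c, Inc c v → (inr c : Vtx) ∉ hull B k

/-- A path of high faces from the inner box to the outside traverses one of the four rectangles
making up the annulus in its short direction. -/
theorem sealed_of_no_cross {k : Vtx → ℤ} (hk : k ∈ Hom) {X0 X1 Y0 Y1 x0 x1 y0 y1 : ℤ} (hX0 : X0 < x0)
    (hX1 : x1 < X1) (hY0 : Y0 < y0) (hY1 : y1 < Y1) (hx : x0 ≤ x1) (hy : y0 ≤ y1)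
    (h1 : ¬ CrossY (high k) (X0 - 1) X1 (Y0 - 1) (y0 - 1)) (h2 : ¬ CrossY (high k) (X0 - 1) X1 y1 Y1)
    (h3 : ¬ CrossX (high k) (X0 - 1) (x0 - 1) (Y0 - 1) Y1) (h4 : ¬ CrossX (high k) x1 X1 (Y0 - 1) Y1) :
    Sealed (box X0 X1 Y0 Y1) (box x0 x1 y0 y1) k := by
  intro v0 hv0 c0 hcv0 hmem
  have hc0 : x0 - 1 ≤ c0.1 ∧ c0.1 ≤ x1 ∧ y0 - 1 ≤ c0.2 ∧ c0.2 ≤ y1 := by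
    simp only [mem_box, Inc] at hv0 hcv0; omega
  obtain ⟨c1, ⟨v, hv, hvB⟩, hc⟩ := exists_high_path hk hmem (fun v hv => by simp only [mem_box, Inc] at *; omega)
  have hext : c1 ∉ box X0 (X1 - 1) Y0 (Y1 - 1) := fun h => hvB (by simp only [mem_box, Inc] at *; omega)
  obtain ⟨c2, h5, h6⟩ : ∃ c2, c2 ∉ box X0 (X1 - 1) Y0 (Y1 - 1) ∧
      Conn adj4 (high k ∩ box (X0 - 1) X1 (Y0 - 1) Y1) c0 c2 := by
    rcases hc.symm4.first_exit (box X0 (X1 - 1) Y0 (Y1 - 1)) (by simp only [mem_box]; omega) with h | ⟨a, b, h, hab, hb, hbB⟩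
    · exact absurd h.right.2 hext
    · have h' : Conn adj4 (high k ∩ box (X0 - 1) X1 (Y0 - 1) Y1) c0 a := h.mono fun u hu => ⟨hu.1, by
        have := hu.2
        simp only [mem_box] at *; omega⟩
      refine ⟨b, hbB, h'.tail hab ⟨hb, ?_⟩⟩
      · have := h.right.2
        simp only [mem_box, adj4] at *; omega
  have h7 := h6.right.2
  have vert : ∀ {a b : ℤ × ℤ} {y y' : ℤ}, y ≤ y' → Y0 - 1 ≤ y → y' ≤ Y1 → a.2 ≤ y → y' ≤ b.2 →
      Conn adj4 (high k ∩ box (X0 - 1) X1 (Y0 - 1) Y1) a b → CrossY (high k) (X0 - 1) X1 y y' := by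
    intro a b y y' hyy _ _ ha hb h
    obtain ⟨s, t, hst⟩ := h.sub_rows hyy ha hb
    refine ⟨_, _, rfl, rfl, hst.mono fun u hu => ⟨hu.1.1, ?_⟩⟩
    have e1 := hu.1.2
    have e2 := hu.2
    simp only [mem_box, mem_rows] at *; omega
  have horz : ∀ {a b : ℤ × ℤ} {x x' : ℤ}, x ≤ x' → X0 - 1 ≤ x → x' ≤ X1 → a.1 ≤ x → x' ≤ b.1 →
      Conn adj4 (high k ∩ box (X0 - 1) X1 (Y0 - 1) Y1) a b → CrossX (high k) x x' (Y0 - 1) Y1 := by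
    intro a b x x' hxx _ _ ha hb h
    have h' := h.map (r' := adj4) (T := Prod.swap ⁻¹' (high k ∩ box (X0 - 1) X1 (Y0 - 1) Y1)) Prod.swap
      (fun u hu => by simpa using hu) (fun u v _ _ h => adj4_swap.2 h)
    obtain ⟨s, t, hst⟩ := h'.sub_rows hxx ha hb
    refine ⟨(x, s), (x', t), rfl, rfl, hst.map (r' := adj4) (T := high k ∩ box x x' (Y0 - 1) Y1) Prod.swap ?_
      (fun u v _ _ h => adj4_swap.2 h)⟩
    refine fun u hu => ⟨hu.1.1, ?_⟩
    have e1 := hu.1.2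
    have e2 := hu.2
    simp only [mem_box, mem_rows, Prod.fst_swap, Prod.snd_swap] at *; omega
  simp only [mem_box] at h5 h7
  by_cases e1 : c2.2 = Y0 - 1
  · exact h1 (vert (by omega) (by omega) (by omega) (by omega) (by omega) h6.symm4)
  by_cases e2 : c2.2 = Y1
  · exact h2 (vert (by omega) (by omega) (by omega) (by omega) (by omega) h6)
  by_cases e3 : c2.1 = X0 - 1
  · exact h3 (horz (by omega) (by omega) (by omega) (by omega) (by omega) h6.symm4)
  · exact h4 (horz (by omega) (by omega) (by omega) (by omega) (by omega) h6)

theorem highConst_nonneg (N : ℕ) : 0 ≤ highConst N := by unfold highConst; positivity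

/-- The four rectangles are free of high crossings with the product of the probabilities at least,
these being decreasing events. -/
theorem Base.pr_sealed {D M : Set (ℤ × ℤ)} (hB : Base D M) {X0 X1 Y0 Y1 x0 x1 y0 y1 : ℤ} {H : ℤ} {N : ℕ} (hH : 0 ≤ H)
    (hX0 : X0 + 3 * H + 2 ≤ x0) (hX1 : x1 + 3 * H + 2 ≤ X1) (hY0 : Y0 + 3 * H + 2 ≤ y0) (hY1 : y1 + 3 * H + 2 ≤ Y1)
    (hx : x0 ≤ x1) (hy : y0 ≤ y1) (hM : box (X0 - 1) X1 (Y0 - 1) Y1 ⊆ M) (hN : 0 < N)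
    (hw : X1 - X0 + 1 < N * (H / 16 + 1)) (hw' : Y1 - Y0 + 1 < N * (H / 16 + 1)) :
    highConst N ^ 4 ≤ pr (baseF D M) (flat ∅) {k | Sealed (box X0 X1 Y0 Y1) (box x0 x1 y0 y1) k} := by
  have sub : ∀ {a b c d : ℤ}, X0 - 1 ≤ a → b ≤ X1 → Y0 - 1 ≤ c → d ≤ Y1 → box a b c d ⊆ M := fun _ _ _ _ v hv =>
    hM (by simp only [mem_box] at *; omega)
  have p1 := hB.pr_no_crossY (x0 := X0 - 1) (x1 := X1) (y0 := Y0 - 1) (y1 := y0 - 1)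
    (sub le_rfl le_rfl le_rfl (by omega)) hH (by omega) hN (by omega)
  have p2 := hB.pr_no_crossY (x0 := X0 - 1) (x1 := X1) (y0 := y1) (y1 := Y1)
    (sub le_rfl le_rfl (by omega) le_rfl) hH (by omega) hN (by omega)
  have p3 := hB.pr_no_crossX (x0 := X0 - 1) (x1 := x0 - 1) (y0 := Y0 - 1) (y1 := Y1)
    (sub le_rfl (by omega) (by omega) le_rfl) hH (by omega) hN (by omega)
  have p4 := hB.pr_no_crossX (x0 := x1) (x1 := X1) (y0 := Y0 - 1) (y1 := Y1)
    (sub (by omega) le_rfl (by omega) le_rfl) hH (by omega) hN (by omega)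
  have lowY : ∀ a b c d, IsLowerSet {k : Vtx → ℤ | ¬ CrossY (high k) a b c d} := fun _ _ _ _ k k' h hk h' =>
    hk (h'.mono (high_mono h))
  have lowX : ∀ a b c d, IsLowerSet {k : Vtx → ℤ | ¬ CrossX (high k) a b c d} := fun _ _ _ _ k k' h hk h' =>
    hk (h'.mono (high_mono h))
  have c0 := highConst_nonneg N
  have q1 := (mul_le_mul p1 p2 c0 pr_nonneg).trans
    (pr_mul_le_of_lower hB.finite (flat_hom ∅) (lowY _ _ _ _) (lowY _ _ _ _))
  have q2 := (mul_le_mul p3 p4 c0 pr_nonneg).trans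
    (pr_mul_le_of_lower hB.finite (flat_hom ∅) (lowX _ _ _ _) (lowX _ _ _ _))
  have q3 := (mul_le_mul q1 q2 (mul_nonneg c0 c0) pr_nonneg).trans
    (pr_mul_le_of_lower hB.finite (flat_hom ∅) ((lowY _ _ _ _).inter (lowY _ _ _ _)) ((lowX _ _ _ _).inter (lowX _ _ _ _)))
  rw [show highConst N ^ 4 = highConst N * highConst N * (highConst N * highConst N) by ring]
  refine q3.trans (pr_mono hB.finite fun k hk h => ?_)
  exact sealed_of_no_cross hk.1 (by omega) (by omega) (by omega) (by omega) hx hy h.1.1 h.1.2 h.2.1 h.2.2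

end SquareIce

namespace SquareIce
open Sum

/-! ### Crossing clusters of odd sites away from the hull -/

def rim (K : Set Vtx) : Set Vtx := {x | x ∉ K ∧ ∃ y ∈ K, adjV y x}

theorem outer_hull {B : Set (ℤ × ℤ)} {k : Vtx → ℤ} {x : Vtx} (h : x ∈ outer B) : x ∈ hull B k :=
  ⟨x, h, .refl (.inl h)⟩

theorem hull_tail {B : Set (ℤ × ℤ)} {k : Vtx → ℤ} {x y : Vtx} (h : x ∈ hull B k) (hxy : adjV x y) (hy : 2 ≤ k y) :
    y ∈ hull B k := by
  obtain ⟨o, ho, hc⟩ := h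
  exact ⟨o, ho, hc.tail hxy (.inr hy)⟩

theorem rim_le {B : Set (ℤ × ℤ)} {k : Vtx → ℤ} {x : Vtx} (h : x ∈ rim (hull B k)) : k x ≤ 1 := by
  obtain ⟨h1, y, hy, hyx⟩ := h
  by_contra h
  exact h1 (hull_tail hy hyx (by omega))

/-- The exploration only reads heights on the hull and on its rim, so `hull B k` and these heights
can be conditioned on. -/
theorem hull_congr {B : Set (ℤ × ℤ)} {k k' : Vtx → ℤ} (h : ∀ x ∈ hull B k ∪ rim (hull B k), k' x = k x) :
    hull B k' = hull B k := by
  ext x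
  constructor
  · rintro ⟨o, ho, hc⟩
    refine hc.rec' (p := fun x => x ∈ hull B k) (outer_hull ho) ?_
    intro u v _ huv hv hu
    by_contra hn
    have := h v (.inr ⟨hn, u, hu, huv⟩)
    rcases hv with hv | hv
    · exact hn (outer_hull hv)
    · exact hn (hull_tail hu huv (by rw [← this]; exact hv))
  · rintro ⟨o, ho, hc⟩
    refine ⟨o, ho, hc.reach.mono fun v hv => ?_⟩
    rcases Conn.right hv with h' | h'
    · exact .inl h'
    · refine .inr ?_
      have := h v (.inl ⟨o, ho, hv⟩)
      simp only [Set.mem_ofPred_eq] at h' ⊢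
      omega

theorem hull_face {B : Set (ℤ × ℤ)} {k : Vtx → ℤ} (hk : k ∈ Hom) {v c : ℤ × ℤ} (h : (inl v : Vtx) ∈ hull B k)
    (hcv : Inc c v) : (inr c : Vtx) ∈ hull B k := by
  by_cases hv : v ∈ B
  · refine hull_tail h ⟨c, v, hcv, .inl ⟨rfl, rfl⟩⟩ ?_
    obtain ⟨o, ho, hc⟩ := h
    have h2 : 2 ≤ k (inl v) := hc.right.resolve_left fun h => h hv
    have h3 := hk.1 c v hcv
    obtain ⟨m, hm⟩ := hk.2.1 v
    omega
  · exact outer_hull ⟨v, hcv, hv⟩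

open Classical in
/-- The values on the hull and its neighbours. -/
noncomputable def cls (B : Set (ℤ × ℤ)) (k : Vtx → ℤ) : Vtx → Option ℤ :=
  fun x => if x ∈ hull B k ∪ rim (hull B k) then some (k x) else none

theorem cls_eq {B : Set (ℤ × ℤ)} {k k' : Vtx → ℤ} :
    cls B k' = cls B k ↔ ∀ x ∈ hull B k ∪ rim (hull B k), k' x = k x := by
  constructor
  · intro h x hx
    have := congrFun h x
    rw [cls, cls, if_pos hx] at this
    split_ifs at this with h'
    exact Option.some.inj this
  · intro h
    funext x
    rw [cls, cls, hull_congr h]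
    split_ifs with h'
    · rw [h x h']
    · rfl

/-- Folding of the values exceeding `1`. -/
def fold (k : Vtx → ℤ) : Vtx → ℤ := fun x => 1 - |k x - 1|

theorem fold_hom {k : Vtx → ℤ} (hk : k ∈ Hom) : fold k ∈ Hom := by
  refine ⟨fun c v hcv => ?_, fun v => ?_, fun c => ?_⟩
  · have := hk.1 c v hcv
    simp only [fold]
    rcases abs_cases (k (inl v) - 1) with h | h <;> rcases abs_cases (k (inr c) - 1) with h' | h' <;> omega
  · have h := hk.2.1 v
    simp only [fold]
    rw [Int.odd_iff] at *
    rcases abs_cases (k (inl v) - 1) with h | h <;> omega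
  · have h := hk.2.2 c
    simp only [fold]
    rw [Int.even_iff] at *
    rcases abs_cases (k (inr c) - 1) with h | h <;> omega

theorem fold_le (k : Vtx → ℤ) (x : Vtx) : fold k x ≤ 1 := by
  simp only [fold]; have := abs_nonneg (k x - 1); omega

theorem fold_of_le {k : Vtx → ℤ} {x : Vtx} (h : k x ≤ 1) : fold k x = k x := by
  simp only [fold]; rcases abs_cases (k x - 1) with h | h <;> omega

theorem sum_ncard_eq {α : Type*} (G : Finset α) (s : Finset ℤ) (f : α → Set ℤ) (hf : ∀ k, f k ⊆ s) :
    ∑ k ∈ G, (f k).ncard = ∑ x ∈ s, {k | k ∈ G ∧ x ∈ f k}.ncard := by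
  classical
  have h := Finset.sum_card_bipartiteAbove_eq_sum_card_bipartiteBelow (s := G) (t := s) (fun k x => x ∈ f k)
  rw [Finset.sum_congr rfl fun k _ => ?_, h, Finset.sum_congr rfl fun x _ => ?_]
  · rw [← Set.ncard_coe_finset]; congr 1; ext k; simp [Finset.bipartiteBelow]
  · rw [← Set.ncard_coe_finset]; congr 1; ext x; simp only [Finset.bipartiteAbove, Finset.coe_filter, Set.mem_ofPred_eq]
    exact ⟨fun h => ⟨hf k h, h⟩, fun h => h.2⟩

def hullFaces (B : Set (ℤ × ℤ)) (k : Vtx → ℤ) : Set (ℤ × ℤ) := {c | (inr c : Vtx) ∈ hull B k}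

variable {D M : Set (ℤ × ℤ)}

/-- Folding brings the prescribed values on the hull down to at most `1` and leaves the rim
unchanged. The faces of the hull are declared disabled, and sealing keeps the hull and its rim away
from the core of `R`. -/
theorem admissible_hull (hB : Base D M) {B R : Set (ℤ × ℤ)} {κ : Vtx → ℤ} (hκ : κ ∈ Om (baseF D M) (flat ∅))
    (hs : Sealed B R κ) (hD : ∀ v ∈ core R, ∀ c, Inc c v → c ∈ D) :
    Admissible (baseF D M ∪ (hull B κ ∪ rim (hull B κ))) (fold κ) (hullFaces B κ) R where
  finite := hB.finite.subset (Set.compl_subset_compl.2 Set.subset_union_left)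
  hom := fold_hom hκ.1
  le_one v _ := fold_le κ v
  disabled c hc := .inr (.inl hc)
  site v hv h := by
    have hvR : v ∈ R := hv v (by simp only [adj8]; omega)
    rcases h with h | h | ⟨-, y, hy, hyv⟩
    · have := base_inl hκ h
      rw [fold_of_le (by omega)]; omega
    · exact absurd (hull_face hκ.1 h (Inc.self v)) (hs v hvR v (Inc.self v))
    · obtain ⟨c, u, hcu, ⟨rfl, h⟩ | ⟨rfl, h⟩⟩ := hyv
      · cases h
      · cases h; exact absurd hy (hs v hvR c hcu)
  face v hv c hcv h := by
    have hvR : v ∈ R := hv v (by simp only [adj8]; omega)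
    rcases h with h | h | ⟨-, y, hy, hyc⟩
    · exact h (hD v hv c hcv)
    · exact hs v hvR c hcv h
    · obtain ⟨c', u, hcu, ⟨rfl, h⟩ | ⟨rfl, h⟩⟩ := hyc
      · cases h
        exact hs u (hv u (hcu.adj8 hcv)) c hcu (hull_face hκ.1 hy hcu)
      · cases h

/-- All faces of a site of the hull are in the hull, hence disabled, so a cluster starting in `R`
never contains or touches a site of the hull. -/
theorem reps_congr_off_hull {B R : Set (ℤ × ℤ)} {κ : Vtx → ℤ} (hκ : κ ∈ Hom) (hs : Sealed B R κ) {k k' : Vtx → ℤ}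
    (h : ∀ v ∉ hull B κ, k' v = k v) {y0 y1 x : ℤ} (hx : x ∈ reps (hullFaces B κ) R y0 y1 k) :
    x ∈ reps (hullFaces B κ) R y0 y1 k' := by
  have hx' := reps_mem hx
  have off : ∀ {u v}, adjK (hullFaces B κ) u v → (inl v : Vtx) ∉ hull B κ := by
    rintro u v ⟨c, hc, -, hcv⟩ hv
    exact hc (hull_face hκ hv hcv)
  have e : cluster (hullFaces B κ) k' (x, y0) = cluster (hullFaces B κ) k (x, y0) := by
    refine cluster_congr (cluster_white hx'.1) fun v hv => h _ ?_
    rcases hv with hv | ⟨u, -, huv⟩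
    · refine Conn.rec' (p := fun v => (inl v : Vtx) ∉ hull B κ) hv ?_ fun u v _ huv _ _ => off huv
      exact fun h => hs _ hx'.2 _ (Inc.self _) (hull_face hκ h (Inc.self _))
    · exact off huv
  show IsRep _ _ _ _ _
  rw [e]; exact hx

/-- Given the heights on hull and rim, the configuration off the hull has the same law as with
folded values prescribed there, by `Om.glue`. The main estimate for the folded values therefore
holds within each class. -/
theorem Base.sum_reps_cls_le (hB : Base D M) {B : Set (ℤ × ℤ)} {y0 y1 w : ℤ} (Rg : Region y0 y1 w) {κ : Vtx → ℤ}
    (hκ : κ ∈ Om (baseF D M) (flat ∅)) (hs : Sealed B Rg.R κ) (hD : ∀ v ∈ core Rg.R, ∀ c, Inc c v → c ∈ D)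
    {H : ℤ} {N : ℕ} (hH : 0 ≤ H) (h0 : y0 < -H) (h1 : 2 * H < y1) (hN : 0 < N) (hw : w < N * (H / 16 + 1))
    (G : Finset (Vtx → ℤ)) (hG : ∀ k, k ∈ G ↔ k ∈ Om (baseF D M) (flat ∅) ∧ cls B k = cls B κ) :
    ∑ k ∈ G, (reps (hullFaces B k) Rg.R y0 y1 k).ncard ≤ 1800 * N * G.card := by
  have hA := admissible_hull hB hκ hs hD
  set F' := baseF D M ∪ (hull B κ ∪ rim (hull B κ)) with hF'
  have hpos : 0 < (Om F' (fold κ)).ncard := (Set.ncard_pos (Om.finite hA.finite _)).2 (Om.self_mem hA.hom)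
  have e1 : ∑ k ∈ G, (reps (hullFaces B k) Rg.R y0 y1 k).ncard =
      ∑ k ∈ G, (reps (hullFaces B κ) Rg.R y0 y1 k).ncard := by
    refine Finset.sum_congr rfl fun k hk => ?_
    rw [hullFaces, hull_congr (cls_eq.1 ((hG k).1 hk).2)]; rfl
  have hsub : ∀ k, reps (hullFaces B κ) Rg.R y0 y1 k ⊆ ((Finset.Icc 0 w : Finset ℤ) : Set ℤ) := fun k => by
    rw [Finset.coe_Icc]; exact reps_sub Rg
  have e2 := Rg.sum_reps_le hA hH h0 h1 hN hw
  rw [sum_ncard_eq _ _ _ hsub] at e2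
  rw [e1, sum_ncard_eq _ _ _ hsub]
  refine Nat.le_of_mul_le_mul_right ?_ hpos
  have glue : ∀ x, {k | k ∈ G ∧ x ∈ reps (hullFaces B κ) Rg.R y0 y1 k}.ncard * (Om F' (fold κ)).ncard =
      G.card * {k | k ∈ (Om.finite hA.finite (fold κ)).toFinset ∧ x ∈ reps (hullFaces B κ) Rg.R y0 y1 k}.ncard := by
    intro x
    have key := Om.glue (F := baseF D M) (I := hull B κ) (B := rim (hull B κ)) hB.finite (ξ := flat ∅) (ξ' := fold κ)
      (𝒜 := {k | cls B k = cls B κ}) (W := {k | x ∈ reps (hullFaces B κ) Rg.R y0 y1 k})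
      (fun v c hcv hv => .inl (hull_face hκ.1 hv hcv))
      (fun v c hcv hc => ?_)
      (fun v hv => ?_)
      (fun k hk hk𝒜 v hv => ?_)
      (fun k hk k' h => ?_)
      (fun k hk k' h => reps_congr_off_hull hκ.1 hs h hk)
    · convert key using 2
      · congr 1
        ext k
        simp only [hG, Set.mem_inter_iff, Set.mem_ofPred_eq]
      · rw [← Set.ncard_coe_finset]
        congr 1
        ext k
        rw [Finset.mem_coe, hG]; rfl
      · congr 1
        ext k
        simp only [Set.Finite.mem_toFinset, Set.mem_inter_iff, Set.mem_ofPred_eq, hF']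
    · by_cases h : (inl v : Vtx) ∈ hull B κ
      · exact .inl h
      · exact .inr ⟨h, _, hc, c, v, hcv, .inr ⟨rfl, rfl⟩⟩
    · have h := hκ.2 v hv.1
      have h' : flat ∅ v ≤ 1 := by
        rcases v with v | c
        · rcases flat_cases ∅ v with h | h <;> omega
        · rw [flat_inr]; omega
      rw [fold_of_le (by omega), h]
    · rw [cls_eq.1 hk𝒜 v (.inr hv), fold_of_le (rim_le hv)]
    · refine cls_eq.2 fun x hx => ?_
      rw [h x hx, cls_eq.1 hk x hx]
  calc _ = ∑ x ∈ Finset.Icc 0 w, G.card *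
        {k | k ∈ (Om.finite hA.finite (fold κ)).toFinset ∧ x ∈ reps (hullFaces B κ) Rg.R y0 y1 k}.ncard := by
        rw [Finset.sum_mul]; exact Finset.sum_congr rfl fun x _ => glue x
    _ ≤ G.card * (1800 * N * (Om F' (fold κ)).ncard) := by
        rw [← Finset.mul_sum]; exact Nat.mul_le_mul_left _ e2
    _ = _ := by ring

theorem sealed_congr {B R : Set (ℤ × ℤ)} {k k' : Vtx → ℤ} (h : cls B k' = cls B k) :
    Sealed B R k' ↔ Sealed B R k := by
  simp only [Sealed, hull_congr (cls_eq.1 h)]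

theorem Base.sum_reps_sealed_le (hB : Base D M) {B : Set (ℤ × ℤ)} {y0 y1 w : ℤ} (Rg : Region y0 y1 w)
    (hD : ∀ v ∈ core Rg.R, ∀ c, Inc c v → c ∈ D)
    {H : ℤ} {N : ℕ} (hH : 0 ≤ H) (h0 : y0 < -H) (h1 : 2 * H < y1) (hN : 0 < N) (hw : w < N * (H / 16 + 1))
    (G : Finset (Vtx → ℤ)) (hG : ∀ k, k ∈ G ↔ k ∈ Om (baseF D M) (flat ∅) ∧ Sealed B Rg.R k) :
    ∑ k ∈ G, (reps (hullFaces B k) Rg.R y0 y1 k).ncard ≤ 1800 * N * G.card := by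
  classical
  have hmaps : ∀ k ∈ G, cls B k ∈ G.image (cls B) := fun k hk => Finset.mem_image_of_mem _ hk
  rw [← Finset.sum_fiberwise_of_maps_to hmaps, Finset.card_eq_sum_card_fiberwise hmaps, Finset.mul_sum]
  refine Finset.sum_le_sum fun b hb => ?_
  obtain ⟨κ, hκ, rfl⟩ := Finset.mem_image.1 hb
  obtain ⟨hκ1, hκ2⟩ := (hG κ).1 hκ
  refine hB.sum_reps_cls_le Rg hκ1 hκ2 hD hH h0 h1 hN hw _ fun k => ?_
  rw [Finset.mem_filter, hG]
  exact ⟨fun h => ⟨h.1.1, h.2⟩, fun h => ⟨⟨h.1, (sealed_congr h.2).2 hκ2⟩, h.2⟩⟩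

end SquareIce

namespace SquareIce
open Sum

/-! ### Absence of white crossings with positive probability -/

def black (k : Vtx → ℤ) : Set (ℤ × ℤ) := {v | k (inl v) ≤ -1}

def Region.cut {Y0 Y1 w : ℤ} (Rh : Region Y0 Y1 w) (y0 y1 : ℤ) : Region y0 y1 w where
  R := Rh.R ∩ rows y0 y1
  sub v hv := by
    have h1 := Rh.sub hv.1
    have h2 := hv.2
    simp only [mem_box, mem_rows] at *; omega
  convex v hv := by
    by_cases h : v ∈ Rh.R
    · have h' : v ∉ rows y0 y1 := fun h' => hv ⟨h, h'⟩
      exact .inl fun x _ hx => h' hx.2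
    · exact (Rh.convex v h).imp (fun h x hx hx' => h x hx hx'.1) (fun h x hx hx' => h x hx hx'.1)

/-- Enabled faces have all corners in the box, so a cluster starting from a white crossing stays in
the rows `Y0` to `Y1`. A black crossing of these rows between two white ones then keeps their
clusters distinct. Starting points are compared on the bottom row `Y0`, clusters are counted in the
thinner strip. -/
theorem le_ncard_reps_of_alternating {k : Vtx → ℤ} {X0 X1 Y0 Y1 w : ℤ} (Rh : Region Y0 Y1 w)
    {y0 y1 : ℤ} (h0 : Y0 ≤ y0) (h01 : y0 ≤ y1) (h1 : y1 ≤ Y1)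
    (hs : Sealed (box X0 X1 Y0 Y1) (Rh.cut y0 y1).R k) {e : ℕ → ℤ} (he : Monotone e) {n : ℕ}
    (hwhite : ∀ i < n, ∃ x, e (2 * i) ≤ x ∧ x < e (2 * i + 1) ∧ CrossFrom (white k ∩ Rh.R) Y0 Y1 x)
    (hblack : ∀ i < n, ∃ x, e (2 * i + 1) ≤ x ∧ x < e (2 * i + 2) ∧ CrossFrom (black k ∩ Rh.R) Y0 Y1 x) :
    n ≤ (reps (hullFaces (box X0 X1 Y0 Y1) k) (Rh.cut y0 y1).R y0 y1 k).ncard := by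
  classical
  set Kf := hullFaces (box X0 X1 Y0 Y1) k with hKf
  have hrows : ∀ v ∈ Rh.R, v ∈ rows Y0 Y1 := fun v hv => by
    have := Rh.sub hv
    simp only [mem_box, mem_rows] at *; omega
  have step : ∀ u v, adjK Kf u v → v ∈ rows Y0 Y1 ∧ u ∈ rows Y0 Y1 := by
    rintro u v ⟨c, hc, hcu, hcv⟩
    have hin : ∀ v, Inc c v → v ∈ rows Y0 Y1 := fun v hcv => by
      have : v ∈ box X0 X1 Y0 Y1 := by_contra fun h => hc (outer_hull ⟨v, hcv, h⟩)
      simp only [mem_box, mem_rows] at *; omega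
    exact ⟨hin v hcv, hin u hcu⟩
  have pick : ∀ i < n, ∃ z, z ∈ reps Kf (Rh.cut y0 y1).R y0 y1 k ∧ ∃ x, e (2 * i) ≤ x ∧ x < e (2 * i + 1) ∧
      Conn adj8 (white k ∩ rows Y0 Y1) (x, Y0) (z, y0) := by
    intro i hi
    obtain ⟨x, hx1, hx2, t, ht⟩ := hwhite i hi
    obtain ⟨a, b, hab⟩ := ht.reach.sub_rows h01 h0 h1
    have hcr : CrossFrom (white k ∩ (Rh.cut y0 y1).R) y0 y1 a := ⟨b, hab.mono fun v hv => by
      have h := Conn.right hv.1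
      exact ⟨h.1, h.2, hv.2⟩⟩
    have hstart : Conn adj4 (white k ∩ Rh.R) (x, Y0) (a, y0) := hab.left.1
    obtain ⟨z, hz, hc⟩ := exists_rep (Rh.cut y0 y1) (Kf := Kf) (fun v hv => hs v hv v (Inc.self v)) hcr
    refine ⟨z, hz, x, hx1, hx2, ?_⟩
    have h2 : Conn adj8 (white k ∩ rows Y0 Y1) (x, Y0) (a, y0) :=
      hstart.to8.mono fun v hv => ⟨hv.1, hrows v hv.2⟩
    refine h2.trans (hc.rec' (p := fun v => Conn adj8 (white k ∩ rows Y0 Y1) (a, y0) v) (.refl h2.right) ?_)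
    rintro u v _ huv hv ih
    obtain ⟨c, -, hcu, hcv⟩ := id huv
    exact ih.tail (hcu.adj8 hcv) ⟨hv, (step u v huv).1⟩
  choose! z hz x hx1 hx2 hxz using pick
  have sep : ∀ i j, i < j → j < n → z i ≠ z j := by
    intro i j hij hj hzz
    have hi : i < n := hij.trans hj
    obtain ⟨p, hp1, hp2, q, hpq⟩ := hblack i hi
    have hc := (hxz i hi).trans (hzz ▸ (hxz j hj).symm8)
    have m1 : e (2 * i + 2) ≤ e (2 * j) := he (by omega)
    have m2 := hx1 j hj
    have m3 := hx2 i hi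
    refine no_cross_strip hpq (fun v hv => hrows v hv.2) hc (fun v hv => ?_) (.inl ⟨rfl, ?_⟩) (.inl ⟨rfl, ?_⟩)
    · refine ⟨hv.2.1, hv.2.2, fun h => ?_⟩
      have h1 := hv.1
      have h2 := h.1
      simp only [white, black, Set.mem_ofPred_eq] at h1 h2; omega
    · dsimp only; omega
    · dsimp only; omega
  have hinj : Set.InjOn z (Finset.range n : Set ℕ) := by
    intro i hi j hj hzz
    simp only [Finset.coe_range, Set.mem_Iio] at hi hj
    rcases lt_trichotomy i j with h | h | h
    · exact absurd hzz (sep i j h hj)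
    · exact h
    · exact absurd hzz.symm (sep j i h hi)
  calc n = (z '' (Finset.range n : Set ℕ)).ncard := by
        rw [hinj.ncard_image, Set.ncard_coe_finset, Finset.card_range]
    _ ≤ _ := by
        refine Set.ncard_le_ncard ?_ (reps_finite _)
        rintro _ ⟨i, hi, rfl⟩
        exact hz i (by simpa using hi)

/-- Either a supermultiplicative interval function is not small, or there are many consecutive intervals where it
is small. -/
theorem exists_cuts {f : ℤ → ℤ → ℝ} (h0 : ∀ a, 1 ≤ f a a) (hmul : ∀ a b c, f a b * f b c ≤ f a c)
    (hone : ∀ a, 1 / 2 ≤ f a (a + 1)) {δ : ℝ} (hδ : 0 < δ) (hδ1 : δ < 1) {w : ℤ} (j : ℕ) :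
    ∀ a ≤ w, (δ / 2) ^ j ≤ f a w ∨ ∃ e : ℕ → ℤ, Monotone e ∧ e 0 = a ∧ ∀ i < j, f (e i) (e (i + 1)) ≤ δ := by
  induction j with
  | zero => exact fun a _ => .inr ⟨fun _ => a, monotone_const, rfl, fun i hi => absurd hi (Nat.not_lt_zero i)⟩
  | succ j ih =>
    intro a haw
    have hle1 : (δ / 2) ^ j ≤ 1 := pow_le_one₀ (by positivity) (by linarith)
    have hpow : (δ / 2) ^ (j + 1) ≤ δ := by
      rw [pow_succ]; nlinarith [pow_pos (half_pos hδ) j]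
    by_cases hsmall : f a w ≤ δ
    swap
    · left; linarith
    have hex : ∃ m : ℕ, f a (a + m) ≤ δ := ⟨(w - a).toNat, by
      rw [Int.toNat_of_nonneg (by omega)]; rwa [show a + (w - a) = w by ring]⟩
    classical
    -- The shortest initial interval on which `f` is at most `δ` is cut off, and the induction
    -- continues on the rest.
    set m := Nat.find hex with hm
    have hm1 : f a (a + m) ≤ δ := Nat.find_spec hex
    have hmin : ∀ m' < m, δ < f a (a + m') := fun m' h => not_le.1 (Nat.find_min hex h)
    obtain ⟨m', hm'⟩ : ∃ m', m = m' + 1 := by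
      refine Nat.exists_eq_succ_of_ne_zero fun h => ?_
      rw [h] at hm1
      have := h0 a
      norm_num at hm1; linarith
    have hmw : a + m ≤ w := by
      have : m ≤ (w - a).toNat := Nat.find_min' hex (by
        rw [Int.toNat_of_nonneg (by omega)]; rwa [show a + (w - a) = w by ring])
      omega
    -- By minimality, `f` exceeds `δ` before the last unit step, and that step costs at most a
    -- factor `1 / 2`.
    have hbig : δ / 2 ≤ f a (a + m) := by
      have e1 := hmin m' (by omega)
      have e2 := hone (a + m')
      have e3 := hmul a (a + m') (a + m' + 1)
      rw [show a + (m : ℤ) = a + m' + 1 by rw [hm']; push_cast; ring]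
      nlinarith
    rcases ih (a + m) hmw with h | ⟨e, he, he0, hej⟩
    · left
      have e3 := hmul a (a + m) w
      rw [pow_succ]
      have := mul_le_mul h hbig (by positivity) (le_trans (by positivity) h)
      linarith [mul_comm (f a (a + m)) (f (a + m) w)]
    · right
      refine ⟨fun i => Nat.casesOn i a e, monotone_nat_of_le_succ fun i => ?_, rfl, fun i hi => ?_⟩
      · cases i with
        | zero => show a ≤ e 0; rw [he0]; omega
        | succ i => exact he (Nat.le_succ i)
      · cases i with
        | zero => show f a (e 0) ≤ δ; rw [he0]; exact hm1
        | succ i => exact hej i (by omega)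

theorem pr_univ {F : Set Vtx} (hF : Fᶜ.Finite) {ξ : Vtx → ℤ} (hξ : ξ ∈ Hom) : pr F ξ Set.univ = 1 := by
  rw [pr, Set.inter_univ, div_self (Om.ncard_pos hF (Om.self_mem hξ)).ne']

theorem pr_le_one {F : Set Vtx} (hF : Fᶜ.Finite) {ξ : Vtx → ℤ} (hξ : ξ ∈ Hom) (U : Set (Vtx → ℤ)) : pr F ξ U ≤ 1 := by
  rw [← pr_univ hF hξ]; exact pr_mono hF fun _ _ _ => trivial

theorem pr_forall_lt {F : Set Vtx} (hF : Fᶜ.Finite) {ξ : Vtx → ℤ} (hξ : ξ ∈ Hom) {U : ℕ → Set (Vtx → ℤ)} {δ : ℝ}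
    {m : ℕ} (h : ∀ i < m, pr F ξ (U i)ᶜ ≤ δ) : 1 - m * δ ≤ pr F ξ {k | ∀ i < m, k ∈ U i} := by
  induction m with
  | zero => 
    have e : {k : Vtx → ℤ | ∀ i < 0, k ∈ U i} = Set.univ := Set.eq_univ_of_forall fun k i hi => absurd hi (Nat.not_lt_zero i)
    rw [e, pr_univ hF hξ]; simp
  | succ m ih =>
    have h1 := ih fun i hi => h i (by omega)
    have h2 := pr_compl hF (Om.self_mem (F := F) hξ) (U m)
    have h3 := h m (by omega)
    have h4 := pr_union_add_inter hF (ξ := ξ) {k | ∀ i < m, k ∈ U i} (U m)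
    have h5 := pr_le_one hF hξ ({k | ∀ i < m, k ∈ U i} ∪ U m)
    have e : {k | ∀ i < m + 1, k ∈ U i} = {k | ∀ i < m, k ∈ U i} ∩ U m := by
      ext k
      simp only [Set.mem_inter_iff, Set.mem_ofPred_eq]
      exact ⟨fun h => ⟨fun i hi => h i (by omega), h m (by omega)⟩, fun h i hi => by
        rcases Nat.lt_succ_iff_lt_or_eq.1 hi with hi | rfl
        exacts [h.1 i hi, h.2]⟩
    rw [e]
    push_cast
    linarith

variable {D M : Set (ℤ × ℤ)}

theorem white_ng {k : Vtx → ℤ} {R : Set (ℤ × ℤ)} (hR : R ⊆ M) : white (ng D M k) ∩ R = black k ∩ R := by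
  ext v
  refine and_congr_left fun hv => ?_
  simp only [white, black, Set.mem_ofPred_eq, ng_inl (hR hv)]; omega

theorem Base.half_le_pr_not_white (hB : Base D M) {v : ℤ × ℤ} (hv : v ∈ M) :
    1 / 2 ≤ pr (baseF D M) (flat ∅) {k | v ∉ white k} := by
  have h1 := pr_compl hB.finite (Om.self_mem (F := baseF D M) (flat_hom ∅)) {k | v ∈ white k}
  have h2 := hB.pr_ng {k | v ∈ white k}
  have h3 : pr (baseF D M) (flat ∅) {k | ng D M k ∈ {k | v ∈ white k}} =
      pr (baseF D M) (flat ∅) {k | v ∉ white k} := pr_congr fun k hk => by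
    obtain ⟨m, hm⟩ := hk.1.2.1 v
    simp only [white, Set.mem_ofPred_eq, ng_inl hv]; omega
  have e : {k | v ∈ white k}ᶜ = {k : Vtx → ℤ | v ∉ white k} := rfl
  rw [e] at h1
  linarith

/-- The annulus around the strip has side lengths within `w + 6 * H + 5` and `9 * H + 7`, both
fitting in `N + 145` windows. -/
noncomputable def sealConst (N : ℕ) : ℝ := highConst (N + 145) ^ 4

theorem sealConst_pos (N : ℕ) : 0 < sealConst N := pow_pos (highConst_pos (by omega)) 4

/-- The number `n` of clusters that contradicts the mean bound `1800 * N` when it occurs with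
probability at least `sealConst N / 2`. -/
noncomputable def altCount (N : ℕ) : ℕ := ⌊3600 * N / sealConst N⌋₊ + 1

theorem altCount_pos (N : ℕ) : 0 < altCount N := Nat.succ_pos _

theorem lt_altCount (N : ℕ) : 3600 * N < altCount N * sealConst N := by
  have h := Nat.lt_floor_add_one (3600 * N / sealConst N)
  rw [div_lt_iff₀ (sealConst_pos N)] at h
  rw [altCount]; push_cast; exact h

/-- The failure probability `δ` per interval; over `2 * n` intervals the total failure is half of
`sealConst N`. -/
noncomputable def altProb (N : ℕ) : ℝ := sealConst N / (4 * altCount N)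

theorem altProb_pos (N : ℕ) : 0 < altProb N := by
  have := altCount_pos N
  have := sealConst_pos N
  unfold altProb; positivity

/-- A lower bound for the probability that a strip is not crossed. -/
noncomputable def crossConst (N : ℕ) : ℝ := (altProb N / 2) ^ (2 * altCount N)

theorem crossConst_pos (N : ℕ) : 0 < crossConst N := pow_pos (half_pos (altProb_pos N)) _

theorem Base.pr_no_white (hB : Base D M) {H w : ℤ} {N : ℕ} (hH : 0 ≤ H) (hw0 : 0 ≤ w) (hN : 0 < N)
    (hw : w < N * (H / 16 + 1)) {Y0 Y1 : ℤ} (hY0 : Y0 = -4 * H - 3)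
    (hY1 : Y1 = 5 * H + 3) (Rh : Region Y0 Y1 w)
    (hD : ∀ v ∈ core Rh.R, ∀ c, Inc c v → c ∈ D)
    (hM : box (-3 * H - 3) (w + 3 * H + 2) (Y0 - 1) Y1 ⊆ M) :
    crossConst N ≤ pr (baseF D M) (flat ∅) {k | ∀ x, ¬ CrossFrom (white k ∩ Rh.R) Y0 Y1 x} := by
  set p := sealConst N with hp
  set n := altCount N with hn
  set δ := altProb N with hδ
  have hpp := sealConst_pos N
  have hnp := altCount_pos N
  have hδp := altProb_pos N
  have hfin := hB.finite
  have hflat := flat_hom ∅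
  have hRM : Rh.R ⊆ M := fun v hv => hM (by
    have := Rh.sub hv
    simp only [mem_box] at *; omega)
  have hseal : p ≤ pr (baseF D M) (flat ∅)
      {k | Sealed (box (-3 * H - 2) (w + 3 * H + 2) Y0 Y1) (box 0 w (-H - 1) (2 * H + 1)) k} := by
    refine hB.pr_sealed hH (by omega) (by omega) (by omega) (by omega) hw0 (by omega) ?_ (by omega) ?_ ?_
    · convert hM using 2; ring
    · push_cast
      have : 6 * H + 5 < 145 * (H / 16 + 1) := by omega
      nlinarith
    · push_cast
      have h1 : 9 * H + 7 < 145 * (H / 16 + 1) := by omega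
      have h2 : 0 ≤ (N : ℤ) * (H / 16 + 1) := by positivity
      nlinarith
  have hp1 : p ≤ 1 := hseal.trans (pr_le_one hfin hflat _)
  have hn1 : (1 : ℝ) ≤ n := by exact_mod_cast hnp
  have hδn : 2 * n * δ = p / 2 := by
    rw [hδ, altProb]; field_simp; ring
  have hδ1 : δ < 1 := by nlinarith
  -- The probability that no white crossing starts in `[a, b)`. It is supermultiplicative because
  -- these events are decreasing, and on one point it is at least `1/2` by sign symmetry.
  let f : ℤ → ℤ → ℝ := fun a b =>
    pr (baseF D M) (flat ∅) {k | ∀ x, a ≤ x → x < b → ¬ CrossFrom (white k ∩ Rh.R) Y0 Y1 x}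
  have hlow : ∀ a b, IsLowerSet {k : Vtx → ℤ | ∀ x, a ≤ x → x < b → ¬ CrossFrom (white k ∩ Rh.R) Y0 Y1 x} := by
    rintro a b k k' h hk x hx hx' ⟨t, ht⟩
    exact hk x hx hx' ⟨t, ht.mono (Set.inter_subset_inter_left _ (white_mono h))⟩
  have h0 : ∀ a, 1 ≤ f a a := by
    intro a
    have e : {k : Vtx → ℤ | ∀ x, a ≤ x → x < a → ¬ CrossFrom (white k ∩ Rh.R) Y0 Y1 x} = Set.univ :=
      Set.eq_univ_of_forall fun k x h1 h2 => absurd h2 (not_lt.2 h1)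
    show 1 ≤ pr _ _ _
    rw [e, pr_univ hfin hflat]
  have hmul : ∀ a b c, f a b * f b c ≤ f a c := by
    intro a b c
    refine (pr_mul_le_of_lower hfin hflat (hlow a b) (hlow b c)).trans (pr_mono hfin fun k _ hk x h1 h2 => ?_)
    by_cases h : x < b
    · exact hk.1 x h1 h
    · exact hk.2 x (not_lt.1 h) h2
  have hone : ∀ a, 1 / 2 ≤ f a (a + 1) := by
    intro a
    by_cases ha : (a, Y0) ∈ Rh.R
    · refine (hB.half_le_pr_not_white (hRM ha)).trans (pr_mono hfin fun k _ hk x h1 h2 hc => hk ?_)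
      obtain rfl : x = a := by omega
      obtain ⟨t, ht⟩ := hc
      exact ht.left.1
    · have : (1 : ℝ) / 2 ≤ pr (baseF D M) (flat ∅) Set.univ := by rw [pr_univ hfin hflat]; norm_num
      refine this.trans (pr_mono hfin fun k _ _ x h1 h2 hc => ha ?_)
      obtain rfl : x = a := by omega
      obtain ⟨t, ht⟩ := hc
      exact ht.left.2
  rcases exists_cuts h0 hmul hone hδp hδ1 (w := w + 1) (2 * n) 0 (by omega) with h | ⟨e, he, -, hej⟩
  · refine h.trans (pr_mono hfin fun k _ hk x hx => ?_)
    have hx' : (x, Y0) ∈ Rh.R := by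
      obtain ⟨t, ht⟩ := hx
      exact ht.left.2
    have := Rh.sub hx'
    simp only [mem_box] at this
    exact hk x (by omega) (by omega) hx
  · exfalso
    -- White crossings are required from even intervals and black ones from odd intervals; by sign
    -- symmetry each requirement fails with probability at most `δ`.
    let U : ℕ → Set (Vtx → ℤ) := fun i => if Even i
      then {k | ∃ x, e i ≤ x ∧ x < e (i + 1) ∧ CrossFrom (white k ∩ Rh.R) Y0 Y1 x}
      else {k | ∃ x, e i ≤ x ∧ x < e (i + 1) ∧ CrossFrom (black k ∩ Rh.R) Y0 Y1 x}
    have hU : ∀ i < 2 * n, pr (baseF D M) (flat ∅) (U i)ᶜ ≤ δ := by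
      intro i hi
      have h := hej i hi
      by_cases hi : Even i
      · refine le_trans (b := f (e i) (e (i + 1))) (pr_mono hfin fun k _ hk x hx hx' hc => hk ?_) h
        simp only [U, if_pos hi]
        exact ⟨x, hx, hx', hc⟩
      · have h' : pr (baseF D M) (flat ∅)
            {k | ng D M k ∈ {k | ∀ x, e i ≤ x → x < e (i + 1) → ¬ CrossFrom (white k ∩ Rh.R) Y0 Y1 x}} ≤ δ := by
          rw [hB.pr_ng]; exact h
        refine le_trans (pr_mono (U' := {k | ng D M k ∈ {k | ∀ x, e i ≤ x → x < e (i + 1) →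
          ¬ CrossFrom (white k ∩ Rh.R) Y0 Y1 x}}) hfin fun k _ hk x hx hx' hc => hk ?_) h'
        simp only [U, if_neg hi]
        rw [white_ng hRM] at hc
        exact ⟨x, hx, hx', hc⟩
    have halt := pr_forall_lt hfin hflat hU
    set A := {k | ∀ i < 2 * n, k ∈ U i} with hA
    set R := Rh.cut (-H - 1) (2 * H + 1) with hR
    set B := box (-3 * H - 2) (w + 3 * H + 2) Y0 Y1 with hBdef
    have hseal' : p ≤ pr (baseF D M) (flat ∅) {k | Sealed B R.R k} := by
      refine hseal.trans (pr_mono hfin fun k _ hk v hv => hk v (R.sub hv))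
    -- All crossings are present with probability at least `1 - p / 2` and sealing has probability
    -- at least `p`, so both hold with probability at least `p / 2`.
    have hboth : p / 2 ≤ pr (baseF D M) (flat ∅) (A ∩ {k | Sealed B R.R k}) := by
      have h1 := pr_union_add_inter hfin (ξ := flat ∅) A {k | Sealed B R.R k}
      have h2 := pr_le_one hfin hflat (A ∪ {k | Sealed B R.R k})
      push_cast at halt
      linarith
    classical
    let O := (Om.finite hfin (flat ∅)).toFinset
    let G := O.filter fun k => Sealed B R.R k
    have hsum := hB.sum_reps_sealed_le (B := B) R (H := H) (N := N) (fun v hv => hD v fun u hu => (hv u hu).1) hH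
      (by omega) (by omega) hN hw G (fun k => by simp only [G, O, Finset.mem_filter, Set.Finite.mem_toFinset])
    -- On this event there are at least `n` clusters, and `p / 2 * n` exceeds the bound `1800 * N`
    -- on the mean.
    have hge : (G.filter fun k => k ∈ A).card * n ≤ ∑ k ∈ G, (reps (hullFaces B k) R.R (-H - 1) (2 * H + 1) k).ncard := by
      rw [← smul_eq_mul, ← Finset.sum_const]
      refine le_trans (Finset.sum_le_sum fun k hk => ?_) (Finset.sum_le_sum_of_subset (Finset.filter_subset _ G))
      obtain ⟨hkG, hkA⟩ := Finset.mem_filter.1 hk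
      refine le_ncard_reps_of_alternating Rh (by omega) (by omega) (by omega) (Finset.mem_filter.1 hkG).2 he
        (fun i hi => ?_) (fun i hi => ?_)
      · have := hkA (2 * i) (by omega)
        simpa only [U, if_pos (even_two_mul i), Set.mem_ofPred_eq] using this
      · have := hkA (2 * i + 1) (by omega)
        have hodd : ¬ Even (2 * i + 1) := by simp
        simpa only [U, if_neg hodd, Set.mem_ofPred_eq] using this
    have hOpos := Om.ncard_pos hfin (Om.self_mem (F := baseF D M) hflat)
    have hcard : ((G.filter fun k => k ∈ A).card : ℝ) =
        pr (baseF D M) (flat ∅) (A ∩ {k | Sealed B R.R k}) * (Om (baseF D M) (flat ∅)).ncard := by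
      rw [pr, div_mul_cancel₀ _ hOpos.ne', ← Set.ncard_coe_finset]
      congr 2
      ext k
      simp only [G, O, Finset.coe_filter, Finset.mem_filter, Set.Finite.mem_toFinset, Set.mem_ofPred_eq, Set.mem_inter_iff]
      tauto
    have hGO : (G.card : ℝ) ≤ (Om (baseF D M) (flat ∅)).ncard := by
      have : G.card ≤ O.card := Finset.card_filter_le _ _
      rw [Set.ncard_eq_toFinset_card _ (Om.finite hfin (flat ∅))]
      exact_mod_cast this
    have hfinal : ((G.filter fun k => k ∈ A).card : ℝ) * n ≤ 1800 * N * G.card := by exact_mod_cast hge.trans hsum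
    have hlt := lt_altCount N
    rw [hcard] at hfinal
    have h1 : p / 2 * (Om (baseF D M) (flat ∅)).ncard * n ≤ 1800 * N * (Om (baseF D M) (flat ∅)).ncard := by
      refine le_trans ?_ (hfinal.trans (mul_le_mul_of_nonneg_left hGO (by positivity)))
      exact mul_le_mul_of_nonneg_right (mul_le_mul_of_nonneg_right hboth hOpos.le) (by positivity)
    have h2 : p / 2 * n ≤ 1800 * N := by
      refine le_of_mul_le_mul_right ?_ hOpos
      linarith
    linarith

end SquareIce

namespace SquareIce
open Sum

/-! ### Passable paths along thin boxes -/

variable {D M : Set (ℤ × ℤ)}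

/-- The sites that are white or out of the strip `|v.1 - v.2| ≤ A`. -/
def passable (A : ℤ) (k : Vtx → ℤ) : Set (ℤ × ℤ) := {v | 1 ≤ k (inl v) ∨ v.1 - v.2 < -A ∨ A < v.1 - v.2}

theorem passable_mono (A : ℤ) {k k' : Vtx → ℤ} (h : k ≤ k') : passable A k ⊆ passable A k' := fun v hv =>
  hv.imp_left fun h1 => le_trans h1 (h (inl v))

def PathX (S : Set (ℤ × ℤ)) (x0 x1 y0 y1 : ℤ) : Prop :=
  ∃ p q : ℤ × ℤ, p.1 = x0 ∧ q.1 = x1 ∧ Conn adj8 (S ∩ box x0 x1 y0 y1) p q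

def PathY (S : Set (ℤ × ℤ)) (x0 x1 y0 y1 : ℤ) : Prop :=
  ∃ p q : ℤ × ℤ, p.2 = y0 ∧ q.2 = y1 ∧ Conn adj8 (S ∩ box x0 x1 y0 y1) p q

theorem isUpperSet_pathX (A x0 x1 y0 y1 : ℤ) : IsUpperSet {k | PathX (passable A k) x0 x1 y0 y1} :=
  fun _ _ h ⟨p, q, hp, hq, hc⟩ => ⟨p, q, hp, hq, hc.mono (Set.inter_subset_inter_left _ (passable_mono A h))⟩

theorem isUpperSet_pathY (A x0 x1 y0 y1 : ℤ) : IsUpperSet {k | PathY (passable A k) x0 x1 y0 y1} :=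
  fun _ _ h ⟨p, q, hp, hq, hc⟩ => ⟨p, q, hp, hq, hc.mono (Set.inter_subset_inter_left _ (passable_mono A h))⟩

/-- The rectangle is cut by the diagonal strip `|v.1 - v.2| ≤ A`, whose rows are intervals, so it is
a `Region`. The absence of black 4-crossings of this region gives, by duality in the whole
rectangle, an 8-path of sites that are white or outside the strip. -/
theorem Base.pr_pathX (hB : Base D M) {A x0 x1 y0 y1 H : ℤ} {N : ℕ} (hH : 0 ≤ H) (hx : x0 ≤ x1) (hN : 0 < N)
    (hw : x1 - x0 < N * (H / 16 + 1)) (hy : y1 = y0 + 9 * H + 6)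
    (hD : ∀ c ∈ box x0 x1 y0 y1, -A < c.1 - c.2 → c.1 - c.2 < A → c ∈ D)
    (hM : box (x0 - 3 * H - 3) (x1 + 3 * H + 3) (y0 - 3 * H - 3) (y1 + 3 * H + 3) ⊆ M) :
    crossConst N ≤ pr (baseF D M) (flat ∅) {k | PathX (passable A k) x0 x1 y0 y1} := by
  set b := y0 + 4 * H + 3 with hb
  set φ := LatIso.shift x0 b with hφ
  let Rh : Region (-4 * H - 3) (5 * H + 3) (x1 - x0) :=
    { R := box 0 (x1 - x0) (-4 * H - 3) (5 * H + 3) ∩ {v | -A ≤ v.1 + x0 - (v.2 + b) ∧ v.1 + x0 - (v.2 + b) ≤ A}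
      sub := Set.inter_subset_left
      convex := fun v hv => by
        simp only [Set.mem_inter_iff, mem_box, Set.mem_ofPred_eq] at *
        by_cases h : v.1 < 0 ∨ v.1 + x0 - (v.2 + b) < -A
        · left; intros; omega
        · by_cases h' : x1 - x0 < v.1 ∨ A < v.1 + x0 - (v.2 + b)
          · right; intros; omega
          · left; intros; omega }
  have hB' := hB.pull φ
  have hM' : box (-3 * H - 3) (x1 - x0 + 3 * H + 2) (-4 * H - 3 - 1) (5 * H + 3) ⊆ φ.f ⁻¹' M := fun v hv => hM (by
    simp only [mem_box, hφ, LatIso.shift, Equiv.coe_fn_mk] at *; omega)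
  have hRM : Rh.R ⊆ φ.f ⁻¹' M := fun v hv => hM' (by
    have := Rh.sub hv
    simp only [mem_box] at *; omega)
  have h := hB'.pr_no_white hH (by omega) hN hw rfl rfl Rh (fun v hv c hcv => hD _ ?_ ?_ ?_) hM'
  · rw [← hB'.pr_ng, φ.pr_pull] at h
    refine h.trans (pr_mono hB.finite fun k hk h => ?_)
    have hno : ∀ x, ¬ CrossFrom (black (φ.pull k) ∩ Rh.R) (-4 * H - 3) (5 * H + 3) x := fun x => by
      rw [← white_ng hRM]; exact h x
    rcases exists_cross_box (black k ∩ {v | -A ≤ v.1 - v.2 ∧ v.1 - v.2 ≤ A}) hx (show y0 ≤ y1 by omega) with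
      ⟨p, q, hp, hq, hc⟩ | ⟨p, q, hp, hq, hc⟩
    · exfalso
      refine hno (p.1 - x0) ⟨q.1 - x0, ?_⟩
      have := hc.map (T := black (φ.pull k) ∩ Rh.R) (r' := adj4)
        (fun v => (v.1 - x0, v.2 - b)) (fun u hu => ⟨?_, ?_⟩) (fun u v _ _ h => by simp only [adj4] at *; omega)
      · convert this using 2 <;> omega
      · have e : φ.f (u.1 - x0, u.2 - b) = u := by ext <;> simp [hφ, LatIso.shift]
        simp only [black, LatIso.pull, Set.mem_ofPred_eq, Sum.map_inl, e]; exact hu.1.1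
      · have h1 := hu.2
        have h2 := hu.1.2
        simp only [Rh, Set.mem_inter_iff, mem_box, Set.mem_ofPred_eq] at *; omega
    · refine ⟨p, q, hp, hq, hc.mono fun v hv => ⟨?_, hv.1⟩⟩
      have h1 := hv.2
      have h2 := Hom.odd_lt hk.1 v
      simp only [black, passable, Set.mem_inter_iff, Set.mem_ofPred_eq] at *
      omega
  all_goals
    have e1 := hv v (by simp only [adj8]; omega)
    have e2 := hv (v.1 - 1, v.2 + 1) (by simp only [adj8]; omega)
    have e3 := hv (v.1 + 1, v.2 - 1) (by simp only [adj8]; omega)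
    simp only [Rh, Set.mem_inter_iff, mem_box, Set.mem_ofPred_eq, hφ, LatIso.shift, Equiv.coe_fn_mk, Inc] at *
    omega

theorem Base.pr_pathY (hB : Base D M) {A x0 x1 y0 y1 H : ℤ} {N : ℕ} (hH : 0 ≤ H) (hy : y0 ≤ y1) (hN : 0 < N)
    (hw : y1 - y0 < N * (H / 16 + 1)) (hx : x1 = x0 + 9 * H + 6)
    (hD : ∀ c ∈ box x0 x1 y0 y1, -A < c.1 - c.2 → c.1 - c.2 < A → c ∈ D)
    (hM : box (x0 - 3 * H - 3) (x1 + 3 * H + 3) (y0 - 3 * H - 3) (y1 + 3 * H + 3) ⊆ M) :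
    crossConst N ≤ pr (baseF D M) (flat ∅) {k | PathY (passable A k) x0 x1 y0 y1} := by
  set φ := LatIso.diag 0 with hφ
  have h := (hB.pull φ).pr_pathX (A := A) (x0 := y0) (x1 := y1) (y0 := x0) (y1 := x1) hH hy hN hw hx
    (fun c hc h1 h2 => hD _
      (by simp only [mem_box, hφ, LatIso.diag, Equiv.coe_fn_mk] at *; omega)
      (by simp only [hφ, LatIso.diag, Equiv.coe_fn_mk] at *; omega)
      (by simp only [hφ, LatIso.diag, Equiv.coe_fn_mk] at *; omega))
    (fun v hv => hM (by simp only [mem_box, hφ, LatIso.diag, Equiv.coe_fn_mk] at *; omega))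
  rw [φ.pr_pull] at h
  refine h.trans (pr_mono hB.finite fun k _ hk => ?_)
  obtain ⟨p, q, hp, hq, hc⟩ := hk
  refine ⟨p.swap, q.swap, hp, hq, ?_⟩
  refine hc.map (r' := adj8) Prod.swap (fun u hu => ⟨?_, ?_⟩) (fun u v _ _ h => adj8_swap.2 h)
  · have e : φ.f u = u.swap := by ext <;> simp [hφ, LatIso.diag]
    have h1 := hu.1
    simp only [passable, LatIso.pull, Set.mem_ofPred_eq, Sum.map_inl, e, Prod.fst_swap, Prod.snd_swap] at *
    omega
  · have := hu.2
    simp only [mem_box, Prod.fst_swap, Prod.snd_swap] at *; omega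

theorem pr_pow_le_of_upper {F : Set Vtx} (hF : Fᶜ.Finite) {ξ : Vtx → ℤ} (hξ : ξ ∈ Hom) {U : ℕ → Set (Vtx → ℤ)}
    (hU : ∀ i, IsUpperSet (U i)) {c : ℝ} (hc : 0 ≤ c) {m : ℕ} (h : ∀ i < m, c ≤ pr F ξ (U i)) :
    c ^ m ≤ pr F ξ {k | ∀ i < m, k ∈ U i} := by
  induction m with
  | zero =>
    have e : {k : Vtx → ℤ | ∀ i < 0, k ∈ U i} = Set.univ := Set.eq_univ_of_forall fun k i hi => absurd hi (Nat.not_lt_zero i)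
    rw [e, pr_univ hF hξ, pow_zero]
  | succ m ih =>
    rw [pow_succ]
    refine (mul_le_mul (ih fun i hi => h i (by omega)) (h m (by omega)) hc pr_nonneg).trans ((pr_mul_le_of_upper hF hξ ?_ (hU m)).trans
      (pr_mono hF fun k _ hk i hi => ?_))
    · exact fun k k' h hk i hi => hU i h (hk i hi)
    · rcases Nat.lt_succ_iff_lt_or_eq.1 hi with hi | rfl
      exacts [hk.1 i hi, hk.2]

/-! ### Joining paths -/

theorem Conn.sub_cols8 {S : Set (ℤ × ℤ)} {a b : ℤ × ℤ} (h : Conn adj8 S a b) {x x' : ℤ} (hx : x ≤ x')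
    (ha : a.1 ≤ x) (hb : x' ≤ b.1) :
    ∃ u v : ℤ × ℤ, u.1 = x ∧ v.1 = x' ∧ Conn adj8 (S ∩ {v | x ≤ v.1 ∧ v.1 ≤ x'}) u v := by
  exact h.passage (P := {v | v.1 < x}) (M := {v | x ≤ v.1 ∧ v.1 ≤ x'}) (Q := {v | x' < v.1})
    (I := fun u => u.1 = x) (F := fun v => v.1 = x')
    (by
      intro v _
      simp only [Set.mem_union, Set.mem_ofPred_eq]; omega)
    (by simp only [Set.mem_ofPred_eq]; omega)
    (by simp only [Set.mem_ofPred_eq]; omega)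
    (by simp only [Set.mem_ofPred_eq, adj8]; intros; omega)
    (by simp only [Set.mem_ofPred_eq, adj8]; intros; omega)
    (by simp only [Set.mem_ofPred_eq, adj8]; intros; omega)

/-- Two `8`-connected paths crossing one another come close together. -/
theorem exists_adj8_of_cross {P P' : Set (ℤ × ℤ)} {x0 x1 y0 y1 x0' x1' y0' y1' : ℤ} {p q p' q' : ℤ × ℤ}
    (hP : Conn adj8 P p q) (hPs : P ⊆ box x0 x1 y0 y1) (hp : p.1 = x0) (hq : q.1 = x1)
    (hP' : Conn adj8 P' p' q') (hPs' : P' ⊆ box x0' x1' y0' y1') (hp' : p'.2 = y0') (hq' : q'.2 = y1')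
    (h0 : x0 ≤ x0') (h01 : x0' ≤ x1') (h1 : x1' ≤ x1) (h2 : y0' ≤ y0) (h3 : y1 ≤ y1') :
    ∃ u ∈ P, ∃ v ∈ P', adj8 u v := by
  by_contra! hno
  obtain ⟨u, v, hu, hv, hc⟩ := hP.sub_cols8 h01 (by omega) (by omega)
  -- Two 8-paths may cross without sharing a site. Thickening `P'` to its 8-neighbourhood makes it
  -- 4-connected, so that `no_cross_box` applies.
  set X : Set (ℤ × ℤ) := {v | v ∈ box x0' x1' y0' y1' ∧ ∃ w ∈ P', adj8 w v} with hX
  have hPX : ∀ w ∈ P', w ∈ X := fun w hw => ⟨hPs' hw, w, hw, by simp only [adj8]; omega⟩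
  have hXc : Conn adj4 X p' q' := by
    refine hP'.rec' (p := fun v => Conn adj4 X p' v) (.refl (hPX _ hP'.left)) ?_
    intro a b ha hab hb ih
    have ha' := hPs' ha.right
    have hb' := hPs' hb
    have hmid : (a.1, b.2) ∈ X := by
      refine ⟨?_, a, ha.right, ?_⟩
      · simp only [mem_box] at *; omega
      · simp only [adj8] at *; omega
    refine (ih.tail ?_ hmid).tail ?_ (hPX b hb)
    · simp only [adj4, adj8, true_and] at *; omega
    · simp only [adj4, adj8, true_and] at *; omega
  refine no_cross_box hXc (fun v hv => hv.1) hp' hq' hc (fun w hw => ⟨?_, ?_⟩) hu hv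
  · have e1 := hPs hw.1
    have e2 := hw.2
    simp only [mem_box, Set.mem_ofPred_eq] at *; omega
  · rintro ⟨-, z, hz, hzw⟩
    exact hno w hw.1 z hz (adj8_symm _ _ hzw)

theorem PathX.join {S : Set (ℤ × ℤ)} {x0 x1 y0 y1 x0' x1' y0' y1' : ℤ} {p q p' q' : ℤ × ℤ}
    (h : Conn adj8 (S ∩ box x0 x1 y0 y1) p q) (hp : p.1 = x0) (hq : q.1 = x1)
    (h' : Conn adj8 (S ∩ box x0' x1' y0' y1') p' q') (hp' : p'.2 = y0') (hq' : q'.2 = y1')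
    (h0 : x0 ≤ x0') (h01 : x0' ≤ x1') (h1 : x1' ≤ x1) (h2 : y0' ≤ y0) (h3 : y1 ≤ y1') {T : Set (ℤ × ℤ)}
    (hT : S ∩ box x0 x1 y0 y1 ⊆ T) (hT' : S ∩ box x0' x1' y0' y1' ⊆ T) : Conn adj8 T p p' := by
  obtain ⟨u, hu, v, hv, huv⟩ := exists_adj8_of_cross h.reach (fun v hv => (Conn.right hv).2) hp hq h'.reach
    (fun v hv => (Conn.right hv).2) hp' hq' h0 h01 h1 h2 h3
  exact (((Conn.mono hT hu).tail huv (hT' (Conn.right hv))).trans (Conn.mono hT' hv).symm8)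

end SquareIce

namespace SquareIce
open Sum

/-! ### A zigzag of thin boxes -/

variable {D M : Set (ℤ × ℤ)}

/-- Horizontal boxes descending along an antidiagonal are linked by vertical ones, each of which is
crossed by the paths of its two neighbours. In all the boxes `v.1 + v.2` stays in a fixed interval
of length `l + 2 * h`. -/
theorem exists_zigzag {S T : Set (ℤ × ℤ)} {a b l h : ℤ} (hl : 0 ≤ l) (hh : 0 ≤ h) {m : ℕ}
    (hX : ∀ i : ℕ, i ≤ m → PathX S (a + i * l) (a + i * l + l + h) (b - i * l) (b - i * l + h))
    (hY : ∀ i : ℕ, i < m → PathY S (a + i * l + l) (a + i * l + l + h) (b - i * l - l) (b - i * l + h))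
    (hT : ∀ v ∈ S, a + b ≤ v.1 + v.2 → v.1 + v.2 ≤ a + b + l + 2 * h → v ∈ T) :
    ∃ p q : ℤ × ℤ, p.1 = a ∧ b ≤ p.2 ∧ q.1 = a + m * l + l + h ∧ q.2 ≤ b - m * l + h ∧ Conn adj8 T p q := by
  suffices H : ∃ p p' q : ℤ × ℤ, p.1 = a ∧ b ≤ p.2 ∧ p'.1 = a + m * l ∧ q.1 = a + m * l + l + h ∧ Conn adj8 T p p' ∧
      Conn adj8 (S ∩ box (a + m * l) (a + m * l + l + h) (b - m * l) (b - m * l + h)) p' q by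
    obtain ⟨p, p', q, h1, h2, h3, h4, h5, h6⟩ := H
    refine ⟨p, q, h1, h2, h4, ?_, h5.trans (h6.mono fun v hv => hT v hv.1 ?_ ?_)⟩
    · have := h6.right.2
      simp only [mem_box] at this; omega
    all_goals
      have := hv.2
      simp only [mem_box] at this
      generalize (m : ℤ) * l = t at this
      omega
  have subX : ∀ t : ℤ, S ∩ box (a + t) (a + t + l + h) (b - t) (b - t + h) ⊆ T := fun t v hv => by
    have := hv.2
    simp only [mem_box] at this
    exact hT v hv.1 (by omega) (by omega)
  have subY : ∀ t : ℤ, S ∩ box (a + t + l) (a + t + l + h) (b - t - l) (b - t + h) ⊆ T := fun t v hv => by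
    have := hv.2
    simp only [mem_box] at this
    exact hT v hv.1 (by omega) (by omega)
  induction m with
  | zero =>
    obtain ⟨p, q, hp, hq, hc⟩ := hX 0 le_rfl
    have hp2 := hc.left.2
    simp only [mem_box] at hp2
    push_cast at hp hq hc hp2 ⊢
    have hpT := subX 0 (by simpa using hc.left)
    exact ⟨p, p, q, by omega, by omega, hp, hq, .refl hpT, hc⟩
  | succ m ih =>
    obtain ⟨p, p', q, h1, h2, h3, h4, h5, h6⟩ := ih (fun i hi => hX i (by omega)) (fun i hi => hY i (by omega))
    obtain ⟨r, s, hr, hs, hrs⟩ := hY m (by omega)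
    obtain ⟨p1, q1, hp1, hq1, hpq⟩ := hX (m + 1) le_rfl
    have e : ((m + 1 : ℕ) : ℤ) * l = m * l + l := by push_cast; ring
    rw [e] at hp1 hq1 hpq ⊢
    generalize (m : ℤ) * l = t at *
    have hT' : S ∩ box (a + (t + l)) (a + (t + l) + l + h) (b - (t + l)) (b - (t + l) + h) ⊆ T := subX (t + l)
    have j1 := PathX.join h6 h3 h4 hrs hr hs (by omega) (by omega) (by omega) (by omega) (by omega) (subX t) (subY t)
    have j2 := PathX.join hpq hp1 hq1 hrs hr hs (by omega) (by omega) (by omega) (by omega) (by omega) hT' (subY t)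
    exact ⟨p, p1, q1, h1, h2, hp1, hq1, (h5.trans j1).trans j2.symm8, hpq⟩

/-- Here `l = 20 * H` and `h = 9 * H + 6`. The choice of `b` centres the interval for `v.1 + v.2`
near `0`, so that it fits in a rectangle of half-height `n ≥ 40 * H`. The choice of `a` starts the
path to the left of `-A` in the coordinate `v.1 - v.2`, and `hm` takes it beyond `A`. -/
theorem Base.pr_zigzag (hB : Base D M) {A n H a b : ℤ} {m : ℕ} (hH : 1 ≤ H) (hn : 40 * H ≤ n)
    (hm : 2 * A + 2 ≤ (2 * m + 1) * (20 * H)) (ha : a = b - A - 1) (hb : b = (A + 1 - (19 * H + 6)) / 2)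
    (hD : ∀ c : ℤ × ℤ, -A < c.1 - c.2 → c.1 - c.2 < A → -n < c.1 + c.2 + 2 → c.1 + c.2 + 2 < n → c ∈ D)
    (hM : box (a - 3 * H - 3) (a + m * (20 * H) + 32 * H + 9) (b - m * (20 * H) - 23 * H - 3) (b + 12 * H + 9) ⊆ M) :
    (crossConst 464 * crossConst 464) ^ (m + 1) ≤ pr (baseF D M) (flat ∅) {k | ∃ p q : ℤ × ℤ, p.1 - p.2 < -A ∧
      A < q.1 - q.2 ∧ Conn adj8 (passable A k ∩ {v | -n + 1 < v.1 + v.2 + 1 ∧ v.1 + v.2 + 1 < n - 1}) p q} := by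
  have hfin := hB.finite
  have hflat := flat_hom ∅
  have c0 := (crossConst_pos 464).le
  let UX : ℕ → Set (Vtx → ℤ) := fun i => {k | PathX (passable A k) (a + i * (20 * H))
    (a + i * (20 * H) + 20 * H + (9 * H + 6)) (b - i * (20 * H)) (b - i * (20 * H) + (9 * H + 6))}
  let UY : ℕ → Set (Vtx → ℤ) := fun i => {k | PathY (passable A k) (a + i * (20 * H) + 20 * H)
    (a + i * (20 * H) + 20 * H + (9 * H + 6)) (b - i * (20 * H) - 20 * H) (b - i * (20 * H) + (9 * H + 6))}
  -- `464 = 16 * 29`: the longer side of a box fits in 464 windows of length `H / 16`.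
  have hwid : 29 * H + 6 < ((464 : ℕ) : ℤ) * (H / 16 + 1) := by push_cast; omega
  have hti : ∀ i < m + 1, 0 ≤ (i : ℤ) * (20 * H) ∧ (i : ℤ) * (20 * H) ≤ m * (20 * H) := fun i hi =>
    ⟨by positivity, mul_le_mul_of_nonneg_right (by exact_mod_cast Nat.lt_succ_iff.1 hi) (by omega)⟩
  have pX : ∀ i < m + 1, crossConst 464 ≤ pr (baseF D M) (flat ∅) (UX i) := by
    intro i hi
    obtain ⟨t1, t2⟩ := hti i hi
    simp only [UX]
    generalize (i : ℤ) * (20 * H) = t at *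
    refine hB.pr_pathX (H := H) (by omega) (by omega) (by norm_num) (by omega) (by omega) (fun c hc h1 h2 => hD c h1 h2 ?_ ?_)
      (fun v hv => hM ?_)
    · simp only [mem_box] at hc; omega
    · simp only [mem_box] at hc; omega
    · simp only [mem_box] at hv ⊢; omega
  have pY : ∀ i < m + 1, crossConst 464 ≤ pr (baseF D M) (flat ∅) (UY i) := by
    intro i hi
    obtain ⟨t1, t2⟩ := hti i hi
    simp only [UY]
    generalize (i : ℤ) * (20 * H) = t at *
    refine hB.pr_pathY (H := H) (by omega) (by omega) (by norm_num) (by omega) (by omega) (fun c hc h1 h2 => hD c h1 h2 ?_ ?_)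
      (fun v hv => hM ?_)
    · simp only [mem_box] at hc; omega
    · simp only [mem_box] at hc; omega
    · simp only [mem_box] at hv ⊢; omega
  have uX : ∀ i, IsUpperSet (UX i) := fun i => isUpperSet_pathX _ _ _ _ _
  have uY : ∀ i, IsUpperSet (UY i) := fun i => isUpperSet_pathY _ _ _ _ _
  refine (pr_pow_le_of_upper hfin hflat (fun i => (uX i).inter (uY i)) (mul_nonneg c0 c0) fun i hi =>
    (mul_le_mul (pX i hi) (pY i hi) c0 pr_nonneg).trans (pr_mul_le_of_upper hfin hflat (uX i) (uY i))).trans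
    (pr_mono hfin fun k _ hk => ?_)
  obtain ⟨p, q, h1, h2, h3, h4, hc⟩ := exists_zigzag (S := passable A k)
    (T := passable A k ∩ {v | -n + 1 < v.1 + v.2 + 1 ∧ v.1 + v.2 + 1 < n - 1}) (a := a) (b := b) (l := 20 * H)
    (h := 9 * H + 6) (by omega) (by omega) (m := m) (fun i hi => (hk i (by omega)).1) (fun i hi => (hk i (by omega)).2)
    (fun v hv e1 e2 => ⟨hv, by simp only [Set.mem_ofPred_eq]; omega⟩)
  refine ⟨p, q, by omega, ?_, hc⟩
  have : (2 * (m : ℤ) + 1) * (20 * H) = m * (20 * H) + m * (20 * H) + 20 * H := by ring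
  rw [this] at hm
  generalize (m : ℤ) * (20 * H) = t at *
  omega

/-! ### The square lattice as sites and faces -/

/-- The rotation by 45 degrees: sites go to odd vertices, faces to even vertices, and incidence
becomes adjacency in the square lattice (`adj_pos`). -/
def pos : Vtx → ℤ × ℤ := Sum.elim (fun v => (v.1 - v.2, v.1 + v.2 + 1)) (fun c => (c.1 - c.2, c.1 + c.2 + 2))

open Classical in
noncomputable def unpos (w : ℤ × ℤ) : Vtx :=
  if Even (w.1 + w.2) then inr ((w.1 + w.2) / 2 - 1, (w.2 - w.1) / 2 - 1)
  else inl ((w.1 + w.2 - 1) / 2, (w.2 - w.1 - 1) / 2)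

theorem unpos_pos (x : Vtx) : unpos (pos x) = x := by
  rcases x with v | c
  · have h : ¬ Even (v.1 - v.2 + (v.1 + v.2 + 1)) := by rw [Int.even_iff]; omega
    show unpos (v.1 - v.2, v.1 + v.2 + 1) = inl v
    rw [unpos, if_neg h]
    exact congrArg inl (Prod.ext (by dsimp only; omega) (by dsimp only; omega))
  · have h : Even (c.1 - c.2 + (c.1 + c.2 + 2)) := by rw [Int.even_iff]; omega
    show unpos (c.1 - c.2, c.1 + c.2 + 2) = inr c
    rw [unpos, if_pos h]
    exact congrArg inr (Prod.ext (by dsimp only; omega) (by dsimp only; omega))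

theorem pos_unpos (w : ℤ × ℤ) : pos (unpos w) = w := by
  by_cases h : Even (w.1 + w.2)
  · rw [unpos, if_pos h]
    rw [Int.even_iff] at h
    ext <;> simp only [pos, Sum.elim_inr] <;> omega
  · rw [unpos, if_neg h]
    rw [Int.even_iff] at h
    ext <;> simp only [pos, Sum.elim_inl] <;> omega

theorem pos_injective : Function.Injective pos := Function.LeftInverse.injective unpos_pos

theorem adj_iff (u v : ℤ × ℤ) : latticeGraph.Adj u v ↔
    u.1 = v.1 ∧ (u.2 = v.2 + 1 ∨ v.2 = u.2 + 1) ∨ u.2 = v.2 ∧ (u.1 = v.1 + 1 ∨ v.1 = u.1 + 1) := by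
  show (u.1 - v.1) ^ 2 + (u.2 - v.2) ^ 2 = 1 ↔ _
  constructor
  · intro h
    have h1 : -1 ≤ u.1 - v.1 ∧ u.1 - v.1 ≤ 1 := by constructor <;> nlinarith [sq_nonneg (u.2 - v.2)]
    have h2 : -1 ≤ u.2 - v.2 ∧ u.2 - v.2 ≤ 1 := by constructor <;> nlinarith [sq_nonneg (u.1 - v.1)]
    rcases (by omega : u.1 - v.1 = -1 ∨ u.1 - v.1 = 0 ∨ u.1 - v.1 = 1) with e | e | e <;>
      rcases (by omega : u.2 - v.2 = -1 ∨ u.2 - v.2 = 0 ∨ u.2 - v.2 = 1) with e' | e' | e' <;>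
      rw [e, e'] at h <;> omega
  · rintro (⟨h, h' | h'⟩ | ⟨h, h' | h'⟩) <;> rw [h, h'] <;> ring

theorem adj_pos (v c : ℤ × ℤ) : latticeGraph.Adj (pos (inl v)) (pos (inr c)) ↔ Inc c v := by
  rw [adj_iff]; simp only [pos, Sum.elim_inl, Sum.elim_inr, Inc]; omega

theorem even_pos_inr (c : ℤ × ℤ) : IsEvenVertex (pos (inr c)) := by
  simp only [IsEvenVertex, pos, Sum.elim_inr, Int.even_iff]; omega

theorem not_even_pos_inl (v : ℤ × ℤ) : ¬ IsEvenVertex (pos (inl v)) := by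
  simp only [IsEvenVertex, pos, Sum.elim_inl, Int.even_iff]; omega

theorem exists_inc_of_adj {x y : Vtx} (h : latticeGraph.Adj (pos x) (pos y)) : adjV x y := by
  rcases x with v | c <;> rcases y with v' | c'
  · rw [adj_iff] at h; simp only [pos, Sum.elim_inl] at h; omega
  · exact ⟨c', v, (adj_pos v c').1 h, .inl ⟨rfl, rfl⟩⟩
  · exact ⟨c, v', (adj_pos v' c).1 h.symm, .inr ⟨rfl, rfl⟩⟩
  · rw [adj_iff] at h; simp only [pos, Sum.elim_inr] at h; omega

end SquareIce

namespace SquareIce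
open Sum

/-! ### Height functions on a domain and heights on the whole lattice -/

/-- The faces that are vertices of `D` off its boundary. -/
def freeFaces (D : Finset (ℤ × ℤ)) : Set (ℤ × ℤ) := {c | pos (inr c) ∈ D ∧ pos (inr c) ∉ boundary D}

noncomputable def restrict (D : Finset (ℤ × ℤ)) (k : Vtx → ℤ) : D → ℤ := fun v => k (unpos v)

open Classical in
noncomputable def splice (D : Finset (ℤ × ℤ)) (h : D → ℤ) (k : Vtx → ℤ) : Vtx → ℤ :=
  fun x => if hx : pos x ∈ D then h ⟨pos x, hx⟩ else k x

theorem splice_of_mem {D : Finset (ℤ × ℤ)} {h : D → ℤ} {k : Vtx → ℤ} {x : Vtx} (hx : pos x ∈ D) :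
    splice D h k x = h ⟨pos x, hx⟩ := dif_pos hx

theorem splice_of_notMem {D : Finset (ℤ × ℤ)} {h : D → ℤ} {k : Vtx → ℤ} {x : Vtx} (hx : pos x ∉ D) :
    splice D h k x = k x := dif_neg hx

theorem restrict_splice {D : Finset (ℤ × ℤ)} (h : D → ℤ) (k : Vtx → ℤ) : restrict D (splice D h k) = h := by
  funext v
  have hv : pos (unpos v) ∈ D := by rw [pos_unpos]; exact v.2
  rw [restrict, splice_of_mem hv]
  congr 1
  exact Subtype.ext (pos_unpos v)

theorem splice_restrict {D : Finset (ℤ × ℤ)} {k k' : Vtx → ℤ} (h : ∀ x, pos x ∉ D → k' x = k x) :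
    splice D (restrict D k) k' = k := by
  funext x
  by_cases hx : pos x ∈ D
  · rw [splice_of_mem hx, restrict, unpos_pos]
  · rw [splice_of_notMem hx, h x hx]

variable {D : Finset (ℤ × ℤ)} {M : Set (ℤ × ℤ)}

/-- A face that is in `D` but not on its boundary has all its neighbours in `D`, hence all its
corners in `M`. -/
theorem base_domain (hM : ∀ v, pos (inl v) ∈ D → v ∈ M) (hfin : M.Finite) : Base (freeFaces D) M where
  finD := (D.finite_toSet.preimage (f := fun c => pos (inr c))
    (fun _ _ _ _ h => Sum.inr.inj (pos_injective h))).subset fun c hc => hc.1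
  finM := hfin
  corner c hc v hcv := by
    refine hM v (by_contra fun hv => hc.2 ⟨hc.1, _, ((adj_pos v c).2 hcv).symm, hv⟩)

theorem splice_mem (hD : ∀ v ∈ boundary D, IsEvenVertex v) (hM : ∀ v, pos (inl v) ∈ D → v ∈ M) {h : D → ℤ}
    (hh : h ∈ zeroBoundaryHeights D) {k : Vtx → ℤ} (hk : k ∈ Om (baseF (freeFaces D) M) (flat ∅)) :
    splice D h k ∈ Om (baseF (freeFaces D) M) (flat ∅) := by
  refine ⟨⟨fun c v hcv => ?_, fun v => ?_, fun c => ?_⟩, ?_⟩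
  · have hadj := (adj_pos v c).2 hcv
    have h0 := hk.1.1 c v hcv
    by_cases hv : pos (inl v) ∈ D <;> by_cases hc : pos (inr c) ∈ D
    · have := hh.1.1 ⟨_, hv⟩ ⟨_, hc⟩ hadj
      rw [splice_of_mem hv, splice_of_mem hc]
      rcases abs_cases (h ⟨_, hv⟩ - h ⟨_, hc⟩) with h' | h' <;> omega
    · exact absurd (hD _ ⟨hv, _, hadj, hc⟩) (not_even_pos_inl v)
    · have hb : pos (inr c) ∈ boundary D := ⟨hc, _, hadj.symm, hv⟩
      have h1 := hh.2 ⟨_, hc⟩ hb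
      have h2 := base_inr hk (c := c) fun h => h.2 hb
      rw [splice_of_notMem hv, splice_of_mem hc, h1]; omega
    · rwa [splice_of_notMem hv, splice_of_notMem hc]
  · by_cases hv : pos (inl v) ∈ D
    · rw [splice_of_mem hv, ← Int.not_even_iff_odd, hh.1.2]
      exact not_even_pos_inl v
    · rw [splice_of_notMem hv]; exact hk.1.2.1 v
  · by_cases hc : pos (inr c) ∈ D
    · rw [splice_of_mem hc, hh.1.2]
      exact even_pos_inr c
    · rw [splice_of_notMem hc]; exact hk.1.2.2 c
  · intro x hx
    by_cases hxD : pos x ∈ D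
    · rcases x with v | c
      · exact absurd (hM v hxD) hx
      · have hb : pos (inr c) ∈ boundary D := by_contra fun h => hx ⟨hxD, h⟩
        rw [splice_of_mem hxD, hh.2 _ hb]; rfl
    · rw [splice_of_notMem hxD]; exact hk.2 x hx

theorem restrict_mem (hD : ∀ v ∈ boundary D, IsEvenVertex v) {k : Vtx → ℤ}
    (hk : k ∈ Om (baseF (freeFaces D) M) (flat ∅)) : restrict D k ∈ zeroBoundaryHeights D := by
  refine ⟨⟨fun u v huv => ?_, fun v => ?_⟩, fun v hv => ?_⟩
  · rw [← pos_unpos u, ← pos_unpos v] at huv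
    obtain ⟨c, w, hcw, h⟩ := exists_inc_of_adj huv
    have h1 := hk.1.1 c w hcw
    obtain ⟨m, hm⟩ := hk.1.2.1 w
    obtain ⟨m', hm'⟩ := hk.1.2.2 c
    simp only [restrict]
    rcases h with ⟨h, h'⟩ | ⟨h, h'⟩ <;> rw [h, h'] <;>
      rcases abs_cases (k (inl w) - k (inr c)) with h2 | h2 <;>
      rcases abs_cases (k (inr c) - k (inl w)) with h3 | h3 <;> omega
  · have e : pos (unpos v) = v := pos_unpos v
    rw [restrict, ← e]
    rcases unpos v with w | c
    · rw [unpos_pos]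
      exact iff_of_false (Int.not_even_iff_odd.2 (hk.1.2.1 w)) (not_even_pos_inl w)
    · rw [unpos_pos]
      exact iff_of_true (hk.1.2.2 c) (even_pos_inr c)
  · have hev := hD _ hv
    rw [← pos_unpos (v : ℤ × ℤ)] at hev hv
    rw [restrict]
    rcases hx : unpos (v : ℤ × ℤ) with w | c
    · rw [hx] at hev; exact absurd hev (not_even_pos_inl w)
    · rw [hx] at hv; exact base_inr hk fun h => h.2 hv

/-- Outside `D` only sites are free, and they touch faces of height `0` only, since the boundary is
even. They are thus independent of the heights on `D`, and all fibres of `restrict D` have the same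
size. -/
theorem ncard_restrict_preimage (hD : ∀ v ∈ boundary D, IsEvenVertex v) (hM : ∀ v, pos (inl v) ∈ D → v ∈ M)
    (E : Set (D → ℤ)) : (Om (baseF (freeFaces D) M) (flat ∅) ∩ {k | restrict D k ∈ E}).ncard =
    (zeroBoundaryHeights D ∩ E).ncard *
      {k | k ∈ Om (baseF (freeFaces D) M) (flat ∅) ∧ ∀ x, pos x ∈ D → k x = flat ∅ x}.ncard := by
  rw [← Set.ncard_prod]
  have hself : flat ∅ ∈ Om (baseF (freeFaces D) M) (flat ∅) := ⟨flat_hom ∅, fun _ _ => rfl⟩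
  refine (Set.ncard_congr (fun p _ => splice D p.1 p.2) ?_ ?_ ?_).symm
  · rintro ⟨h, k⟩ ⟨⟨h1, h2⟩, h3, h4⟩
    refine ⟨splice_mem hD hM h1 h3, ?_⟩
    rw [Set.mem_ofPred_eq, restrict_splice]; exact h2
  · rintro ⟨h, k⟩ ⟨h', k'⟩ ⟨-, -, h4⟩ ⟨-, -, h4'⟩ heq
    have e1 := congrArg (restrict D) heq
    rw [restrict_splice, restrict_splice] at e1
    refine Prod.ext e1 ?_
    funext x
    by_cases hx : pos x ∈ D
    · exact (h4 x hx).trans (h4' x hx).symm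
    · have := congrFun heq x
      rwa [splice_of_notMem hx, splice_of_notMem hx] at this
  · rintro k ⟨h1, h2⟩
    refine ⟨(restrict D k, splice D (restrict D (flat ∅)) k), ⟨⟨restrict_mem hD h1, h2⟩, ?_, ?_⟩, ?_⟩
    · exact splice_mem hD hM (restrict_mem hD hself) h1
    · intro x hx
      show splice D _ k x = _
      rw [splice_of_mem hx, restrict, unpos_pos]
    · exact splice_restrict fun x hx => splice_of_notMem hx

theorem real_zeroBoundaryMeasure (hD : ∀ v ∈ boundary D, IsEvenVertex v) (hM : ∀ v, pos (inl v) ∈ D → v ∈ M)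
    (hfin : M.Finite) (E : Set (D → ℤ)) : (zeroBoundaryMeasure D).real E =
    pr (baseF (freeFaces D) M) (flat ∅) {k | restrict D k ∈ E} := by
  have hB := base_domain hM hfin
  have hOm := Om.finite hB.finite (flat ∅)
  have hself : flat ∅ ∈ Om (baseF (freeFaces D) M) (flat ∅) := ⟨flat_hom ∅, fun _ _ => rfl⟩
  have hs : (zeroBoundaryHeights D).Finite := by
    refine (hOm.image (restrict D)).subset fun h hh => ⟨splice D h (flat ∅), splice_mem hD hM hh hself, restrict_splice _ _⟩
  have hne : (zeroBoundaryHeights D).Nonempty := ⟨_, restrict_mem hD hself⟩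
  set Z := {k | k ∈ Om (baseF (freeFaces D) M) (flat ∅) ∧ ∀ x, pos x ∈ D → k x = flat ∅ x} with hZ
  have hZpos : (0 : ℝ) < Z.ncard := by
    exact_mod_cast (Set.ncard_pos (s := Z) (hOm.subset fun k hk => hk.1)).2 ⟨flat ∅, hself, fun _ _ => rfl⟩
  have e1 := ncard_restrict_preimage hD hM E
  have e2 := ncard_restrict_preimage hD hM Set.univ
  rw [show {k : Vtx → ℤ | restrict D k ∈ (Set.univ : Set (D → ℤ))} = Set.univ from
    Set.eq_univ_of_forall fun _ => trivial, Set.inter_univ, Set.inter_univ] at e2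
  rw [pr, e1, e2]
  push_cast
  rw [mul_div_mul_right _ _ hZpos.ne']
  rw [MeasureTheory.measureReal_def, zeroBoundaryMeasure, ProbabilityTheory.uniformOn,
    ProbabilityTheory.cond_apply hs.measurableSet, MeasureTheory.Measure.count_apply_finite _ hs,
    MeasureTheory.Measure.count_apply_finite _ (hs.inter_of_left E), ENNReal.toReal_mul, ENNReal.toReal_inv]
  rw [Set.ncard_eq_toFinset_card _ hs, Set.ncard_eq_toFinset_card _ (hs.inter_of_left E)]
  simp only [ENNReal.toReal_natCast]
  rw [div_eq_inv_mul]

/-! ### From connections to walks -/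

theorem exists_walk {S : Set (ℤ × ℤ)} {u v : ℤ × ℤ} (h : Conn adj4 S u v) :
    ∃ p : latticeGraph.Walk u v, ∀ w ∈ p.support, w ∈ S := by
  refine h.rec' (p := fun v => ∃ p : latticeGraph.Walk u v, ∀ w ∈ p.support, w ∈ S)
    ⟨.nil, fun w hw => by rw [SimpleGraph.Walk.support_nil, List.mem_singleton] at hw; rw [hw]; exact h.left⟩ ?_
  rintro a b - hab hb ⟨p, hp⟩
  by_cases heq : a = b
  · subst heq; exact ⟨p, hp⟩
  · have hadj : latticeGraph.Adj a b := by
      rw [adj_iff]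
      have : ¬ (a.1 = b.1 ∧ a.2 = b.2) := fun h => heq (Prod.ext h.1 h.2)
      simp only [adj4] at hab; omega
    refine ⟨p.concat hadj, fun w hw => ?_⟩
    rw [SimpleGraph.Walk.support_concat, List.mem_append, List.mem_singleton] at hw
    rcases hw with hw | rfl
    exacts [hp w hw, hb]

/-- The vertices of the rectangle at which the height is nonnegative. -/
def nonneg (A n : ℤ) (k : Vtx → ℤ) : Set (ℤ × ℤ) :=
  {w | -A ≤ w.1 ∧ w.1 ≤ A ∧ -n ≤ w.2 ∧ w.2 ≤ n ∧ 0 ≤ k (unpos w)}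

theorem mem_horizontalCrossing {D : Finset (ℤ × ℤ)} {a n : ℕ} (hD : rect a n ⊆ D) {k : Vtx → ℤ} {u v : ℤ × ℤ}
    (hu : u.1 = -(a : ℤ)) (hv : v.1 = a) (h : Conn adj4 (nonneg a n k) u v) :
    restrict D k ∈ horizontalCrossing D (Set.Ici 0) a n := by
  obtain ⟨p, hp⟩ := exists_walk h
  refine ⟨u, v, p, hu, hv, fun w hw => ?_⟩
  obtain ⟨h1, h2, h3, h4, h5⟩ := hp w hw
  have hr : w ∈ rect a n := by
    rw [rect, Finset.mem_product, Finset.mem_Icc, Finset.mem_Icc]; exact ⟨⟨h1, h2⟩, h3, h4⟩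
  exact ⟨hr, hD hr, h5⟩

theorem nonneg_site {A n : ℤ} {k : Vtx → ℤ} {v : ℤ × ℤ} (h : 1 ≤ k (inl v)) (h1 : -A ≤ v.1 - v.2) (h2 : v.1 - v.2 ≤ A)
    (h3 : -n ≤ v.1 + v.2 + 1) (h4 : v.1 + v.2 + 1 ≤ n) : pos (inl v) ∈ nonneg A n k := by
  refine ⟨h1, h2, h3, h4, ?_⟩
  rw [unpos_pos]; omega

theorem nonneg_face {A n : ℤ} {k : Vtx → ℤ} (hk : k ∈ Hom) {v c : ℤ × ℤ} (h : 1 ≤ k (inl v)) (hcv : Inc c v)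
    (h1 : -A ≤ c.1 - c.2) (h2 : c.1 - c.2 ≤ A) (h3 : -n ≤ c.1 + c.2 + 2) (h4 : c.1 + c.2 + 2 ≤ n) :
    pos (inr c) ∈ nonneg A n k := by
  refine ⟨h1, h2, h3, h4, ?_⟩
  rw [unpos_pos]
  have := hk.1 c v hcv
  omega

theorem adj4_pos {v c : ℤ × ℤ} (h : Inc c v) : adj4 (pos (inl v)) (pos (inr c)) := by
  simp only [Inc, adj4, pos, Sum.elim_inl, Sum.elim_inr] at *; omega

/-- The passable path is cut to the strip, where passable means white. Two 8-adjacent white sites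
share a face of nonnegative height, which becomes the intermediate vertex of the lattice path; the
margin of one in `v.1 + v.2 + 1` keeps these faces in the rectangle. -/
theorem exists_conn_nonneg {A n : ℤ} (hA : 1 ≤ A) {k : Vtx → ℤ} (hk : k ∈ Hom) {p q : ℤ × ℤ} (hp : p.1 - p.2 < -A)
    (hq : A < q.1 - q.2)
    (hc : Conn adj8 (passable A k ∩ {v | -n + 1 < v.1 + v.2 + 1 ∧ v.1 + v.2 + 1 < n - 1}) p q) :
    ∃ u v : ℤ × ℤ, u.1 = -A ∧ v.1 = A ∧ Conn adj4 (nonneg A n k) u v := by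
  obtain ⟨u, v, hu, hv, h⟩ := hc.passage (P := {v | v.1 - v.2 < -A}) (M := {v | -A ≤ v.1 - v.2 ∧ v.1 - v.2 ≤ A})
    (Q := {v | A < v.1 - v.2}) (I := fun u => u.1 - u.2 ≤ -A + 1) (F := fun v => A - 1 ≤ v.1 - v.2)
    (by
      intro v _
      simp only [Set.mem_union, Set.mem_ofPred_eq]; omega)
    (by simp only [Set.mem_ofPred_eq]; omega)
    (by simp only [Set.mem_ofPred_eq]; omega)
    (by simp only [Set.mem_ofPred_eq, adj8]; intros; omega)
    (by simp only [Set.mem_ofPred_eq, adj8]; intros; omega)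
    (by simp only [Set.mem_ofPred_eq, adj8]; intros; omega)
  have site : ∀ v ∈ passable A k ∩ {v | -n + 1 < v.1 + v.2 + 1 ∧ v.1 + v.2 + 1 < n - 1} ∩
      {v | -A ≤ v.1 - v.2 ∧ v.1 - v.2 ≤ A},
      1 ≤ k (inl v) ∧ -n + 1 < v.1 + v.2 + 1 ∧ v.1 + v.2 + 1 < n - 1 ∧ -A ≤ v.1 - v.2 ∧ v.1 - v.2 ≤ A := by
    intro v hv
    have h1 := hv.1.1
    have h2 := hv.1.2
    have h3 := hv.2
    simp only [passable, Set.mem_ofPred_eq] at *; omega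
  have mem : ∀ v, (1 ≤ k (inl v) ∧ -n + 1 < v.1 + v.2 + 1 ∧ v.1 + v.2 + 1 < n - 1 ∧ -A ≤ v.1 - v.2 ∧ v.1 - v.2 ≤ A) →
      pos (inl v) ∈ nonneg A n k := fun v h => nonneg_site h.1 h.2.2.2.1 h.2.2.2.2 (by omega) (by omega)
  have hmain : Conn adj4 (nonneg A n k) (pos (inl u)) (pos (inl v)) := by
    refine h.rec' (p := fun v => Conn adj4 (nonneg A n k) (pos (inl u)) (pos (inl v))) (.refl (mem u (site u h.left))) ?_
    intro a b ha hab hb ih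
    have ha' := site a ha.right
    have hb' := site b hb
    have i1 : Inc (min a.1 b.1, min a.2 b.2) a := by simp only [Inc, adj8] at *; omega
    have i2 : Inc (min a.1 b.1, min a.2 b.2) b := by simp only [Inc, adj8] at *; omega
    refine (ih.tail (adj4_pos i1) (nonneg_face hk ha'.1 i1 ?_ ?_ ?_ ?_)).tail (adj4_symm _ _ (adj4_pos i2)) (mem b hb') <;>
      simp only [adj8] at hab <;> dsimp only <;> omega
  have hu' := site u h.left
  have hv' := site v h.right
  have left : ∃ s : ℤ × ℤ, s.1 = -A ∧ Conn adj4 (nonneg A n k) s (pos (inl u)) := by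
    by_cases e : u.1 - u.2 = -A
    · exact ⟨_, e, .refl (mem u hu')⟩
    · have i : Inc (u.1 - 1, u.2) u := by simp only [Inc]; omega
      refine ⟨pos (inr (u.1 - 1, u.2)), ?_, .single (nonneg_face hk hu'.1 i ?_ ?_ ?_ ?_) (adj4_symm _ _ (adj4_pos i)) (mem u hu')⟩
      · simp only [pos, Sum.elim_inr]; omega
      all_goals dsimp only; omega
  have right : ∃ s : ℤ × ℤ, s.1 = A ∧ Conn adj4 (nonneg A n k) (pos (inl v)) s := by
    by_cases e : v.1 - v.2 = A
    · exact ⟨_, e, .refl (mem v hv')⟩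
    · have i : Inc (v.1, v.2 - 1) v := by simp only [Inc]; omega
      refine ⟨pos (inr (v.1, v.2 - 1)), ?_, .single (mem v hv') (adj4_pos i) (nonneg_face hk hv'.1 i ?_ ?_ ?_ ?_)⟩
      · simp only [pos, Sum.elim_inr]; omega
      all_goals dsimp only; omega
  obtain ⟨s, hs, h1⟩ := left
  obtain ⟨t, ht, h2⟩ := right
  exact ⟨s, t, hs, ht, (h1.trans hmain).trans h2⟩

/-- A row of white sites yields a crossing. -/
theorem exists_conn_row {A n : ℤ} (hA : 0 ≤ A) (hn : 0 ≤ n) {k : Vtx → ℤ} (hk : k ∈ Hom)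
    (h : ∀ a : ℤ, -A - 1 ≤ a → a ≤ A → 1 ≤ k (inl (a, -1 - a))) :
    Conn adj4 (nonneg A n k) (-A, 0) (A, 0) := by
  refine conn_horizontal (by omega) fun s h1 h2 => ?_
  rcases Int.even_or_odd' s with ⟨a, rfl | rfl⟩
  · have e : ((2 * a, 0) : ℤ × ℤ) = pos (inr (a - 1, -1 - a)) := by
      ext <;> simp only [pos, Sum.elim_inr] <;> ring
    rw [e]
    refine nonneg_face hk (h a (by omega) (by omega)) ?_ ?_ ?_ ?_ ?_
    · simp only [Inc]; omega
    all_goals dsimp only; omega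
  · have e : ((2 * a + 1, 0) : ℤ × ℤ) = pos (inl (a, -1 - a)) := by
      ext <;> simp only [pos, Sum.elim_inl] <;> ring
    rw [e]
    refine nonneg_site (h a (by omega) (by omega)) ?_ ?_ ?_ ?_ <;> dsimp only <;> omega

end SquareIce

/-! ### Lower bounds for a given domain, and the conclusion. -/

namespace SquareIce
open Sum

theorem Base.half_le_pr_white {D M : Set (ℤ × ℤ)} (hB : Base D M) {v : ℤ × ℤ} (hv : v ∈ M) :
    1 / 2 ≤ pr (baseF D M) (flat ∅) {k | v ∈ white k} := by
  have h := hB.half_le_pr_not_white hv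
  rw [← hB.pr_ng] at h
  refine h.trans (pr_mono hB.finite fun k hk h => ?_)
  obtain ⟨m, hm⟩ := hk.1.2.1 v
  simp only [white, Set.mem_ofPred_eq, ng_inl hv] at *; omega

theorem exists_site_bound (D : Finset (ℤ × ℤ)) (L : ℤ) :
    ∃ K ≥ L, ∀ v, pos (inl v) ∈ D → v ∈ box (-K) K (-K) K := by
  set K := ∑ w ∈ D, (|w.1| + |w.2|) with hK
  have hle : ∀ w ∈ D, |w.1| + |w.2| ≤ K := fun w hw =>
    Finset.single_le_sum (f := fun w : ℤ × ℤ => |w.1| + |w.2|) (fun _ _ => by positivity) hw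
  refine ⟨max L (K + 1), le_max_left _ _, fun v hv => ?_⟩
  have h := hle _ hv
  simp only [pos, Sum.elim_inl] at h
  have h2 := le_max_right L (K + 1)
  simp only [mem_box]
  rcases abs_cases (v.1 - v.2) with h3 | h3 <;> rcases abs_cases (v.1 + v.2 + 1) with h4 | h4 <;> omega

theorem mem_freeFaces {D : Finset (ℤ × ℤ)} {a n : ℕ} (hD : rect a n ⊆ D) {c : ℤ × ℤ} (h1 : -(a : ℤ) < c.1 - c.2)
    (h2 : c.1 - c.2 < a) (h3 : -(n : ℤ) < c.1 + c.2 + 2) (h4 : c.1 + c.2 + 2 < n) : c ∈ freeFaces D := by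
  have key : ∀ w : ℤ × ℤ, -(a : ℤ) ≤ w.1 → w.1 ≤ a → -(n : ℤ) ≤ w.2 → w.2 ≤ n → w ∈ D := fun w e1 e2 e3 e4 =>
    hD (by rw [rect, Finset.mem_product, Finset.mem_Icc, Finset.mem_Icc]; exact ⟨⟨e1, e2⟩, e3, e4⟩)
  refine ⟨key _ ?_ ?_ ?_ ?_, ?_⟩
  any_goals simp only [pos, Sum.elim_inr]; omega
  rintro ⟨-, w, hadj, hw⟩
  rw [adj_iff] at hadj
  simp only [pos, Sum.elim_inr] at hadj
  exact hw (key w (by omega) (by omega) (by omega) (by omega))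

/-- A crude bound for narrow rectangles: all of `2 * a + 2` sites along the middle row are white,
each with probability at least `1/2`. -/
theorem row_le {D : Finset (ℤ × ℤ)} (hev : ∀ v ∈ boundary D, IsEvenVertex v) {a n : ℕ} (hD : rect a n ⊆ D) :
    (1 / 2 : ℝ) ^ (2 * a + 2) ≤ (zeroBoundaryMeasure D).real (horizontalCrossing D (Set.Ici 0) a n) := by
  obtain ⟨K, hK, hsite⟩ := exists_site_bound D (a + 1)
  have hB := base_domain hsite (box_finite _ _ _ _)
  rw [real_zeroBoundaryMeasure hev hsite (box_finite _ _ _ _)]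
  refine (pr_pow_le_of_upper hB.finite (flat_hom ∅)
    (U := fun i => {k | ((i : ℤ) - a - 1, -1 - ((i : ℤ) - a - 1)) ∈ white k})
    (fun i k k' h hk => white_mono h hk) (by norm_num) fun i hi => hB.half_le_pr_white ?_).trans
    (pr_mono hB.finite fun k hk hU => ?_)
  · simp only [mem_box]; omega
  · refine mem_horizontalCrossing hD rfl rfl (exists_conn_row (by omega) (by omega) hk.1 fun x h1 h2 => ?_)
    have h := hU (x + a + 1).toNat (by omega)
    rw [Set.mem_ofPred_eq, Int.toNat_of_nonneg (by omega)] at h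
    rw [show x + a + 1 - a - 1 = x by ring] at h
    exact h

theorem zigzag_le {D : Finset (ℤ × ℤ)} (hev : ∀ v ∈ boundary D, IsEvenVertex v) {a n : ℕ} (hD : rect a n ⊆ D)
    (ha : 1 ≤ a) {H : ℤ} {m : ℕ} (hH : 1 ≤ H) (hn : 40 * H ≤ n) (hm : 2 * (a : ℤ) + 2 ≤ (2 * m + 1) * (20 * H)) :
    (crossConst 464 * crossConst 464) ^ (m + 1) ≤
      (zeroBoundaryMeasure D).real (horizontalCrossing D (Set.Ici 0) a n) := by
  obtain ⟨b, hb⟩ : ∃ b : ℤ, b = (a + 1 - (19 * H + 6)) / 2 := ⟨_, rfl⟩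
  obtain ⟨K, hK, hsite⟩ := exists_site_bound D (|b| + a + m * (20 * H) + 40 * H + 20)
  have hB := base_domain hsite (box_finite _ _ _ _)
  rw [real_zeroBoundaryMeasure hev hsite (box_finite _ _ _ _)]
  have ht : 0 ≤ (m : ℤ) * (20 * H) := by positivity
  refine (hB.pr_zigzag (A := a) (n := n) (a := b - a - 1) hH hn hm rfl hb
    (fun c h1 h2 h3 h4 => mem_freeFaces hD h1 h2 h3 h4) fun v hv => ?_).trans (pr_mono hB.finite fun k hk h => ?_)
  · simp only [mem_box] at *
    generalize (m : ℤ) * (20 * H) = t at *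
    rcases abs_cases b with h | h <;> omega
  · obtain ⟨p, q, hp, hq, hc⟩ := h
    obtain ⟨u, v, hu, hv, h⟩ := exists_conn_nonneg (by omega) hk.1 hp hq hc
    exact mem_horizontalCrossing hD hu hv h

end SquareIce

theorem proposition4p1 (ρ : ℝ) (hρ : 0 < ρ) :
    ∃ c : ℝ, 0 < c ∧ ∀ (n : ℕ) (D : Finset (ℤ × ℤ)), SquareIce.IsEvenDomain D →
      SquareIce.rect ⌊ρ * n⌋₊ n ⊆ D →
      c ≤ (SquareIce.zeroBoundaryMeasure D).real
        (SquareIce.horizontalCrossing D (Set.Ici 0) ⌊ρ * n⌋₊ n) := by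
  have hc := SquareIce.crossConst_pos 464
  refine ⟨min ((SquareIce.crossConst 464 * SquareIce.crossConst 464) ^ (⌈4 * ρ⌉₊ + 1))
    ((1 / 2) ^ (2 * ⌊40 * ρ⌋₊ + 2)), lt_min (by positivity) (by positivity), fun n D hdom hD => ?_⟩
  by_cases hbig : 40 ≤ n ∧ 1 ≤ ⌊ρ * n⌋₊
  -- With `H = n / 40 ≥ 1` one has `n ≤ 80 * H`, so `2 * (ρ * n) ≤ 40 * (4 * ρ) * H`, and `m = ⌈4 *
  -- ρ⌉₊` stages suffice, independently of `n`.
  · refine (min_le_left _ _).trans (SquareIce.zigzag_le hdom.2 hD hbig.2 (H := (n : ℤ) / 40) (by omega) (by omega) ?_)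
    obtain ⟨H, hH⟩ : ∃ H : ℤ, H = (n : ℤ) / 40 := ⟨_, rfl⟩
    rw [← hH]
    have h1 : (n : ℝ) ≤ 80 * H := by
      have : (n : ℤ) ≤ 80 * H := by omega
      exact_mod_cast this
    have h2 : (1 : ℝ) ≤ H := by
      have : (1 : ℤ) ≤ H := by omega
      exact_mod_cast this
    have h3 : ((⌊ρ * n⌋₊ : ℕ) : ℝ) ≤ ρ * n := Nat.floor_le (by positivity)
    have h4 : 4 * ρ ≤ (⌈4 * ρ⌉₊ : ℕ) := Nat.le_ceil _
    have h5 : ρ * n ≤ ρ * (80 * H) := mul_le_mul_of_nonneg_left h1 hρ.le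
    have h6 : 4 * ρ * H ≤ (⌈4 * ρ⌉₊ : ℕ) * (H : ℝ) := mul_le_mul_of_nonneg_right h4 (by linarith)
    have h7 : 2 * ((⌊ρ * n⌋₊ : ℕ) : ℝ) + 2 ≤ (2 * (⌈4 * ρ⌉₊ : ℕ) + 1) * (20 * H) := by linarith
    exact_mod_cast h7
  -- In the remaining cases `n < 40` or the half-width is `0`, so the half-width is at most `⌊40 *
  -- ρ⌋₊`.
  · refine (min_le_right _ _).trans (le_trans ?_ (SquareIce.row_le hdom.2 hD))
    refine pow_le_pow_of_le_one (by norm_num) (by norm_num) ?_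
    have : ⌊ρ * n⌋₊ ≤ ⌊40 * ρ⌋₊ := by
      by_cases hn : 40 ≤ n
      · have : ⌊ρ * n⌋₊ = 0 := by omega
        omega
      · refine Nat.floor_le_floor ?_
        have : (n : ℝ) ≤ 40 := by exact_mod_cast (by omega : n ≤ 40)
        nlinarith
    omega
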